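/- **Notation.** Let $\mathbb H$ be the quaternions with imaginary units $\mathfrak e_1,\mathfrak e_2,\mathfrak e_3$, $\mathfrak e_i\mathfrak e_j=-\delta_{ij}+\epsilon_{ijk}\mathfrak e_k$ (repeated indices are summed), and $\mathfrak j(x)=x^i\mathfrak e_i/|x|$ for $x\in\mathbb R^3\setminus\{0\}$. On $L^2(\mathbb R^3,\mathbb H)$, with inner product $\langle\Phi,\Psi\rangle=\int\Phi(x)^*\Psi(x)\,dx$, let $J$ be left multiplication by $\mathfrak j(x)$, $Q^i$ multiplication by $x^i$, $\nabla_i=\partial_i+\frac12\epsilon_{ijk}\frac{x^j}{|x|^2}\mathfrak e_k$ and $P_i=-\hbar J\nabla_i$. For real $\kappa=eg$ put $\beta_{ij}(x)=\kappa\,\epsilon_{ijk}x^k/|x|^3$; the operators $P_i$, $Q^i$ correspond to $eg=\hbar/2$, i.e. $[P_i,P_j]=\hbar J\beta_{ij}$ with $\kappa=\hbar/2$. Let $$T(u,v)=V(\hbar u)\,e^{Jv\cdot Q}\,e^{-J\hbar u\cdot v/2},\qquad (V(a)\Psi)(x)=\mathrm w(a,x+a)\Psi(x+a),$$ $$\mathrm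 w(a,x)=\exp\Big(\tfrac12\,\epsilon_{ijk}a^ix^j\mathfrak e_k\int_0^1\frac{ds}{|x-sa|^2}\Big).$$ For $f\in L^2(\mathbb R^6;\mathbb C)$, a function of $(p,q)$, let $\tilde f(u,v)=(2\pi)^{-3}\int e^{-i(p\cdot u+q\cdot v)}f(p,q)\,dp\,dq$ and let $$\mathcal O_f=\frac1{(2\pi)^3}\int du\,dv\;T(u,v)\,\big(\mathrm{Re}\tilde f(u,v)+J\,\mathrm{Im}\tilde f(u,v)\big)$$ (a weak integral of operators on $L^2(\mathbb R^3,\mathbb H)$). A function $h\in L^2(\mathbb R^6;\mathbb C)$ is called the star product $f\star_\hbar g$ if $\mathcal O_h=\mathcal O_f\mathcal O_g$. The Zassenhaus terms $C_n(X,Y)$, $n\ge2$, are defined by $e^{X+Y}=e^Xe^Y\prod_{n\ge2}e^{C_n(X,Y)}$, $C_n$ being homogeneous of degree $n$. **Theorem.** (0) $T(u,v)=e^{J(u\cdot P+v\cdot Q)}$ in the following sense: if $\Psi$ is smooth on $\mathbb R^3\setminus\{0\}$ and the line $x+\mathbb Ru$ does not contain $0$, then $(T(tu,tv)\Psi)(x)$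 equals $\Psi(x)$ at $t=0$, is differentiable in $t$, and its derivative is $\big(J(u\cdot P+v\cdot Q)\,T(tu,tv)\Psi\big)(x)$. There are real numbers $r_{n,a}$ and polynomials $W_n$ ($n\ge0$) in the components of $u,v,u',v'$, whose coefficients are universal complex polynomials in $\beta_{ij}$ and its partial derivatives, such that the following holds. (1) For $n\ge2$, as operators on smooth $\mathbb H$-valued functions on $\mathbb R^3\setminus\{0\}$, $$C_n(Ju\cdot P,Ju'\cdot P)=\hbar^{n-1}J\,c_n(u,u';x)\big|_{\kappa=\hbar/2},\qquad c_n(u,u';x)=\sum_{a+b=n-2}r_{n,a}(u\cdot\partial)^a(u'\cdot\partial)^b\big(u^i\beta_{ij}(x)u'^j\big).$$ (2) For every $\kappa\in\mathbb R$ and $q\ne0$, the value of $W_n$ at $\partial^\gamma\beta_{ij}(q)$ and $u,v,u',v'$ is the coefficient of $\hbar^n$ in the formal power series (with $\beta$ regarded as independent of $\hbar$) $$\exp\Big(-i\sum_{n\ge2}\hbar^{n-1}c_n\big(u,u';q+\tfrac\hbar2(u+u')\big)+\tfrac{i\hbar}2(u\cdot v'-v\cdot u')\Big),$$ where each $c_n$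 is Taylor expanded about $q$. (3) Let $B_n(f,g)$ be the bidifferential operator obtained from $W_n$ by $u\to-i\partial_p$, $v\to-i\partial_q$ acting on $f$ and $u'\to-i\partial_p$, $v'\to-i\partial_q$ acting on $g$, with coefficients evaluated at $q$. Then for every $\kappa\in\mathbb R$ and all smooth $f,g$ on $\{(p,q):q\ne0\}$, $B_0(f,g)=fg$, $$B_1(f,g)=\tfrac i2\big(\partial_{q^i}f\,\partial_{p_i}g-\partial_{p_i}f\,\partial_{q^i}g+\beta_{ij}\,\partial_{p_i}f\,\partial_{p_j}g\big),$$ $$\begin{aligned}B_2(f,g)={}&-\tfrac18\big(\partial_{q^i}\partial_{q^j}f\,\partial_{p_i}\partial_{p_j}g-2\,\partial_{q^i}\partial_{p_j}f\,\partial_{p_i}\partial_{q^j}g+\partial_{p_i}\partial_{p_j}f\,\partial_{q^i}\partial_{q^j}g\big)\\&-\tfrac14\beta_{ij}\big(\partial_{q^k}\partial_{p_i}f\,\partial_{p_k}\partial_{p_j}g-\partial_{p_k}\partial_{p_i}f\,\partial_{q^k}\partial_{p_j}g\big)-\tfrac18\beta_{ij}\beta_{kl}\,\partial_{p_i}\partial_{p_k}f\,\partial_{p_j}\partial_{p_l}g\\&+\tfrac1{12}\,\partial_{q^k}\beta_{ij}\big(\partial_{p_i}\partial_{p_k}f\,\partial_{p_j}g-\partial_{p_i}f\,\partial_{p_k}\partial_{p_j}g\big).\end{aligned}$$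 (4) For all Schwartz functions $f,g$ on $\mathbb R^6$ and every $\hbar>0$ the star product $f\star_\hbar g$ exists, is unique almost everywhere, and has a representative that is continuous on $\{q\neq0\}$. For this representative, for every $N\ge0$ and every $(p,q)$ with $q\ne0$, $$(f\star_\hbar g)(p,q)=\sum_{n=0}^N\hbar^nB_n(f,g)(p,q)\Big|_{\kappa=\hbar/2}+O(\hbar^{N+1})\qquad(\hbar\to0^+).$$ -/

import Mathlib

open scoped Quaternion ContDiff SchwartzMap
open MeasureTheory Filter Topology Asymptotics

noncomputable section

namespace Monopole

/-- Three-dimensional Euclidean space. -/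
abbrev E := EuclideanSpace ℝ (Fin 3)

/-- Phase space; a point is a pair `(p, q)` of momentum and position. -/
abbrev Phase := E × E

/-- The Levi-Civita symbol. -/
def eps (i j k : Fin 3) : ℝ :=
  (((j : ℕ) : ℝ) - ((i : ℕ) : ℝ)) * (((k : ℕ) : ℝ) - ((i : ℕ) : ℝ)) *
    (((k : ℕ) : ℝ) - ((j : ℕ) : ℝ)) / 2

/-- Standard basis vectors of `ℝ³`. -/
def basisVec (i : Fin 3) : E := EuclideanSpace.single i (1 : ℝ)

/-- The quaternion `x · 𝔢 = x¹ 𝔢₁ + x² 𝔢₂ + x³ 𝔢₃`. -/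
def vecQ (x : E) : ℍ[ℝ] := ⟨0, x 0, x 1, x 2⟩

/-- The imaginary unit quaternion `𝔧(x) = x · 𝔢 / |x|`, for `x ≠ 0`. -/
def jq (x : E) : ℍ[ℝ] := ‖x‖⁻¹ • vecQ x

/-- The quaternion `(a × x) · 𝔢`, that is `ε_{ijk} aⁱ xʲ 𝔢_k`. -/
def crossQ (a x : E) : ℍ[ℝ] :=
  ∑ i, ∑ j, ∑ k, (eps i j k * a i * x j) • vecQ (basisVec k)

/-! ### Derivatives -/

/-- The directional derivative `(v · ∂) φ`. -/
def dirDeriv {V F : Type*} [NormedAddCommGroup V] [NormedSpace ℝ V]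
    [NormedAddCommGroup F] [NormedSpace ℝ F] (v : V) (φ : V → F) : V → F :=
  fun x => fderiv ℝ φ x v

/-- `∂ / ∂p_i` on phase-space functions. -/
def dP (i : Fin 3) (f : Phase → ℂ) : Phase → ℂ := dirDeriv ((basisVec i, 0) : Phase) f

/-- `∂ / ∂q^i` on phase-space functions. -/
def dQ (i : Fin 3) (f : Phase → ℂ) : Phase → ℂ := dirDeriv ((0, basisVec i) : Phase) f

/-- `∂_p^α ∂_q^γ` for multi-indices `α`, `γ`. -/
def multiDeriv (α γ : Fin 3 → ℕ) (f : Phase → ℂ) : Phase → ℂ :=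
  (dP 0)^[α 0] ((dP 1)^[α 1] ((dP 2)^[α 2]
    ((dQ 0)^[γ 0] ((dQ 1)^[γ 1] ((dQ 2)^[γ 2] f)))))

/-! ### The monopole field -/

/-- `β_{ij}(x) = eg ε_{ijk} x^k / |x|³`, with `eg` the product of the two charges. -/
def beta (eg : ℝ) (i j : Fin 3) (x : E) : ℝ :=
  eg * ∑ k, eps i j k * x k / ‖x‖ ^ 3

/-- The partial derivative `∂^γ β_{ij}(x)`. -/
def betaDeriv (eg : ℝ) (i j : Fin 3) (γ : Fin 3 → ℕ) : E → ℝ :=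
  (dirDeriv (basisVec 0))^[γ 0] ((dirDeriv (basisVec 1))^[γ 1]
    ((dirDeriv (basisVec 2))^[γ 2] (beta eg i j)))

/-- The bilinear form `u · β(x) u'`. -/
def betaForm (eg : ℝ) (u u' : E) (x : E) : ℝ := ∑ i, ∑ j, u i * beta eg i j x * u' j

/-- The magnetic Poisson bracket. -/
def magneticBracket (eg : ℝ) (f g : Phase → ℂ) (z : Phase) : ℂ :=
  (∑ i, (dQ i f z * dP i g z - dP i f z * dQ i g z)) +
    ∑ i, ∑ j, (beta eg i j z.2 : ℂ) * dP i f z * dP j g z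

/-! ### The quaternionic Weyl system -/

/-- `(a · ∇) Ψ`, with `∇_i = ∂_i + ½ ε_{ijk} (x^j / |x|²) 𝔢_k`, off the origin
(and `0` at the origin, by convention). -/
def nablaFun (a : E) (Ψ : E → ℍ[ℝ]) (x : E) : ℍ[ℝ] :=
  open Classical in
  if x = 0 then 0 else fderiv ℝ Ψ x a + ((1 / 2) * (‖x‖ ^ 2)⁻¹) • (crossQ a x * Ψ x)

/-- The momentum operator `P_i = -ħ J ∇_i` on functions. -/
def momFun (ħ : ℝ) (i : Fin 3) (Ψ : E → ℍ[ℝ]) (x : E) : ℍ[ℝ] :=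
  -(ħ • (jq x * nablaFun (basisVec i) Ψ x))

/-- The operator `J (u · P + v · Q)` on functions. -/
def weylGenerator (ħ : ℝ) (u v : E) (Ψ : E → ℍ[ℝ]) (x : E) : ℍ[ℝ] :=
  jq x * ((∑ i, u i • momFun ħ i Ψ x) + ∑ i, v i • (x i • Ψ x))

/-- The phase `w(a, x) = exp (½ (a × x) · 𝔢 ∫₀¹ ds / |x - s a|²)`. -/
def wPhase (a x : E) : ℍ[ℝ] :=
  NormedSpace.exp (((1 / 2) * ∫ s in (0 : ℝ)..1, (‖x - s • a‖ ^ 2)⁻¹) • crossQ a x)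

/-- `V(a) = e^{a·∇} = e^{a·∂} W(a)`, where `W(a)` is multiplication by `w(a, ·)`. -/
def transl (a : E) (Ψ : E → ℍ[ℝ]) (x : E) : ℍ[ℝ] := wPhase a (x + a) * Ψ (x + a)

/-- Multiplication by `e^{𝔧(x) θ(x)}`. -/
def jPhase (θ : E → ℝ) (Ψ : E → ℍ[ℝ]) (x : E) : ℍ[ℝ] := NormedSpace.exp (θ x • jq x) * Ψ x

/-- The Weyl operators
`T(u,v) = e^{J(u·P + v·Q)} = e^{J u·P} e^{J v·Q} e^{-J ħ u·v/2}`, with `e^{J u·P} = V(ħ u)`. -/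
def weylT (ħ : ℝ) (u v : E) (Ψ : E → ℍ[ℝ]) : E → ℍ[ℝ] :=
  transl (ħ • u) (jPhase (fun x => inner ℝ v x) (jPhase (fun _ => -(ħ * inner ℝ u v / 2)) Ψ))

/-! ### The quaternionic Weyl correspondence and its star product -/

/-- The quaternionic Hilbert space `L²(ℝ³, ℍ)`. -/
abbrev L2H := Lp ℍ[ℝ] 2 (volume : Measure E)

/-- The quaternion-valued inner product `∫ Φ(x)* Ψ(x) dx`. -/
def qInner (Φ Ψ : E → ℍ[ℝ]) : ℍ[ℝ] := ∫ x, star (Φ x) * Ψ x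

/-- The quaternion `Re c + 𝔧(x) Im c`. -/
def embedQ (c : ℂ) (x : E) : ℍ[ℝ] := (c.re : ℍ[ℝ]) + c.im • jq x

/-- The Fourier transform `(2π)⁻³ ∫ e^{-i(p·u + q·v)} φ(p,q) dp dq`. -/
def fourierPh (φ : Phase → ℂ) (w : Phase) : ℂ :=
  (((2 * Real.pi) ^ 3 : ℝ) : ℂ)⁻¹ *
    ∫ z : Phase, Complex.exp (-Complex.I * ((inner ℝ z.1 w.1 + inner ℝ z.2 w.2 : ℝ) : ℂ)) * φ z

/-- `F` is the Fourier transform of the square-integrable function `f`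
(characterized by duality with Schwartz functions). -/
def IsFourierL2 (f F : Phase → ℂ) : Prop :=
  MemLp f 2 (volume : Measure Phase) ∧ MemLp F 2 (volume : Measure Phase) ∧
    ∀ φ : 𝓢(Phase, ℂ), ∫ w, F w * φ w = ∫ z, f z * fourierPh φ z

/-- `A = 𝒪_f`: `f` is the Weyl symbol of the bounded operator `A`, that is,
`A = (2π)⁻³ ∫ du dv T(u,v) 𝔣̃(u,v)`, the operator-valued integral being understood weakly; here
`𝔣̃(u,v)` is left multiplication by `Re f̃(u,v) + 𝔧(x) Im f̃(u,v)`. -/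
def IsWeylOperator (ħ : ℝ) (f : Phase → ℂ) (A : L2H →L[ℝ] L2H) : Prop :=
  ∃ F : Phase → ℂ, IsFourierL2 f F ∧ ∀ Φ Ψ : L2H,
    Integrable (fun w : Phase => qInner Φ (weylT ħ w.1 w.2 (fun x => embedQ (F w) x * Ψ x))) ∧
    qInner Φ (A Ψ) = ((2 * Real.pi) ^ 3)⁻¹ •
      ∫ w : Phase, qInner Φ (weylT ħ w.1 w.2 (fun x => embedQ (F w) x * Ψ x))

/-- `h = f ⋆_ħ g`: `h` is the symbol of the operator product `𝒪_f 𝒪_g`. -/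
def IsStarProduct (ħ : ℝ) (f g h : Phase → ℂ) : Prop :=
  ∃ A B : L2H →L[ℝ] L2H, IsWeylOperator ħ f A ∧ IsWeylOperator ħ g B ∧
    IsWeylOperator ħ h (A.comp B)

/-! ### Zassenhaus terms -/

/-- The formal exponential `exp (t^n c)`, for `n ≥ 1`. -/
def expPow {A : Type*} [Ring A] [Algebra ℝ A] (n : ℕ) (c : A) : PowerSeries A :=
  PowerSeries.mk fun k => if n ∣ k then ((Nat.factorial (k / n) : ℝ)⁻¹) • c ^ (k / n) else 0

/-- The formal series `exp(-t^{k+1} C_{k+1}) ⋯ exp(-t² C₂) exp(-tY) exp(-tX) exp(t(X+Y))`, where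
`C_n` is the coefficient of `t^n` in the series with index `n - 2`. -/
def zassRem {A : Type*} [Ring A] [Algebra ℝ A] (X Y : A) : ℕ → PowerSeries A
  | 0 => expPow 1 (-Y) * expPow 1 (-X) * expPow 1 (X + Y)
  | k + 1 => expPow (k + 2) (-(PowerSeries.coeff (k + 2) (zassRem X Y k))) * zassRem X Y k

/-- The terms `C_n(X,Y)`, `n ≥ 2`, of the Zassenhaus formula
`exp(X+Y) = exp(X) exp(Y) exp(C₂) exp(C₃) ⋯`. -/
def zassenhaus {A : Type*} [Ring A] [Algebra ℝ A] (X Y : A) (n : ℕ) : A :=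
  PowerSeries.coeff n (zassRem X Y (n - 2))

/-- Smooth `ℍ`-valued functions on `ℝ³ ∖ {0}` (extended by `0` to the origin). -/
def SmoothField : Submodule ℝ (E → ℍ[ℝ]) where
  carrier := {Ψ | ContDiffOn ℝ ∞ Ψ {0}ᶜ ∧ Ψ 0 = 0}
  add_mem' := fun ha hb => ⟨ha.1.add hb.1, by simp [ha.2, hb.2]⟩
  zero_mem' := ⟨contDiffOn_const, rfl⟩
  smul_mem' := fun c _ ha => ⟨ha.1.const_smul c, by simp [ha.2]⟩

lemma contDiff_vecQ : ContDiff ℝ ∞ vecQ := by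
  have h : vecQ = fun x : E =>
      x 0 • vecQ (basisVec 0) + x 1 • vecQ (basisVec 1) + x 2 • vecQ (basisVec 2) := by
    funext x
    ext
    · change (0 : ℝ) = x 0 * 0 + x 1 * 0 + x 2 * 0
      ring
    · change x 0 = x 0 * basisVec 0 0 + x 1 * basisVec 1 0 + x 2 * basisVec 2 0
      simp [basisVec]
    · change x 1 = x 0 * basisVec 0 1 + x 1 * basisVec 1 1 + x 2 * basisVec 2 1
      simp [basisVec]
    · change x 2 = x 0 * basisVec 0 2 + x 1 * basisVec 1 2 + x 2 * basisVec 2 2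
      simp [basisVec]
  rw [h]
  fun_prop

lemma contDiffOn_jq : ContDiffOn ℝ ∞ jq {0}ᶜ := by
  intro x hx
  have hx' : x ≠ 0 := hx
  have h1 : ContDiffAt ℝ ∞ (fun y : E => ‖y‖⁻¹) x :=
    (contDiffAt_norm ℝ hx').inv (norm_ne_zero_iff.mpr hx')
  exact (h1.smul contDiff_vecQ.contDiffAt).contDiffWithinAt

lemma contDiff_crossQ (a : E) : ContDiff ℝ ∞ (crossQ a) := by
  unfold crossQ
  fun_prop

lemma nablaFun_mem (a : E) {Ψ : E → ℍ[ℝ]} (h : Ψ ∈ SmoothField) :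
    nablaFun a Ψ ∈ SmoothField := by
  refine ⟨?_, by simp [nablaFun]⟩
  have hd : ContDiffOn ℝ ∞ (fun x => fderiv ℝ Ψ x a) {0}ᶜ :=
    (h.1.fderiv_of_isOpen isOpen_compl_singleton (by simp)).clm_apply contDiffOn_const
  have hn : ContDiffOn ℝ ∞ (fun x : E => (1 / 2 : ℝ) * (‖x‖ ^ 2)⁻¹) {0}ᶜ := by
    intro x hx
    have hx' : x ≠ 0 := hx
    have h1 : ContDiffAt ℝ ∞ (fun y : E => ‖y‖ ^ 2) x := (contDiff_norm_sq ℝ).contDiffAt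
    exact (contDiffAt_const.mul (h1.inv (by positivity))).contDiffWithinAt
  refine (hd.add (hn.smul ((contDiff_crossQ a).contDiffOn.mul h.1))).congr ?_
  intro x hx
  have hx' : x ≠ 0 := hx
  simp [nablaFun, hx']

/-- The operator `a · ∇` on smooth functions on `ℝ³ ∖ {0}`. -/
def nablaOp (a : E) : Module.End ℝ SmoothField where
  toFun Ψ := ⟨nablaFun a Ψ, nablaFun_mem a Ψ.2⟩
  map_add' := by
    rintro ⟨Ψ, hΨ⟩ ⟨Φ, hΦ⟩
    ext1
    funext x
    by_cases hx : x = 0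
    · simp [nablaFun, hx]
    · have d1 : DifferentiableAt ℝ Ψ x :=
        (hΨ.1.contDiffAt (isOpen_compl_singleton.mem_nhds hx)).differentiableAt (by simp)
      have d2 : DifferentiableAt ℝ Φ x :=
        (hΦ.1.contDiffAt (isOpen_compl_singleton.mem_nhds hx)).differentiableAt (by simp)
      simp only [nablaFun, hx, if_false, Submodule.coe_add, Pi.add_apply,
        fderiv_add d1 d2, add_apply, mul_add, smul_add]
      abel
  map_smul' := by
    rintro c ⟨Ψ, hΨ⟩
    ext1
    funext x
    by_cases hx : x = 0
    · simp [nablaFun, hx]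
    · have d1 : DifferentiableAt ℝ Ψ x :=
        (hΨ.1.contDiffAt (isOpen_compl_singleton.mem_nhds hx)).differentiableAt (by simp)
      simp only [nablaFun, hx, if_false, Submodule.coe_smul, Pi.smul_apply, RingHom.id_apply,
        fderiv_const_smul d1, smul_apply, mul_smul_comm, smul_add]
      rw [smul_comm c]

/-- The operator `J` of left multiplication by `𝔧(x)`. -/
def jOp : Module.End ℝ SmoothField where
  toFun Ψ := ⟨fun x => jq x * (Ψ : E → ℍ[ℝ]) x, contDiffOn_jq.mul Ψ.2.1, by
    have h : (Ψ : E → ℍ[ℝ]) 0 = 0 := Ψ.2.2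
    simp [h]⟩
  map_add' := by
    intro Ψ Φ
    ext1
    funext x
    simp [mul_add]
  map_smul' := by
    intro c Ψ
    ext1
    funext x
    simp

/-- The momentum operators `P_i = -ħ J ∇_i`. -/
def momOp (ħ : ℝ) (i : Fin 3) : Module.End ℝ SmoothField := -(ħ • (jOp * nablaOp (basisVec i)))

/-- The operator `J u · P`. -/
def jMom (ħ : ℝ) (u : E) : Module.End ℝ SmoothField := jOp * ∑ i, u i • momOp ħ i

/-- For `n ≥ 2`, the combination `∑_{a+b=n-2} r_{n,a} (u·∂)^a (u'·∂)^b (u · β u')` of derivatives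
of the magnetic field. -/
def zassTerm (r : ℕ → ℕ → ℝ) (eg : ℝ) (n : ℕ) (u u' : E) : E → ℝ := fun x =>
  ∑ a ∈ Finset.range (n - 1),
    r n a * (dirDeriv u)^[a] ((dirDeriv u')^[n - 2 - a] (betaForm eg u u')) x

/-! ### The formal multiplier and bidifferential operators -/

/-- The formal exponential of a power series with zero constant term. -/
def formalExp (S : PowerSeries ℂ) : PowerSeries ℂ :=
  PowerSeries.mk fun N => ∑ k ∈ Finset.range (N + 1),
    ((Nat.factorial k : ℂ)⁻¹) * PowerSeries.coeff N (S ^ k)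

/-- The power series in `ħ` (with `β` regarded as independent of `ħ`)
`-i ∑_{n ≥ 2} ħ^{n-1} c_n(u,u'; q + ħ(u+u')/2) + (iħ/2)(u·v' - v·u')`,
`c_n` being the functions `zassTerm r eg n`, Taylor expanded about `q`. -/
def multiplierExponent (r : ℕ → ℕ → ℝ) (eg : ℝ) (q u v u' v' : E) : PowerSeries ℂ :=
  PowerSeries.mk fun N =>
    -Complex.I * ((∑ k ∈ Finset.range N, ((2 : ℝ) ^ k * (Nat.factorial k : ℝ))⁻¹ *
      (dirDeriv (u + u'))^[k] (zassTerm r eg (N + 1 - k) u u') q : ℝ) : ℂ) +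
    if N = 1 then Complex.I / 2 * ((inner ℝ u v' - inner ℝ v u' : ℝ) : ℂ) else 0

/-- The expansion in powers of `ħ` of the composite multiplier, with `𝔧` replaced by `i` and the
argument `q + ħ(u+u')/2` expanded about `q`. -/
def multiplierSeries (r : ℕ → ℕ → ℝ) (eg : ℝ) (q u v u' v' : E) : PowerSeries ℂ :=
  formalExp (multiplierExponent r eg q u v u' v')

/-- Polynomials in the components of `u, v, u', v'` (in this order). -/
abbrev SymbolPoly (R : Type) [CommRing R] := MvPolynomial (Fin 4 × Fin 3) R

/-- Polynomials in indeterminates standing for the derivatives `∂^γ β_{ij}`. -/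
abbrev JetPoly := MvPolynomial (Fin 3 × Fin 3 × (Fin 3 → ℕ)) ℂ

/-- Substitution of the values `∂^γ β_{ij}(q)` in the coefficients of a polynomial. -/
def evalJet (eg : ℝ) (q : E) (W : SymbolPoly JetPoly) : SymbolPoly ℂ :=
  MvPolynomial.map (MvPolynomial.eval fun s => (betaDeriv eg s.1 s.2.1 s.2.2 q : ℂ)) W

/-- The value of a polynomial at `(u, v, u', v')`. -/
def evalSymbol (P : SymbolPoly ℂ) (u v u' v' : E) : ℂ :=
  MvPolynomial.eval (fun s => (((![u, v, u', v'] s.1) s.2 : ℝ) : ℂ)) P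

/-- The bidifferential operator obtained from a polynomial by the replacements `u → -i ∂_p`,
`v → -i ∂_q` acting on `f` and `u' → -i ∂_p`, `v' → -i ∂_q` acting on `g`. -/
def bidiff (P : SymbolPoly ℂ) (f g : Phase → ℂ) (z : Phase) : ℂ :=
  ∑ m ∈ P.support, P.coeff m * (-Complex.I) ^ (m.degree) *
    multiDeriv (fun i => m (0, i)) (fun i => m (1, i)) f z *
    multiDeriv (fun i => m (2, i)) (fun i => m (3, i)) g z

/-- The operator `B(f,g)` at the point `z = (p,q)`, for `β` with charge product `eg`. -/
def starCoeff (W : SymbolPoly JetPoly) (eg : ℝ) (f g : Phase → ℂ) (z : Phase) : ℂ :=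
  bidiff (evalJet eg z.2 W) f g z

/-- The second-order term of the star product. -/
def secondOrder (eg : ℝ) (f g : Phase → ℂ) (z : Phase) : ℂ :=
  -(1 / 8) * (∑ i, ∑ j, (dQ i (dQ j f) z * dP i (dP j g) z
      - 2 * dQ i (dP j f) z * dP i (dQ j g) z + dP i (dP j f) z * dQ i (dQ j g) z))
  - (1 / 4) * (∑ i, ∑ j, ∑ k, (beta eg i j z.2 : ℂ) *
      (dQ k (dP i f) z * dP k (dP j g) z - dP k (dP i f) z * dQ k (dP j g) z))
  - (1 / 8) * (∑ i, ∑ j, ∑ k, ∑ l, (beta eg i j z.2 : ℂ) * (beta eg k l z.2 : ℂ) *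
      dP i (dP k f) z * dP j (dP l g) z)
  + (1 / 12) * (∑ i, ∑ j, ∑ k, ((dirDeriv (basisVec k) (beta eg i j) z.2 : ℝ) : ℂ) *
      (dP i (dP k f) z * dP j g z - dP i f z * dP k (dP j g) z))

/-- The phase space with the position of the monopole removed. -/
def regular : Set Phase := {z | z.2 ≠ 0}

end Monopole

end

open scoped Quaternion ContDiff SchwartzMap
open MeasureTheory Filter Topology Asymptotics

noncomputable section

namespace Monopole

/-! ### Quaternions attached to vectors -/

/-! The connection `∇` has two features that make everything explicit: the imaginary unit `𝔧` is
covariantly constant, and the curvature is a real multiple of `𝔧`, namely `-β 𝔧` with charge product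
`1/2`. Parallel transport from `x` to `y` along a segment that misses the origin is the
normalization of the quaternion `dQuat y x = |y||x| - (y·𝔢)(x·𝔢)`, the spin lift of the shortest
rotation of the direction of `x` to that of `y` (`wPhase_eq_of_segment`). It intertwines `𝔧(x)` and
`𝔧(y)` (`jq_mul_uTrans`), so the holonomy of a triangle lies in the copy of `ℂ` spanned by `1` and
`𝔧`, and is the explicit phase `triPhase` (`uTrans_triangle`).

Zassenhaus terms. The commutator of `J u·P` and `J u'·P` is `-ħ J (u·βu')`; further commutators only
differentiate `β`, and real multiples of `𝔧` commute with each other. In such a metabelian situation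
the logarithmic derivative of the Zassenhaus remainder follows from Hadamard's formula, and the
terms can be read off one degree at a time (`zassenhaus_metabelian`, `zassenhaus_jMom`). The
multiplier coefficients are universal polynomials in the jet of `β`, because polynomials in jets are
closed under differentiation (`hasJetDeriv`).

Existence and uniqueness of the star product. Fourier inversion in `v` turns the weak integral of
Weyl operators into an integral operator whose kernel at `(x, y)` is `(2πħ)⁻³` times the transport
from `y` to `x` times the partial Fourier transform of the symbol at direction `(y-x)/ħ` and
midpoint `(x+y)/2` (`integral_weylMatrix`). By Plancherel the passage from symbols to kernels is, up
to a constant, an `L²` isometry, which gives uniqueness (`ae_eq_zero_of_weak_integrals`). In a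
product of two kernels the transports compose up to `triPhase`, so the product is again of this
form, with symbol `starFun` (`integral_weylKernel_mul`, `isStarProduct_starFun`). Fourier inversion
rewrites `starFun` as a bilinear Fourier multiplier, whose symbol `multiplier` is `triPhase` times
the usual symplectic phase (`starFun_eq_pairInt`).

The expansion. For a small triangle, `triPhase` is the exponential of `-i` times the magnetic flux
through it (`triPhase_eq_flux`). Taylor expansion of the field about the midpoint `q` leaves
monomials to integrate over a simplex, and these integrals are exactly the Zassenhaus coefficients
(`integral_taylor_term`). Hence `multiplier` agrees with the formal series up to `ħ^(N+1)` times a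
polynomial in the frequencies; for frequencies too large for the triangle to be small, boundedness
of the multiplier suffices (`multiplier_expansion`). Rapid decay of the Fourier transforms
integrates the remainder, and polynomial multipliers are bidifferential operators (`bidiff_invFt`);
together these give `starFun_expansion`. -/

lemma quaternion_coe_eq (r : ℝ) : (r : ℍ[ℝ]) = r • (1 : ℍ[ℝ]) := by
  rw [← Quaternion.coe_mul_eq_smul, mul_one]

lemma vecQ_re (x : E) : (vecQ x).re = 0 := rfl
lemma vecQ_imI (x : E) : (vecQ x).imI = x 0 := rfl
lemma vecQ_imJ (x : E) : (vecQ x).imJ = x 1 := rfl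
lemma vecQ_imK (x : E) : (vecQ x).imK = x 2 := rfl

lemma crossQ_eq (a x : E) : crossQ a x =
    ⟨0, a 1 * x 2 - a 2 * x 1, a 2 * x 0 - a 0 * x 2, a 0 * x 1 - a 1 * x 0⟩ := by
  ext <;> simp [crossQ, Fin.sum_univ_three, eps, vecQ_re, vecQ_imI, vecQ_imJ, vecQ_imK,
    basisVec] <;> ring

lemma crossQ_re (a x : E) : (crossQ a x).re = 0 := by rw [crossQ_eq]
lemma crossQ_imI (a x : E) : (crossQ a x).imI = a 1 * x 2 - a 2 * x 1 := by rw [crossQ_eq]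
lemma crossQ_imJ (a x : E) : (crossQ a x).imJ = a 2 * x 0 - a 0 * x 2 := by rw [crossQ_eq]
lemma crossQ_imK (a x : E) : (crossQ a x).imK = a 0 * x 1 - a 1 * x 0 := by rw [crossQ_eq]

lemma inner_eq (x y : E) : inner ℝ x y = x 0 * y 0 + x 1 * y 1 + x 2 * y 2 := by
  simp [PiLp.inner_apply, Fin.sum_univ_three]; ring

lemma norm_sq_eq (x : E) : ‖x‖ ^ 2 = x 0 ^ 2 + x 1 ^ 2 + x 2 ^ 2 := by
  rw [← real_inner_self_eq_norm_sq, inner_eq]; ring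

lemma vecQ_mul_vecQ (x y : E) : vecQ x * vecQ y = -((inner ℝ x y : ℝ) : ℍ[ℝ]) + crossQ x y := by
  ext <;> simp [vecQ_re, vecQ_imI, vecQ_imJ, vecQ_imK, crossQ_re, crossQ_imI, crossQ_imJ,
    crossQ_imK, inner_eq] <;> ring

lemma vecQ_mul_self (x : E) : vecQ x * vecQ x = -((‖x‖ ^ 2 : ℝ) : ℍ[ℝ]) := by
  rw [vecQ_mul_vecQ, real_inner_self_eq_norm_sq]
  have : crossQ x x = 0 := by
    ext <;> simp [crossQ_re, crossQ_imI, crossQ_imJ, crossQ_imK] <;> ring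
  rw [this, add_zero]

lemma crossQ_swap (x y : E) : crossQ y x = -crossQ x y := by
  ext <;> simp [crossQ_re, crossQ_imI, crossQ_imJ, crossQ_imK] <;> ring

/-- Lagrange's identity for `|x × y|²`, since an imaginary quaternion squares to minus its squared
length. -/
lemma crossQ_mul_self (x y : E) :
    crossQ x y * crossQ x y = ((-(‖x‖ ^ 2 * ‖y‖ ^ 2 - inner ℝ x y ^ 2) : ℝ) : ℍ[ℝ]) := by
  obtain ⟨N, hN⟩ : ∃ N, N = -(‖x‖ ^ 2 * ‖y‖ ^ 2 - inner ℝ x y ^ 2) := ⟨_, rfl⟩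
  rw [← hN]
  rw [norm_sq_eq, norm_sq_eq, inner_eq] at hN
  ext <;> simp [crossQ_re, crossQ_imI, crossQ_imJ, crossQ_imK] <;> (try rw [hN]) <;> ring

lemma crossQ_add_right (a x y : E) : crossQ a (x + y) = crossQ a x + crossQ a y := by
  ext <;> simp [crossQ_re, crossQ_imI, crossQ_imJ, crossQ_imK] <;> ring

lemma crossQ_smul_left (s : ℝ) (a x : E) : crossQ (s • a) x = s • crossQ a x := by
  ext <;> simp [crossQ_re, crossQ_imI, crossQ_imJ, crossQ_imK] <;> ring

lemma crossQ_smul_right (s : ℝ) (a x : E) : crossQ a (s • x) = s • crossQ a x := by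
  ext <;> simp [crossQ_re, crossQ_imI, crossQ_imJ, crossQ_imK] <;> ring

lemma crossQ_self (x : E) : crossQ x x = 0 := by
  ext <;> simp [crossQ_re, crossQ_imI, crossQ_imJ, crossQ_imK] <;> ring

lemma jq_mul_self {x : E} (hx : x ≠ 0) : jq x * jq x = -1 := by
  have h : ‖x‖ ≠ 0 := norm_ne_zero_iff.mpr hx
  simp only [jq, smul_mul_smul_comm, vecQ_mul_self, smul_neg]
  rw [← Quaternion.coe_smul, smul_eq_mul]
  congr 1
  rw [show ‖x‖⁻¹ * ‖x‖⁻¹ * ‖x‖ ^ 2 = 1 by field_simp, Quaternion.coe_one]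

/-! ### Parallel transport along segments -/

/-- An unnormalized quaternion rotating the direction of `x` to that of `y`. -/
def dQuat (y x : E) : ℍ[ℝ] := ((‖y‖ * ‖x‖ : ℝ) : ℍ[ℝ]) - vecQ y * vecQ x

/-- With `θ` the angle between `x` and `y`, the scalar part is `2|x||y| cos²(θ/2)` and the vector
part has length `2|x||y| sin(θ/2) cos(θ/2)`. So `dQuat` is a nonnegative multiple of the unit
quaternion of the rotation from `x` to `y`, and it vanishes only for opposite directions or a zero
vector. -/
lemma dQuat_eq (y x : E) :
    dQuat y x = ((‖y‖ * ‖x‖ + inner ℝ y x : ℝ) : ℍ[ℝ]) + crossQ x y := by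
  rw [dQuat, vecQ_mul_vecQ, crossQ_swap y x]
  push_cast
  abel

lemma star_vecQ (x : E) : star (vecQ x) = -vecQ x := by
  ext <;> simp [vecQ_re, vecQ_imI, vecQ_imJ, vecQ_imK]

lemma star_dQuat (y x : E) : star (dQuat y x) = dQuat x y := by
  rw [dQuat, dQuat, star_sub, star_mul, star_vecQ, star_vecQ, neg_mul_neg, Quaternion.star_coe,
    mul_comm]

lemma ne_zero_of_dQuat_ne_zero {y x : E} (h : dQuat y x ≠ 0) : y ≠ 0 ∧ x ≠ 0 := by
  have h0 : vecQ 0 = 0 := by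
    ext <;> simp [vecQ_re, vecQ_imI, vecQ_imJ, vecQ_imK]
  constructor
  · rintro rfl
    simp [dQuat, h0] at h
  · rintro rfl
    simp [dQuat, h0] at h

/-- If the segment met the origin, its endpoints would be `s • a` and `(s-1) • a` with opposite
directions, and `‖y‖‖x‖` would cancel the inner product. -/
lemma segment_ne_zero_of_dQuat_ne_zero {a x : E} (h : dQuat (x - a) x ≠ 0) {s : ℝ} (h0 : 0 ≤ s)
    (h1 : s ≤ 1) : x - s • a ≠ 0 := by
  intro hs
  apply h
  have hx : x = s • a := sub_eq_zero.mp hs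
  have hy : x - a = (s - 1) • a := by rw [hx]; module
  rw [dQuat_eq, hy, hx, crossQ_smul_left, crossQ_smul_right, crossQ_self, norm_smul, norm_smul,
    inner_smul_left, inner_smul_right, real_inner_self_eq_norm_sq, Real.norm_of_nonneg h0,
    Real.norm_of_nonpos (by linarith)]
  have : -(s - 1) * ‖a‖ * (s * ‖a‖) + (starRingEnd ℝ) (s - 1) * (s * ‖a‖ ^ 2) = 0 := by
    simp; ring
  rw [this]; simp

lemma crossQ_eq_zero_of_dQuat_eq_zero {y x : E} (h : dQuat y x = 0) : crossQ x y = 0 := by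
  have hI := congrArg (fun q : ℍ[ℝ] => q.im) h
  rw [dQuat_eq] at hI
  ext
  · exact crossQ_re _ _
  · simpa using congrArg (fun q : ℍ[ℝ] => q.imI) hI
  · simpa using congrArg (fun q : ℍ[ℝ] => q.imJ) hI
  · simpa using congrArg (fun q : ℍ[ℝ] => q.imK) hI

lemma dQuat_ne_zero_of_crossQ_ne_zero {y x : E} (h : crossQ x y ≠ 0) : dQuat y x ≠ 0 :=
  fun h' => h (crossQ_eq_zero_of_dQuat_eq_zero h')

lemma norm_exp_smul_crossQ (k : ℝ) (a x : E) : ‖NormedSpace.exp (k • crossQ a x)‖ = 1 := by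
  rw [Quaternion.norm_exp]
  simp [crossQ_re]

lemma norm_wPhase (a x : E) : ‖wPhase a x‖ = 1 := norm_exp_smul_crossQ _ _ _

lemma hasDerivAt_norm_line {x a : E} {s : ℝ} (h : x - s • a ≠ 0) :
    HasDerivAt (fun s : ℝ => ‖x - s • a‖) (-(inner ℝ a (x - s • a)) / ‖x - s • a‖) s := by
  have h1 : HasDerivAt (fun s : ℝ => x - s • a) (-a) s := by
    simpa using ((hasDerivAt_id s).smul_const a).const_sub x
  have h2 := (h1.norm_sq).sqrt (by positivity)
  have h3 : (fun s : ℝ => √(‖x - s • a‖ ^ 2)) = fun s : ℝ => ‖x - s • a‖ := by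
    funext s; exact Real.sqrt_sq (norm_nonneg _)
  rw [h3, Real.sqrt_sq (norm_nonneg _)] at h2
  convert h2 using 1
  rw [inner_neg_right, real_inner_comm]
  field_simp

lemma continuousAt_inv_norm_sq_line {x a : E} {s : ℝ} (h : x - s • a ≠ 0) :
    ContinuousAt (fun s : ℝ => (‖x - s • a‖ ^ 2)⁻¹) s :=
  ContinuousAt.inv₀ (by fun_prop) (by positivity)

/-- The integrands used here may be singular outside `[0, s]`, when the full line passes through the
origin. Pointwise continuity on the interval and global measurability are all that the fundamental
theorem needs. -/
lemma hasDerivAt_integral_of_continuousAt {f : ℝ → ℝ} {s : ℝ} (hs : 0 ≤ s)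
    (hm : StronglyMeasurable f)
    (hc : ∀ t ∈ Set.Icc 0 s, ContinuousAt f t) :
    HasDerivAt (fun t => ∫ σ in (0 : ℝ)..t, f σ) (f s) s := by
  refine intervalIntegral.integral_hasDerivAt_right ?_ ?_ (hc s ⟨hs, le_rfl⟩)
  · apply ContinuousOn.intervalIntegrable
    rw [Set.uIcc_of_le hs]
    exact fun t ht => (hc t ht).continuousWithinAt
  · exact hm.stronglyMeasurableAtFilter

/-- The logarithmic derivative of `‖dQuat (x - s • a) x‖`. -/
def transportRate (a x : E) (s : ℝ) : ℝ :=
  (2 * ‖x - s • a‖ ^ 2)⁻¹ * (-(‖x - s • a‖ * (2 * inner ℝ a (x - s • a) + s * ‖a‖ ^ 2)) /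
    (‖x‖ + ‖x - s • a‖) - inner ℝ a (x - s • a))

/-- The vector part is linear in `s` because `x × (x - s a) = s (a × x)`. -/
lemma dQuat_line (a x : E) (s : ℝ) : dQuat (x - s • a) x =
    ((‖x - s • a‖ * ‖x‖ + inner ℝ (x - s • a) x : ℝ) : ℍ[ℝ]) + s • crossQ a x := by
  rw [dQuat_eq]
  congr 1
  ext <;> simp [crossQ_re, crossQ_imI, crossQ_imJ, crossQ_imK] <;> ring

/-- The parallel transport equation up to a real rate: the term with `transportRate` changes only
the norm, the other term is the connection. This is what identifies `dQuat` with the path-ordered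
exponential. -/
lemma hasDerivAt_dQuat_line {a x : E} {s : ℝ} (h : x - s • a ≠ 0) :
    HasDerivAt (fun s : ℝ => dQuat (x - s • a) x)
      (transportRate a x s • dQuat (x - s • a) x +
        (1 / 2 * (‖x - s • a‖ ^ 2)⁻¹) • (crossQ a x * dQuat (x - s • a) x)) s := by
  have h1 := hasDerivAt_norm_line h
  have h2 : HasDerivAt (fun s : ℝ => inner ℝ (x - s • a) x) (-(inner ℝ a x)) s := by
    have : HasDerivAt (fun s : ℝ => x - s • a) (-a) s := by
      simpa using ((hasDerivAt_id s).smul_const a).const_sub x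
    simpa using this.inner ℝ (hasDerivAt_const s x)
  have h3 := (((h1.mul_const ‖x‖).add h2).smul_const (1 : ℍ[ℝ])).add
    ((hasDerivAt_id s).smul_const (crossQ a x))
  have hf : (fun s : ℝ => dQuat (x - s • a) x) = (fun y : ℝ => ((fun y : ℝ => ‖x - y • a‖ * ‖x‖) +
      fun s : ℝ => inner ℝ (x - s • a) x) y • (1 : ℍ[ℝ])) + fun y : ℝ => id y • crossQ a x := by
    funext s
    rw [dQuat_line]
    simp only [Pi.add_apply, id, ← Quaternion.coe_mul_eq_smul, mul_one]
  rw [hf]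
  refine h3.congr_deriv ?_
  rw [dQuat_line, mul_add, mul_smul_comm, ← Quaternion.coe_commutes, Quaternion.coe_mul_eq_smul]
  set y := x - s • a with hy
  -- Everything is expressed through `‖y‖`, `‖a‖`, `⟨a, y⟩` and `‖x‖`, with `hX` as the only
  -- relation. The scalar component of the equation is then `key1` and the component along `a × x`
  -- is `key2`.
  have hxy : x = y + s • a := by rw [hy]; abel
  have hcy : crossQ a x = crossQ a y := by
    rw [hxy, crossQ_add_right, crossQ_smul_right, crossQ_self]; simp
  have hN : crossQ a x * crossQ a x = (-(‖a‖ ^ 2 * ‖y‖ ^ 2 - inner ℝ a y ^ 2)) • (1 : ℍ[ℝ]) := by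
    rw [hcy, crossQ_mul_self, ← Quaternion.coe_mul_eq_smul, mul_one]
  rw [hN]
  have hy0 : 0 < ‖y‖ := norm_pos_iff.mpr h
  have hX : ‖x‖ ^ 2 = ‖y‖ ^ 2 + 2 * s * inner ℝ a y + s ^ 2 * ‖a‖ ^ 2 := by
    rw [hxy, norm_add_sq_real, inner_smul_right, norm_smul, mul_pow, real_inner_comm]
    simp; ring
  have hyx : inner ℝ y x = ‖y‖ ^ 2 + s * inner ℝ a y := by
    rw [hxy, inner_add_right, inner_smul_right, real_inner_self_eq_norm_sq, real_inner_comm y a]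
  have hax : inner ℝ a x = inner ℝ a y + s * ‖a‖ ^ 2 := by
    rw [hxy, inner_add_right, inner_smul_right, real_inner_self_eq_norm_sq]
  have hs : 0 < ‖x‖ + ‖y‖ := by positivity
  rw [quaternion_coe_eq, transportRate, ← hy, hyx, hax]
  simp only [smul_add, smul_smul]
  have key1 : -inner ℝ a y / ‖y‖ * ‖x‖ + -(inner ℝ a y + s * ‖a‖ ^ 2) =
      (2 * ‖y‖ ^ 2)⁻¹ * (-(‖y‖ * (2 * inner ℝ a y + s * ‖a‖ ^ 2)) / (‖x‖ + ‖y‖) - inner ℝ a y) *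
        (‖y‖ * ‖x‖ + (‖y‖ ^ 2 + s * inner ℝ a y)) +
      1 / 2 * (‖y‖ ^ 2)⁻¹ * (s * -(‖a‖ ^ 2 * ‖y‖ ^ 2 - inner ℝ a y ^ 2)) := by
    generalize inner ℝ a y = w at *
    generalize ‖x‖ = X at *
    generalize ‖y‖ = Y at *
    generalize ‖a‖ = A at *
    field_simp
    linear_combination (-w * Y) * hX
  have key2 : (1 : ℝ) =
      (2 * ‖y‖ ^ 2)⁻¹ * (-(‖y‖ * (2 * inner ℝ a y + s * ‖a‖ ^ 2)) / (‖x‖ + ‖y‖) - inner ℝ a y) * s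
      + 1 / 2 * (‖y‖ ^ 2)⁻¹ * (‖y‖ * ‖x‖ + (‖y‖ ^ 2 + s * inner ℝ a y)) := by
    generalize inner ℝ a y = w at *
    generalize ‖x‖ = X at *
    generalize ‖y‖ = Y at *
    generalize ‖a‖ = A at *
    field_simp
    linear_combination (-Y) * hX
  rw [key1, congrArg (· • crossQ a x) key2]
  module

lemma stronglyMeasurable_inv_norm_sq_line (a x : E) :
    StronglyMeasurable fun s : ℝ => (‖x - s • a‖ ^ 2)⁻¹ := by
  have : Measurable fun s : ℝ => (‖x - s • a‖ ^ 2)⁻¹ := by fun_prop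
  exact this.stronglyMeasurable

lemma hasDerivAt_exp_smul {k : ℝ → ℝ} {k' t : ℝ} (hk : HasDerivAt k k' t) (c : ℍ[ℝ]) :
    HasDerivAt (fun s => NormedSpace.exp (k s • c)) (k' • (c * NormedSpace.exp (k t • c))) t :=
  (hasDerivAt_exp_smul_const' c (k t)).scomp t hk

/-- Along the segment the axis `a × x` is constant, so the path-ordered exponential is an ordinary
one. It solves the same linear equation as `dQuat` up to a positive scalar, and having norm one it
must be the normalization. -/
lemma wPhase_eq_of_segment {a x : E} (h : ∀ s ∈ Set.Icc (0 : ℝ) 1, x - s • a ≠ 0) :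
    wPhase a x = ‖dQuat (x - a) x‖⁻¹ • dQuat (x - a) x := by
  set c := crossQ a x with hc
  set I : ℝ → ℝ := fun s => ∫ σ in (0 : ℝ)..s, (‖x - σ • a‖ ^ 2)⁻¹ with hI
  set R : ℝ → ℝ := fun s => ∫ σ in (0 : ℝ)..s, transportRate a x σ with hR
  have hx0 : x ≠ 0 := by simpa using h 0 ⟨le_rfl, zero_le_one⟩
  have hIc : ∀ s ∈ Set.Icc (0 : ℝ) 1, HasDerivAt I ((‖x - s • a‖ ^ 2)⁻¹) s := fun s hs =>
    hasDerivAt_integral_of_continuousAt hs.1 (stronglyMeasurable_inv_norm_sq_line a x)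
      fun t ht => continuousAt_inv_norm_sq_line (h t ⟨ht.1, ht.2.trans hs.2⟩)
  have hRc : ∀ s ∈ Set.Icc (0 : ℝ) 1, HasDerivAt R (transportRate a x s) s := by
    intro s hs
    refine hasDerivAt_integral_of_continuousAt hs.1 ?_ ?_
    · have : Measurable (transportRate a x) := by unfold transportRate; fun_prop
      exact this.stronglyMeasurable
    · intro t ht
      have h1 : x - t • a ≠ 0 := h t ⟨ht.1, ht.2.trans hs.2⟩
      have h2 : 0 < ‖x - t • a‖ := norm_pos_iff.mpr h1
      unfold transportRate
      refine ContinuousAt.mul (ContinuousAt.inv₀ (by fun_prop) (by positivity))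
        (ContinuousAt.sub (ContinuousAt.div (by fun_prop) (by fun_prop) (by positivity))
        (by fun_prop))
  -- Variation of constants: undoing both the real rate and the rotation leaves a constant, whose
  -- value at `s = 0` is the positive number `2‖x‖²`.
  set G : ℝ → ℍ[ℝ] := fun s => Real.exp (-R s) •
    (NormedSpace.exp ((-(1 / 2) * I s) • c) * dQuat (x - s • a) x) with hG
  have hGd : ∀ s ∈ Set.Icc (0 : ℝ) 1, HasDerivAt G 0 s := by
    intro s hs
    have e1 := ((hRc s hs).neg).exp
    have e2 := hasDerivAt_exp_smul ((hIc s hs).const_mul (-(1 / 2))) c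
    have e3 := hasDerivAt_dQuat_line (h s hs)
    refine (e1.smul (e2.mul e3)).congr_deriv ?_
    have hcomm : NormedSpace.exp ((-(1 / 2) * I s) • c) * c =
        c * NormedSpace.exp ((-(1 / 2) * I s) • c) :=
      ((Commute.refl c).smul_left (-(1 / 2) * I s)).exp_left.eq
    simp only [Pi.neg_apply, Pi.mul_apply]
    rw [← hc, mul_add, mul_smul_comm, mul_smul_comm, ← mul_assoc, hcomm, smul_mul_assoc]
    module
  have hconst : G 1 = G 0 := by
    refine constant_of_has_deriv_right_zero (a := 0) (b := 1) ?_ ?_ 1 ⟨zero_le_one, le_rfl⟩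
    · exact fun s hs => (hGd s hs).continuousAt.continuousWithinAt
    · exact fun s hs => (hGd s ⟨hs.1, hs.2.le⟩).hasDerivWithinAt
  have hG0 : G 0 = ((2 * ‖x‖ ^ 2 : ℝ) : ℍ[ℝ]) := by
    simp only [hG, hI, hR, intervalIntegral.integral_same]
    have h2 : ‖x - (0 : ℝ) • a‖ * ‖x‖ + inner ℝ (x - (0 : ℝ) • a) x = 2 * ‖x‖ ^ 2 := by
      rw [zero_smul, sub_zero, real_inner_self_eq_norm_sq]
      ring
    rw [dQuat_line, h2]
    simp
  set ρ : ℝ := Real.exp (R 1) * (2 * ‖x‖ ^ 2) with hρ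
  have hρ0 : 0 < ρ := by positivity
  have hD : dQuat (x - a) x = ρ • wPhase a x := by
    have h1 : NormedSpace.exp ((-(1 / 2) * I 1) • c) * dQuat (x - a) x = (ρ : ℍ[ℝ]) := by
      rw [hG0] at hconst
      have h2 : Real.exp (R 1) • G 1 =
          NormedSpace.exp ((-(1 / 2) * I 1) • c) * dQuat (x - a) x := by
        simp only [hG, smul_smul, ← Real.exp_add, one_smul, add_neg_cancel, Real.exp_zero]
      rw [← h2, hconst, ← Quaternion.coe_mul_eq_smul, hρ]
      push_cast
      rfl
    let _ : NormedAlgebra ℚ ℍ[ℝ] := NormedAlgebra.restrictScalars ℚ ℝ ℍ[ℝ]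
    have h3 : wPhase a x * NormedSpace.exp ((-(1 / 2) * I 1) • c) = 1 := by
      rw [wPhase, ← hc, show (1 / 2 * ∫ s in (0 : ℝ)..1, (‖x - s • a‖ ^ 2)⁻¹) = 1 / 2 * I 1 from rfl,
        show (-(1 / 2) * I 1) • c = -((1 / 2 * I 1) • c) by module,
        ← NormedSpace.exp_add_of_commute (Commute.neg_right (Commute.refl _)), add_neg_cancel,
        NormedSpace.exp_zero]
    calc dQuat (x - a) x = wPhase a x * (NormedSpace.exp ((-(1 / 2) * I 1) • c) *
          dQuat (x - a) x) := by rw [← mul_assoc, h3, one_mul]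
      _ = ρ • wPhase a x := by rw [h1, ← Quaternion.coe_commutes, Quaternion.coe_mul_eq_smul]
  rw [hD, norm_smul, norm_wPhase, mul_one, Real.norm_of_nonneg hρ0.le, smul_smul,
    inv_mul_cancel₀ hρ0.ne', one_smul]

/-- Parallel transport from `x` to `y` along the segment joining them. -/
def uTrans (y x : E) : ℍ[ℝ] := wPhase (x - y) x

lemma norm_uTrans (y x : E) : ‖uTrans y x‖ = 1 := norm_wPhase _ _

lemma uTrans_eq {y x : E} (h : dQuat y x ≠ 0) : uTrans y x = ‖dQuat y x‖⁻¹ • dQuat y x := by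
  have h' : dQuat (x - (x - y)) x ≠ 0 := by simpa using h
  have := wPhase_eq_of_segment (a := x - y) (x := x)
    fun s hs => segment_ne_zero_of_dQuat_ne_zero h' hs.1 hs.2
  simpa [uTrans] using this

/-- In the degenerate case the axis vanishes, so the exponent is zero whatever value the possibly
divergent integral is given. -/
lemma uTrans_eq_one {y x : E} (h : dQuat y x = 0) : uTrans y x = 1 := by
  have : crossQ (x - y) x = 0 := by
    rw [sub_eq_add_neg, crossQ_swap, crossQ_add_right, crossQ_self, ← neg_one_smul ℝ y,
      crossQ_smul_right, crossQ_eq_zero_of_dQuat_eq_zero h]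
    simp
  simp [uTrans, wPhase, this]

open Classical in
lemma uTrans_eq_ite (y x : E) :
    uTrans y x = if dQuat y x = 0 then 1 else ‖dQuat y x‖⁻¹ • dQuat y x := by
  split_ifs with h
  · exact uTrans_eq_one h
  · exact uTrans_eq h

lemma vecQ_mul_dQuat (y x : E) : ‖x‖ • (vecQ y * dQuat y x) = ‖y‖ • (dQuat y x * vecQ x) := by
  rw [dQuat, mul_sub, sub_mul, ← mul_assoc, vecQ_mul_self, mul_assoc, vecQ_mul_self,
    ← Quaternion.coe_commutes, mul_neg, ← Quaternion.coe_commutes, neg_mul]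
  simp only [Quaternion.coe_mul_eq_smul]
  module

/-- Covariant constancy of `𝔧` in integrated form; it comes from `(x·𝔢)² = -|x|²` applied on either
side of `dQuat`. -/
lemma jq_mul_uTrans {y x : E} (h : dQuat y x ≠ 0) : jq y * uTrans y x = uTrans y x * jq x := by
  obtain ⟨hy, hx⟩ := ne_zero_of_dQuat_ne_zero h
  have hy' : ‖y‖ ≠ 0 := norm_ne_zero_iff.mpr hy
  have hx' : ‖x‖ ≠ 0 := norm_ne_zero_iff.mpr hx
  have key := vecQ_mul_dQuat y x
  rw [uTrans_eq h, jq, jq, smul_mul_smul_comm, smul_mul_smul_comm]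
  have : vecQ y * dQuat y x = (‖x‖⁻¹ * ‖y‖) • (dQuat y x * vecQ x) := by
    rw [mul_smul, ← key, smul_smul, inv_mul_cancel₀ hx', one_smul]
  rw [this, smul_smul]
  congr 1
  field_simp

lemma embedQ_mul_uTrans {y x : E} (h : dQuat y x ≠ 0) (c : ℂ) :
    embedQ c y * uTrans y x = uTrans y x * embedQ c x := by
  rw [embedQ, embedQ, add_mul, mul_add, smul_mul_assoc, mul_smul_comm, jq_mul_uTrans h,
    Quaternion.coe_commutes]

/-- Since `𝔧(x)² = -1`, the map `c ↦ Re c + 𝔧(x) Im c` is a copy of `ℂ` inside `ℍ`; the point `0` is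
excluded because there `𝔧` takes the value `0`. -/
lemma embedQ_mul (c d : ℂ) {x : E} (hx : x ≠ 0) :
    embedQ c x * embedQ d x = embedQ (c * d) x := by
  simp only [embedQ, quaternion_coe_eq, add_mul, mul_add, smul_mul_assoc, mul_smul_comm,
    jq_mul_self hx, Complex.mul_re, Complex.mul_im, one_mul, mul_one, smul_neg]
  module

lemma star_jq (x : E) : star (jq x) = -jq x := by
  rw [jq, Quaternion.star_smul, star_vecQ, smul_neg]

lemma star_embedQ (c : ℂ) (x : E) : star (embedQ c x) = embedQ (star c) x := by
  simp [embedQ, star_jq]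

lemma norm_embedQ (c : ℂ) {x : E} (hx : x ≠ 0) : ‖embedQ c x‖ = ‖c‖ := by
  have h : embedQ c x * star (embedQ c x) = ((‖c‖ ^ 2 : ℝ) : ℍ[ℝ]) := by
    rw [star_embedQ, embedQ_mul _ _ hx]
    have : c * star c = ((‖c‖ ^ 2 : ℝ) : ℂ) := by
      rw [Complex.star_def, Complex.mul_conj, Complex.normSq_eq_norm_sq]
    rw [this]
    simp [embedQ]
    norm_cast
    simp
  have h2 := congrArg norm h
  rw [norm_mul, norm_star, Quaternion.norm_coe, Real.norm_of_nonneg (by positivity)] at h2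
  nlinarith [norm_nonneg (embedQ c x), norm_nonneg c]

/-! ### The phase of a triangle -/

/-- The triple product `x₀ · (x₁ × x₂)`. -/
def det3 (x₀ x₁ x₂ : E) : ℝ :=
  x₀ 0 * (x₁ 1 * x₂ 2 - x₁ 2 * x₂ 1) + x₀ 1 * (x₁ 2 * x₂ 0 - x₁ 0 * x₂ 2) +
    x₀ 2 * (x₁ 0 * x₂ 1 - x₁ 1 * x₂ 0)

/-- The real part of the unnormalized phase of a triangle. -/
def triRe (x₀ x₁ x₂ : E) : ℝ :=
  ‖x₀‖ * ‖x₁‖ * ‖x₂‖ + ‖x₂‖ * inner ℝ x₀ x₁ + ‖x₁‖ * inner ℝ x₀ x₂ + ‖x₀‖ * inner ℝ x₁ x₂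

/-- The unnormalized phase of a triangle. -/
def triZ (x₀ x₁ x₂ : E) : ℂ := ⟨triRe x₀ x₁ x₂, -det3 x₀ x₁ x₂⟩

/-- The phase `exp(-iΩ/2)`, `Ω` the solid angle of the triangle seen from the origin. -/
def triPhase (x₀ x₁ x₂ : E) : ℂ := (‖triZ x₀ x₁ x₂‖⁻¹ : ℝ) • triZ x₀ x₁ x₂

lemma vecQ_mul_crossQ_mul_vecQ (x₀ x₁ x₂ : E) : vecQ x₂ * crossQ x₀ x₁ * vecQ x₂ =
    ‖x₂‖ ^ 2 • crossQ x₀ x₁ - (2 * det3 x₀ x₁ x₂) • vecQ x₂ := by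
  rw [norm_sq_eq]
  ext <;> simp [vecQ_re, vecQ_imI, vecQ_imJ, vecQ_imK, crossQ_re, crossQ_imI, crossQ_imJ,
    crossQ_imK, det3] <;> ring

lemma vecQ_anticomm (x y : E) :
    vecQ x * vecQ y + vecQ y * vecQ x = (-2 * inner ℝ x y) • (1 : ℍ[ℝ]) := by
  rw [vecQ_mul_vecQ, vecQ_mul_vecQ, crossQ_swap y x, real_inner_comm y x,
    quaternion_coe_eq]
  module

/-- The product is a holonomy based at `x₂`, hence commutes with `𝔧(x₂)` and has no component
orthogonal to `1` and `𝔧(x₂)`. Here this is seen by multiplying out into eight terms. -/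
lemma dQuat_triangle (x₀ x₁ x₂ : E) : dQuat x₂ x₀ * dQuat x₀ x₁ * dQuat x₁ x₂ =
    (2 * (‖x₀‖ * ‖x₁‖ * ‖x₂‖)) • embedQ (triZ x₀ x₁ x₂) x₂ := by
  rcases eq_or_ne x₂ 0 with rfl | hx₂
  · have h0 : vecQ 0 = 0 := by ext <;> simp [vecQ_re, vecQ_imI, vecQ_imJ, vecQ_imK]
    simp [dQuat, h0]
  have hr₂ : ‖x₂‖ ≠ 0 := norm_ne_zero_iff.mpr hx₂
  have e00 := vecQ_mul_self x₀
  have e11 := vecQ_mul_self x₁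
  have e12 := vecQ_anticomm x₁ x₂
  have e02 := vecQ_anticomm x₀ x₂
  have e01 := vecQ_mul_vecQ x₀ x₁
  have e2 := vecQ_mul_self x₂
  have ec := vecQ_mul_crossQ_mul_vecQ x₀ x₁ x₂
  rw [quaternion_coe_eq] at e00 e11 e01 e2
  have hexp : dQuat x₂ x₀ * dQuat x₀ x₁ * dQuat x₁ x₂ =
      (‖x₀‖ ^ 2 * ‖x₁‖ ^ 2 * ‖x₂‖ ^ 2) • (1 : ℍ[ℝ])
      - (‖x₀‖ ^ 2 * ‖x₁‖ * ‖x₂‖) • (vecQ x₁ * vecQ x₂)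
      - (‖x₀‖ * ‖x₁‖ * ‖x₂‖ ^ 2) • (vecQ x₀ * vecQ x₁)
      + (‖x₀‖ * ‖x₂‖) • (vecQ x₀ * (vecQ x₁ * vecQ x₁) * vecQ x₂)
      - (‖x₀‖ * ‖x₁‖ ^ 2 * ‖x₂‖) • (vecQ x₂ * vecQ x₀)
      + (‖x₁‖ * ‖x₂‖) • (vecQ x₂ * (vecQ x₀ * vecQ x₀) * vecQ x₁)
      + (‖x₀‖ * ‖x₁‖) • (vecQ x₂ * (vecQ x₀ * vecQ x₁) * vecQ x₂)
      - vecQ x₂ * (vecQ x₀ * vecQ x₀) * (vecQ x₁ * vecQ x₁) * vecQ x₂ := by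
    simp only [dQuat, quaternion_coe_eq, sub_mul, mul_sub, smul_mul_assoc, mul_smul_comm, one_mul, mul_one,
      smul_smul, ← mul_assoc, smul_sub]
    module
  rw [hexp, e00, e11, e01]
  simp only [mul_neg, neg_mul, mul_add, add_mul, mul_smul_comm, smul_mul_assoc, mul_one, ec, e2,
    neg_neg, smul_neg, smul_smul]
  rw [embedQ, triZ, triRe, jq, quaternion_coe_eq]
  -- Moving `vecQ x₂` to the left pairs the remaining products into anticommutators, which are real.
  have f12 : vecQ x₁ * vecQ x₂ = (-2 * inner ℝ x₁ x₂) • (1 : ℍ[ℝ]) - vecQ x₂ * vecQ x₁ :=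
    eq_sub_of_add_eq e12
  have f02 : vecQ x₀ * vecQ x₂ = (-2 * inner ℝ x₀ x₂) • (1 : ℍ[ℝ]) - vecQ x₂ * vecQ x₀ :=
    eq_sub_of_add_eq e02
  rw [f12, f02]
  simp only [smul_add, smul_smul, smul_sub]
  have : 2 * (‖x₀‖ * ‖x₁‖ * ‖x₂‖) * (-det3 x₀ x₁ x₂ * ‖x₂‖⁻¹) =
    -(2 * (‖x₀‖ * ‖x₁‖ * det3 x₀ x₁ x₂)) := by field_simp
  rw [this]
  module

/-- Taking norms in `dQuat_triangle` shows that the three normalizing factors multiply to the one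
needed for `triZ`, and in particular that `triZ` is nonzero. -/
lemma uTrans_triangle {x₀ x₁ x₂ : E} (h₂₀ : dQuat x₂ x₀ ≠ 0) (h₀₁ : dQuat x₀ x₁ ≠ 0)
    (h₁₂ : dQuat x₁ x₂ ≠ 0) :
    uTrans x₂ x₀ * uTrans x₀ x₁ * uTrans x₁ x₂ = embedQ (triPhase x₀ x₁ x₂) x₂ := by
  obtain ⟨hx₂, hx₀⟩ := ne_zero_of_dQuat_ne_zero h₂₀
  obtain ⟨-, hx₁⟩ := ne_zero_of_dQuat_ne_zero h₀₁
  have key := dQuat_triangle x₀ x₁ x₂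
  set ρ : ℝ := 2 * (‖x₀‖ * ‖x₁‖ * ‖x₂‖) with hρ
  have hρ0 : 0 < ρ := by
    have := norm_pos_iff.mpr hx₀
    have := norm_pos_iff.mpr hx₁
    have := norm_pos_iff.mpr hx₂
    positivity
  have hn := congrArg norm key
  rw [norm_mul, norm_mul, norm_smul, norm_embedQ _ hx₂, Real.norm_of_nonneg hρ0.le] at hn
  have hZ : ‖triZ x₀ x₁ x₂‖ ≠ 0 := by
    intro h0
    rw [h0, mul_zero] at hn
    simp [h₂₀, h₀₁, h₁₂] at hn
  have hs : ∀ (r : ℝ) (c : ℂ), embedQ (r • c) x₂ = r • embedQ c x₂ := by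
    intro r c
    simp only [embedQ, Complex.smul_re, Complex.smul_im, smul_eq_mul, smul_add, smul_smul,
      quaternion_coe_eq]
  rw [uTrans_eq h₂₀, uTrans_eq h₀₁, uTrans_eq h₁₂, smul_mul_smul_comm, smul_mul_smul_comm, key,
    triPhase, hs, smul_smul]
  congr 1
  rw [← mul_inv, ← mul_inv, hn]
  field_simp

lemma star_uTrans (y x : E) : star (uTrans y x) = uTrans x y := by
  by_cases h : dQuat y x = 0
  · have h' : dQuat x y = 0 := by rw [← star_dQuat, h, star_zero]
    rw [uTrans_eq_one h, uTrans_eq_one h', star_one]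
  · have h' : dQuat x y ≠ 0 := by rw [← star_dQuat]; simpa using h
    rw [uTrans_eq h, uTrans_eq h', Quaternion.star_smul, star_dQuat, ← star_dQuat y x, norm_star]

lemma uTrans_mul_uTrans_swap (y x : E) : uTrans y x * uTrans x y = 1 := by
  rw [← star_uTrans y x, Quaternion.self_mul_star, Quaternion.normSq_eq_norm_mul_self, norm_uTrans]
  simp

/-- The cocycle relation behind the composition of Weyl operators: two transports equal the direct
one up to a phase at the source `x₂`. -/
lemma uTrans_mul_uTrans {x₀ x₁ x₂ : E} (h₂₀ : dQuat x₂ x₀ ≠ 0) (h₀₁ : dQuat x₀ x₁ ≠ 0)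
    (h₁₂ : dQuat x₁ x₂ ≠ 0) :
    uTrans x₀ x₁ * uTrans x₁ x₂ = uTrans x₀ x₂ * embedQ (triPhase x₀ x₁ x₂) x₂ := by
  rw [← uTrans_triangle h₂₀ h₀₁ h₁₂, ← mul_assoc, ← mul_assoc, uTrans_mul_uTrans_swap, one_mul]

/-- Only an inequality, since the normalization gives `0` when `triZ` vanishes. -/
lemma norm_triPhase_le (x₀ x₁ x₂ : E) : ‖triPhase x₀ x₁ x₂‖ ≤ 1 := by
  rw [triPhase, norm_smul, norm_inv, norm_norm]
  exact inv_mul_le_one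

/-! ### The Weyl operators as exponentials -/

/-- Vanishing of `dQuat` forces equality in Cauchy–Schwarz with opposite directions, so `‖y‖ x + ‖x‖
y = 0`. Dividing by `‖x‖ + ‖y‖` exhibits the origin as a point of the segment. -/
lemma dQuat_ne_zero {y x : E} (h : ∀ s ∈ Set.Icc (0 : ℝ) 1, x - s • (x - y) ≠ 0) :
    dQuat y x ≠ 0 := by
  intro hD
  have hx : x ≠ 0 := by simpa using h 0 ⟨le_rfl, zero_le_one⟩
  have hx' : 0 < ‖x‖ := norm_pos_iff.mpr hx
  have hre : ‖y‖ * ‖x‖ + inner ℝ y x = 0 := by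
    have := congrArg (fun q : ℍ[ℝ] => q.re) hD
    rw [dQuat_eq, crossQ_eq_zero_of_dQuat_eq_zero hD, add_zero] at this
    exact this
  have hz : ‖y‖ • x + ‖x‖ • y = 0 := by
    rw [← norm_eq_zero, ← sq_eq_zero_iff, norm_add_sq_real, norm_smul, norm_smul, inner_smul_left,
      inner_smul_right, real_inner_comm]
    simp only [norm_norm, conj_trivial]
    linear_combination (2 * ‖x‖ * ‖y‖) * hre
  refine h (‖x‖ / (‖x‖ + ‖y‖)) ⟨by positivity, ?_⟩ ?_
  · rw [div_le_one (by positivity)]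
    linarith [norm_nonneg y]
  · have : x - (‖x‖ / (‖x‖ + ‖y‖)) • (x - y) = (‖x‖ + ‖y‖)⁻¹ • (‖y‖ • x + ‖x‖ • y) := by
      have h1 : (1 : ℝ) - ‖x‖ / (‖x‖ + ‖y‖) = (‖x‖ + ‖y‖)⁻¹ * ‖y‖ := by
        field_simp; ring
      rw [smul_add, smul_smul, smul_smul, ← h1, div_eq_inv_mul]
      module
    rw [this, hz, smul_zero]

/-- The closed form of the quaternion exponential is written with `|θ|`; evenness of `cos` and of
`sin θ / θ` removes the absolute value. -/
lemma exp_smul_jq (θ : ℝ) {x : E} (hx : x ≠ 0) :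
    NormedSpace.exp (θ • jq x) = embedQ (Complex.exp (θ * Complex.I)) x := by
  have hn : ‖jq x‖ = 1 := by
    have := congrArg norm (jq_mul_self hx)
    rw [norm_mul, norm_neg, norm_one] at this
    nlinarith [norm_nonneg (jq x)]
  have hre : (θ • jq x).re = 0 := by simp [jq, vecQ_re]
  rw [Quaternion.exp_of_re_eq_zero _ hre, embedQ, Complex.exp_ofReal_mul_I_re,
    Complex.exp_ofReal_mul_I_im, norm_smul, hn, mul_one, Real.norm_eq_abs, Real.cos_abs, smul_smul]
  congr 2
  rcases eq_or_ne θ 0 with rfl | hθ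
  · simp
  · rcases abs_choice θ with h | h <;> rw [h]
    · field_simp
    · rw [Real.sin_neg]
      field_simp

/-- The two phases combine to `v·(x + ħu) - ħ u·v/2 = v·(x + ħu/2)`: the character is evaluated at
the midpoint of the segment, which is the Weyl ordering. -/
lemma weylT_apply (ħ : ℝ) (u v : E) (Ψ : E → ℍ[ℝ]) {x : E} (hx : x + ħ • u ≠ 0) :
    weylT ħ u v Ψ x = uTrans x (x + ħ • u) *
      (embedQ (Complex.exp ((inner ℝ v (x + (ħ / 2) • u) : ℝ) * Complex.I)) (x + ħ • u) *
        Ψ (x + ħ • u)) := by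
  simp only [weylT, transl, jPhase]
  rw [exp_smul_jq _ hx, exp_smul_jq _ hx, ← mul_assoc (embedQ _ _), embedQ_mul _ _ hx,
    ← Complex.exp_add, ← add_mul, ← Complex.ofReal_add, uTrans, add_sub_cancel_left]
  congr 5
  rw [inner_add_right, inner_add_right, inner_smul_right, inner_smul_right, real_inner_comm v u]
  ring_nf

lemma nablaFun_eq_sum (u : E) (Ψ : E → ℍ[ℝ]) (x : E) :
    ∑ i, u i • nablaFun (basisVec i) Ψ x = nablaFun u Ψ x := by
  by_cases hx : x = 0
  · simp [nablaFun, hx]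
  have hu : u = ∑ i, u i • basisVec i := by
    ext j
    fin_cases j <;> simp [Fin.sum_univ_three, basisVec]
  simp only [nablaFun, hx, if_false, smul_add, Finset.sum_add_distrib]
  congr 1
  · conv_rhs => rw [hu, map_sum]
    simp
  · have hc : crossQ u x = ∑ i, u i • crossQ (basisVec i) x := by
      ext <;> simp [Fin.sum_univ_three, crossQ_re, crossQ_imI, crossQ_imJ, crossQ_imK, basisVec]
        <;> ring
    rw [hc, Finset.sum_mul, Finset.smul_sum]
    refine Finset.sum_congr rfl fun i _ => ?_
    rw [smul_mul_assoc, smul_comm]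

/-- From `J (-ħ J ∇) = ħ ∇`: the momentum part of the generator contains no `𝔧` at all. -/
lemma weylGenerator_eq (ħ : ℝ) (u v : E) (Ψ : E → ℍ[ℝ]) {x : E} (hx : x ≠ 0) :
    weylGenerator ħ u v Ψ x =
      ħ • nablaFun u Ψ x + (inner ℝ v x : ℝ) • (jq x * Ψ x) := by
  rw [weylGenerator, mul_add]
  congr 1
  · rw [← nablaFun_eq_sum, Finset.mul_sum, Finset.smul_sum]
    refine Finset.sum_congr rfl fun i _ => ?_
    rw [momFun, mul_smul_comm, mul_neg, mul_smul_comm, ← mul_assoc, jq_mul_self hx, neg_one_mul]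
    module
  · rw [Finset.mul_sum, inner_eq, Fin.sum_univ_three]
    simp only [mul_smul_comm]
    module

lemma differentiableAt_vecQ (x : E) : DifferentiableAt ℝ vecQ x :=
  contDiff_vecQ.contDiffAt.differentiableAt (by simp)

lemma differentiableAt_dQuat_comp {f g : E → E} {x : E} (hf : DifferentiableAt ℝ f x)
    (hg : DifferentiableAt ℝ g x) (h1 : f x ≠ 0) (h2 : g x ≠ 0) :
    DifferentiableAt ℝ (fun y => dQuat (f y) (g y)) x := by
  have e1 := hf.norm ℝ h1
  have e2 := hg.norm ℝ h2
  have e3 : DifferentiableAt ℝ (fun y => vecQ (f y)) x := (differentiableAt_vecQ _).comp x hf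
  have e4 : DifferentiableAt ℝ (fun y => vecQ (g y)) x := (differentiableAt_vecQ _).comp x hg
  simp only [dQuat, quaternion_coe_eq]
  exact ((e1.mul e2).smul_const _).sub (e3.mul e4)

lemma continuous_vecQ : Continuous vecQ := contDiff_vecQ.continuous

lemma continuous_dQuat : Continuous fun z : E × E => dQuat z.1 z.2 := by
  have := continuous_vecQ
  simp only [dQuat, quaternion_coe_eq]
  fun_prop

lemma differentiableAt_jq {x : E} (hx : x ≠ 0) : DifferentiableAt ℝ jq x :=
  (contDiffOn_jq.contDiffAt (isOpen_compl_singleton.mem_nhds hx)).differentiableAt (by simp)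

lemma differentiableAt_weylT (ħ : ℝ) (u v : E) {Ψ : E → ℍ[ℝ]} (hΨ : ContDiffOn ℝ ∞ Ψ {0}ᶜ)
    {x : E} (hD : dQuat x (x + ħ • u) ≠ 0) : DifferentiableAt ℝ (weylT ħ u v Ψ) x := by
  obtain ⟨hx, hx'⟩ := ne_zero_of_dQuat_ne_zero hD
  have hs : DifferentiableAt ℝ (fun y : E => y + ħ • u) x := by fun_prop
  have hd : DifferentiableAt ℝ (fun y : E => dQuat y (y + ħ • u)) x :=
    differentiableAt_dQuat_comp differentiableAt_id hs hx hx'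
  have hU : DifferentiableAt ℝ (fun y : E => uTrans y (y + ħ • u)) x := by
    have : (fun y : E => uTrans y (y + ħ • u)) =ᶠ[𝓝 x] fun y =>
        ‖dQuat y (y + ħ • u)‖⁻¹ • dQuat y (y + ħ • u) := by
      filter_upwards [hd.continuousAt.eventually_ne hD] with y hy using uTrans_eq hy
    refine DifferentiableAt.congr_of_eventuallyEq ?_ this
    exact ((hd.norm ℝ hD).inv (norm_ne_zero_iff.mpr hD)).smul hd
  have hj : DifferentiableAt ℝ (fun y : E => jq (y + ħ • u)) x :=
    DifferentiableAt.comp (g := jq) x (differentiableAt_jq hx') hs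
  have hP : DifferentiableAt ℝ (fun y : E => Ψ (y + ħ • u)) x :=
    DifferentiableAt.comp (g := Ψ) x ((hΨ.contDiffAt
      (isOpen_compl_singleton.mem_nhds hx')).differentiableAt (by simp)) hs
  have hev : weylT ħ u v Ψ =ᶠ[𝓝 x] fun x => uTrans x (x + ħ • u) *
      ((Real.cos (inner ℝ v (x + (ħ / 2) • u)) • (1 : ℍ[ℝ]) +
        Real.sin (inner ℝ v (x + (ħ / 2) • u)) • jq (x + ħ • u)) * Ψ (x + ħ • u)) := by
    filter_upwards [hs.continuousAt.eventually_ne hx'] with y hy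
    rw [weylT_apply _ _ _ _ hy, embedQ, Complex.exp_ofReal_mul_I_re, Complex.exp_ofReal_mul_I_im,
      quaternion_coe_eq]
  refine DifferentiableAt.congr_of_eventuallyEq ?_ hev
  have hi : DifferentiableAt ℝ (fun x : E => inner ℝ v (x + (ħ / 2) • u)) x :=
    (differentiableAt_const v).inner ℝ (by fun_prop)
  exact hU.mul (((hi.cos.smul_const _).add (hi.sin.smul hj)).mul hP)

/-- The primitive of `‖x + σ • u‖⁻²` along a line. -/
def lineInt (x u : E) (τ : ℝ) : ℝ := ∫ σ in (0 : ℝ)..τ, (‖x + σ • u‖ ^ 2)⁻¹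

lemma continuous_inv_norm_sq_line {x u : E} (h : ∀ s : ℝ, x + s • u ≠ 0) :
    Continuous fun σ : ℝ => (‖x + σ • u‖ ^ 2)⁻¹ :=
  Continuous.inv₀ (by fun_prop) fun s => by have := h s; positivity

lemma hasDerivAt_lineInt {x u : E} (h : ∀ s : ℝ, x + s • u ≠ 0) (τ : ℝ) :
    HasDerivAt (lineInt x u) ((‖x + τ • u‖ ^ 2)⁻¹) τ :=
  intervalIntegral.integral_hasDerivAt_right
    ((continuous_inv_norm_sq_line h).intervalIntegrable _ _)
    (continuous_inv_norm_sq_line h).stronglyMeasurable.stronglyMeasurableAtFilter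
    (continuous_inv_norm_sq_line h).continuousAt

/-- All transports along one line share the axis `u × x`, so they form a one-parameter family
governed by the primitive `lineInt`; the factor `τ - ε` of the axis is absorbed by substitution in
the integral. -/
lemma uTrans_line {x u : E} (h : ∀ s : ℝ, x + s • u ≠ 0) (ε τ : ℝ) :
    uTrans (x + ε • u) (x + τ • u) =
      NormedSpace.exp ((1 / 2 * (lineInt x u τ - lineInt x u ε)) • crossQ u x) := by
  have h1 : x + τ • u - (x + ε • u) = (τ - ε) • u := by module
  have hc : crossQ ((τ - ε) • u) (x + τ • u) = (τ - ε) • crossQ u x := by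
    rw [crossQ_smul_left, crossQ_add_right, crossQ_smul_right, crossQ_self, smul_zero, add_zero]
  have h2 : (τ - ε) * ∫ s in (0 : ℝ)..1, (‖x + τ • u - s • ((τ - ε) • u)‖ ^ 2)⁻¹ =
      lineInt x u τ - lineInt x u ε := by
    have := intervalIntegral.mul_integral_comp_sub_mul (a := 0) (b := 1)
      (f := fun σ : ℝ => (‖x + σ • u‖ ^ 2)⁻¹) (τ - ε) τ
    rw [lineInt, lineInt, intervalIntegral.integral_interval_sub_left
      ((continuous_inv_norm_sq_line h).intervalIntegrable _ _)
      ((continuous_inv_norm_sq_line h).intervalIntegrable _ _)]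
    convert this using 2
    · congr 1
      funext s
      congr 4
      module
    · ring
    · ring
  rw [uTrans, wPhase, h1, hc, smul_smul, ← h2]
  congr 2
  ring

lemma dQuat_line_ne_zero {x u : E} (h : ∀ s : ℝ, x + s • u ≠ 0) (ε τ : ℝ) :
    dQuat (x + ε • u) (x + τ • u) ≠ 0 := by
  refine dQuat_ne_zero fun s _ => ?_
  have : x + τ • u - s • (x + τ • u - (x + ε • u)) = x + (τ - s * (τ - ε)) • u := by module
  rw [this]
  exact h _

-- On the line `x + ℝ u` the function `T(su, sv)Ψ` is an explicit expression in `s` and the position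
-- `ε`. The derivative in `s` at `ε = 0` is compared with `ħ` times the derivative in `ε`: the
-- connection term of `∇` removes the contribution of the moving left endpoint, and the surplus `⟨v,
-- x⟩` in the derivative of the phase is the term `J v·Q`.
set_option maxHeartbeats 400000 in
theorem weylT_isExponential (ħ : ℝ) (u v x : E) (Ψ : E → ℍ[ℝ]) (hΨ : ContDiffOn ℝ ∞ Ψ {0}ᶜ)
    (h : ∀ s : ℝ, x + s • u ≠ 0) :
    weylT ħ ((0 : ℝ) • u) ((0 : ℝ) • v) Ψ x = Ψ x ∧
      ∀ t : ℝ, HasDerivAt (fun s : ℝ => weylT ħ (s • u) (s • v) Ψ x)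
        (weylGenerator ħ u v (weylT ħ (t • u) (t • v) Ψ) x) t := by
  have hx : x ≠ 0 := by simpa using h 0
  refine ⟨by simp [weylT, transl, jPhase, wPhase, show crossQ 0 x = 0 by simp [crossQ]], fun t => ?_⟩
  set C := crossQ u x with hC
  set J : ℝ → ℍ[ℝ] := fun τ => jq (x + τ • u) with hJ
  set P : ℝ → ℍ[ℝ] := fun τ => Ψ (x + τ • u) with hP
  set A : ℝ → ℝ → ℍ[ℝ] := fun ε τ =>
    NormedSpace.exp ((1 / 2 * (lineInt x u τ - lineInt x u ε)) • C) with hA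
  set θ : ℝ → ℝ → ℝ := fun s ε => s * inner ℝ v x + s * ε * inner ℝ v u +
    s ^ 2 * ħ / 2 * inner ℝ v u with hθ
  have hform : ∀ s ε : ℝ, weylT ħ (s • u) (s • v) Ψ (x + ε • u) = A ε (ε + s * ħ) *
      ((Real.cos (θ s ε) • (1 : ℍ[ℝ]) + Real.sin (θ s ε) • J (ε + s * ħ)) * P (ε + s * ħ)) := by
    intro s ε
    have h1 : x + ε • u + ħ • s • u = x + (ε + s * ħ) • u := by module
    have h2 : inner ℝ (s • v) (x + ε • u + (ħ / 2) • s • u) = θ s ε := by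
      simp only [inner_add_right, inner_smul_right, inner_smul_left, hθ, conj_trivial]
      ring
    rw [weylT_apply _ _ _ _ (by rw [h1]; exact h _), h1, h2, embedQ, Complex.exp_ofReal_mul_I_re,
      Complex.exp_ofReal_mul_I_im, uTrans_line h, quaternion_coe_eq]
  have hJd : ∀ τ, HasDerivAt J (deriv J τ) τ := by
    intro τ
    refine DifferentiableAt.hasDerivAt ?_
    exact DifferentiableAt.comp (g := jq) τ (differentiableAt_jq (h τ)) (by fun_prop)
  have hPd : ∀ τ, HasDerivAt P (deriv P τ) τ := by
    intro τ
    refine DifferentiableAt.hasDerivAt ?_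
    exact DifferentiableAt.comp (g := Ψ) τ ((hΨ.contDiffAt
      (isOpen_compl_singleton.mem_nhds (h τ))).differentiableAt (by simp)) (by fun_prop)
  have hfd : fderiv ℝ (weylT ħ (t • u) (t • v) Ψ) x u =
      deriv (fun ε : ℝ => weylT ħ (t • u) (t • v) Ψ (x + ε • u)) 0 := by
    have hdx : DifferentiableAt ℝ (weylT ħ (t • u) (t • v) Ψ) x := by
      refine differentiableAt_weylT _ _ _ hΨ ?_
      have := dQuat_line_ne_zero h 0 (ħ * t)
      simpa [smul_smul] using this
    have hl : HasDerivAt (fun ε : ℝ => x + ε • u) u 0 := by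
      simpa using ((hasDerivAt_id (0 : ℝ)).smul_const u).const_add x
    have hdx' : HasFDerivAt (weylT ħ (t • u) (t • v) Ψ)
        (fderiv ℝ (weylT ħ (t • u) (t • v) Ψ) x) (x + (0 : ℝ) • u) := by
      simpa using hdx.hasFDerivAt
    exact (hdx'.comp_hasDerivAt (0 : ℝ) hl).deriv.symm
  -- derivative in the group parameter
  have hτs : HasDerivAt (fun s : ℝ => (0 : ℝ) + s * ħ) ħ t := by
    simpa using ((hasDerivAt_id t).mul_const ħ).const_add (0 : ℝ)
  have hτε : HasDerivAt (fun ε : ℝ => ε + t * ħ) 1 0 := by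
    simpa using (hasDerivAt_id (0 : ℝ)).add_const (t * ħ)
  have hθs : HasDerivAt (fun s => θ s 0) (inner ℝ v x + t * ħ * inner ℝ v u) t := by
    have e1 := (hasDerivAt_id t).mul_const (inner ℝ v x : ℝ)
    have e2 := (((hasDerivAt_id t).pow 2).mul_const ħ).div_const 2 |>.mul_const (inner ℝ v u : ℝ)
    refine ((e1.add e2).congr_deriv ?_).congr_of_eventuallyEq (Eventually.of_forall fun s => ?_)
    · simp only [id, Nat.cast_ofNat]; ring
    · simp [hθ]
  have hθε : HasDerivAt (fun ε => θ t ε) (t * inner ℝ v u) 0 := by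
    have e1 := (((hasDerivAt_id (0 : ℝ)).const_mul t).mul_const (inner ℝ v u : ℝ)).const_add
      (t * inner ℝ v x) |>.add_const (t ^ 2 * ħ / 2 * inner ℝ v u)
    exact e1.congr_deriv (by simp)
  set L := lineInt x u with hL
  have hLd : ∀ τ, HasDerivAt L ((‖x + τ • u‖ ^ 2)⁻¹) τ := fun τ => hasDerivAt_lineInt h τ
  set τ₀ : ℝ := 0 + t * ħ with hτ₀
  have hAs : HasDerivAt (fun s : ℝ => A 0 (0 + s * ħ))
      ((1 / 2 * ((‖x + τ₀ • u‖ ^ 2)⁻¹ * ħ)) • (C * A 0 τ₀)) t :=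
    hasDerivAt_exp_smul ((((hLd τ₀).comp t hτs).sub_const (L 0)).const_mul (1 / 2)) C
  have hAε : HasDerivAt (fun ε : ℝ => A ε (ε + t * ħ))
      ((1 / 2 * ((‖x + τ₀ • u‖ ^ 2)⁻¹ * 1 - (‖x + (0 : ℝ) • u‖ ^ 2)⁻¹)) • (C * A 0 τ₀)) 0 :=
    hasDerivAt_exp_smul ((((hLd τ₀).comp (0 : ℝ) hτε).sub (hLd 0)).const_mul (1 / 2)) C
  have hJJ : ∀ z, J τ₀ * (J τ₀ * z) = -z := fun z => by
    rw [← mul_assoc, jq_mul_self (h τ₀), neg_one_mul]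
  have hJA : ∀ z, jq x * (A 0 τ₀ * z) = A 0 τ₀ * (J τ₀ * z) := fun z => by
    have e1 := jq_mul_uTrans (dQuat_line_ne_zero h 0 τ₀)
    rw [uTrans_line h, zero_smul, add_zero] at e1
    rw [← mul_assoc, ← mul_assoc]
    exact congrArg (· * z) e1
  -- From here on only the derivative formulas and the two commutation rules `hJJ`, `hJA` are used.
  clear_value A J P θ L C
  have hds : HasDerivAt (fun s => A 0 (0 + s * ħ) *
      ((Real.cos (θ s 0) • (1 : ℍ[ℝ]) + Real.sin (θ s 0) • J (0 + s * ħ)) * P (0 + s * ħ)))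
      (((1 / 2 * ((‖x + τ₀ • u‖ ^ 2)⁻¹ * ħ)) • (C * A 0 τ₀)) *
        ((Real.cos (θ t 0) • (1 : ℍ[ℝ]) + Real.sin (θ t 0) • J τ₀) * P τ₀) + A 0 τ₀ *
        (((-Real.sin (θ t 0) * (inner ℝ v x + t * ħ * inner ℝ v u)) • (1 : ℍ[ℝ]) +
          (Real.sin (θ t 0) • ħ • deriv J τ₀ +
            (Real.cos (θ t 0) * (inner ℝ v x + t * ħ * inner ℝ v u)) • J τ₀)) * P τ₀ +
          (Real.cos (θ t 0) • (1 : ℍ[ℝ]) + Real.sin (θ t 0) • J τ₀) * ħ • deriv P τ₀)) t :=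
    hAs.mul ((((hθs.cos).smul_const (1 : ℍ[ℝ])).add (hθs.sin.smul
      ((hJd τ₀).scomp t hτs))).mul ((hPd τ₀).scomp t hτs))
  have hdε : HasDerivAt (fun ε => A ε (ε + t * ħ) *
      ((Real.cos (θ t ε) • (1 : ℍ[ℝ]) + Real.sin (θ t ε) • J (ε + t * ħ)) * P (ε + t * ħ)))
      (((1 / 2 * ((‖x + τ₀ • u‖ ^ 2)⁻¹ * 1 - (‖x + (0 : ℝ) • u‖ ^ 2)⁻¹)) • (C * A 0 τ₀)) *
        ((Real.cos (θ t 0) • (1 : ℍ[ℝ]) + Real.sin (θ t 0) • J τ₀) * P τ₀) + A 0 τ₀ *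
        (((-Real.sin (θ t 0) * (t * inner ℝ v u)) • (1 : ℍ[ℝ]) +
          (Real.sin (θ t 0) • (1 : ℝ) • deriv J τ₀ +
            (Real.cos (θ t 0) * (t * inner ℝ v u)) • J τ₀)) * P τ₀ +
          (Real.cos (θ t 0) • (1 : ℍ[ℝ]) + Real.sin (θ t 0) • J τ₀) * (1 : ℝ) • deriv P τ₀)) 0 :=
    hAε.mul ((((hθε.cos).smul_const (1 : ℍ[ℝ])).add (hθε.sin.smul
      ((hJd τ₀).scomp (0 : ℝ) hτε))).mul ((hPd τ₀).scomp (0 : ℝ) hτε))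
  have hcs : (fun s : ℝ => weylT ħ (s • u) (s • v) Ψ x) = fun s => A 0 (0 + s * ħ) *
      ((Real.cos (θ s 0) • (1 : ℍ[ℝ]) + Real.sin (θ s 0) • J (0 + s * ħ)) * P (0 + s * ħ)) := by
    funext s
    simpa using hform s 0
  have hcε : (fun ε : ℝ => weylT ħ (t • u) (t • v) Ψ (x + ε • u)) = fun ε => A ε (ε + t * ħ) *
      ((Real.cos (θ t ε) • (1 : ℍ[ℝ]) + Real.sin (θ t ε) • J (ε + t * ħ)) * P (ε + t * ħ)) := by
    funext ε
    exact hform t ε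
  have h0 : weylT ħ (t • u) (t • v) Ψ x = A 0 τ₀ *
      ((Real.cos (θ t 0) • (1 : ℍ[ℝ]) + Real.sin (θ t 0) • J τ₀) * P τ₀) := congrFun hcs t
  rw [hcs]
  refine hds.congr_deriv ?_
  rw [weylGenerator_eq _ _ _ _ hx, nablaFun, if_neg hx, hfd, hcε, hdε.deriv, h0, ← hC,
    show (‖x + (0 : ℝ) • u‖ ^ 2)⁻¹ = (‖x‖ ^ 2)⁻¹ by simp]
  rw [hJA]
  generalize A 0 τ₀ = a
  simp only [smul_mul_assoc, mul_smul_comm, add_mul, mul_add, one_mul, hJJ,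
    mul_assoc, smul_add, mul_neg, smul_neg]
  module

/-! ### Zassenhaus terms in a metabelian situation -/

section Zassenhaus

variable {A : Type*} [Ring A] [Algebra ℝ A]

/-- The Euler derivation `t d/dt` of formal power series. -/
def eulerOp (f : PowerSeries A) : PowerSeries A :=
  PowerSeries.mk fun n => (n : ℝ) • PowerSeries.coeff n f

lemma coeff_eulerOp (n : ℕ) (f : PowerSeries A) :
    PowerSeries.coeff n (eulerOp f) = (n : ℝ) • PowerSeries.coeff n f := by
  rw [eulerOp, PowerSeries.coeff_mk]

lemma eulerOp_mul (f g : PowerSeries A) : eulerOp (f * g) = eulerOp f * g + f * eulerOp g := by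
  ext n
  rw [coeff_eulerOp, map_add, PowerSeries.coeff_mul, PowerSeries.coeff_mul, PowerSeries.coeff_mul,
    Finset.smul_sum, ← Finset.sum_add_distrib]
  refine Finset.sum_congr rfl fun p hp => ?_
  rw [Finset.HasAntidiagonal.mem_antidiagonal] at hp
  rw [coeff_eulerOp, coeff_eulerOp, ← hp, smul_mul_assoc, mul_smul_comm, Nat.cast_add, add_smul]

/-- The differential equation of `exp (t^n c)`. Formal series are compared throughout by such
equations rather than by their coefficients. -/
lemma eulerOp_expPow {n : ℕ} (hn : n ≠ 0) (c : A) :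
    eulerOp (expPow n c) = PowerSeries.X ^ n * PowerSeries.C ((n : ℝ) • c) * expPow n c := by
  ext k
  rw [coeff_eulerOp, mul_assoc, PowerSeries.coeff_X_pow_mul', PowerSeries.coeff_C_mul, expPow,
    PowerSeries.coeff_mk, PowerSeries.coeff_mk]
  by_cases hk : n ∣ k
  · obtain ⟨m, rfl⟩ := hk
    rw [if_pos (dvd_mul_right n m), Nat.mul_div_cancel_left m (Nat.pos_of_ne_zero hn)]
    rcases m with _ | m
    · simp [hn]
    · rw [if_pos (Nat.le_mul_of_pos_right n m.succ_pos), show n * (m + 1) - n = n * m by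
        rw [Nat.mul_succ]; omega, if_pos (dvd_mul_right n m),
        Nat.mul_div_cancel_left m (Nat.pos_of_ne_zero hn), smul_mul_smul_comm, ← pow_succ',
        smul_smul]
      congr 1
      rw [Nat.factorial_succ]
      push_cast
      have : (m.factorial : ℝ) ≠ 0 := by positivity
      field_simp
  · rw [if_neg hk, smul_zero]
    split_ifs with h1 h2
    · exact absurd ((Nat.dvd_sub_iff_left h1 dvd_rfl).mp h2) hk
    · simp
    · rfl

lemma coeff_zero_expPow (n : ℕ) (c : A) : PowerSeries.coeff 0 (expPow n c) = 1 := by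
  simp [expPow]

/-- The equation determines each coefficient from the previous one, division by `n + 1` being
possible over `ℝ`. -/
lemma eq_of_eulerOp_eq {f g : PowerSeries A} {c : A}
    (hf : eulerOp f = PowerSeries.X * (PowerSeries.C c * f))
    (hg : eulerOp g = PowerSeries.X * (PowerSeries.C c * g))
    (h0 : PowerSeries.coeff 0 f = PowerSeries.coeff 0 g) : f = g := by
  have key : ∀ (f : PowerSeries A), eulerOp f = PowerSeries.X * (PowerSeries.C c * f) → ∀ n : ℕ,
      PowerSeries.coeff (n + 1) f = ((n + 1 : ℕ) : ℝ)⁻¹ • (c * PowerSeries.coeff n f) := by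
    intro f hf n
    have := congrArg (PowerSeries.coeff (n + 1)) hf
    rw [coeff_eulerOp, PowerSeries.coeff_succ_X_mul, PowerSeries.coeff_C_mul] at this
    rw [← this, smul_smul, inv_mul_cancel₀ (by positivity), one_smul]
  ext n
  induction n with
  | zero => exact h0
  | succ n ih => rw [key f hf, key g hg, ih]

lemma commute_C_expPow {c d : A} (h : Commute c d) (n : ℕ) :
    Commute (PowerSeries.C c) (expPow n d) := by
  refine PowerSeries.ext fun k => ?_
  rw [PowerSeries.coeff_C_mul, PowerSeries.coeff_mul_C, expPow, PowerSeries.coeff_mk]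
  split_ifs
  · exact ((h.pow_right _).smul_right _).eq
  · simp

/-- Hadamard's formula `e^{-tX} W e^{tX} = ∑ (-t)^k/k! ad_X^k W`, written without the inverse; `w k`
stands for `ad_X^k W`. Both sides solve the equation with left coefficient `-X`. -/
lemma exp_mul_C (X W : A) (w : ℕ → A) (h0 : w 0 = W) (hs : ∀ k, w (k + 1) = X * w k - w k * X) :
    expPow 1 (-X) * PowerSeries.C W =
      (PowerSeries.mk fun k => (((-1) ^ k * (k.factorial : ℝ)⁻¹ : ℝ)) • w k) * expPow 1 (-X) := by
  set M : PowerSeries A := PowerSeries.mk fun k => (((-1) ^ k * (k.factorial : ℝ)⁻¹ : ℝ)) • w k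
    with hM
  have hMd : eulerOp M = PowerSeries.X * (PowerSeries.C (-X) * M - M * PowerSeries.C (-X)) := by
    ext n
    rcases n with _ | n
    · simp [coeff_eulerOp]
    · rw [coeff_eulerOp, PowerSeries.coeff_succ_X_mul, map_sub, PowerSeries.coeff_C_mul,
        PowerSeries.coeff_mul_C, hM, PowerSeries.coeff_mk, PowerSeries.coeff_mk, hs]
      rw [mul_smul_comm, smul_mul_assoc, ← smul_sub, smul_smul]
      have : ((n + 1 : ℕ) : ℝ) * ((-1) ^ (n + 1) * ((n + 1).factorial : ℝ)⁻¹) =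
          -((-1) ^ n * (n.factorial : ℝ)⁻¹) := by
        rw [Nat.factorial_succ]
        push_cast
        have : (n.factorial : ℝ) ≠ 0 := by positivity
        field_simp
        ring
      rw [this, neg_smul, ← smul_neg]
      congr 1
      noncomm_ring
  have hE := eulerOp_expPow one_ne_zero (-X)
  rw [pow_one, Nat.cast_one, one_smul] at hE
  refine eq_of_eulerOp_eq (c := -X) ?_ ?_ ?_
  · rw [eulerOp_mul, hE]
    have : eulerOp (PowerSeries.C W) = 0 := by
      ext n
      rw [coeff_eulerOp, PowerSeries.coeff_C]
      rcases n with _ | n <;> simp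
    rw [this, mul_zero, add_zero, mul_assoc, mul_assoc]
  · rw [eulerOp_mul, hE, hMd]
    rw [← mul_assoc M, ← mul_assoc M, ← PowerSeries.X_mul]
    noncomm_ring
  · simp [PowerSeries.coeff_mul, hM, coeff_zero_expPow, h0]

/-- Hadamard's formula applied to each coefficient of a series; `w k l` stands for `ad_X^l (m k)`.
-/
lemma exp_mul_series (X : A) (m : ℕ → A) (w : ℕ → ℕ → A) (h0 : ∀ k, w k 0 = m k)
    (hs : ∀ k l, w k (l + 1) = X * w k l - w k l * X) :
    expPow 1 (-X) * PowerSeries.mk m = (PowerSeries.mk fun n =>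
      ∑ p ∈ Finset.HasAntidiagonal.antidiagonal n, (((-1) ^ p.2 * (p.2.factorial : ℝ)⁻¹ : ℝ)) • w p.1 p.2) *
        expPow 1 (-X) := by
  ext n
  have hk : ∀ k i, PowerSeries.coeff i (expPow 1 (-X)) * m k = ∑ p ∈ Finset.HasAntidiagonal.antidiagonal i,
      ((((-1) ^ p.1 * (p.1.factorial : ℝ)⁻¹ : ℝ)) • w k p.1) *
        PowerSeries.coeff p.2 (expPow 1 (-X)) := by
    intro k i
    have := congrArg (PowerSeries.coeff i) (exp_mul_C X (m k) (w k) (h0 k) (hs k))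
    rw [PowerSeries.coeff_mul_C, PowerSeries.coeff_mul] at this
    simpa only [PowerSeries.coeff_mk] using this
  rw [PowerSeries.coeff_mul, PowerSeries.coeff_mul]
  simp only [PowerSeries.coeff_mk, hk, Finset.sum_mul, Finset.sum_sigma']
  -- Regrouping of a triple sum: degree `(l + j) + k` is read as `(k + l) + j`, with `j` the degree
  -- taken from the exponential.
  refine Finset.sum_nbij' (fun s => ⟨(s.1.2 + s.2.1, s.2.2), (s.1.2, s.2.1)⟩)
    (fun s => ⟨(s.2.2 + s.1.2, s.2.1), (s.2.2, s.1.2)⟩) ?_ ?_ ?_ ?_ ?_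
  · rintro ⟨⟨i, k⟩, ⟨l, j⟩⟩ h
    simp only [Finset.mem_sigma, Finset.HasAntidiagonal.mem_antidiagonal] at h
    refine Finset.mem_sigma.mpr ⟨Finset.HasAntidiagonal.mem_antidiagonal.mpr ?_,
      Finset.HasAntidiagonal.mem_antidiagonal.mpr ?_⟩ <;> dsimp only <;> omega
  · rintro ⟨⟨N, j⟩, ⟨k, l⟩⟩ h
    simp only [Finset.mem_sigma, Finset.HasAntidiagonal.mem_antidiagonal] at h
    refine Finset.mem_sigma.mpr ⟨Finset.HasAntidiagonal.mem_antidiagonal.mpr ?_,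
      Finset.HasAntidiagonal.mem_antidiagonal.mpr ?_⟩ <;> dsimp only <;> omega
  · rintro ⟨⟨i, k⟩, ⟨l, j⟩⟩ h
    simp only [Finset.mem_sigma, Finset.HasAntidiagonal.mem_antidiagonal] at h
    obtain ⟨-, rfl⟩ := h
    rfl
  · rintro ⟨⟨N, j⟩, ⟨k, l⟩⟩ h
    simp only [Finset.mem_sigma, Finset.HasAntidiagonal.mem_antidiagonal] at h
    obtain ⟨-, rfl⟩ := h
    rfl
  · rintro ⟨⟨i, k⟩, ⟨l, j⟩⟩ h
    rfl

/-- The coefficients of the Zassenhaus terms in the metabelian case, up to sign. -/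
def zassCoeff (n a : ℕ) : ℝ :=
  (-1) ^ n * ((n : ℝ) * ((a + 1).factorial : ℝ) * ((n - 2 - a).factorial : ℝ))⁻¹

variable {X Y : A} {z : ℕ → ℕ → A}

/-- The logarithm of the Zassenhaus product, in the metabelian case. -/
def metabelianTerm (z : ℕ → ℕ → A) (n : ℕ) : A :=
  -∑ a ∈ Finset.range (n - 1), zassCoeff n a • z a (n - 2 - a)

/-- Conjugating `Y` first by `e^{-tX}` and then by `e^{-tY}` gives `Y` plus the terms
`(-t)^{a+1+b}/((a+1)! b!) z a b`. The coefficient of `t^n` is `n + 1` times a metabelian term, which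
accounts for the factor `n` in the denominator of `zassCoeff`. -/
lemma exp_mul_exp_mul_C (h0 : z 0 0 = X * Y - Y * X)
    (hX : ∀ a b, X * z a b - z a b * X = z (a + 1) b)
    (hY : ∀ a b, Y * z a b - z a b * Y = z a (b + 1)) :
    expPow 1 (-Y) * expPow 1 (-X) * PowerSeries.C Y =
      (PowerSeries.C Y + PowerSeries.mk fun n =>
        ((n + 1 : ℕ) : ℝ) • metabelianTerm z (n + 1)) * (expPow 1 (-Y) * expPow 1 (-X)) := by
  -- The iterates of `ad_X` on `Y`, as `[X, Y] = z 0 0`.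
  set w : ℕ → A := fun k => if k = 0 then Y else z (k - 1) 0 with hw
  have h1 := exp_mul_C X Y w rfl (by
    intro k
    rcases k with _ | k
    · simp [hw, h0]
    · simp [hw, hX])
  -- The iterates of `ad_Y` on the previous terms; for `k = 0` only `l = 0` survives, because `Y`
  -- commutes with itself.
  set w' : ℕ → ℕ → A := fun k l => ((-1) ^ k * (k.factorial : ℝ)⁻¹ : ℝ) •
    (if k = 0 then (if l = 0 then Y else 0) else z (k - 1) l) with hw'
  have h2 := exp_mul_series Y (fun k => (((-1) ^ k * (k.factorial : ℝ)⁻¹ : ℝ)) • w k) w' (by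
    intro k
    rcases k with _ | k <;> simp [hw, hw']) (by
    intro k l
    simp only [hw', mul_smul_comm, smul_mul_assoc, ← smul_sub]
    congr 1
    rcases k with _ | k
    · rcases l with _ | l <;> simp
    · simp [hY])
  rw [mul_assoc, h1, ← mul_assoc, h2, mul_assoc]
  congr 1
  ext n
  rw [map_add, PowerSeries.coeff_mk, PowerSeries.coeff_mk, PowerSeries.coeff_C,
    Finset.Nat.sum_antidiagonal_eq_sum_range_succ
      (fun k l => ((-1) ^ l * (l.factorial : ℝ)⁻¹ : ℝ) • w' k l), Finset.sum_range_succ', add_comm]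
  congr 1
  · rcases n with _ | n <;> simp [hw']
  · rw [metabelianTerm, smul_neg, Finset.smul_sum, ← Finset.sum_neg_distrib]
    refine Finset.sum_congr (by simp) fun a ha => ?_
    rw [Finset.mem_range] at ha
    obtain ⟨b, rfl⟩ : ∃ b, n = a + 1 + b := ⟨n - (a + 1), by omega⟩
    simp only [hw', Nat.add_eq_zero_iff, one_ne_zero, and_false, if_false, Nat.add_sub_cancel,
      smul_smul, zassCoeff]
    rw [show a + 1 + b - (a + 1) = b by omega, show a + 1 + b + 1 - 2 - a = b by omega, ← neg_smul]
    congr 1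
    have e1 : (b.factorial : ℝ) ≠ 0 := by positivity
    have e2 : ((a + 1).factorial : ℝ) ≠ 0 := by positivity
    have e3 : ((a + 1 + b + 1 : ℕ) : ℝ) ≠ 0 := by positivity
    field_simp
    ring

lemma commute_metabelianTerm (hz : ∀ a b c d, Commute (z a b) (z c d)) (m n : ℕ) :
    Commute (metabelianTerm z m) (metabelianTerm z n) := by
  unfold metabelianTerm
  refine Commute.neg_left (Commute.neg_right ?_)
  refine Commute.sum_left _ _ _ fun a _ => Commute.sum_right _ _ _ fun b _ => ?_
  exact ((hz _ _ _ _).smul_left _).smul_right _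

/-- Logarithmic derivative of `e^{-tY} e^{-tX} e^{t(X+Y)}`: the contributions of `X` cancel, and
those of `Y` leave the conjugate of `Y` minus `Y` itself. -/
lemma eulerOp_zassRem_zero (h0 : z 0 0 = X * Y - Y * X)
    (hX : ∀ a b, X * z a b - z a b * X = z (a + 1) b)
    (hY : ∀ a b, Y * z a b - z a b * Y = z a (b + 1)) :
    eulerOp (zassRem X Y 0) = (PowerSeries.X * PowerSeries.mk fun n =>
      ((n + 1 : ℕ) : ℝ) • metabelianTerm z (n + 1)) * zassRem X Y 0 := by
  have key := exp_mul_exp_mul_C h0 hX hY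
  have e1 := eulerOp_expPow one_ne_zero (-Y)
  have e2 := eulerOp_expPow one_ne_zero (-X)
  have e3 := eulerOp_expPow one_ne_zero (X + Y)
  rw [pow_one, Nat.cast_one, one_smul] at e1 e2 e3
  have c2 : PowerSeries.C X * expPow 1 (-X) = expPow 1 (-X) * PowerSeries.C X :=
    (commute_C_expPow (Commute.neg_right (Commute.refl X)) 1).eq
  rw [zassRem, eulerOp_mul, eulerOp_mul, e1, e2, e3]
  set M := PowerSeries.mk fun n => ((n + 1 : ℕ) : ℝ) • metabelianTerm z (n + 1)
  set EY := expPow 1 (-Y)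
  set EX := expPow 1 (-X)
  set EZ := expPow 1 (X + Y)
  have x1 : ∀ f : PowerSeries A, f * PowerSeries.X = PowerSeries.X * f := fun f =>
    PowerSeries.X_mul.symm
  simp only [map_neg, map_add]
  have step : (PowerSeries.X * -PowerSeries.C Y * EY * EX +
      EY * (PowerSeries.X * -PowerSeries.C X * EX)) * EZ +
      EY * EX * (PowerSeries.X * (PowerSeries.C X + PowerSeries.C Y) * EZ) =
      PowerSeries.X * ((EY * EX * PowerSeries.C Y - PowerSeries.C Y * (EY * EX)) * EZ +
        EY * (EX * PowerSeries.C X - PowerSeries.C X * EX) * EZ) := by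
    have y1 : EY * (PowerSeries.X * -PowerSeries.C X * EX) =
        PowerSeries.X * (EY * -PowerSeries.C X * EX) := by
      rw [← mul_assoc, ← mul_assoc, x1, mul_assoc, mul_assoc, mul_assoc]
    have y2 : EY * EX * (PowerSeries.X * (PowerSeries.C X + PowerSeries.C Y) * EZ) =
        PowerSeries.X * (EY * EX * (PowerSeries.C X + PowerSeries.C Y) * EZ) := by
      rw [← mul_assoc, ← mul_assoc, x1]
      simp only [mul_assoc]
    rw [y1, y2]
    noncomm_ring
  rw [step, c2, key]
  noncomm_ring

/-- The logarithmic derivative of the `k`-th remainder is the tail of one fixed series. Because its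
coefficients commute, stripping off an exponential factor deletes exactly the lowest term of that
tail, so the induction reproduces itself. -/
lemma eulerOp_zassRem (h0 : z 0 0 = X * Y - Y * X)
    (hX : ∀ a b, X * z a b - z a b * X = z (a + 1) b)
    (hY : ∀ a b, Y * z a b - z a b * Y = z a (b + 1))
    (hz : ∀ a b c d, Commute (z a b) (z c d)) (k : ℕ) :
    eulerOp (zassRem X Y k) = (PowerSeries.mk fun n =>
      if k + 2 ≤ n then (n : ℝ) • metabelianTerm z n else 0) * zassRem X Y k ∧
    PowerSeries.coeff 0 (zassRem X Y k) = 1 ∧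
    PowerSeries.coeff (k + 2) (zassRem X Y k) = metabelianTerm z (k + 2) := by
  -- In degree `k + 2` only the lowest term of the tail meets the constant coefficient `1` of the
  -- remainder.
  have hlast : ∀ k : ℕ, eulerOp (zassRem X Y k) = (PowerSeries.mk fun n =>
      if k + 2 ≤ n then (n : ℝ) • metabelianTerm z n else 0) * zassRem X Y k →
      PowerSeries.coeff 0 (zassRem X Y k) = 1 →
      PowerSeries.coeff (k + 2) (zassRem X Y k) = metabelianTerm z (k + 2) := by
    intro k h1 h2
    have := congrArg (PowerSeries.coeff (k + 2)) h1
    rw [coeff_eulerOp, PowerSeries.coeff_mul, Finset.sum_eq_single (k + 2, 0)] at this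
    · rw [PowerSeries.coeff_mk, if_pos le_rfl, h2, mul_one] at this
      exact smul_right_injective A (r := ((k + 2 : ℕ) : ℝ)) (by positivity) this
    · rintro ⟨i, j⟩ hij hne
      rw [Finset.HasAntidiagonal.mem_antidiagonal] at hij
      rw [PowerSeries.coeff_mk, if_neg, zero_mul]
      intro hi
      apply hne
      simp only at hij hi
      ext <;> simp only <;> omega
    · intro h
      exact absurd (Finset.HasAntidiagonal.mem_antidiagonal.mpr (by simp)) h
  induction k with
  | zero =>
    have h1 : eulerOp (zassRem X Y 0) = (PowerSeries.mk fun n =>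
        if 0 + 2 ≤ n then (n : ℝ) • metabelianTerm z n else 0) * zassRem X Y 0 := by
      rw [eulerOp_zassRem_zero h0 hX hY]
      congr 1
      ext n
      rw [PowerSeries.coeff_mk]
      rcases n with _ | n
      · simp
      · rw [PowerSeries.coeff_succ_X_mul, PowerSeries.coeff_mk]
        rcases n with _ | n
        · simp [metabelianTerm]
        · simp
    have h2 : PowerSeries.coeff 0 (zassRem X Y 0) = 1 := by
      simp [zassRem, PowerSeries.coeff_mul, coeff_zero_expPow]
    exact ⟨h1, h2, hlast 0 h1 h2⟩
  | succ k ih =>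
    obtain ⟨i1, i2, i3⟩ := ih
    have h1 : eulerOp (zassRem X Y (k + 1)) = (PowerSeries.mk fun n =>
        if k + 1 + 2 ≤ n then (n : ℝ) • metabelianTerm z n else 0) * zassRem X Y (k + 1) := by
      rw [zassRem, i3, eulerOp_mul, i1, eulerOp_expPow (by omega)]
      set Ek := expPow (k + 2) (-metabelianTerm z (k + 2))
      set S := PowerSeries.mk fun n => if k + 2 ≤ n then (n : ℝ) • metabelianTerm z n else 0
        with hS
      -- The one place where commutativity of the iterated commutators enters.
      have hc : Ek * S = S * Ek := by
        ext n
        rw [PowerSeries.coeff_mul, PowerSeries.coeff_mul, ← Finset.Nat.sum_antidiagonal_swap]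
        refine Finset.sum_congr rfl fun p _ => ?_
        simp only [Prod.fst_swap, Prod.snd_swap, hS, PowerSeries.coeff_mk, Ek, expPow]
        split_ifs
        · exact ((((((commute_metabelianTerm hz (k + 2) p.1).neg_left).pow_left _).smul_left
            _).smul_right _)).eq
        all_goals simp
      rw [← mul_assoc Ek, hc]
      -- The tail starting one degree later is the old tail corrected by the logarithmic derivative
      -- of the new factor.
      have hS' : (PowerSeries.mk fun n =>
          if k + 1 + 2 ≤ n then (n : ℝ) • metabelianTerm z n else 0) = S +
          PowerSeries.X ^ (k + 2) *
            PowerSeries.C (((k + 2 : ℕ) : ℝ) • -metabelianTerm z (k + 2)) := by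
        ext n
        rw [map_add, hS, PowerSeries.coeff_mk, PowerSeries.coeff_mk, PowerSeries.coeff_mul_C,
          PowerSeries.coeff_X_pow]
        rcases lt_trichotomy n (k + 2) with h | h | h
        · rw [if_neg (by omega), if_neg (by omega), if_neg (by omega)]; simp
        · subst h; rw [if_neg (by omega), if_pos le_rfl, if_pos rfl]; simp
        · rw [if_pos (by omega), if_pos (by omega), if_neg (by omega)]; simp
      rw [hS']
      noncomm_ring
    have h2 : PowerSeries.coeff 0 (zassRem X Y (k + 1)) = 1 := by
      simp only [zassRem, PowerSeries.coeff_mul, Finset.HasAntidiagonal.antidiagonal_zero, Finset.sum_singleton,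
        coeff_zero_expPow, i2, mul_one]
    exact ⟨h1, h2, hlast (k + 1) h1 h2⟩

/-- The Zassenhaus terms when the iterated commutators of `X`, `Y` with `[X, Y]` commute. -/
theorem zassenhaus_metabelian (h0 : z 0 0 = X * Y - Y * X)
    (hX : ∀ a b, X * z a b - z a b * X = z (a + 1) b)
    (hY : ∀ a b, Y * z a b - z a b * Y = z a (b + 1))
    (hz : ∀ a b c d, Commute (z a b) (z c d)) {n : ℕ} (hn : 2 ≤ n) :
    zassenhaus X Y n = metabelianTerm z n := by
  obtain ⟨k, rfl⟩ : ∃ k, n = k + 2 := ⟨n - 2, by omega⟩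
  exact (eulerOp_zassRem h0 hX hY hz k).2.2

end Zassenhaus

/-! ### Directional derivatives on open sets -/

section DirDeriv

variable {V F : Type*} [NormedAddCommGroup V] [NormedSpace ℝ V]
  [NormedAddCommGroup F] [NormedSpace ℝ F] {U : Set V} {f g : V → F}

lemma contDiffOn_dirDeriv (hU : IsOpen U) (hf : ContDiffOn ℝ ∞ f U) (v : V) :
    ContDiffOn ℝ ∞ (dirDeriv v f) U :=
  (hf.fderiv_of_isOpen hU (by simp)).clm_apply contDiffOn_const

lemma contDiffOn_dirDeriv_iterate (hU : IsOpen U) (hf : ContDiffOn ℝ ∞ f U) (v : V) (n : ℕ) :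
    ContDiffOn ℝ ∞ ((dirDeriv v)^[n] f) U := by
  induction n with
  | zero => exact hf
  | succ n ih => rw [Function.iterate_succ_apply']; exact contDiffOn_dirDeriv hU ih v

lemma eqOn_dirDeriv (hU : IsOpen U) (h : Set.EqOn f g U) (v : V) :
    Set.EqOn (dirDeriv v f) (dirDeriv v g) U := fun x hx => by
  have : f =ᶠ[𝓝 x] g := h.eventuallyEq_of_mem (hU.mem_nhds hx)
  rw [dirDeriv, dirDeriv, this.fderiv_eq]

lemma eqOn_dirDeriv_iterate (hU : IsOpen U) (h : Set.EqOn f g U) (v : V) (n : ℕ) :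
    Set.EqOn ((dirDeriv v)^[n] f) ((dirDeriv v)^[n] g) U := by
  induction n with
  | zero => exact h
  | succ n ih =>
    rw [Function.iterate_succ_apply', Function.iterate_succ_apply']
    exact eqOn_dirDeriv hU ih v

lemma differentiableAt_of_contDiffOn (hU : IsOpen U) (hf : ContDiffOn ℝ ∞ f U) {x : V}
    (hx : x ∈ U) : DifferentiableAt ℝ f x :=
  (hf.contDiffAt (hU.mem_nhds hx)).differentiableAt (by simp)

/-- Symmetry of the second derivative; all commutations of iterated derivatives below reduce to
this. -/
lemma dirDeriv_comm (hU : IsOpen U) (hf : ContDiffOn ℝ ∞ f U) (v w : V) :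
    Set.EqOn (dirDeriv v (dirDeriv w f)) (dirDeriv w (dirDeriv v f)) U := by
  intro x hx
  have hfx : ContDiffAt ℝ ∞ f x := hf.contDiffAt (hU.mem_nhds hx)
  have hd : DifferentiableAt ℝ (fderiv ℝ f) x :=
    (hfx.fderiv_right (m := ∞) (by simp)).differentiableAt (by simp)
  have key : ∀ a b : V, dirDeriv a (dirDeriv b f) x = fderiv ℝ (fderiv ℝ f) x a b := by
    intro a b
    have : HasFDerivAt (fun y => fderiv ℝ f y b)
        ((ContinuousLinearMap.apply ℝ F b).comp (fderiv ℝ (fderiv ℝ f) x)) x :=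
      (ContinuousLinearMap.apply ℝ F b).hasFDerivAt.comp x hd.hasFDerivAt
    rw [dirDeriv, show dirDeriv b f = fun y => fderiv ℝ f y b from rfl, this.fderiv]
    rfl
  rw [key, key]
  exact hfx.isSymmSndFDerivAt (by simp; exact WithTop.coe_le_coe.mpr le_top) v w

lemma dirDeriv_iterate_comm (hU : IsOpen U) (hf : ContDiffOn ℝ ∞ f U) (v w : V) (n : ℕ) :
    Set.EqOn (dirDeriv v ((dirDeriv w)^[n] f)) ((dirDeriv w)^[n] (dirDeriv v f)) U := by
  induction n with
  | zero => exact fun x _ => rfl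
  | succ n ih =>
    rw [Function.iterate_succ_apply', Function.iterate_succ_apply']
    exact (dirDeriv_comm hU (contDiffOn_dirDeriv_iterate hU hf w n) v w).trans
      (eqOn_dirDeriv hU ih w)

lemma dirDeriv_add_vec (v w : V) (f : V → F) :
    dirDeriv (v + w) f = dirDeriv v f + dirDeriv w f := by
  funext x
  simp [dirDeriv]

lemma dirDeriv_smul_vec (c : ℝ) (v : V) (f : V → F) :
    dirDeriv (c • v) f = c • dirDeriv v f := by
  funext x
  simp [dirDeriv]

end DirDeriv

/-! ### The magnetic field -/

lemma betaForm_eq (eg : ℝ) (u u' x : E) : betaForm eg u u' x = eg * det3 u u' x / ‖x‖ ^ 3 := by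
  simp [betaForm, beta, Fin.sum_univ_three, eps, det3]
  ring

lemma contDiffOn_norm_inv_pow (n : ℕ) : ContDiffOn ℝ ∞ (fun x : E => (‖x‖ ^ n)⁻¹) {0}ᶜ := by
  intro x hx
  have hx' : x ≠ 0 := hx
  exact (((contDiffAt_norm ℝ hx').pow n).inv
    (pow_ne_zero _ (norm_ne_zero_iff.mpr hx'))).contDiffWithinAt

lemma contDiffOn_beta (eg : ℝ) (i j : Fin 3) : ContDiffOn ℝ ∞ (beta eg i j) {0}ᶜ := by
  have h : beta eg i j = fun x : E => eg * ∑ k, eps i j k * x k * (‖x‖ ^ 3)⁻¹ := by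
    funext x; simp [beta, div_eq_mul_inv]
  rw [h]
  refine contDiffOn_const.mul (ContDiffOn.sum fun k _ => ?_)
  refine ContDiffOn.mul (ContDiff.contDiffOn ?_) (contDiffOn_norm_inv_pow 3)
  fun_prop

lemma contDiffOn_betaForm (eg : ℝ) (u u' : E) : ContDiffOn ℝ ∞ (betaForm eg u u') {0}ᶜ := by
  unfold betaForm
  exact ContDiffOn.sum fun i _ => ContDiffOn.sum fun j _ =>
    (contDiffOn_const.mul (contDiffOn_beta eg i j)).mul contDiffOn_const

/-! ### Operators on smooth fields -/

/-- Multiplication by `f(x) 𝔧(x)`. -/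
def jMulOp (f : E → ℝ) (hf : ContDiffOn ℝ ∞ f {0}ᶜ) : Module.End ℝ SmoothField where
  toFun Ψ := ⟨fun x => f x • (jq x * (Ψ : E → ℍ[ℝ]) x), hf.smul (contDiffOn_jq.mul Ψ.2.1), by
    have h : (Ψ : E → ℍ[ℝ]) 0 = 0 := Ψ.2.2
    simp [h]⟩
  map_add' := by
    intro Ψ Φ
    ext1
    funext x
    simp [mul_add]
  map_smul' := by
    intro c Ψ
    ext1
    funext x
    simp only [SetLike.val_smul, Pi.smul_apply, mul_smul_comm, RingHom.id_apply]
    exact smul_comm _ _ _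

lemma smoothField_apply_zero (Ψ : SmoothField) : (Ψ : E → ℍ[ℝ]) 0 = 0 := Ψ.2.2

lemma end_ext {S T : Module.End ℝ SmoothField}
    (h : ∀ (Ψ : SmoothField) (x : E), x ≠ 0 → (S Ψ : E → ℍ[ℝ]) x = (T Ψ : E → ℍ[ℝ]) x) : S = T := by
  refine LinearMap.ext fun Ψ => Subtype.ext (funext fun x => ?_)
  by_cases hx : x = 0
  · rw [hx, smoothField_apply_zero, smoothField_apply_zero]
  · exact h Ψ x hx

lemma end_smul_sub (c : ℝ) (S T : Module.End ℝ SmoothField) : c • S - c • T = c • (S - T) :=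
  end_ext fun Ψ x _ => (smul_sub c ((S Ψ : E → ℍ[ℝ]) x) ((T Ψ : E → ℍ[ℝ]) x)).symm

/-- As `J² = -1`, the operators `J u·P` are real multiples of covariant derivatives, so their
commutators are curvatures. -/
lemma jMom_eq (ħ : ℝ) (u : E) : jMom ħ u = ħ • nablaOp u := by
  refine end_ext fun Ψ x hx => ?_
  have hsum : (((∑ i, u i • momOp ħ i : Module.End ℝ SmoothField) Ψ : SmoothField) : E → ℍ[ℝ]) x =
      ∑ i, u i • momFun ħ i Ψ x := by
    rw [LinearMap.sum_apply, Submodule.coe_sum, Finset.sum_apply]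
    rfl
  have : (jMom ħ u Ψ : E → ℍ[ℝ]) x = jq x * ∑ i, u i • momFun ħ i Ψ x := by
    rw [← hsum]; rfl
  rw [this]
  have h2 := weylGenerator_eq ħ u 0 Ψ hx
  rw [weylGenerator] at h2
  simp only [PiLp.zero_apply, zero_smul, Finset.sum_const_zero, add_zero, inner_zero_left] at h2
  rw [h2]
  rfl

lemma smoothField_differentiableAt (Ψ : SmoothField) {x : E} (hx : x ≠ 0) :
    DifferentiableAt ℝ (Ψ : E → ℍ[ℝ]) x :=
  differentiableAt_of_contDiffOn isOpen_compl_singleton Ψ.2.1 hx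

lemma fderiv_crossQ (a x u : E) : fderiv ℝ (crossQ a) x u = crossQ a u := by
  let L : E →ₗ[ℝ] ℍ[ℝ] :=
    { toFun := crossQ a
      map_add' := crossQ_add_right a
      map_smul' := fun c y => crossQ_smul_right c a y }
  have : HasFDerivAt (crossQ a) L.toContinuousLinearMap x := L.toContinuousLinearMap.hasFDerivAt
  rw [this.fderiv]
  rfl

lemma hasFDerivAt_vecQ (x : E) : ∃ L : E →L[ℝ] ℍ[ℝ], HasFDerivAt vecQ L x ∧ ∀ u, L u = vecQ u := by
  let L : E →ₗ[ℝ] ℍ[ℝ] :=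
    { toFun := vecQ
      map_add' := fun x y => by ext <;> simp [vecQ_re, vecQ_imI, vecQ_imJ, vecQ_imK]
      map_smul' := fun c x => by ext <;> simp [vecQ_re, vecQ_imI, vecQ_imJ, vecQ_imK] }
  exact ⟨L.toContinuousLinearMap, L.toContinuousLinearMap.hasFDerivAt, fun u => rfl⟩

lemma hasFDerivAt_norm_pow_inv {x : E} (hx : x ≠ 0) (n : ℕ) :
    HasFDerivAt (fun y : E => (‖y‖ ^ n)⁻¹)
      ((-(n : ℝ) * (‖x‖ ^ (n + 2))⁻¹) • innerSL ℝ x) x := by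
  have hx' : ‖x‖ ≠ 0 := norm_ne_zero_iff.mpr hx
  have h1 : HasFDerivAt (fun y : E => ‖y‖) (‖x‖⁻¹ • innerSL ℝ x) x := by
    have h2 := (hasStrictFDerivAt_norm_sq x).hasFDerivAt.sqrt (pow_ne_zero 2 hx')
    have h3 : (fun y : E => √(‖y‖ ^ 2)) = fun y => ‖y‖ := by
      funext y; exact Real.sqrt_sq (norm_nonneg y)
    rw [h3, Real.sqrt_sq (norm_nonneg x)] at h2
    refine h2.congr_fderiv ?_
    rw [← Nat.cast_smul_eq_nsmul ℝ, smul_smul]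
    congr 1
    push_cast
    field_simp
  have h4 := (hasDerivAt_inv (pow_ne_zero n hx')).comp_hasFDerivAt x (h1.pow n)
  refine h4.congr_fderiv ?_
  ext v
  simp only [_root_.smul_apply, smul_eq_mul, nsmul_eq_mul]
  rcases n with _ | n
  · simp
  · simp only [Nat.add_sub_cancel]
    field_simp
    ring

lemma fderiv_connection {x : E} (hx : x ≠ 0) (a u : E) (φ : E → ℍ[ℝ])
    (hφ : DifferentiableAt ℝ φ x) :
    fderiv ℝ (fun y => ((1 / 2) * (‖y‖ ^ 2)⁻¹) • (crossQ a y * φ y)) x u =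
      (-(‖x‖ ^ 4)⁻¹ * inner ℝ x u) • (crossQ a x * φ x) +
      ((1 / 2) * (‖x‖ ^ 2)⁻¹) • (crossQ a u * φ x + crossQ a x * fderiv ℝ φ x u) := by
  have h1 := (hasFDerivAt_norm_pow_inv hx 2).const_mul (1 / 2 : ℝ)
  have h2 : HasFDerivAt (crossQ a) (fderiv ℝ (crossQ a) x) x :=
    (differentiableAt_of_contDiffOn isOpen_univ (contDiff_crossQ a).contDiffOn
      (Set.mem_univ x)).hasFDerivAt
  have h3 := h1.smul (h2.mul' hφ.hasFDerivAt)
  have h3' : fderiv ℝ (fun y => ((1 / 2) * (‖y‖ ^ 2)⁻¹) • (crossQ a y * φ y)) x = _ := h3.fderiv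
  rw [h3']
  simp only [_root_.add_apply, _root_.smul_apply, ContinuousLinearMap.smulRight_apply,
    fderiv_crossQ, innerSL_apply_apply, smul_eq_mul, MulOpposite.smul_eq_mul_unop,
    MulOpposite.unop_op]
  push_cast
  rw [add_comm]
  congr 1
  · congr 1; ring
  · rw [add_comm]

lemma nablaOp_apply (a : E) (Ψ : SmoothField) {x : E} (hx : x ≠ 0) :
    (nablaOp a Ψ : E → ℍ[ℝ]) x = fderiv ℝ (Ψ : E → ℍ[ℝ]) x a +
      ((1 / 2) * (‖x‖ ^ 2)⁻¹) • (crossQ a x * (Ψ : E → ℍ[ℝ]) x) := by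
  change nablaFun a Ψ x = _
  rw [nablaFun, if_neg hx]

lemma nablaOp_nablaOp_apply (a b : E) (Ψ : SmoothField) {x : E} (hx : x ≠ 0) :
    (nablaOp a (nablaOp b Ψ) : E → ℍ[ℝ]) x = dirDeriv a (dirDeriv b Ψ) x +
      ((-(‖x‖ ^ 4)⁻¹ * inner ℝ x a) • (crossQ b x * (Ψ : E → ℍ[ℝ]) x) +
      ((1 / 2) * (‖x‖ ^ 2)⁻¹) • (crossQ b a * (Ψ : E → ℍ[ℝ]) x +
        crossQ b x * fderiv ℝ (Ψ : E → ℍ[ℝ]) x a)) +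
      ((1 / 2) * (‖x‖ ^ 2)⁻¹) • (crossQ a x * (fderiv ℝ (Ψ : E → ℍ[ℝ]) x b +
      ((1 / 2) * (‖x‖ ^ 2)⁻¹) • (crossQ b x * (Ψ : E → ℍ[ℝ]) x))) := by
  rw [nablaOp_apply a _ hx, nablaOp_apply b _ hx]
  have hev : (nablaOp b Ψ : E → ℍ[ℝ]) =ᶠ[𝓝 x] fun y => dirDeriv b (Ψ : E → ℍ[ℝ]) y +
      ((1 / 2) * (‖y‖ ^ 2)⁻¹) • (crossQ b y * (Ψ : E → ℍ[ℝ]) y) := by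
    filter_upwards [isOpen_compl_singleton.mem_nhds hx] with y hy
    exact nablaOp_apply b Ψ hy
  rw [hev.fderiv_eq]
  have hd := smoothField_differentiableAt Ψ hx
  have d1 : DifferentiableAt ℝ (dirDeriv b (Ψ : E → ℍ[ℝ])) x :=
    differentiableAt_of_contDiffOn isOpen_compl_singleton
      (contDiffOn_dirDeriv isOpen_compl_singleton Ψ.2.1 b) hx
  have d2 : DifferentiableAt ℝ
      (fun y => ((1 / 2) * (‖y‖ ^ 2)⁻¹) • (crossQ b y * (Ψ : E → ℍ[ℝ]) y)) x :=
    ((hasFDerivAt_norm_pow_inv hx 2).differentiableAt.const_mul (1 / 2 : ℝ)).smul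
      ((differentiableAt_of_contDiffOn isOpen_univ (contDiff_crossQ b).contDiffOn
      (Set.mem_univ x)).mul hd)
  have hs := fderiv_add d1 d2
  rw [show (fun y => dirDeriv b (Ψ : E → ℍ[ℝ]) y +
      ((1 / 2) * (‖y‖ ^ 2)⁻¹) • (crossQ b y * (Ψ : E → ℍ[ℝ]) y)) = dirDeriv b (Ψ : E → ℍ[ℝ]) +
      fun y => ((1 / 2) * (‖y‖ ^ 2)⁻¹) • (crossQ b y * (Ψ : E → ℍ[ℝ]) y) from rfl, hs,
    _root_.add_apply, fderiv_connection hx b a _ hd]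
  rfl

/-- The algebraic content of `dA + A ∧ A` for the connection form `A(a) = ½|x|⁻² (a × x)·𝔢`; no
function is differentiated here. -/
lemma curvature_identity (a b : E) {x : E} (hx : x ≠ 0) :
    (-(‖x‖ ^ 4)⁻¹ * inner ℝ x a) • crossQ b x + ((1 / 2) * (‖x‖ ^ 2)⁻¹) • crossQ b a
    - ((-(‖x‖ ^ 4)⁻¹ * inner ℝ x b) • crossQ a x + ((1 / 2) * (‖x‖ ^ 2)⁻¹) • crossQ a b)
    + ((1 / 2) * (‖x‖ ^ 2)⁻¹ * ((1 / 2) * (‖x‖ ^ 2)⁻¹)) •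
      (crossQ a x * crossQ b x - crossQ b x * crossQ a x) =
    -(1 / 2 * det3 a b x * (‖x‖ ^ 4)⁻¹) • vecQ x := by
  have hx' : ‖x‖ ^ 2 ≠ 0 := pow_ne_zero 2 (norm_ne_zero_iff.mpr hx)
  -- With `|x|²` turned into a variable, only rational identities in the coordinates remain.
  rw [show ‖x‖ ^ 4 = (‖x‖ ^ 2) ^ 2 by ring]
  have hN := norm_sq_eq x
  generalize ‖x‖ ^ 2 = N at hx' hN
  rw [inner_eq, inner_eq]
  ext <;> simp [crossQ_re, crossQ_imI, crossQ_imJ, crossQ_imK, vecQ_re, vecQ_imI, vecQ_imJ,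
    vecQ_imK, det3] <;> field_simp <;> (try rw [hN]) <;> (try ring_nf) <;> (try simp)

/-- Second derivatives cancel by symmetry and first-order terms cancel in pairs; what is left is the
curvature, minus the monopole field of charge product `1/2` times `𝔧`. -/
lemma nablaOp_commutator (a b : E) (Ψ : SmoothField) {x : E} (hx : x ≠ 0) :
    (nablaOp a (nablaOp b Ψ) : E → ℍ[ℝ]) x - (nablaOp b (nablaOp a Ψ) : E → ℍ[ℝ]) x =
      -(1 / 2 * det3 a b x * (‖x‖ ^ 3)⁻¹) • (jq x * (Ψ : E → ℍ[ℝ]) x) := by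
  rw [nablaOp_nablaOp_apply a b Ψ hx, nablaOp_nablaOp_apply b a Ψ hx,
    dirDeriv_comm isOpen_compl_singleton Ψ.2.1 a b hx]
  have key := congrArg (· * (Ψ : E → ℍ[ℝ]) x) (curvature_identity a b hx)
  have hx' : ‖x‖ ≠ 0 := norm_ne_zero_iff.mpr hx
  have hr : -(1 / 2 * det3 a b x * (‖x‖ ^ 3)⁻¹) • (jq x * (Ψ : E → ℍ[ℝ]) x) =
      -(1 / 2 * det3 a b x * (‖x‖ ^ 4)⁻¹) • vecQ x * (Ψ : E → ℍ[ℝ]) x := by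
    rw [jq, smul_mul_assoc, neg_smul, neg_smul, smul_smul, neg_mul, smul_mul_assoc]
    congr 2
    field_simp
  rw [hr, ← key]
  simp only [add_mul, sub_mul, smul_mul_assoc, mul_add, mul_smul_comm, mul_assoc]
  module

/-- Covariant constancy of `𝔧`: the commutator can only differentiate the scalar factor. -/
lemma nablaOp_jMulOp (a : E) (f : E → ℝ) (hf : ContDiffOn ℝ ∞ f {0}ᶜ) :
    nablaOp a * jMulOp f hf - jMulOp f hf * nablaOp a =
      jMulOp (dirDeriv a f) (contDiffOn_dirDeriv isOpen_compl_singleton hf a) := by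
  refine end_ext fun Ψ x hx => ?_
  have hx' : ‖x‖ ≠ 0 := norm_ne_zero_iff.mpr hx
  have hd := smoothField_differentiableAt Ψ hx
  obtain ⟨L, hL, hLu⟩ := hasFDerivAt_vecQ x
  have hj : HasFDerivAt jq _ x := (by simpa using hasFDerivAt_norm_pow_inv hx 1 :
    HasFDerivAt (fun y : E => ‖y‖⁻¹) _ x).smul hL
  have hfd : HasFDerivAt f (fderiv ℝ f x) x :=
    (differentiableAt_of_contDiffOn isOpen_compl_singleton hf hx).hasFDerivAt
  have h1 : fderiv ℝ (jMulOp f hf Ψ : E → ℍ[ℝ]) x a = dirDeriv a f x • (jq x * (Ψ : E → ℍ[ℝ]) x) +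
      f x • ((‖x‖⁻¹ • vecQ a - ((‖x‖ ^ 3)⁻¹ * inner ℝ x a) • vecQ x) * (Ψ : E → ℍ[ℝ]) x +
        jq x * fderiv ℝ (Ψ : E → ℍ[ℝ]) x a) := by
    have h2 : HasFDerivAt (jMulOp f hf Ψ : E → ℍ[ℝ]) _ x :=
      hfd.smul (hj.mul' hd.hasFDerivAt)
    rw [h2.fderiv]
    simp only [_root_.add_apply, _root_.smul_apply, ContinuousLinearMap.smulRight_apply,
      smul_eq_mul, MulOpposite.smul_eq_mul_unop, MulOpposite.unop_op, hLu, dirDeriv]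
    rw [add_comm]
    congr 2
    rw [add_comm]
    congr 2
    rw [show (-((‖x‖ ^ 3)⁻¹ • (innerSL ℝ) x)) a = -((‖x‖ ^ 3)⁻¹ * inner ℝ x a) from rfl, neg_smul,
      sub_eq_add_neg]
  have h3 : (((nablaOp a * jMulOp f hf - jMulOp f hf * nablaOp a) Ψ : SmoothField) : E → ℍ[ℝ]) x =
      (nablaOp a (jMulOp f hf Ψ) : E → ℍ[ℝ]) x - f x • (jq x * (nablaOp a Ψ : E → ℍ[ℝ]) x) := rfl
  rw [h3, nablaOp_apply a _ hx, nablaOp_apply a _ hx, h1]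
  have h4 : (jMulOp f hf Ψ : E → ℍ[ℝ]) x = f x • (jq x * (Ψ : E → ℍ[ℝ]) x) := rfl
  have h5 : (jMulOp (dirDeriv a f) (contDiffOn_dirDeriv isOpen_compl_singleton hf a) Ψ :
    E → ℍ[ℝ]) x = dirDeriv a f x • (jq x * (Ψ : E → ℍ[ℝ]) x) := rfl
  rw [h4, h5]
  -- The directional derivative of `𝔧` equals its commutator with the connection form, that is `∇𝔧 =
  -- 0`.
  have key : ‖x‖⁻¹ • vecQ a - ((‖x‖ ^ 3)⁻¹ * inner ℝ x a) • vecQ x =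
      ((1 / 2) * (‖x‖ ^ 2)⁻¹) • (jq x * crossQ a x - crossQ a x * jq x) := by
    have hN := norm_sq_eq x
    have : ‖x‖⁻¹ = (‖x‖ ^ 3)⁻¹ * ‖x‖ ^ 2 := by field_simp
    rw [jq, smul_mul_assoc, mul_smul_comm, ← smul_sub, smul_smul,
      show 1 / 2 * (‖x‖ ^ 2)⁻¹ * ‖x‖⁻¹ = (‖x‖ ^ 3)⁻¹ * (1 / 2) by field_simp, this, mul_smul,
      mul_smul, mul_smul, ← smul_sub]
    congr 1
    rw [hN, inner_eq]
    ext <;> simp [crossQ_re, crossQ_imI, crossQ_imJ, crossQ_imK, vecQ_re, vecQ_imI, vecQ_imJ,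
      vecQ_imK] <;> ring
  rw [key]
  simp only [sub_mul, smul_mul_assoc, mul_add, mul_smul_comm, mul_assoc]
  module

/-- Iterated derivatives of the form `u · β u'`. -/
def betaIter (eg : ℝ) (u u' : E) (a b : ℕ) : E → ℝ :=
  (dirDeriv u)^[a] ((dirDeriv u')^[b] (betaForm eg u u'))

lemma contDiffOn_betaIter (eg : ℝ) (u u' : E) (a b : ℕ) :
    ContDiffOn ℝ ∞ (betaIter eg u u' a b) {0}ᶜ :=
  contDiffOn_dirDeriv_iterate isOpen_compl_singleton
    (contDiffOn_dirDeriv_iterate isOpen_compl_singleton (contDiffOn_betaForm eg u u') u' b) u a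

lemma jMulOp_congr {f g : E → ℝ} {hf : ContDiffOn ℝ ∞ f {0}ᶜ} {hg : ContDiffOn ℝ ∞ g {0}ᶜ}
    (h : Set.EqOn f g {0}ᶜ) : jMulOp f hf = jMulOp g hg :=
  end_ext fun Ψ x hx => by
    change f x • (jq x * (Ψ : E → ℍ[ℝ]) x) = g x • (jq x * (Ψ : E → ℍ[ℝ]) x)
    rw [h hx]

/-- The commutators are scalar functions times `𝔧`, and these commute with each other, so the
metabelian formula applies. -/
theorem zassenhaus_jMom (ħ : ℝ) {n : ℕ} (hn : 2 ≤ n) (u u' : E) (Ψ : SmoothField) (x : E) :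
    (zassenhaus (jMom ħ u) (jMom ħ u') n Ψ : E → ℍ[ℝ]) x =
      (ħ ^ (n - 1) * zassTerm zassCoeff (ħ / 2) n u u' x) • (jq x * (Ψ : E → ℍ[ℝ]) x) := by
  -- The exponent is `a + b + 1` although `a + b + 2` operators are involved, because one power of
  -- `ħ` is already contained in the charge product `ħ/2`.
  set z : ℕ → ℕ → Module.End ℝ SmoothField := fun a b =>
    (-(ħ ^ (a + b + 1))) • jMulOp _ (contDiffOn_betaIter (ħ / 2) u u' a b) with hz
  have h0 : z 0 0 = jMom ħ u * jMom ħ u' - jMom ħ u' * jMom ħ u := by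
    rw [jMom_eq, jMom_eq]
    refine end_ext fun Φ y hy => ?_
    have e1 : (((ħ • nablaOp u * ħ • nablaOp u' - ħ • nablaOp u' * ħ • nablaOp u) Φ :
        SmoothField) : E → ℍ[ℝ]) y = (ħ * ħ) • ((nablaOp u (nablaOp u' Φ) : E → ℍ[ℝ]) y -
        (nablaOp u' (nablaOp u Φ) : E → ℍ[ℝ]) y) := by
      rw [smul_mul_smul_comm, smul_mul_smul_comm, end_smul_sub]
      rfl
    have e2 : (z 0 0 Φ : E → ℍ[ℝ]) y = (-(ħ ^ (0 + 0 + 1))) • (betaForm (ħ / 2) u u' y •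
      (jq y * (Φ : E → ℍ[ℝ]) y)) := rfl
    rw [e1, e2, nablaOp_commutator u u' Φ hy, betaForm_eq, smul_smul, smul_smul]
    congr 1
    ring
  have hX : ∀ a b, jMom ħ u * z a b - z a b * jMom ħ u = z (a + 1) b := by
    intro a b
    rw [jMom_eq, hz]
    simp only
    rw [smul_mul_smul_comm, smul_mul_smul_comm, mul_comm ħ, end_smul_sub, nablaOp_jMulOp]
    have : jMulOp _ (contDiffOn_dirDeriv isOpen_compl_singleton
        (contDiffOn_betaIter (ħ / 2) u u' a b) u) =
        jMulOp _ (contDiffOn_betaIter (ħ / 2) u u' (a + 1) b) := by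
      refine jMulOp_congr fun y _ => ?_
      rw [betaIter, betaIter, Function.iterate_succ_apply']
    rw [this]
    congr 1
    ring
  have hY : ∀ a b, jMom ħ u' * z a b - z a b * jMom ħ u' = z a (b + 1) := by
    intro a b
    rw [jMom_eq, hz]
    simp only
    rw [smul_mul_smul_comm, smul_mul_smul_comm, mul_comm ħ, end_smul_sub, nablaOp_jMulOp]
    have : jMulOp _ (contDiffOn_dirDeriv isOpen_compl_singleton
        (contDiffOn_betaIter (ħ / 2) u u' a b) u') =
        jMulOp _ (contDiffOn_betaIter (ħ / 2) u u' a (b + 1)) := by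
      refine jMulOp_congr fun y hy => ?_
      rw [betaIter, betaIter, Function.iterate_succ_apply' (n := b)]
      exact dirDeriv_iterate_comm isOpen_compl_singleton
        (contDiffOn_dirDeriv_iterate isOpen_compl_singleton (contDiffOn_betaForm _ u u') u' b)
        u' u a hy
    rw [this]
    congr 1
    ring
  have hc : ∀ a b c d, Commute (z a b) (z c d) := by
    intro a b c d
    refine (Commute.smul_left ?_ _).smul_right _
    refine end_ext fun Φ y _ => ?_
    change betaIter (ħ / 2) u u' a b y • (jq y * betaIter (ħ / 2) u u' c d y •
      (jq y * (Φ : E → ℍ[ℝ]) y)) = betaIter (ħ / 2) u u' c d y • (jq y *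
        betaIter (ħ / 2) u u' a b y • (jq y * (Φ : E → ℍ[ℝ]) y))
    rw [mul_smul_comm, mul_smul_comm, smul_comm]
  rw [zassenhaus_metabelian h0 hX hY hc hn, metabelianTerm, zassTerm]
  have e3 : (((-∑ a ∈ Finset.range (n - 1), zassCoeff n a • z a (n - 2 - a) :
      Module.End ℝ SmoothField) Ψ : SmoothField) : E → ℍ[ℝ]) x =
      -∑ a ∈ Finset.range (n - 1), zassCoeff n a • ((-(ħ ^ (a + (n - 2 - a) + 1))) •
        (betaIter (ħ / 2) u u' a (n - 2 - a) x • (jq x * (Ψ : E → ℍ[ℝ]) x))) := by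
    rw [LinearMap.neg_apply, LinearMap.sum_apply, Submodule.coe_neg, Submodule.coe_sum,
      Pi.neg_apply, Finset.sum_apply]
    rfl
  rw [e3, Finset.mul_sum, Finset.sum_smul, ← Finset.sum_neg_distrib]
  refine Finset.sum_congr rfl fun a ha => ?_
  rw [Finset.mem_range] at ha
  rw [show a + (n - 2 - a) + 1 = n - 1 by omega, ← betaIter, smul_smul, smul_smul, ← neg_smul]
  congr 1
  ring

/-! ### Jets of the magnetic field -/

/-- A sum of coordinate derivatives. -/
lemma eq_sum_basisVec (u : E) : u = ∑ i, u i • basisVec i := by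
  ext j
  fin_cases j <;> simp [Fin.sum_univ_three, basisVec]

/-- Evaluation of a polynomial in jets and symbols. -/
def jetEval (eg : ℝ) (q u v u' v' : E) : SymbolPoly JetPoly →+* ℂ :=
  (MvPolynomial.eval fun s : Fin 4 × Fin 3 => (((![u, v, u', v'] s.1) s.2 : ℝ) : ℂ)).comp
    (MvPolynomial.map (MvPolynomial.eval fun s => (betaDeriv eg s.1 s.2.1 s.2.2 q : ℂ)))

lemma evalSymbol_evalJet (eg : ℝ) (q u v u' v' : E) (W : SymbolPoly JetPoly) :
    evalSymbol (evalJet eg q W) u v u' v' = jetEval eg q u v u' v' W := rfl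

lemma contDiffOn_betaDeriv (eg : ℝ) (i j : Fin 3) (γ : Fin 3 → ℕ) :
    ContDiffOn ℝ ∞ (betaDeriv eg i j γ) {0}ᶜ := by
  unfold betaDeriv
  have hU : IsOpen ({0}ᶜ : Set E) := isOpen_compl_singleton
  exact contDiffOn_dirDeriv_iterate hU (contDiffOn_dirDeriv_iterate hU
    (contDiffOn_dirDeriv_iterate hU (contDiffOn_beta eg i j) _ _) _ _) _ _

/-- `betaDeriv` applies the coordinate derivatives in a fixed order, so the new one has to be moved
inwards to its slot. -/
lemma dirDeriv_betaDeriv (eg : ℝ) (i j k : Fin 3) (γ : Fin 3 → ℕ) :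
    Set.EqOn (dirDeriv (basisVec k) (betaDeriv eg i j γ))
      (betaDeriv eg i j (γ + Pi.single k 1)) {0}ᶜ := by
  have hU : IsOpen ({0}ᶜ : Set E) := isOpen_compl_singleton
  have h2 := contDiffOn_dirDeriv_iterate hU (contDiffOn_beta eg i j) (basisVec 2) (γ 2)
  have h1 := contDiffOn_dirDeriv_iterate hU h2 (basisVec 1) (γ 1)
  fin_cases k
  · intro x _
    simp only [betaDeriv]
    simp [Function.iterate_succ_apply']
  · refine (dirDeriv_iterate_comm hU h1 (basisVec 1) (basisVec 0) (γ 0)).trans ?_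
    intro x _
    simp only [betaDeriv]
    simp [Function.iterate_succ_apply']
  · refine (dirDeriv_iterate_comm hU h1 (basisVec 2) (basisVec 0) (γ 0)).trans ?_
    refine (eqOn_dirDeriv_iterate hU
      (dirDeriv_iterate_comm hU h2 (basisVec 2) (basisVec 1) (γ 1)) _ _).trans ?_
    intro x _
    simp only [betaDeriv]
    simp [← Function.iterate_succ_apply' (dirDeriv (basisVec 2))]

/-- Polynomials in jets have polynomial derivatives. -/
def HasJetDeriv (W : SymbolPoly JetPoly) : Prop :=
  ∃ W' : Fin 3 → SymbolPoly JetPoly, ∀ (eg : ℝ) (q u v u' v' : E), q ≠ 0 →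
    DifferentiableAt ℝ (fun y => jetEval eg y u v u' v' W) q ∧
    ∀ k, fderiv ℝ (fun y => jetEval eg y u v u' v' W) q (basisVec k) =
      jetEval eg q u v u' v' (W' k)

lemma HasJetDeriv.add {W₁ W₂ : SymbolPoly JetPoly} (h₁ : HasJetDeriv W₁) (h₂ : HasJetDeriv W₂) :
    HasJetDeriv (W₁ + W₂) := by
  obtain ⟨W₁', h₁⟩ := h₁
  obtain ⟨W₂', h₂⟩ := h₂
  refine ⟨W₁' + W₂', fun eg q u v u' v' hq => ?_⟩
  obtain ⟨d₁, e₁⟩ := h₁ eg q u v u' v' hq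
  obtain ⟨d₂, e₂⟩ := h₂ eg q u v u' v' hq
  have heq : (fun y => jetEval eg y u v u' v' (W₁ + W₂)) =
      (fun y => jetEval eg y u v u' v' W₁) + fun y => jetEval eg y u v u' v' W₂ := by
    funext y; simp
  rw [heq]
  refine ⟨d₁.add d₂, fun k => ?_⟩
  rw [fderiv_add d₁ d₂, _root_.add_apply, e₁, e₂, Pi.add_apply, map_add]

lemma HasJetDeriv.mul {W₁ W₂ : SymbolPoly JetPoly} (h₁ : HasJetDeriv W₁) (h₂ : HasJetDeriv W₂) :
    HasJetDeriv (W₁ * W₂) := by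
  obtain ⟨W₁', h₁⟩ := h₁
  obtain ⟨W₂', h₂⟩ := h₂
  refine ⟨fun k => W₁ * W₂' k + W₂ * W₁' k, fun eg q u v u' v' hq => ?_⟩
  obtain ⟨d₁, e₁⟩ := h₁ eg q u v u' v' hq
  obtain ⟨d₂, e₂⟩ := h₂ eg q u v u' v' hq
  have heq : (fun y => jetEval eg y u v u' v' (W₁ * W₂)) =
      (fun y => jetEval eg y u v u' v' W₁) * fun y => jetEval eg y u v u' v' W₂ := by
    funext y; simp
  rw [heq]
  refine ⟨d₁.mul d₂, fun k => ?_⟩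
  rw [fderiv_mul d₁ d₂, _root_.add_apply, _root_.smul_apply, _root_.smul_apply, e₁, e₂]
  simp

lemma hasJetDeriv_const {W : SymbolPoly JetPoly}
    (h : ∀ (eg : ℝ) (q q' u v u' v' : E), jetEval eg q u v u' v' W = jetEval eg q' u v u' v' W) :
    HasJetDeriv W := by
  refine ⟨0, fun eg q u v u' v' _ => ?_⟩
  have : (fun y => jetEval eg y u v u' v' W) = fun _ => jetEval eg q u v u' v' W := by
    funext y; exact h _ _ _ _ _ _ _
  rw [this]
  exact ⟨differentiableAt_const _, fun k => by simp⟩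

lemma jetEval_jet (eg : ℝ) (q u v u' v' : E) (s : Fin 3 × Fin 3 × (Fin 3 → ℕ)) :
    jetEval eg q u v u' v' (MvPolynomial.C (MvPolynomial.X s)) =
      (betaDeriv eg s.1 s.2.1 s.2.2 q : ℂ) := by
  simp [jetEval]

lemma jetEval_X (eg : ℝ) (q u v u' v' : E) (s : Fin 4 × Fin 3) :
    jetEval eg q u v u' v' (MvPolynomial.X s) = (((![u, v, u', v'] s.1) s.2 : ℝ) : ℂ) := by
  simp [jetEval]

lemma jetEval_const (eg : ℝ) (q u v u' v' : E) (c : ℂ) :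
    jetEval eg q u v u' v' (MvPolynomial.C (MvPolynomial.C c)) = c := by
  simp [jetEval]

lemma fderiv_ofReal_comp {φ : E → ℝ} {q : E} (h : DifferentiableAt ℝ φ q) (a : E) :
    DifferentiableAt ℝ (fun y => (φ y : ℂ)) q ∧
    fderiv ℝ (fun y => (φ y : ℂ)) q a = ((dirDeriv a φ q : ℝ) : ℂ) := by
  have : HasFDerivAt (fun y => (φ y : ℂ)) (Complex.ofRealCLM.comp (fderiv ℝ φ q)) q :=
    Complex.ofRealCLM.hasFDerivAt.comp q h.hasFDerivAt
  refine ⟨this.differentiableAt, ?_⟩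
  rw [this.fderiv]
  rfl

/-- Induction over both layers of polynomials: the only ingredients depending on `q` are the jet
variables, and differentiating one of them raises its multi-index. -/
lemma hasJetDeriv (W : SymbolPoly JetPoly) : HasJetDeriv W := by
  induction W using MvPolynomial.induction_on with
  | C c =>
    induction c using MvPolynomial.induction_on with
    | C c => exact hasJetDeriv_const fun _ _ _ _ _ _ _ => by rw [jetEval_const, jetEval_const]
    | add p q hp hq => rw [map_add]; exact hp.add hq
    | mul_X p s hp =>
      rw [map_mul]
      refine hp.mul ⟨fun k => MvPolynomial.C (MvPolynomial.X
        (s.1, s.2.1, s.2.2 + Pi.single k 1)), fun eg q u v u' v' hq => ?_⟩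
      simp only [jetEval_jet]
      have hd : DifferentiableAt ℝ (betaDeriv eg s.1 s.2.1 s.2.2) q :=
        differentiableAt_of_contDiffOn isOpen_compl_singleton (contDiffOn_betaDeriv _ _ _ _) hq
      refine ⟨(fderiv_ofReal_comp hd 0).1, fun k => ?_⟩
      rw [(fderiv_ofReal_comp hd _).2, dirDeriv_betaDeriv eg _ _ k _ hq]
  | add p q hp hq => exact hp.add hq
  | mul_X p s hp =>
    exact hp.mul (hasJetDeriv_const fun _ _ _ _ _ _ _ => by rw [jetEval_X, jetEval_X])

/-- Functions of `(β, u, u', q)` that are polynomial in `u`, `u'` and the jet of `β` at `q`. -/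
def JetRep (φ : ℝ → E → E → E → ℝ) : Prop :=
  ∃ W : SymbolPoly JetPoly, ∀ (eg : ℝ) (q u v u' v' : E), q ≠ 0 →
    jetEval eg q u v u' v' W = (φ eg u u' q : ℂ)

lemma JetRep.const_mul {φ : ℝ → E → E → E → ℝ} (h : JetRep φ) (c : ℝ) :
    JetRep fun eg u u' q => c * φ eg u u' q := by
  obtain ⟨W, hW⟩ := h
  refine ⟨MvPolynomial.C (MvPolynomial.C (c : ℂ)) * W, fun eg q u v u' v' hq => ?_⟩
  rw [map_mul, jetEval_const, hW _ _ _ _ _ _ hq]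
  push_cast
  rfl

lemma JetRep.sum {ι : Type*} (s : Finset ι) {φ : ι → ℝ → E → E → E → ℝ}
    (h : ∀ i ∈ s, JetRep (φ i)) : JetRep fun eg u u' q => ∑ i ∈ s, φ i eg u u' q := by
  classical
  choose! W hW using h
  refine ⟨∑ i ∈ s, W i, fun eg q u v u' v' hq => ?_⟩
  rw [map_sum, Complex.ofReal_sum]
  exact Finset.sum_congr rfl fun i hi => hW i hi _ _ _ _ _ _ hq

/-- By the chain rule the derivative along `c u + c' u'` is a combination of the coordinate
derivatives with coefficients linear in `u`, `u'`. Universality survives because the polynomials of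
`HasJetDeriv` depend on none of the data. -/
lemma JetRep.dirDeriv {φ : ℝ → E → E → E → ℝ} (h : JetRep φ) (c c' : ℝ) :
    JetRep fun eg u u' => dirDeriv (c • u + c' • u') (φ eg u u') := by
  obtain ⟨W, hW⟩ := h
  obtain ⟨W', hW'⟩ := hasJetDeriv W
  refine ⟨∑ k, (MvPolynomial.C (MvPolynomial.C (c : ℂ)) * MvPolynomial.X (0, k) +
    MvPolynomial.C (MvPolynomial.C (c' : ℂ)) * MvPolynomial.X (2, k)) * W' k,
    fun eg q u v u' v' hq => ?_⟩
  obtain ⟨hd, hk⟩ := hW' eg q u v u' v' hq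
  have hev : (fun y => jetEval eg y u v u' v' W) =ᶠ[𝓝 q] fun y => ((φ eg u u' y : ℝ) : ℂ) := by
    filter_upwards [isOpen_compl_singleton.mem_nhds hq] with y hy
    exact hW _ _ _ _ _ _ hy
  have hd' : DifferentiableAt ℝ (fun y => ((φ eg u u' y : ℝ) : ℂ)) q := hd.congr_of_eventuallyEq
    hev.symm
  -- Smoothness of `φ` is no part of `JetRep`; it is recovered as the real part of the polynomial
  -- expression that agrees with it near `q`.
  have hφ : DifferentiableAt ℝ (φ eg u u') q := by
    have := Complex.reCLM.differentiableAt.comp q hd'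
    exact this
  rw [← (fderiv_ofReal_comp hφ _).2, ← hev.fderiv_eq]
  conv_rhs => rw [eq_sum_basisVec (c • u + c' • u'), map_sum]
  simp only [map_smul, hk, map_sum, map_mul, map_add, jetEval_const, jetEval_X]
  refine Finset.sum_congr rfl fun k _ => ?_
  simp

lemma JetRep.dirDeriv_iterate {φ : ℝ → E → E → E → ℝ} (h : JetRep φ) (c c' : ℝ) (n : ℕ) :
    JetRep fun eg u u' => (Monopole.dirDeriv (c • u + c' • u'))^[n] (φ eg u u') := by
  induction n with
  | zero => exact h
  | succ n ih =>
    simp only [Function.iterate_succ_apply']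
    exact ih.dirDeriv c c'

lemma jetRep_betaForm : JetRep fun eg u u' q => betaForm eg u u' q := by
  refine ⟨∑ i, ∑ j, MvPolynomial.X (0, i) * MvPolynomial.C (MvPolynomial.X (i, j, 0)) *
    MvPolynomial.X (2, j), fun eg q u v u' v' _ => ?_⟩
  simp [betaForm, jetEval_X, jetEval_jet, betaDeriv]

lemma jetRep_zassTerm (r : ℕ → ℕ → ℝ) (n : ℕ) :
    JetRep fun eg u u' q => zassTerm r eg n u u' q := by
  refine JetRep.sum _ fun a _ => JetRep.const_mul ?_ _
  have := (jetRep_betaForm.dirDeriv_iterate 0 1 (n - 2 - a)).dirDeriv_iterate 1 0 a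
  simpa using this

lemma jetRep_exponent (r : ℕ → ℕ → ℝ) (N : ℕ) :
    JetRep fun eg u u' q => ∑ k ∈ Finset.range N, ((2 : ℝ) ^ k * (Nat.factorial k : ℝ))⁻¹ *
      (dirDeriv (u + u'))^[k] (zassTerm r eg (N + 1 - k) u u') q := by
  refine JetRep.sum _ fun k _ => JetRep.const_mul ?_ _
  have := (jetRep_zassTerm r (N + 1 - k)).dirDeriv_iterate 1 1 k
  simpa using this

lemma exists_exponent_poly (r : ℕ → ℕ → ℝ) (N : ℕ) : ∃ W : SymbolPoly JetPoly,
    ∀ (eg : ℝ) (q u v u' v' : E), q ≠ 0 → jetEval eg q u v u' v' W =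
      PowerSeries.coeff N (multiplierExponent r eg q u v u' v') := by
  obtain ⟨W, hW⟩ := jetRep_exponent r N
  refine ⟨MvPolynomial.C (MvPolynomial.C (-Complex.I)) * W + (if N = 1 then
    MvPolynomial.C (MvPolynomial.C (Complex.I / 2)) * ∑ i : Fin 3,
      (MvPolynomial.X (0, i) * MvPolynomial.X (3, i) - MvPolynomial.X (1, i) * MvPolynomial.X (2, i))
      else 0), fun eg q u v u' v' hq => ?_⟩
  rw [multiplierExponent, PowerSeries.coeff_mk, map_add, map_mul, jetEval_const, hW _ _ _ _ _ _ hq]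
  congr 1
  split_ifs
  · rw [map_mul, jetEval_const, map_sum, inner_eq, inner_eq]
    simp [jetEval_X, Fin.sum_univ_three]
  · simp

/-- The coefficients of the exponent of the multiplier, as polynomials. -/
def exponentPoly (N : ℕ) : SymbolPoly JetPoly := (exists_exponent_poly zassCoeff N).choose

lemma jetEval_exponentPoly (N : ℕ) (eg : ℝ) {q : E} (u v u' v' : E) (hq : q ≠ 0) :
    jetEval eg q u v u' v' (exponentPoly N) =
      PowerSeries.coeff N (multiplierExponent zassCoeff eg q u v u' v') :=
  (exists_exponent_poly zassCoeff N).choose_spec eg q u v _ _ hq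

/-- The coefficients of the multiplier, as polynomials. -/
def multiplierPoly (n : ℕ) : SymbolPoly JetPoly :=
  ∑ k ∈ Finset.range (n + 1), MvPolynomial.C (MvPolynomial.C ((Nat.factorial k : ℂ)⁻¹)) *
    PowerSeries.coeff n (PowerSeries.mk exponentPoly ^ k)

/-- Evaluation at a jet is a ring homomorphism, hence commutes with taking powers of series and
extracting their coefficients. -/
theorem evalSymbol_multiplierPoly (eg : ℝ) (n : ℕ) {q : E} (u v u' v' : E) (hq : q ≠ 0) :
    evalSymbol (evalJet eg q (multiplierPoly n)) u v u' v' =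
      PowerSeries.coeff n (multiplierSeries zassCoeff eg q u v u' v') := by
  rw [evalSymbol_evalJet, multiplierPoly, multiplierSeries, formalExp, PowerSeries.coeff_mk, map_sum]
  refine Finset.sum_congr rfl fun k _ => ?_
  rw [map_mul, jetEval_const, ← PowerSeries.coeff_map, map_pow]
  congr 4
  ext N
  rw [PowerSeries.coeff_map, PowerSeries.coeff_mk, jetEval_exponentPoly N eg u v _ _ hq]

/-! ### Bidifferential operators -/

lemma isOpen_regular : IsOpen regular := by
  have : regular = Prod.snd ⁻¹' ({0}ᶜ : Set E) := rfl
  rw [this]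
  exact isOpen_compl_singleton.preimage continuous_snd

/-- Operators on functions that respect smoothness and equality on an open set and commute with
directional derivatives there. -/
structure DiffOp {V : Type*} [NormedAddCommGroup V] [NormedSpace ℝ V] (U : Set V)
    (T : (V → ℂ) → V → ℂ) : Prop where
  smooth : ∀ f, ContDiffOn ℝ ∞ f U → ContDiffOn ℝ ∞ (T f) U
  congr : ∀ f g, Set.EqOn f g U → Set.EqOn (T f) (T g) U
  comm : ∀ f v, ContDiffOn ℝ ∞ f U → Set.EqOn (dirDeriv v (T f)) (T (dirDeriv v f)) U

section

variable {V : Type*} [NormedAddCommGroup V] [NormedSpace ℝ V] {U : Set V}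

lemma DiffOp.comp {S T : (V → ℂ) → V → ℂ} (hU : IsOpen U) (hS : DiffOp U S) (hT : DiffOp U T) :
    DiffOp U fun f => S (T f) where
  smooth f hf := hS.smooth _ (hT.smooth f hf)
  congr f g h := hS.congr _ _ (hT.congr f g h)
  comm f v hf := (hS.comm _ v (hT.smooth f hf)).trans (hS.congr _ _ (hT.comm f v hf))

lemma diffOp_iterate (hU : IsOpen U) (w : V) (n : ℕ) :
    DiffOp U fun f : V → ℂ => (dirDeriv w)^[n] f where
  smooth f hf := contDiffOn_dirDeriv_iterate hU hf w n
  congr f g h := eqOn_dirDeriv_iterate hU h w n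
  comm f v hf := dirDeriv_iterate_comm hU hf v w n

/-- Raising the order of the middle derivative in a product of derivatives. -/
lemma DiffOp.iterate_succ {S T : (V → ℂ) → V → ℂ} (hU : IsOpen U) (hS : DiffOp U S)
    (hT : DiffOp U T) (w : V) (n : ℕ) {f : V → ℂ} (hf : ContDiffOn ℝ ∞ f U) :
    Set.EqOn (S ((dirDeriv w)^[n + 1] (T f))) (S ((dirDeriv w)^[n] (T (dirDeriv w f)))) U := by
  refine hS.congr _ _ ?_
  rw [Function.iterate_succ_apply]
  exact eqOn_dirDeriv_iterate hU (hT.comm f w hf) w n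

end

lemma diffOp_dP (i : Fin 3) (n : ℕ) : DiffOp regular fun f => (dP i)^[n] f :=
  diffOp_iterate isOpen_regular _ n

lemma diffOp_dQ (i : Fin 3) (n : ℕ) : DiffOp regular fun f => (dQ i)^[n] f :=
  diffOp_iterate isOpen_regular _ n

lemma diffOp_id : DiffOp regular fun f => f :=
  ⟨fun _ h => h, fun _ _ h => h, fun _ _ _ _ _ => rfl⟩

/-- The extra derivative commutes with everything to the right of its slot; splitting the composite
at that slot into outer and inner operators gives all three cases. -/
lemma multiDeriv_add_single_dP (α γ : Fin 3 → ℕ) (i : Fin 3) {f : Phase → ℂ}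
    (hf : ContDiffOn ℝ ∞ f regular) :
    Set.EqOn (multiDeriv (α + Pi.single i 1) γ f) (multiDeriv α γ (dP i f)) regular := by
  have hU := isOpen_regular
  have q0 : DiffOp regular fun f => (dQ 0)^[γ 0] ((dQ 1)^[γ 1] ((dQ 2)^[γ 2] f)) :=
    (diffOp_dQ 0 _).comp hU ((diffOp_dQ 1 _).comp hU (diffOp_dQ 2 _))
  fin_cases i
  · simp [multiDeriv]
    exact DiffOp.iterate_succ hU diffOp_id
      ((diffOp_dP 1 (α 1)).comp hU ((diffOp_dP 2 (α 2)).comp hU q0)) (basisVec 0, 0) (α 0) hf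
  · simp [multiDeriv]
    exact DiffOp.iterate_succ hU (diffOp_dP 0 (α 0))
      ((diffOp_dP 2 (α 2)).comp hU q0) (basisVec 1, 0) (α 1) hf
  · simp [multiDeriv]
    exact DiffOp.iterate_succ hU ((diffOp_dP 0 (α 0)).comp hU
      (diffOp_dP 1 (α 1))) q0 (basisVec 2, 0) (α 2) hf

lemma multiDeriv_add_single_dQ (α γ : Fin 3 → ℕ) (i : Fin 3) {f : Phase → ℂ}
    (hf : ContDiffOn ℝ ∞ f regular) :
    Set.EqOn (multiDeriv α (γ + Pi.single i 1) f) (multiDeriv α γ (dQ i f)) regular := by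
  have hU := isOpen_regular
  have p0 : DiffOp regular fun f => (dP 0)^[α 0] ((dP 1)^[α 1] ((dP 2)^[α 2] f)) :=
    (diffOp_dP 0 _).comp hU ((diffOp_dP 1 _).comp hU (diffOp_dP 2 _))
  fin_cases i
  · simp [multiDeriv]
    exact DiffOp.iterate_succ hU p0
      ((diffOp_dQ 1 (γ 1)).comp hU (diffOp_dQ 2 (γ 2))) (0, basisVec 0) (γ 0) hf
  · simp [multiDeriv]
    exact DiffOp.iterate_succ hU (p0.comp hU (diffOp_dQ 0 (γ 0)))
      (diffOp_dQ 2 (γ 2)) (0, basisVec 1) (γ 1) hf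
  · simp [multiDeriv]
    exact DiffOp.iterate_succ hU (p0.comp hU ((diffOp_dQ 0 (γ 0)).comp hU
      (diffOp_dQ 1 (γ 1)))) diffOp_id (0, basisVec 2) (γ 2) hf

lemma bidiff_eq_sum (P : SymbolPoly ℂ) (f g : Phase → ℂ) (z : Phase) {s : Finset _}
    (hs : P.support ⊆ s) : bidiff P f g z = ∑ m ∈ s, P.coeff m * (-Complex.I) ^ (m.degree) *
      multiDeriv (fun i => m (0, i)) (fun i => m (1, i)) f z *
      multiDeriv (fun i => m (2, i)) (fun i => m (3, i)) g z := by
  refine Finset.sum_subset hs fun m _ hm => ?_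
  rw [MvPolynomial.notMem_support_iff.mp hm]
  simp

lemma bidiff_add (P Q : SymbolPoly ℂ) (f g : Phase → ℂ) (z : Phase) :
    bidiff (P + Q) f g z = bidiff P f g z + bidiff Q f g z := by
  classical
  rw [bidiff_eq_sum (P + Q) f g z MvPolynomial.support_add,
    bidiff_eq_sum P f g z Finset.subset_union_left,
    bidiff_eq_sum Q f g z Finset.subset_union_right, ← Finset.sum_add_distrib]
  refine Finset.sum_congr rfl fun m _ => ?_
  rw [MvPolynomial.coeff_add]
  ring

lemma bidiff_C_mul (c : ℂ) (P : SymbolPoly ℂ) (f g : Phase → ℂ) (z : Phase) :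
    bidiff (MvPolynomial.C c * P) f g z = c * bidiff P f g z := by
  classical
  rw [bidiff_eq_sum (MvPolynomial.C c * P) f g z (s := P.support) ?_, bidiff, Finset.mul_sum]
  · refine Finset.sum_congr rfl fun m _ => ?_
    rw [MvPolynomial.coeff_C_mul]
    ring
  · intro m hm
    rw [MvPolynomial.mem_support_iff] at hm ⊢
    rw [MvPolynomial.coeff_C_mul] at hm
    exact right_ne_zero_of_mul hm

lemma bidiff_sub (P Q : SymbolPoly ℂ) (f g : Phase → ℂ) (z : Phase) :
    bidiff (P - Q) f g z = bidiff P f g z - bidiff Q f g z := by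
  have : P - Q = P + MvPolynomial.C (-1) * Q := by simp [sub_eq_add_neg]
  rw [this, bidiff_add, bidiff_C_mul]
  ring

lemma bidiff_sum {ι : Type*} (s : Finset ι) (P : ι → SymbolPoly ℂ) (f g : Phase → ℂ) (z : Phase) :
    bidiff (∑ i ∈ s, P i) f g z = ∑ i ∈ s, bidiff (P i) f g z := by
  classical
  induction s using Finset.induction_on with
  | empty => simp [bidiff]
  | insert a s ha ih => rw [Finset.sum_insert ha, Finset.sum_insert ha, bidiff_add, ih]

lemma bidiff_monomial (m : Fin 4 × Fin 3 →₀ ℕ) (c : ℂ) (f g : Phase → ℂ) (z : Phase) :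
    bidiff (MvPolynomial.monomial m c) f g z = c * (-Complex.I) ^ (m.degree) *
      multiDeriv (fun i => m (0, i)) (fun i => m (1, i)) f z *
      multiDeriv (fun i => m (2, i)) (fun i => m (3, i)) g z := by
  classical
  rw [bidiff_eq_sum _ f g z MvPolynomial.support_monomial_subset, Finset.sum_singleton,
    MvPolynomial.coeff_monomial, if_pos rfl]

lemma bidiff_one (f g : Phase → ℂ) (z : Phase) : bidiff 1 f g z = f z * g z := by
  have := bidiff_monomial 0 1 f g z
  simpa [multiDeriv] using this

/-- By additivity only monomials matter: a further variable raises the degree by one, whence the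
factor `-i`, and adds one derivative to one of the functions. The hypothesis says which. -/
lemma bidiff_X_mul_aux {f g f' g' : Phase → ℂ} {z : Phase} (s : Fin 4 × Fin 3)
    (h : ∀ m : Fin 4 × Fin 3 →₀ ℕ,
      multiDeriv (fun i => (m + Finsupp.single s 1 : Fin 4 × Fin 3 →₀ ℕ) (0, i))
        (fun i => (m + Finsupp.single s 1 : Fin 4 × Fin 3 →₀ ℕ) (1, i)) f z *
      multiDeriv (fun i => (m + Finsupp.single s 1 : Fin 4 × Fin 3 →₀ ℕ) (2, i))
        (fun i => (m + Finsupp.single s 1 : Fin 4 × Fin 3 →₀ ℕ) (3, i)) g z =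
      multiDeriv (fun i => m (0, i)) (fun i => m (1, i)) f' z *
      multiDeriv (fun i => m (2, i)) (fun i => m (3, i)) g' z) (P : SymbolPoly ℂ) :
    bidiff (MvPolynomial.X s * P) f g z = -Complex.I * bidiff P f' g' z := by
  induction P using MvPolynomial.induction_on' with
  | add p q hp hq => rw [mul_add, bidiff_add, bidiff_add, hp, hq]; ring
  | monomial m c =>
    rw [MvPolynomial.X, MvPolynomial.monomial_mul, one_mul, add_comm, bidiff_monomial,
      bidiff_monomial, mul_assoc, h m, map_add, Finsupp.degree_single, pow_succ]
    ring

section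

variable {f g : Phase → ℂ} {z : Phase}

lemma bidiff_X_zero_mul (hf : ContDiffOn ℝ ∞ f regular) (hz : z ∈ regular) (i : Fin 3)
    (P : SymbolPoly ℂ) :
    bidiff (MvPolynomial.X (0, i) * P) f g z = -Complex.I * bidiff P (dP i f) g z := by
  refine bidiff_X_mul_aux _ (fun m => ?_) P
  have := multiDeriv_add_single_dP (fun i => m (0, i)) (fun i => m (1, i)) i hf hz
  rw [← this]
  congr 2
  · funext j; rcases eq_or_ne i j with rfl | h <;> simp [*, Finsupp.single_apply, Pi.single_eq_of_ne']
  · funext j; simp [Finsupp.single_apply]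
  · funext j; simp [Finsupp.single_apply]
  · funext j; simp [Finsupp.single_apply]

lemma bidiff_X_one_mul (hf : ContDiffOn ℝ ∞ f regular) (hz : z ∈ regular) (i : Fin 3)
    (P : SymbolPoly ℂ) :
    bidiff (MvPolynomial.X (1, i) * P) f g z = -Complex.I * bidiff P (dQ i f) g z := by
  refine bidiff_X_mul_aux _ (fun m => ?_) P
  have := multiDeriv_add_single_dQ (fun i => m (0, i)) (fun i => m (1, i)) i hf hz
  rw [← this]
  congr 2
  · funext j; simp [Finsupp.single_apply]
  · funext j; rcases eq_or_ne i j with rfl | h <;> simp [*, Finsupp.single_apply, Pi.single_eq_of_ne']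
  · funext j; simp [Finsupp.single_apply]
  · funext j; simp [Finsupp.single_apply]

lemma bidiff_X_two_mul (hg : ContDiffOn ℝ ∞ g regular) (hz : z ∈ regular) (i : Fin 3)
    (P : SymbolPoly ℂ) :
    bidiff (MvPolynomial.X (2, i) * P) f g z = -Complex.I * bidiff P f (dP i g) z := by
  refine bidiff_X_mul_aux _ (fun m => ?_) P
  have := multiDeriv_add_single_dP (fun i => m (2, i)) (fun i => m (3, i)) i hg hz
  rw [← this]
  congr 2
  · funext j; simp [Finsupp.single_apply]
  · funext j; simp [Finsupp.single_apply]
  · funext j; rcases eq_or_ne i j with rfl | h <;> simp [*, Finsupp.single_apply, Pi.single_eq_of_ne']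
  · funext j; simp [Finsupp.single_apply]

lemma bidiff_X_three_mul (hg : ContDiffOn ℝ ∞ g regular) (hz : z ∈ regular) (i : Fin 3)
    (P : SymbolPoly ℂ) :
    bidiff (MvPolynomial.X (3, i) * P) f g z = -Complex.I * bidiff P f (dQ i g) z := by
  refine bidiff_X_mul_aux _ (fun m => ?_) P
  have := multiDeriv_add_single_dQ (fun i => m (2, i)) (fun i => m (3, i)) i hg hz
  rw [← this]
  congr 2
  · funext j; simp [Finsupp.single_apply]
  · funext j; simp [Finsupp.single_apply]
  · funext j; simp [Finsupp.single_apply]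
  · funext j; rcases eq_or_ne i j with rfl | h <;> simp [*, Finsupp.single_apply, Pi.single_eq_of_ne']

end

lemma contDiffOn_dP {f : Phase → ℂ} (hf : ContDiffOn ℝ ∞ f regular) (i : Fin 3) :
    ContDiffOn ℝ ∞ (dP i f) regular := contDiffOn_dirDeriv isOpen_regular hf _

lemma contDiffOn_dQ {f : Phase → ℂ} (hf : ContDiffOn ℝ ∞ f regular) (i : Fin 3) :
    ContDiffOn ℝ ∞ (dQ i f) regular := contDiffOn_dirDeriv isOpen_regular hf _

/-- A symbol is determined by its values at real points. -/
lemma symbol_ext {P Q : SymbolPoly ℂ}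
    (h : ∀ u v u' v' : E, evalSymbol P u v u' v' = evalSymbol Q u v u' v') : P = Q := by
  -- A complex polynomial is determined by its values on a product of infinite sets, here copies of
  -- the real line.
  refine MvPolynomial.funext_set (fun _ => Set.range ((↑) : ℝ → ℂ))
    (fun _ => Set.infinite_range_of_injective Complex.ofReal_injective) fun x hx => ?_
  choose y hy using fun s => hx s (Set.mem_univ s)
  have key := h (WithLp.toLp 2 fun i => y (0, i)) (WithLp.toLp 2 fun i => y (1, i))
    (WithLp.toLp 2 fun i => y (2, i)) (WithLp.toLp 2 fun i => y (3, i))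
  have hx' : x = fun s : Fin 4 × Fin 3 => (((![WithLp.toLp 2 fun i => y (0, i),
      WithLp.toLp 2 fun i => y (1, i), WithLp.toLp 2 fun i => y (2, i),
      WithLp.toLp 2 fun i => y (3, i)] s.1 : E) s.2 : ℝ) : ℂ) := by
    funext ⟨a, i⟩
    rw [← hy]
    fin_cases a <;> rfl
  rw [hx']
  exact key

/-! ### The first terms of the multiplier -/

section

variable (eg : ℝ) (q u v u' v' : E)

lemma coeff_zero_multiplierExponent :
    PowerSeries.coeff 0 (multiplierExponent zassCoeff eg q u v u' v') = 0 := by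
  simp [multiplierExponent]

lemma coeff_one_multiplierExponent :
    PowerSeries.coeff 1 (multiplierExponent zassCoeff eg q u v u' v') =
      Complex.I / 2 * ((inner ℝ u v' - inner ℝ v u' - betaForm eg u u' q : ℝ) : ℂ) := by
  simp [multiplierExponent, zassTerm, zassCoeff]
  ring

/-- Two sources combine: the cubic Zassenhaus term with coefficients `-1/6` and `-1/3`, and the
shift of `c₂` to `q + ħ(u+u')/2`, contributing `1/4` in both directions. The sums are `1/12` and
`-1/12`. -/
lemma coeff_two_multiplierExponent {q : E} (hq : q ≠ 0) :
    PowerSeries.coeff 2 (multiplierExponent zassCoeff eg q u v u' v') =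
      -Complex.I / 12 * ((dirDeriv u (betaForm eg u u') q - dirDeriv u' (betaForm eg u u') q : ℝ) :
        ℂ) := by
  have h1 : dirDeriv (u + u') (zassTerm zassCoeff eg 2 u u') q =
      1 / 2 * (dirDeriv u (betaForm eg u u') q + dirDeriv u' (betaForm eg u u') q) := by
    have : zassTerm zassCoeff eg 2 u u' = fun x => (1 / 2 : ℝ) * betaForm eg u u' x := by
      funext x
      simp [zassTerm, zassCoeff]
    have hd : DifferentiableAt ℝ (betaForm eg u u') q :=
      differentiableAt_of_contDiffOn isOpen_compl_singleton (contDiffOn_betaForm eg u u') hq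
    rw [this, dirDeriv, fderiv_const_mul hd]
    simp [dirDeriv, mul_add]
  have h2 : zassTerm zassCoeff eg 3 u u' q = -(1 / 3) * dirDeriv u' (betaForm eg u u') q -
      1 / 6 * dirDeriv u (betaForm eg u u') q := by
    simp [zassTerm, zassCoeff, Finset.sum_range_succ, Nat.factorial]
    ring
  rw [multiplierExponent, PowerSeries.coeff_mk]
  simp only [Finset.sum_range_succ, Finset.sum_range_zero, Function.iterate_zero, id,
    Function.iterate_one, zero_add, if_neg (show ¬ (2 = 1) by norm_num), add_zero]
  norm_num
  rw [h1, h2]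
  push_cast
  ring

lemma coeff_zero_multiplierSeries :
    PowerSeries.coeff 0 (multiplierSeries zassCoeff eg q u v u' v') = 1 := by
  simp [multiplierSeries, formalExp]

lemma coeff_one_multiplierSeries :
    PowerSeries.coeff 1 (multiplierSeries zassCoeff eg q u v u' v') =
      PowerSeries.coeff 1 (multiplierExponent zassCoeff eg q u v u' v') := by
  simp [multiplierSeries, formalExp, Finset.sum_range_succ, PowerSeries.coeff_one]

/-- The exponent has no constant term, so the third order of the exponential and beyond cannot
contribute. -/
lemma coeff_two_multiplierSeries :
    PowerSeries.coeff 2 (multiplierSeries zassCoeff eg q u v u' v') =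
      PowerSeries.coeff 2 (multiplierExponent zassCoeff eg q u v u' v') +
      1 / 2 * PowerSeries.coeff 1 (multiplierExponent zassCoeff eg q u v u' v') ^ 2 := by
  have h0 := coeff_zero_multiplierExponent eg q u v u' v'
  set S := multiplierExponent zassCoeff eg q u v u' v'
  have h2 : PowerSeries.coeff 2 (S ^ 2) = PowerSeries.coeff 1 S ^ 2 := by
    rw [pow_two, PowerSeries.coeff_mul, Finset.Nat.antidiagonal_succ]
    simp [Finset.Nat.antidiagonal_succ, pow_two, h0]
  rw [multiplierSeries, formalExp, PowerSeries.coeff_mk]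
  simp only [Finset.sum_range_succ, Finset.sum_range_zero, pow_zero, pow_one, zero_add]
  rw [h2]
  simp [PowerSeries.coeff_one, Nat.factorial, S]

end

open MvPolynomial in
/-- The first-order symbol. -/
def firstSymbol (eg : ℝ) (q : E) : SymbolPoly ℂ :=
  C (Complex.I / 2) * (∑ i, (X (0, i) * (X (3, i) * 1) - X (1, i) * (X (2, i) * 1)) -
    ∑ i, ∑ j, C (beta eg i j q : ℂ) * (X (0, i) * (X (2, j) * 1)))

open MvPolynomial in
/-- The second-order symbol. -/
def secondSymbol (eg : ℝ) (q : E) : SymbolPoly ℂ :=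
  C (-(1 / 8)) * (∑ i, ∑ j, (X (1, j) * (X (1, i) * (X (2, j) * (X (2, i) * 1)))
      - C 2 * (X (0, j) * (X (1, i) * (X (3, j) * (X (2, i) * 1))))
      + X (0, j) * (X (0, i) * (X (3, j) * (X (3, i) * 1)))))
  - C (1 / 4) * (∑ i, ∑ j, ∑ k, C (beta eg i j q : ℂ) *
      (X (0, i) * (X (1, k) * (X (2, j) * (X (2, k) * 1)))
        - X (0, i) * (X (0, k) * (X (2, j) * (X (3, k) * 1)))))
  - C (1 / 8) * (∑ i, ∑ j, ∑ k, ∑ l, C ((beta eg i j q : ℂ) * (beta eg k l q : ℂ)) *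
      (X (0, k) * (X (0, i) * (X (2, l) * (X (2, j) * 1)))))
  - C (Complex.I / 12) * (∑ i, ∑ j, ∑ k, C ((dirDeriv (basisVec k) (beta eg i j) q : ℝ) : ℂ) *
      (X (0, k) * (X (0, i) * (X (2, j) * 1)) - X (0, i) * (X (2, j) * (X (2, k) * 1))))

lemma dirDeriv_betaForm (eg : ℝ) (a u u' : E) {q : E} (hq : q ≠ 0) :
    dirDeriv a (betaForm eg u u') q =
      ∑ i, ∑ j, ∑ k, dirDeriv (basisVec k) (beta eg i j) q * (a k * u i * u' j) := by
  have hd : ∀ i j, HasFDerivAt (beta eg i j) (fderiv ℝ (beta eg i j) q) q := fun i j =>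
    (differentiableAt_of_contDiffOn isOpen_compl_singleton (contDiffOn_beta eg i j) hq).hasFDerivAt
  have h1 : HasFDerivAt (betaForm eg u u')
      (∑ i, ∑ j, u' j • (u i • fderiv ℝ (beta eg i j) q)) q := by
    unfold betaForm
    refine HasFDerivAt.fun_sum fun i _ => HasFDerivAt.fun_sum fun j _ => ?_
    exact ((hd i j).const_mul (u i)).mul_const (u' j)
  rw [dirDeriv, h1.fderiv]
  simp only [ContinuousLinearMap.sum_apply, _root_.smul_apply, smul_eq_mul]
  refine Finset.sum_congr rfl fun i _ => Finset.sum_congr rfl fun j _ => ?_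
  conv_lhs => rw [eq_sum_basisVec a, map_sum]
  simp only [map_smul, smul_eq_mul, Finset.mul_sum, dirDeriv]
  exact Finset.sum_congr rfl fun k _ => by ring

lemma evalJet_multiplierPoly_zero (eg : ℝ) {q : E} (hq : q ≠ 0) :
    evalJet eg q (multiplierPoly 0) = 1 := by
  refine symbol_ext fun u v u' v' => ?_
  rw [evalSymbol_multiplierPoly eg 0 u v u' v' hq, coeff_zero_multiplierSeries]
  simp [evalSymbol]

lemma evalJet_multiplierPoly_one (eg : ℝ) {q : E} (hq : q ≠ 0) :
    evalJet eg q (multiplierPoly 1) = firstSymbol eg q := by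
  refine symbol_ext fun u v u' v' => ?_
  rw [evalSymbol_multiplierPoly eg 1 u v u' v' hq, coeff_one_multiplierSeries,
    coeff_one_multiplierExponent, inner_eq, inner_eq, betaForm]
  simp only [evalSymbol, firstSymbol, map_mul, map_sub, map_sum, MvPolynomial.eval_C,
    MvPolynomial.eval_X, map_one, Fin.sum_univ_three]
  simp
  ring

/-- With `τ` the symplectic form and `b = u·βu'`, the quadratic part is `-(τ - b)²/8`; the sums
`f1`, `f2`, `f3` are `τ²`, `-τb`, `b²`, and `f4` is the contribution of the derivative of `β`. -/
lemma evalJet_multiplierPoly_two (eg : ℝ) {q : E} (hq : q ≠ 0) :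
    evalJet eg q (multiplierPoly 2) = secondSymbol eg q := by
  refine symbol_ext fun u v u' v' => ?_
  rw [evalSymbol_multiplierPoly eg 2 u v u' v' hq, coeff_two_multiplierSeries,
    coeff_one_multiplierExponent, coeff_two_multiplierExponent eg u v u' v' hq,
    dirDeriv_betaForm _ _ _ _ hq, dirDeriv_betaForm _ _ _ _ hq]
  have hI : Complex.I ^ 2 = -1 := Complex.I_sq
  set τ : ℂ := ∑ i, ((u i : ℂ) * v' i - v i * u' i) with hτ
  set b : ℂ := ∑ i, ∑ j, (beta eg i j q : ℂ) * (u i * u' j) with hb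
  have e1 : ((inner ℝ u v' - inner ℝ v u' - betaForm eg u u' q : ℝ) : ℂ) = τ - b := by
    rw [inner_eq, inner_eq, betaForm, hτ, hb]
    simp only [Fin.sum_univ_three]
    push_cast
    ring
  rw [e1]
  simp only [evalSymbol, secondSymbol, map_mul, map_sub, map_add, map_sum, MvPolynomial.eval_C,
    MvPolynomial.eval_X, map_one]
  have f1 : ∑ i : Fin 3, ∑ j : Fin 3, ((v j : ℂ) * (v i * (u' j * (u' i * 1)))
      - 2 * (u j * (v i * (v' j * (u' i * 1)))) + u j * (u i * (v' j * (v' i * 1)))) = τ ^ 2 := by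
    rw [hτ]; simp only [Fin.sum_univ_three]; ring
  have f2 : ∑ i : Fin 3, ∑ j : Fin 3, ∑ k : Fin 3, (beta eg i j q : ℂ) *
      ((u i : ℂ) * (v k * (u' j * (u' k * 1))) - u i * (u k * (u' j * (v' k * 1)))) = -(τ * b) := by
    rw [hτ, hb]; simp only [Fin.sum_univ_three]; ring
  have f3 : ∑ i : Fin 3, ∑ j : Fin 3, ∑ k : Fin 3, ∑ l : Fin 3,
      ((beta eg i j q : ℂ) * (beta eg k l q : ℂ)) *
      ((u k : ℂ) * (u i * (u' l * (u' j * 1)))) = b ^ 2 := by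
    rw [hb]; simp only [Fin.sum_univ_three]; ring
  have f4 : ∑ i : Fin 3, ∑ j : Fin 3, ∑ k : Fin 3,
      ((dirDeriv (basisVec k) (beta eg i j) q : ℝ) : ℂ) *
      ((u k : ℂ) * (u i * (u' j * 1)) - u i * (u' j * (u' k * 1))) =
      ((∑ i, ∑ j, ∑ k, dirDeriv (basisVec k) (beta eg i j) q * (u k * u i * u' j) -
        ∑ i, ∑ j, ∑ k, dirDeriv (basisVec k) (beta eg i j) q * (u' k * u i * u' j) : ℝ) : ℂ) := by
    rw [← Finset.sum_sub_distrib]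
    push_cast
    refine Finset.sum_congr rfl fun i _ => ?_
    rw [← Finset.sum_sub_distrib]
    refine Finset.sum_congr rfl fun j _ => ?_
    rw [← Finset.sum_sub_distrib]
    refine Finset.sum_congr rfl fun k _ => ?_
    ring
  rw [← f4]
  have g1 := f1
  have g2 := f2
  have g3 := f3
  simp only [Matrix.cons_val_zero, Matrix.cons_val_one, Matrix.cons_val] at *
  rw [f1, f2, f3]
  linear_combination (-1 / 8 * (τ - b) ^ 2) * (-hI)

/-- Once the symbols are known, every variable is replaced by `-i` times a derivative; only the
powers of `i` remain to be collected. -/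
theorem starCoeff_first_terms (eg : ℝ) (f g : Phase → ℂ) (hf : ContDiffOn ℝ ∞ f regular)
    (hg : ContDiffOn ℝ ∞ g regular) (z : Phase) (hz : z ∈ regular) :
    starCoeff (multiplierPoly 0) eg f g z = f z * g z ∧
    starCoeff (multiplierPoly 1) eg f g z = Complex.I / 2 * magneticBracket eg f g z ∧
    starCoeff (multiplierPoly 2) eg f g z = secondOrder eg f g z := by
  have hq : z.2 ≠ 0 := hz
  have hI : Complex.I * Complex.I = -1 := Complex.I_mul_I
  refine ⟨?_, ?_, ?_⟩
  · rw [starCoeff, evalJet_multiplierPoly_zero eg hq, bidiff_one]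
  · rw [starCoeff, evalJet_multiplierPoly_one eg hq, firstSymbol, bidiff_C_mul, bidiff_sub]
    simp only [bidiff_sum, bidiff_sub, bidiff_C_mul, bidiff_X_zero_mul hf hz,
      bidiff_X_one_mul hf hz, bidiff_X_two_mul hg hz, bidiff_X_three_mul hg hz, bidiff_one]
    rw [magneticBracket, sub_eq_add_neg, ← Finset.sum_neg_distrib]
    congr 2
    · refine Finset.sum_congr rfl fun i _ => ?_
      linear_combination (dP i f z * dQ i g z - dQ i f z * dP i g z) * hI
    · refine Finset.sum_congr rfl fun i _ => ?_
      rw [← Finset.sum_neg_distrib]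
      refine Finset.sum_congr rfl fun j _ => ?_
      linear_combination (-(beta eg i j z.2 : ℂ) * dP i f z * dP j g z) * hI
  · rw [starCoeff, evalJet_multiplierPoly_two eg hq, secondSymbol, secondOrder]
    have hfP := contDiffOn_dP hf
    have hfQ := contDiffOn_dQ hf
    have hgP := contDiffOn_dP hg
    have hgQ := contDiffOn_dQ hg
    simp only [bidiff_sum, bidiff_sub, bidiff_add, bidiff_C_mul, bidiff_X_zero_mul hf hz,
      bidiff_X_one_mul hf hz, bidiff_X_two_mul hg hz, bidiff_X_three_mul hg hz, bidiff_one,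
      bidiff_X_zero_mul (hfP _) hz, bidiff_X_one_mul (hfP _) hz, bidiff_X_one_mul (hfQ _) hz,
      bidiff_X_two_mul (hgP _) hz, bidiff_X_two_mul (hgQ _) hz, bidiff_X_three_mul (hgP _) hz,
      bidiff_X_three_mul (hgQ _) hz]
    -- Quartic terms carry `(-i)⁴`; in the cubic terms `(-i)³` is completed to a fourth power by the
    -- `i` of their coefficient.
    have hI4 : Complex.I * (Complex.I * (Complex.I * Complex.I)) = 1 := by
      rw [hI]; linear_combination -hI
    rw [sub_eq_add_neg _ (Complex.I / 12 * _)]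
    congr 1
    · congr 1
      · congr 1
        · congr 1
          refine Finset.sum_congr rfl fun i _ => Finset.sum_congr rfl fun j _ => ?_
          linear_combination (dQ i (dQ j f) z * dP i (dP j g) z - 2 * dQ i (dP j f) z *
            dP i (dQ j g) z + dP i (dP j f) z * dQ i (dQ j g) z) * hI4
        · congr 1
          refine Finset.sum_congr rfl fun i _ => Finset.sum_congr rfl fun j _ =>
            Finset.sum_congr rfl fun k _ => ?_
          linear_combination ((beta eg i j z.2 : ℂ) * (dQ k (dP i f) z * dP k (dP j g) z -
            dP k (dP i f) z * dQ k (dP j g) z)) * hI4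
      · congr 1
        refine Finset.sum_congr rfl fun i _ => Finset.sum_congr rfl fun j _ =>
          Finset.sum_congr rfl fun k _ => Finset.sum_congr rfl fun l _ => ?_
        linear_combination ((beta eg i j z.2 : ℂ) * (beta eg k l z.2 : ℂ) *
          dP i (dP k f) z * dP j (dP l g) z) * hI4
    · rw [Finset.mul_sum, Finset.mul_sum, ← Finset.sum_neg_distrib]
      refine Finset.sum_congr rfl fun i _ => ?_
      rw [Finset.mul_sum, Finset.mul_sum, ← Finset.sum_neg_distrib]
      refine Finset.sum_congr rfl fun j _ => ?_
      rw [Finset.mul_sum, Finset.mul_sum, ← Finset.sum_neg_distrib]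
      refine Finset.sum_congr rfl fun k _ => ?_
      linear_combination (1 / 12 * ((dirDeriv (basisVec k) (beta eg i j) z.2 : ℝ) : ℂ) *
        (dP i (dP k f) z * dP j g z - dP i f z * dP k (dP j g) z)) * hI4

/-! ### The phase of a triangle as a magnetic flux -/

lemma hasDerivAt_norm_path {γ : ℝ → E} {γ' : E} {t : ℝ} (h : HasDerivAt γ γ' t) (h0 : γ t ≠ 0) :
    HasDerivAt (fun s => ‖γ s‖) (inner ℝ (γ t) γ' / ‖γ t‖) t := by
  have h1 := h.norm_sq.sqrt (by positivity)
  have h2 : (fun s => ‖γ s‖) = fun s => √(‖γ s‖ ^ 2) := by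
    funext s; rw [Real.sqrt_sq (norm_nonneg _)]
  rw [h2]
  convert h1 using 1
  rw [Real.sqrt_sq (norm_nonneg _)]
  field_simp

/-- The right-hand side, as a function of `t`, is an explicit antiderivative. Positivity of the
inner products keeps its denominator away from zero. -/
lemma integral_chord {x a : E} {t : ℝ}
    (hpos : ∀ s ∈ Set.uIcc 0 t, 0 < inner ℝ (x - s • a) x) :
    ∫ s in (0 : ℝ)..t, (‖x - s • a‖ ^ 3)⁻¹ =
      t * ((‖x - t • a‖ + ‖x‖) / (‖x - t • a‖ * ‖x‖ * (‖x - t • a‖ * ‖x‖ + inner ℝ (x - t • a) x))) := by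
  have hx : x ≠ 0 := by
    rintro rfl
    have := hpos 0 Set.left_mem_uIcc
    simp at this
  have hy : ∀ s ∈ Set.uIcc 0 t, x - s • a ≠ 0 := fun s hs h => by
    have := hpos s hs
    simp [h] at this
  have hd : ∀ s ∈ Set.uIcc 0 t, HasDerivAt (fun s : ℝ => s * ((‖x - s • a‖ + ‖x‖) /
      (‖x - s • a‖ * ‖x‖ * (‖x - s • a‖ * ‖x‖ + inner ℝ (x - s • a) x)))) ((‖x - s • a‖ ^ 3)⁻¹) s := by
    intro s hs
    have hγ : HasDerivAt (fun s : ℝ => x - s • a) (-a) s := by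
      simpa using ((hasDerivAt_id s).smul_const a).const_sub x
    have hr := hasDerivAt_norm_path hγ (hy s hs)
    have hA : HasDerivAt (fun s : ℝ => inner ℝ (x - s • a) x) (-inner ℝ a x) s := by
      have := hγ.inner ℝ (hasDerivAt_const s x)
      simpa [inner_neg_left] using this
    have hr0 : 0 < ‖x - s • a‖ := norm_pos_iff.mpr (hy s hs)
    have hx0 : 0 < ‖x‖ := norm_pos_iff.mpr hx
    have hA0 := hpos s hs
    have key := (hasDerivAt_id s).mul ((hr.add_const ‖x‖).div ((hr.mul_const ‖x‖).mul
      ((hr.mul_const ‖x‖).add hA)) (ne_of_gt (show 0 < ‖x - s • a‖ * ‖x‖ * (‖x - s • a‖ * ‖x‖ +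
        inner ℝ (x - s • a) x) by positivity)))
    refine key.congr_deriv ?_
    have e1 : s * inner ℝ (x - s • a) (-a) = ‖x - s • a‖ ^ 2 - inner ℝ (x - s • a) x := by
      rw [← real_inner_self_eq_norm_sq, ← inner_sub_right, ← inner_smul_right]
      congr 1
      module
    have e2 : s * inner ℝ a x = ‖x‖ ^ 2 - inner ℝ (x - s • a) x := by
      rw [inner_sub_left, inner_smul_left, real_inner_self_eq_norm_sq]
      simp
    simp only [id, Pi.div_apply, Pi.mul_apply, Pi.add_apply]
    set r := ‖x - s • a‖
    set R := ‖x‖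
    set A := inner ℝ (x - s • a) x
    set c := inner ℝ (x - s • a) (-a)
    set e := inner ℝ a x
    clear_value r R A c e
    have hP : r * R + A ≠ 0 := by positivity
    -- The derivatives of norm and inner product occur only multiplied by `s`, and since `s a = x -
    -- (x - s a)` these products are differences of inner products, by `e1` and `e2`.
    have : (1 * ((r + R) / (r * R * (r * R + A))) + s * ((c / r * (r * R * (r * R + A)) -
        (r + R) * (c / r * R * (r * R + A) + r * R * (c / r * R + -e))) /
        (r * R * (r * R + A)) ^ 2)) =
        (r + R) / (r * R * (r * R + A)) + ((s * c) / r * (r * R * (r * R + A)) -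
        (r + R) * ((s * c) / r * R * (r * R + A) + r * R * ((s * c) / r * R + -(s * e)))) /
        (r * R * (r * R + A)) ^ 2 := by ring
    rw [this, e1, e2]
    field_simp
    ring
  rw [intervalIntegral.integral_eq_sub_of_hasDerivAt hd]
  · simp
  · refine ContinuousOn.intervalIntegrable fun s hs => ?_
    have : ContinuousAt (fun s : ℝ => ‖x - s • a‖ ^ 3) s := by fun_prop
    exact (this.inv₀ (pow_ne_zero _ (norm_ne_zero_iff.mpr (hy s hs)))).continuousWithinAt

/-- The numerator of the field strength is constant on the plane of the triangle, so only `‖·‖⁻³`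
has to be integrated. -/
lemma det3_triangle (x a a' : E) (s t : ℝ) :
    det3 (x - t • a' - t • a) (x - t • a') x = t ^ 2 * det3 a a' x ∧
    det3 a a' (x - t • a' - s • a) = det3 a a' x := by
  constructor <;> simp [det3] <;> ring

/-- The squared modulus of `triZ`; the squared triple product is a Gram determinant, and the sum
then factors. -/
lemma triRe_sq_add_det3_sq (x₀ x₁ x₂ : E) :
    triRe x₀ x₁ x₂ ^ 2 + det3 x₀ x₁ x₂ ^ 2 =
      2 * (‖x₀‖ * ‖x₁‖ + inner ℝ x₀ x₁) * (‖x₀‖ * ‖x₂‖ + inner ℝ x₀ x₂) *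
        (‖x₁‖ * ‖x₂‖ + inner ℝ x₁ x₂) := by
  have h0 := norm_sq_eq x₀
  have h1 := norm_sq_eq x₁
  have h2 := norm_sq_eq x₂
  have hdet : det3 x₀ x₁ x₂ ^ 2 = ‖x₀‖ ^ 2 * ‖x₁‖ ^ 2 * ‖x₂‖ ^ 2 +
      2 * inner ℝ x₀ x₁ * inner ℝ x₀ x₂ * inner ℝ x₁ x₂ - ‖x₀‖ ^ 2 * inner ℝ x₁ x₂ ^ 2 -
      ‖x₁‖ ^ 2 * inner ℝ x₀ x₂ ^ 2 - ‖x₂‖ ^ 2 * inner ℝ x₀ x₁ ^ 2 := by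
    rw [h0, h1, h2, inner_eq, inner_eq, inner_eq, det3]
    ring
  rw [hdet, triRe]
  ring

/-- With positive real part the argument of `triZ` is an arctangent; this is the classical formula
for the tangent of half the solid angle. -/
lemma triPhase_eq_exp_arctan {x₀ x₁ x₂ : E} (h : 0 < triRe x₀ x₁ x₂) :
    triPhase x₀ x₁ x₂ =
      Complex.exp (-(Real.arctan (det3 x₀ x₁ x₂ / triRe x₀ x₁ x₂) : ℝ) * Complex.I) := by
  set Q := triRe x₀ x₁ x₂
  set D := det3 x₀ x₁ x₂
  have hn : ‖triZ x₀ x₁ x₂‖ = Q * √(1 + (D / Q) ^ 2) := by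
    rw [Complex.norm_eq_sqrt_sq_add_sq]
    change √(Q ^ 2 + (-D) ^ 2) = _
    have : Q ^ 2 + (-D) ^ 2 = Q ^ 2 * (1 + (D / Q) ^ 2) := by field_simp
    rw [this, Real.sqrt_mul (by positivity), Real.sqrt_sq h.le]
  have hs : 0 < √(1 + (D / Q) ^ 2) := Real.sqrt_pos.mpr (by positivity)
  rw [triPhase, hn, ← Complex.ofReal_neg, Complex.exp_mul_I, ← Complex.ofReal_cos,
    ← Complex.ofReal_sin, Real.cos_neg, Real.sin_neg, Real.cos_arctan, Real.sin_arctan]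
  apply Complex.ext
  · simp [triZ]
    change _ * Q = _
    field_simp
  · simp [triZ]
    change _ * D = _
    field_simp

lemma triRe_pos {x₀ x₁ x₂ : E} (h₀₁ : 0 < inner ℝ x₀ x₁) (h₀₂ : 0 < inner ℝ x₀ x₂)
    (h₁₂ : 0 < inner ℝ x₁ x₂) : 0 < triRe x₀ x₁ x₂ := by
  have h0 : 0 < ‖x₀‖ := norm_pos_iff.mpr fun h => by simp [h] at h₀₁
  have h1 : 0 < ‖x₁‖ := norm_pos_iff.mpr fun h => by simp [h] at h₀₁
  have h2 : 0 < ‖x₂‖ := norm_pos_iff.mpr fun h => by simp [h] at h₁₂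
  unfold triRe
  positivity

/-- The algebra of the next lemma with all geometry abstracted. By scaling, every derivative times
`t` is a difference of inner products, and the denominator `Q² + (t²d)²` factors by `hsq`. -/
lemma triangle_angle_identity {t d Q r0 r1 r2 A B C c0 c1 c01 c10 c02 c12 : ℝ} (p0 : 0 < r0)
    (p1 : 0 < r1) (hA : 0 < A) (hQ : 0 < Q)
    (hQdef : Q = r0 * r1 * r2 + r2 * A + r1 * B + r0 * C)
    (hsq : Q ^ 2 + (t ^ 2 * d) ^ 2 = 2 * (r0 * r1 + A) * (r0 * r2 + B) * (r1 * r2 + C))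
    (e0 : t * c0 = r0 ^ 2 - B) (e1 : t * c1 = r1 ^ 2 - C) (e01 : t * c01 = A - B)
    (e10 : t * c10 = A - C) (e02 : t * c02 = B - r2 ^ 2) (e12 : t * c12 = C - r2 ^ 2) :
    1 / (1 + (t ^ 2 * d / Q) ^ 2) * ((↑(2 : ℕ) * t ^ (2 - 1) * 1 * d * Q - t ^ 2 * d *
      ((c0 / r0 * r1 + r0 * (c1 / r1)) * r2 + r2 * (c01 + c10) + (c1 / r1 * B + r1 * c02) +
        (c0 / r0 * C + r0 * c12))) / Q ^ 2) =
      1 / 2 * d * (t * ((r0 + r1) / (r0 * r1 * (r0 * r1 + A)))) := by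
  -- After multiplication by `t` the derivative of `Q` is `2Q` minus a product containing two of the
  -- three factors in `hsq`; the `2Q` cancels and these factors divide out.
  have hq : t * ((c0 / r0 * r1 + r0 * (c1 / r1)) * r2 + r2 * (c01 + c10) +
      (c1 / r1 * B + r1 * c02) + (c0 / r0 * C + r0 * c12)) =
      2 * Q - (r0 + r1) * (r0 * r2 + B) * (r1 * r2 + C) / (r0 * r1) := by
    have : t * ((c0 / r0 * r1 + r0 * (c1 / r1)) * r2 + r2 * (c01 + c10) +
      (c1 / r1 * B + r1 * c02) + (c0 / r0 * C + r0 * c12)) =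
      ((t * c0) / r0 * r1 + r0 * ((t * c1) / r1)) * r2 + r2 * (t * c01 + t * c10) +
      ((t * c1) / r1 * B + r1 * (t * c02)) + ((t * c0) / r0 * C + r0 * (t * c12)) := by ring
    rw [this, e0, e1, e01, e10, e02, e12, hQdef]
    field_simp
    ring
  set q' := (c0 / r0 * r1 + r0 * (c1 / r1)) * r2 + r2 * (c01 + c10) +
      (c1 / r1 * B + r1 * c02) + (c0 / r0 * C + r0 * c12)
  clear_value q'
  have hpos : 0 < Q ^ 2 + (t ^ 2 * d) ^ 2 := by positivity
  have hne := hpos.ne'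
  rw [hsq] at hne
  have hBC : (r0 * r2 + B) ≠ 0 ∧ (r1 * r2 + C) ≠ 0 :=
    ⟨fun h => hne (by rw [h]; ring), fun h => hne (by rw [h]; ring)⟩
  have h1 : 1 / (1 + (t ^ 2 * d / Q) ^ 2) * ((↑(2 : ℕ) * t ^ (2 - 1) * 1 * d * Q -
      t ^ 2 * d * q') / Q ^ 2) = t * d * (2 * Q - t * q') / (Q ^ 2 + (t ^ 2 * d) ^ 2) := by
    have h3 : 1 + (t ^ 2 * d / Q) ^ 2 = (Q ^ 2 + (t ^ 2 * d) ^ 2) / Q ^ 2 := by field_simp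
    rw [h3]
    push_cast
    field_simp
  rw [h1, hq, hsq]
  have hA' : r0 * r1 + A ≠ 0 := by positivity
  obtain ⟨hB', hC'⟩ := hBC
  rw [sub_sub_cancel]
  generalize r0 * r2 + B = β at *
  generalize r1 * r2 + C = γ at *
  field_simp

/-- As the triangle at `x` grows with `t`, its half solid angle grows by the flux through the moving
opposite side; the derivative is the value found in `integral_chord`, times half the triple product.
-/
lemma hasDerivAt_triangle_angle {x a a' : E} {t : ℝ}
    (h₀₁ : 0 < inner ℝ (x - t • a' - t • a) (x - t • a'))
    (h₀₂ : 0 < inner ℝ (x - t • a' - t • a) x) (h₁₂ : 0 < inner ℝ (x - t • a') x) :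
    HasDerivAt (fun t : ℝ => Real.arctan (t ^ 2 * det3 a a' x /
        triRe (x - t • a' - t • a) (x - t • a') x))
      (1 / 2 * det3 a a' x * (t * ((‖x - t • a' - t • a‖ + ‖x - t • a'‖) /
        (‖x - t • a' - t • a‖ * ‖x - t • a'‖ * (‖x - t • a' - t • a‖ * ‖x - t • a'‖ +
          inner ℝ (x - t • a' - t • a) (x - t • a')))))) t := by
  have hQ := triRe_pos h₀₁ h₀₂ h₁₂
  have hsq := triRe_sq_add_det3_sq (x - t • a' - t • a) (x - t • a') x
  rw [(det3_triangle x a a' t t).1] at hsq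
  have n0 : x - t • a' - t • a ≠ 0 := fun h => by simp [h] at h₀₁
  have n1 : x - t • a' ≠ 0 := fun h => by simp [h] at h₀₁
  have hγ1 : HasDerivAt (fun s : ℝ => x - s • a') (-a') t := by
    simpa using ((hasDerivAt_id t).smul_const a').const_sub x
  have hγ0 : HasDerivAt (fun s : ℝ => x - s • a' - s • a) (-a' - a) t := by
    exact (hγ1.sub ((hasDerivAt_id t).smul_const a)).congr_deriv (by simp)
  have hc : HasDerivAt (fun _ : ℝ => x) 0 t := hasDerivAt_const t x
  have d0 := hasDerivAt_norm_path hγ0 n0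
  have d1 := hasDerivAt_norm_path hγ1 n1
  have d01 := hγ0.inner ℝ hγ1
  have d02 := hγ0.inner ℝ hc
  have d12 := hγ1.inner ℝ hc
  have dQ := ((((d0.mul d1).mul_const ‖x‖).add (d01.const_mul ‖x‖)).add (d1.mul d02)).add
    (d0.mul d12)
  have e0 : t * inner ℝ (x - t • a' - t • a) (-a' - a) =
      ‖x - t • a' - t • a‖ ^ 2 - inner ℝ (x - t • a' - t • a) x := by
    rw [← real_inner_self_eq_norm_sq, ← inner_sub_right, ← inner_smul_right]
    congr 1; module
  have e1 : t * inner ℝ (x - t • a') (-a') = ‖x - t • a'‖ ^ 2 - inner ℝ (x - t • a') x := by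
    rw [← real_inner_self_eq_norm_sq, ← inner_sub_right, ← inner_smul_right]
    congr 1; module
  have e01 : t * (inner ℝ (x - t • a' - t • a) (-a')) = inner ℝ (x - t • a' - t • a) (x - t • a') -
      inner ℝ (x - t • a' - t • a) x := by
    rw [← inner_sub_right, ← inner_smul_right]
    congr 1; module
  have e10 : t * (inner ℝ (-a' - a) (x - t • a')) = inner ℝ (x - t • a' - t • a) (x - t • a') -
      inner ℝ (x - t • a') x := by
    rw [real_inner_comm (x - t • a') (x - t • a' - t • a), ← inner_sub_right, real_inner_comm,
      ← inner_smul_right]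
    congr 1; module
  have e02 : t * inner ℝ (-a' - a) x = inner ℝ (x - t • a' - t • a) x - ‖x‖ ^ 2 := by
    rw [← real_inner_self_eq_norm_sq, ← inner_sub_left, ← real_inner_smul_left]
    congr 1; module
  have e12 : t * inner ℝ (-a') x = inner ℝ (x - t • a') x - ‖x‖ ^ 2 := by
    rw [← real_inner_self_eq_norm_sq, ← inner_sub_left, ← real_inner_smul_left]
    congr 1; module
  have p0 : 0 < ‖x - t • a' - t • a‖ := norm_pos_iff.mpr n0
  have p1 : 0 < ‖x - t • a'‖ := norm_pos_iff.mpr n1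
  have key := ((((hasDerivAt_id t).pow 2).mul_const (det3 a a' x)).div dQ hQ.ne').arctan
  refine key.congr_deriv ?_
  simp only [inner_zero_right, zero_add, id, Pi.add_apply, Pi.mul_apply, Pi.pow_apply,
    Pi.div_apply]
  rw [show ‖x - t • a' - t • a‖ * ‖x - t • a'‖ * ‖x‖ +
    ‖x‖ * inner ℝ (x - t • a' - t • a) (x - t • a') +
    ‖x - t • a'‖ * inner ℝ (x - t • a' - t • a) x +
    ‖x - t • a' - t • a‖ * inner ℝ (x - t • a') x =
      triRe (x - t • a' - t • a) (x - t • a') x from rfl]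
  set Q := triRe (x - t • a' - t • a) (x - t • a') x with hQdef
  rw [triRe] at hQdef
  set r0 := ‖x - t • a' - t • a‖
  set r1 := ‖x - t • a'‖
  set r2 := ‖x‖
  set A := inner ℝ (x - t • a' - t • a) (x - t • a')
  set B := inner ℝ (x - t • a' - t • a) x
  set C := inner ℝ (x - t • a') x
  set d := det3 a a' x
  clear_value r0 r1 r2 A B C d Q
  exact triangle_angle_identity p0 p1 h₀₁ hQ hQdef hsq e0 e1 e01 e10 e02 e12

/-- Integrating the growth rate from the degenerate triangle `t = 0` gives the full half solid
angle. Positivity of all inner products rules out any jump of the arctangent; integrability is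
recorded because differences of such integrals are taken later. -/
lemma triPhase_eq_flux {x a a' : E}
    (hpos : ∀ s ∈ Set.Icc (0 : ℝ) 1, ∀ t ∈ Set.Icc (0 : ℝ) 1, ∀ s' ∈ Set.Icc (0 : ℝ) 1,
      ∀ t' ∈ Set.Icc (0 : ℝ) 1, 0 < inner ℝ (x - t • a' - s • a) (x - t' • a' - s' • a)) :
    IntervalIntegrable (fun t : ℝ => ∫ s in (0 : ℝ)..t, betaForm (1 / 2) a a' (x - t • a' - s • a))
      volume 0 1 ∧
    triPhase (x - a' - a) (x - a') x =
      Complex.exp (-((∫ t in (0 : ℝ)..1, ∫ s in (0 : ℝ)..t,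
        betaForm (1 / 2) a a' (x - t • a' - s • a) : ℝ) : ℂ) * Complex.I) := by
  have z0 : (0 : ℝ) ∈ Set.Icc (0 : ℝ) 1 := by simp
  have z1 : (1 : ℝ) ∈ Set.Icc (0 : ℝ) 1 := by simp
  have h₀₁ : ∀ t ∈ Set.Icc (0 : ℝ) 1, 0 < inner ℝ (x - t • a' - t • a) (x - t • a') := fun t ht => by
    simpa using hpos t ht t ht 0 z0 t ht
  have h₀₂ : ∀ t ∈ Set.Icc (0 : ℝ) 1, 0 < inner ℝ (x - t • a' - t • a) x := fun t ht => by
    simpa using hpos t ht t ht 0 z0 0 z0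
  have h₁₂ : ∀ t ∈ Set.Icc (0 : ℝ) 1, 0 < inner ℝ (x - t • a') x := fun t ht => by
    simpa using hpos 0 z0 t ht 0 z0 0 z0
  have hinner : ∀ t ∈ Set.Icc (0 : ℝ) 1, ∫ s in (0 : ℝ)..t,
      betaForm (1 / 2) a a' (x - t • a' - s • a) =
      1 / 2 * det3 a a' x * (t * ((‖x - t • a' - t • a‖ + ‖x - t • a'‖) /
        (‖x - t • a' - t • a‖ * ‖x - t • a'‖ * (‖x - t • a' - t • a‖ * ‖x - t • a'‖ +
          inner ℝ (x - t • a' - t • a) (x - t • a'))))) := by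
    intro t ht
    rw [← integral_chord, ← intervalIntegral.integral_const_mul]
    · refine intervalIntegral.integral_congr fun s _ => ?_
      simp only [betaForm_eq, (det3_triangle x a a' s t).2, div_eq_mul_inv]
    · intro s hs
      rw [Set.uIcc_of_le ht.1] at hs
      simpa using hpos s ⟨hs.1, hs.2.trans ht.2⟩ t ht 0 z0 t ht
  have h01 : Set.uIcc (0 : ℝ) 1 = Set.Icc 0 1 := Set.uIcc_of_le zero_le_one
  have hIntg : IntervalIntegrable (fun t : ℝ => 1 / 2 * det3 a a' x *
      (t * ((‖x - t • a' - t • a‖ + ‖x - t • a'‖) /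
        (‖x - t • a' - t • a‖ * ‖x - t • a'‖ * (‖x - t • a' - t • a‖ * ‖x - t • a'‖ +
          inner ℝ (x - t • a' - t • a) (x - t • a')))))) volume 0 1 := by
    refine ContinuousOn.intervalIntegrable fun t ht => ContinuousAt.continuousWithinAt ?_
    rw [h01] at ht
    have hp := h₀₁ t ht
    have n0 : 0 < ‖x - t • a' - t • a‖ := norm_pos_iff.mpr fun h => by simp [h] at hp
    have n1 : 0 < ‖x - t • a'‖ := norm_pos_iff.mpr fun h => by simp [h] at hp
    have c0 : Continuous fun t : ℝ => x - t • a' - t • a := by fun_prop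
    have c1 : Continuous fun t : ℝ => x - t • a' := by fun_prop
    refine continuousAt_const.mul (continuousAt_id.mul (ContinuousAt.div ?_ ?_ ?_))
    · exact (c0.norm.add c1.norm).continuousAt
    · exact ((c0.norm.mul c1.norm).mul ((c0.norm.mul c1.norm).add (c0.inner c1))).continuousAt
    · positivity
  have hsub := intervalIntegral.integral_eq_sub_of_hasDerivAt (a := 0) (b := 1)
    (fun t ht => hasDerivAt_triangle_angle (h₀₁ t (h01 ▸ ht)) (h₀₂ t (h01 ▸ ht)) (h₁₂ t (h01 ▸ ht))) hIntg
  refine ⟨IntervalIntegrable.congr_uIoo hIntg fun t ht => (hinner t (h01 ▸ Set.uIoo_subset_uIcc_self ht)).symm, ?_⟩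
  rw [triPhase_eq_exp_arctan]
  · rw [intervalIntegral.integral_congr (g := fun t => 1 / 2 * det3 a a' x *
      (t * ((‖x - t • a' - t • a‖ + ‖x - t • a'‖) /
        (‖x - t • a' - t • a‖ * ‖x - t • a'‖ * (‖x - t • a' - t • a‖ * ‖x - t • a'‖ +
          inner ℝ (x - t • a' - t • a) (x - t • a')))))) (fun t ht => hinner t (h01 ▸ ht)), hsub]
    have := (det3_triangle x a a' 1 1).1
    simp only [one_smul] at this
    rw [this]
    simp
  · simpa using triRe_pos (h₀₁ 1 z1) (h₀₂ 1 z1) (h₁₂ 1 z1)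

/-! ### Polynomial bounds for symbols -/

lemma dirDeriv_const_smul {V : Type*} [NormedAddCommGroup V] [NormedSpace ℝ V] (v : V) (c : ℝ)
    (φ : V → ℝ) : dirDeriv v (c • φ) = c • dirDeriv v φ := by
  funext x
  simp [dirDeriv, fderiv_const_smul_field]

lemma dirDeriv_iterate_const_smul {V : Type*} [NormedAddCommGroup V] [NormedSpace ℝ V] (v : V)
    (c : ℝ) (φ : V → ℝ) (n : ℕ) : (dirDeriv v)^[n] (c • φ) = c • (dirDeriv v)^[n] φ := by
  induction n with
  | zero => rfl
  | succ n ih => rw [Function.iterate_succ_apply', Function.iterate_succ_apply', ih,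
      dirDeriv_const_smul]

/-- Linearity in the charge makes bounds for `β` uniform over bounded charges, as needed when the
charge is `ħ/2`. -/
lemma betaDeriv_eq_mul (eg : ℝ) (i j : Fin 3) (γ : Fin 3 → ℕ) (x : E) :
    betaDeriv eg i j γ x = eg * betaDeriv 1 i j γ x := by
  have h : beta eg i j = eg • beta 1 i j := by
    funext y; simp [beta]
  rw [betaDeriv, h, dirDeriv_iterate_const_smul, dirDeriv_iterate_const_smul,
    dirDeriv_iterate_const_smul]
  rfl

lemma abs_coord_le (x : E) (i : Fin 3) : |x i| ≤ ‖x‖ := by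
  simpa using PiLp.norm_apply_le x i

/-- Values of symbols are polynomially bounded, uniformly on compact sets off the origin. -/
lemma jetEval_bound (W : SymbolPoly JetPoly) {S : Set E} (hS : IsCompact S) (h0 : (0 : E) ∉ S) :
    ∃ C : ℝ, 0 ≤ C ∧ ∃ K : ℕ, ∀ eg : ℝ, |eg| ≤ 1 → ∀ x ∈ S, ∀ u v u' v' : E,
      ‖jetEval eg x u v u' v' W‖ ≤ C * (1 + ‖u‖ + ‖v‖ + ‖u'‖ + ‖v'‖) ^ K := by
  have hone : ∀ u v u' v' : E, 1 ≤ 1 + ‖u‖ + ‖v‖ + ‖u'‖ + ‖v'‖ := fun u v u' v' => by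
    have := norm_nonneg u; have := norm_nonneg v
    have := norm_nonneg u'; have := norm_nonneg v'
    linarith
  have hadd : ∀ W₁ W₂ : SymbolPoly JetPoly,
      (∃ C : ℝ, 0 ≤ C ∧ ∃ K : ℕ, ∀ eg : ℝ, |eg| ≤ 1 → ∀ x ∈ S, ∀ u v u' v' : E,
        ‖jetEval eg x u v u' v' W₁‖ ≤ C * (1 + ‖u‖ + ‖v‖ + ‖u'‖ + ‖v'‖) ^ K) →
      (∃ C : ℝ, 0 ≤ C ∧ ∃ K : ℕ, ∀ eg : ℝ, |eg| ≤ 1 → ∀ x ∈ S, ∀ u v u' v' : E,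
        ‖jetEval eg x u v u' v' W₂‖ ≤ C * (1 + ‖u‖ + ‖v‖ + ‖u'‖ + ‖v'‖) ^ K) →
      (∃ C : ℝ, 0 ≤ C ∧ ∃ K : ℕ, ∀ eg : ℝ, |eg| ≤ 1 → ∀ x ∈ S, ∀ u v u' v' : E,
        ‖jetEval eg x u v u' v' (W₁ + W₂)‖ ≤ C * (1 + ‖u‖ + ‖v‖ + ‖u'‖ + ‖v'‖) ^ K) := by
    rintro W₁ W₂ ⟨C₁, c₁, K₁, h₁⟩ ⟨C₂, c₂, K₂, h₂⟩
    refine ⟨C₁ + C₂, by positivity, K₁ + K₂, fun eg heg x hx u v u' v' => ?_⟩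
    rw [map_add, add_mul]
    refine (norm_add_le _ _).trans (add_le_add ((h₁ eg heg x hx u v u' v').trans ?_)
      ((h₂ eg heg x hx u v u' v').trans ?_)) <;> gcongr
    · exact hone u v u' v'
    · omega
    · exact hone u v u' v'
    · omega
  have hmul : ∀ W₁ W₂ : SymbolPoly JetPoly,
      (∃ C : ℝ, 0 ≤ C ∧ ∃ K : ℕ, ∀ eg : ℝ, |eg| ≤ 1 → ∀ x ∈ S, ∀ u v u' v' : E,
        ‖jetEval eg x u v u' v' W₁‖ ≤ C * (1 + ‖u‖ + ‖v‖ + ‖u'‖ + ‖v'‖) ^ K) →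
      (∃ C : ℝ, 0 ≤ C ∧ ∃ K : ℕ, ∀ eg : ℝ, |eg| ≤ 1 → ∀ x ∈ S, ∀ u v u' v' : E,
        ‖jetEval eg x u v u' v' W₂‖ ≤ C * (1 + ‖u‖ + ‖v‖ + ‖u'‖ + ‖v'‖) ^ K) →
      (∃ C : ℝ, 0 ≤ C ∧ ∃ K : ℕ, ∀ eg : ℝ, |eg| ≤ 1 → ∀ x ∈ S, ∀ u v u' v' : E,
        ‖jetEval eg x u v u' v' (W₁ * W₂)‖ ≤ C * (1 + ‖u‖ + ‖v‖ + ‖u'‖ + ‖v'‖) ^ K) := by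
    rintro W₁ W₂ ⟨C₁, c₁, K₁, h₁⟩ ⟨C₂, c₂, K₂, h₂⟩
    refine ⟨C₁ * C₂, by positivity, K₁ + K₂, fun eg heg x hx u v u' v' => ?_⟩
    rw [map_mul, norm_mul, pow_add, mul_mul_mul_comm]
    exact mul_le_mul (h₁ eg heg x hx u v u' v') (h₂ eg heg x hx u v u' v') (norm_nonneg _)
      (by positivity)
  induction W using MvPolynomial.induction_on with
  | C c =>
    induction c using MvPolynomial.induction_on with
    | C c =>
      exact ⟨‖c‖, norm_nonneg _, 0, fun eg _ x _ u v u' v' => by rw [jetEval_const]; simp⟩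
    | add p q hp hq => rw [map_add]; exact hadd _ _ hp hq
    | mul_X p s hp =>
      rw [map_mul]
      refine hmul _ _ hp ?_
      have hc : ContinuousOn (betaDeriv 1 s.1 s.2.1 s.2.2) S :=
        (contDiffOn_betaDeriv 1 s.1 s.2.1 s.2.2).continuousOn.mono fun x hx hx0 =>
          h0 ((Set.mem_singleton_iff.mp hx0) ▸ hx)
      obtain ⟨C, hC⟩ := hS.exists_bound_of_continuousOn hc
      refine ⟨|C|, abs_nonneg _, 0, fun eg heg x hx u v u' v' => ?_⟩
      rw [jetEval_jet, betaDeriv_eq_mul, Complex.norm_real, norm_mul, pow_zero, mul_one]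
      have h1 := (hC x hx).trans (le_abs_self C)
      have h2 : ‖eg‖ ≤ 1 := heg
      calc ‖eg‖ * ‖betaDeriv 1 s.1 s.2.1 s.2.2 x‖ ≤ 1 * |C| := by gcongr
        _ = |C| := one_mul _
  | add p q hp hq => exact hadd _ _ hp hq
  | mul_X p s hp =>
    refine hmul _ _ hp ⟨1, zero_le_one, 1, fun eg _ x _ u v u' v' => ?_⟩
    rw [jetEval_X, Complex.norm_real, one_mul, pow_one]
    have h1 := norm_nonneg u; have h2 := norm_nonneg v
    have h3 := norm_nonneg u'; have h4 := norm_nonneg v'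
    obtain ⟨k, i⟩ := s
    fin_cases k
    · exact (abs_coord_le u i).trans (by linarith)
    · exact (abs_coord_le v i).trans (by linarith)
    · exact (abs_coord_le u' i).trans (by linarith)
    · exact (abs_coord_le v' i).trans (by linarith)

/-! ### Directional derivatives as commuting operators -/

/-- Smooth real functions on `ℝ³ ∖ {0}` (extended by `0` to the origin). -/
def SmoothScalar : Submodule ℝ (E → ℝ) where
  carrier := {φ | ContDiffOn ℝ ∞ φ {0}ᶜ ∧ φ 0 = 0}
  add_mem' := fun ha hb => ⟨ha.1.add hb.1, by simp [ha.2, hb.2]⟩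
  zero_mem' := ⟨contDiffOn_const, rfl⟩
  smul_mem' := fun c _ ha => ⟨ha.1.const_smul c, by simp [ha.2]⟩

/-- The value of an element of `SmoothScalar` at a point. -/
def SmoothScalar.eval (x : E) : SmoothScalar →ₗ[ℝ] ℝ :=
  (LinearMap.proj x).comp SmoothScalar.subtype

lemma SmoothScalar.ext_eval {φ χ : SmoothScalar}
    (h : ∀ x ≠ 0, SmoothScalar.eval x φ = SmoothScalar.eval x χ) : φ = χ := by
  refine Subtype.ext (funext fun x => ?_)
  by_cases hx : x = 0
  · rw [hx]; exact φ.2.2.trans χ.2.2.symm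
  · exact h x hx

lemma SmoothScalar.differentiableAt (φ : SmoothScalar) {x : E} (hx : x ≠ 0) :
    DifferentiableAt ℝ (φ : E → ℝ) x :=
  differentiableAt_of_contDiffOn isOpen_compl_singleton φ.2.1 hx

open Classical in
/-- The directional derivative as an operator. -/
def dirOp (v : E) : Module.End ℝ SmoothScalar where
  toFun φ := ⟨fun x => if x = 0 then 0 else dirDeriv v φ x, by
    refine ⟨(contDiffOn_dirDeriv isOpen_compl_singleton φ.2.1 v).congr fun x hx => ?_, by simp⟩
    exact if_neg hx⟩
  map_add' φ χ := SmoothScalar.ext_eval fun x hx => by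
    simp [SmoothScalar.eval, hx, dirDeriv, fderiv_add (SmoothScalar.differentiableAt φ hx) (SmoothScalar.differentiableAt χ hx)]
  map_smul' c φ := SmoothScalar.ext_eval fun x hx => by
    simp [SmoothScalar.eval, hx, dirDeriv, fderiv_const_smul (SmoothScalar.differentiableAt φ hx)]

lemma eval_dirOp (v : E) (φ : SmoothScalar) {x : E} (hx : x ≠ 0) :
    SmoothScalar.eval x (dirOp v φ) = dirDeriv v φ x := by
  simp [SmoothScalar.eval, dirOp, hx]

lemma dirOp_eqOn (v : E) (φ : SmoothScalar) : Set.EqOn (dirOp v φ : E → ℝ) (dirDeriv v φ) {0}ᶜ :=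
  fun _ hx => eval_dirOp v φ hx

lemma dirOp_pow_eqOn (v : E) (n : ℕ) (φ : SmoothScalar) :
    Set.EqOn (((dirOp v) ^ n) φ : E → ℝ) ((dirDeriv v)^[n] φ) {0}ᶜ := by
  induction n with
  | zero => exact fun x _ => rfl
  | succ n ih =>
    rw [pow_succ', Function.iterate_succ_apply']
    exact (dirOp_eqOn v _).trans (eqOn_dirDeriv isOpen_compl_singleton ih v)

/-- An identity of operators, not merely of values off the origin, because elements of
`SmoothScalar` vanish at `0` by convention. This allows the binomial theorem to be applied to
directional derivatives. -/
lemma dirOp_commute (v w : E) : Commute (dirOp v) (dirOp w) :=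
  LinearMap.ext fun φ => SmoothScalar.ext_eval fun x hx => by
    rw [Module.End.mul_apply, Module.End.mul_apply, eval_dirOp v _ hx, eval_dirOp w _ hx,
      eqOn_dirDeriv isOpen_compl_singleton (dirOp_eqOn w φ) v hx,
      eqOn_dirDeriv isOpen_compl_singleton (dirOp_eqOn v φ) w hx]
    exact dirDeriv_comm isOpen_compl_singleton φ.2.1 v w hx

lemma dirOp_comb (c c' : ℝ) (v w : E) : dirOp (c • v + c' • w) = c • dirOp v + c' • dirOp w :=
  LinearMap.ext fun φ => SmoothScalar.ext_eval fun x hx => by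
    rw [LinearMap.add_apply, map_add, LinearMap.smul_apply, LinearMap.smul_apply, map_smul, map_smul,
      eval_dirOp _ _ hx, eval_dirOp _ _ hx, eval_dirOp _ _ hx, dirDeriv_add_vec, dirDeriv_smul_vec,
      dirDeriv_smul_vec]
    rfl

/-- The function `u · β u'` as an element of `SmoothScalar`. -/
def betaScalar (eg : ℝ) (u u' : E) : SmoothScalar :=
  ⟨betaForm eg u u', contDiffOn_betaForm eg u u', by simp [betaForm_eq]⟩

lemma hasDerivAt_eval_dirOp_pow (y q : E) (φ : SmoothScalar) (k : ℕ) {s : ℝ} (h : q + s • y ≠ 0) :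
    HasDerivAt (fun s : ℝ => SmoothScalar.eval (q + s • y) ((dirOp y ^ k) φ))
      (SmoothScalar.eval (q + s • y) ((dirOp y ^ (k + 1)) φ)) s := by
  rw [pow_succ', Module.End.mul_apply, eval_dirOp _ _ h]
  have h1 := (SmoothScalar.differentiableAt ((dirOp y ^ k) φ) h).hasFDerivAt
  have h2 : HasDerivAt (fun s : ℝ => q + s • y) y s := by
    simpa using ((hasDerivAt_id s).smul_const y).const_add q
  exact h1.comp_hasDerivAt s h2

/-- Taylor's formula for a sequence of successive derivatives. -/
lemma taylor_bound {T : ℝ} (N : ℕ) : ∀ (ψ : ℕ → ℝ → ℝ) (M : ℝ),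
    (∀ k, ∀ s ∈ Set.Icc 0 T, HasDerivAt (ψ k) (ψ (k + 1) s) s) →
    (∀ s ∈ Set.Icc 0 T, |ψ N s| ≤ M) → ∀ s ∈ Set.Icc 0 T,
      |ψ 0 s - ∑ k ∈ Finset.range N, s ^ k / (Nat.factorial k : ℝ) * ψ k 0| ≤ M * s ^ N := by
  induction N with
  | zero => intro ψ M _ hM s hs; simpa using hM s hs
  | succ N ih =>
    intro ψ M hd hM t ht
    -- The derivative of the remainder is the remainder of one order less for the shifted sequence;
    -- the mean value inequality then gains one power of `s`.
    have hstep := ih (fun k => ψ (k + 1)) M (fun k => hd (k + 1)) hM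
    have hM0 : 0 ≤ M := (abs_nonneg _).trans (hM t ht)
    set R : ℝ → ℝ := fun s =>
      ψ 0 s - ∑ k ∈ Finset.range (N + 1), s ^ k / (Nat.factorial k : ℝ) * ψ k 0
    have hR : ∀ s ∈ Set.Icc 0 T, HasDerivAt R
        (ψ 1 s - ∑ k ∈ Finset.range N, s ^ k / (Nat.factorial k : ℝ) * ψ (k + 1) 0) s := by
      intro s hs
      refine (hd 0 s hs).sub ?_
      have h1 : ∀ k ∈ Finset.range (N + 1), HasDerivAt
          (fun s : ℝ => s ^ k / (Nat.factorial k : ℝ) * ψ k 0)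
          ((k : ℝ) * s ^ (k - 1) / (Nat.factorial k : ℝ) * ψ k 0) s := fun k _ =>
        ((hasDerivAt_pow k s).div_const _).mul_const _
      refine (HasDerivAt.fun_sum h1).congr_deriv ?_
      rw [Finset.sum_range_succ']
      simp only [Nat.cast_zero, zero_mul, zero_div, add_zero, Nat.add_sub_cancel]
      refine Finset.sum_congr rfl fun k _ => ?_
      rw [Nat.factorial_succ]
      push_cast
      field_simp
    have h0 : R 0 = 0 := by
      simp [R, Finset.sum_range_succ']
    have hsub : ∀ s ∈ Set.Icc 0 t, s ∈ Set.Icc 0 T := fun s hs => ⟨hs.1, hs.2.trans ht.2⟩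
    have := norm_image_sub_le_of_norm_deriv_le_segment' (a := 0) (b := t) (C := M * t ^ N) (f := R)
      (fun s hs => (hR s (hsub s hs)).hasDerivWithinAt) (fun s hs => by
        refine (hstep s (hsub s ⟨hs.1, hs.2.le⟩)).trans ?_
        have := hs.1
        have := hs.2.le
        gcongr) t ⟨ht.1, le_rfl⟩
    rw [h0, sub_zero, sub_zero, Real.norm_eq_abs] at this
    calc |R t| ≤ M * t ^ N * t := this
      _ = M * t ^ (N + 1) := by ring

/-! ### Expansion of the flux -/

/-- The coefficients of the magnetic part of the exponent of the multiplier. -/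
def fluxCoeff (eg : ℝ) (q u u' : E) (N : ℕ) : ℝ :=
  ∑ k ∈ Finset.range N, ((2 : ℝ) ^ k * (Nat.factorial k : ℝ))⁻¹ *
    (dirDeriv (u + u'))^[k] (zassTerm zassCoeff eg (N + 1 - k) u u') q

lemma eval_dirOp_mul (eg : ℝ) (u u' : E) (a b : ℕ) {x : E} (hx : x ≠ 0) :
    SmoothScalar.eval x ((dirOp u ^ a * dirOp u' ^ b) (betaScalar eg u u')) =
      (dirDeriv u)^[a] ((dirDeriv u')^[b] (betaForm eg u u')) x :=
  ((dirOp_pow_eqOn u a _).trans (eqOn_dirDeriv_iterate isOpen_compl_singleton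
    (dirOp_pow_eqOn u' b (betaScalar eg u u')) u a)) hx

lemma zassTerm_eqOn (eg : ℝ) (n : ℕ) (u u' : E) : Set.EqOn (zassTerm zassCoeff eg n u u')
    ((∑ a ∈ Finset.range (n - 1), zassCoeff n a •
      (dirOp u ^ a * dirOp u' ^ (n - 2 - a)) (betaScalar eg u u') : SmoothScalar) : E → ℝ) {0}ᶜ := by
  intro x hx
  change _ = SmoothScalar.eval x _
  rw [map_sum, zassTerm]
  refine Finset.sum_congr rfl fun a _ => ?_
  rw [map_smul, eval_dirOp_mul eg u u' _ _ hx]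
  rfl

/-- With `N = m + 1` the Zassenhaus index `N + 1 - k` becomes `m - k + 2`, so the total number of
derivatives is `m` in every term. -/
lemma fluxCoeff_succ (eg : ℝ) {q : E} (hq : q ≠ 0) (u u' : E) (m : ℕ) :
    fluxCoeff eg q u u' (m + 1) = ∑ k ∈ Finset.range (m + 1), ∑ a ∈ Finset.range (m - k + 1),
      ((2 : ℝ) ^ k * (Nat.factorial k : ℝ))⁻¹ * zassCoeff (m - k + 2) a *
      SmoothScalar.eval q (((dirOp u + dirOp u') ^ k * dirOp u ^ a * dirOp u' ^ (m - k - a))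
        (betaScalar eg u u')) := by
  refine Finset.sum_congr rfl fun k hk => ?_
  have hk' : k ≤ m := Nat.lt_succ_iff.mp (Finset.mem_range.mp hk)
  have e1 : m + 1 + 1 - k = m - k + 2 := by omega
  have hz := (eqOn_dirDeriv_iterate isOpen_compl_singleton
    (zassTerm_eqOn eg (m - k + 2) u u') (u + u') k).trans (dirOp_pow_eqOn (u + u') k _).symm
  have hd : dirOp (u + u') = dirOp u + dirOp u' := by
    have := dirOp_comb 1 1 u u'
    simpa using this
  rw [e1, hz hq, hd]
  change _ * SmoothScalar.eval q _ = _
  rw [map_sum, map_sum, Finset.mul_sum]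
  refine Finset.sum_congr (by congr 1) fun a _ => ?_
  rw [map_smul, map_smul, smul_eq_mul, ← mul_assoc, ← Module.End.mul_apply, ← mul_assoc]
  rfl

lemma natCast_eq_smul_one {R : Type*} [Ring R] [Algebra ℝ R] (n : ℕ) : (n : R) = (n : ℝ) • 1 := by
  rw [← Algebra.algebraMap_eq_smul_one, map_natCast]

lemma factorial_inv_mul_choose {m k : ℕ} (h : k ≤ m) : (m.factorial : ℝ)⁻¹ * (m.choose k : ℝ) =
    (k.factorial : ℝ)⁻¹ * ((m - k).factorial : ℝ)⁻¹ := by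
  rw [Nat.cast_choose ℝ h]
  have := Nat.factorial_ne_zero m
  field_simp

lemma divided_pow_add {R : Type*} [Ring R] [Algebra ℝ R] {X Y : R} (h : Commute X Y) (m : ℕ) :
    (m.factorial : ℝ)⁻¹ • (X + Y) ^ m = ∑ k ∈ Finset.range (m + 1),
      ((k.factorial : ℝ)⁻¹ * ((m - k).factorial : ℝ)⁻¹) • (X ^ k * Y ^ (m - k)) := by
  rw [h.add_pow, Finset.smul_sum]
  refine Finset.sum_congr rfl fun k hk => ?_
  rw [natCast_eq_smul_one (R := R) (m.choose k), mul_smul_comm, mul_one, smul_smul,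
    factorial_inv_mul_choose (Nat.lt_succ_iff.mp (Finset.mem_range.mp hk))]

/-- The vertex of the triangle is `q + ħ(u+u')/2`, so a point of the triangle differs from `q` by a
shift to the vertex, the part `½(X + Y)`, and a displacement `-sX - tY` inside the triangle. The
first becomes the shifted argument of `c_n`, the second the simplex monomials. -/
lemma divided_pow_centered {R : Type*} [Ring R] [Algebra ℝ R] {X Y : R} (h : Commute X Y)
    (s t : ℝ) (m : ℕ) :
    (m.factorial : ℝ)⁻¹ • ((1 / 2 - s) • X + (1 / 2 - t) • Y) ^ m =
      ∑ k ∈ Finset.range (m + 1), ∑ a ∈ Finset.range (m - k + 1),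
        (((2 : ℝ) ^ k * (k.factorial : ℝ))⁻¹ * ((-1) ^ (m - k) * (a.factorial : ℝ)⁻¹ *
          ((m - k - a).factorial : ℝ)⁻¹) * (s ^ a * t ^ (m - k - a))) •
          ((X + Y) ^ k * X ^ a * Y ^ (m - k - a)) := by
  have e : (1 / 2 - s) • X + (1 / 2 - t) • Y =
      (1 / 2 : ℝ) • (X + Y) + ((-s) • X + (-t) • Y) := by module
  have hXY : Commute ((-s) • X) ((-t) • Y) := (h.smul_left _).smul_right _
  have hc : Commute ((1 / 2 : ℝ) • (X + Y)) ((-s) • X + (-t) • Y) := by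
    refine Commute.smul_left ?_ _
    exact (((Commute.refl X).smul_right _).add_right (h.smul_right _)).add_left
      ((h.symm.smul_right _).add_right ((Commute.refl Y).smul_right _))
  rw [e, divided_pow_add hc]
  refine Finset.sum_congr rfl fun k _ => ?_
  rw [mul_smul, ← mul_smul_comm, divided_pow_add hXY, Finset.mul_sum, Finset.smul_sum]
  refine Finset.sum_congr rfl fun a ha => ?_
  have ha' : a ≤ m - k := Nat.lt_succ_iff.mp (Finset.mem_range.mp ha)
  simp only [smul_pow, smul_mul_assoc, mul_smul_comm, smul_smul]
  rw [mul_assoc ((X + Y) ^ k)]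
  congr 1
  have : (-1 : ℝ) ^ (m - k) = (-1) ^ a * (-1) ^ (m - k - a) := by
    rw [← pow_add]; congr 1; omega
  rw [this, neg_pow s, neg_pow t, mul_inv, one_div, inv_pow]
  ring

/-- Double integrals of polynomials over the simplex `0 ≤ s ≤ t ≤ 1`. -/
lemma integral_simplex {ι : Type*} (S : Finset ι) (κ : ι → ℝ) (a b : ι → ℕ) :
    IntervalIntegrable (fun t : ℝ => ∫ s in (0 : ℝ)..t, ∑ i ∈ S, κ i * (s ^ a i * t ^ b i))
      volume 0 1 ∧
    ∫ t in (0 : ℝ)..1, ∫ s in (0 : ℝ)..t, ∑ i ∈ S, κ i * (s ^ a i * t ^ b i) =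
      ∑ i ∈ S, κ i * (((a i : ℝ) + 1) * ((a i : ℝ) + b i + 2))⁻¹ := by
  have hin : ∀ t : ℝ, ∫ s in (0 : ℝ)..t, ∑ i ∈ S, κ i * (s ^ a i * t ^ b i) =
      ∑ i ∈ S, κ i * ((a i : ℝ) + 1)⁻¹ * t ^ (a i + b i + 1) := by
    intro t
    rw [intervalIntegral.integral_finsetSum fun i _ => by
      apply Continuous.intervalIntegrable; fun_prop]
    refine Finset.sum_congr rfl fun i _ => ?_
    rw [intervalIntegral.integral_const_mul, intervalIntegral.integral_mul_const, integral_pow]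
    rw [zero_pow (by omega)]
    field_simp
    ring
  simp_rw [hin]
  refine ⟨by apply Continuous.intervalIntegrable; fun_prop, ?_⟩
  rw [intervalIntegral.integral_finsetSum fun i _ => by
    apply Continuous.intervalIntegrable; fun_prop]
  refine Finset.sum_congr rfl fun i _ => ?_
  rw [intervalIntegral.integral_const_mul, integral_pow]
  rw [zero_pow (by omega)]
  push_cast
  field_simp
  ring

/-- The heart of the comparison. Over the simplex, `s^a t^b` integrates to `1/((a+1)(a+b+2))`, which
turns the Taylor factor `1/(a! b!)` into `1/((a+1)! b! n)` with `n = a+b+2`. That is `zassCoeff`,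
with the sign `(-1)^n` coming from `-s` and `-t`. -/
lemma integral_taylor_term (eg : ℝ) {q : E} (hq : q ≠ 0) (u u' : E) (m : ℕ) :
    (∀ t : ℝ, IntervalIntegrable (fun s : ℝ => (m.factorial : ℝ)⁻¹ * SmoothScalar.eval q
      ((dirOp ((1 / 2 - s) • u + (1 / 2 - t) • u') ^ m) (betaScalar eg u u'))) volume 0 t) ∧
    IntervalIntegrable (fun t : ℝ => ∫ s in (0 : ℝ)..t, (m.factorial : ℝ)⁻¹ * SmoothScalar.eval q
      ((dirOp ((1 / 2 - s) • u + (1 / 2 - t) • u') ^ m) (betaScalar eg u u'))) volume 0 1 ∧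
    ∫ t in (0 : ℝ)..1, ∫ s in (0 : ℝ)..t, (m.factorial : ℝ)⁻¹ * SmoothScalar.eval q
      ((dirOp ((1 / 2 - s) • u + (1 / 2 - t) • u') ^ m) (betaScalar eg u u')) =
      fluxCoeff eg q u u' (m + 1) := by
  set S : Finset (Σ _ : ℕ, ℕ) := (Finset.range (m + 1)).sigma fun k => Finset.range (m - k + 1)
  set κ : (Σ _ : ℕ, ℕ) → ℝ := fun i => (((2 : ℝ) ^ i.1 * (i.1.factorial : ℝ))⁻¹ *
    ((-1) ^ (m - i.1) * (i.2.factorial : ℝ)⁻¹ * ((m - i.1 - i.2).factorial : ℝ)⁻¹)) *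
    SmoothScalar.eval q (((dirOp u + dirOp u') ^ i.1 * dirOp u ^ i.2 * dirOp u' ^ (m - i.1 - i.2))
        (betaScalar eg u u'))
  have hpt : ∀ s t : ℝ, (m.factorial : ℝ)⁻¹ * SmoothScalar.eval q
      ((dirOp ((1 / 2 - s) • u + (1 / 2 - t) • u') ^ m) (betaScalar eg u u')) =
      ∑ i ∈ S, κ i * (s ^ i.2 * t ^ (m - i.1 - i.2)) := by
    intro s t
    rw [← smul_eq_mul, ← map_smul, ← LinearMap.smul_apply, dirOp_comb,
      divided_pow_centered (R := Module.End ℝ SmoothScalar) (dirOp_commute u u'), Finset.sum_sigma, LinearMap.sum_apply, map_sum]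
    refine Finset.sum_congr rfl fun k _ => ?_
    rw [LinearMap.sum_apply, map_sum]
    refine Finset.sum_congr rfl fun a _ => ?_
    rw [LinearMap.smul_apply, map_smul, smul_eq_mul]
    ring
  simp_rw [hpt]
  refine ⟨fun t => by apply Continuous.intervalIntegrable; fun_prop, (integral_simplex S κ _ _).1, ?_⟩
  rw [(integral_simplex S κ _ _).2, fluxCoeff_succ eg hq, Finset.sum_sigma]
  refine Finset.sum_congr rfl fun k hk => Finset.sum_congr rfl fun a ha => ?_
  have ha' : a ≤ m - k := Nat.lt_succ_iff.mp (Finset.mem_range.mp ha)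
  obtain ⟨b, hb⟩ := Nat.exists_eq_add_of_le ha'
  simp only [κ, zassCoeff, hb, Nat.add_sub_cancel_left]
  rw [show a + b + 2 - 2 - a = b by omega, Nat.factorial_succ]
  push_cast
  have := Nat.factorial_ne_zero a
  have := Nat.factorial_ne_zero b
  rw [pow_add (-1 : ℝ) (a + b) 2]
  field_simp

/-- The binomial theorem reduces to mixed derivatives along `u` and `u'`, which are polynomial in
the jet; the exponents are summed to obtain a common one. -/
lemma eval_dirOp_pow_bound (N : ℕ) {S : Set E} (hS : IsCompact S) (h0 : (0 : E) ∉ S) :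
    ∃ C : ℝ, 0 ≤ C ∧ ∃ K : ℕ, ∀ eg : ℝ, |eg| ≤ 1 → ∀ x ∈ S, ∀ u u' : E, ∀ c c' : ℝ, |c| ≤ 1 →
      |c'| ≤ 1 → |SmoothScalar.eval x ((dirOp (c • u + c' • u') ^ N) (betaScalar eg u u'))| ≤
        C * (1 + ‖u‖ + ‖u'‖) ^ K := by
  have hterm : ∀ a ∈ Finset.range (N + 1), ∃ C : ℝ, 0 ≤ C ∧ ∃ K : ℕ, ∀ eg : ℝ, |eg| ≤ 1 → ∀ x ∈ S,
      ∀ u u' : E, |SmoothScalar.eval x ((dirOp u ^ a * dirOp u' ^ (N - a)) (betaScalar eg u u'))| ≤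
        C * (1 + ‖u‖ + ‖u'‖) ^ K := by
    intro a _
    have hrep : JetRep fun eg u u' => (dirDeriv u)^[a] ((dirDeriv u')^[N - a] (betaForm eg u u')) := by
      have := (jetRep_betaForm.dirDeriv_iterate 0 1 (N - a)).dirDeriv_iterate 1 0 a
      simpa using this
    obtain ⟨W, hW⟩ := hrep
    obtain ⟨C, hC, K, h⟩ := jetEval_bound W hS h0
    refine ⟨C, hC, K, fun eg heg x hx u u' => ?_⟩
    have hx0 : x ≠ 0 := fun h => h0 (h ▸ hx)
    have := h eg heg x hx u 0 u' 0
    rw [hW eg x u 0 u' 0 hx0, Complex.norm_real, norm_zero, add_zero, add_zero] at this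
    rw [eval_dirOp_mul eg u u' _ _ hx0]
    exact this
  choose! C hC K h using hterm
  refine ⟨∑ a ∈ Finset.range (N + 1), C a * (N.choose a : ℝ), Finset.sum_nonneg fun a ha =>
    mul_nonneg (hC a ha) (Nat.cast_nonneg _), ∑ a ∈ Finset.range (N + 1), K a,
    fun eg heg x hx u u' c c' hc hc' => ?_⟩
  have hcomm : Commute (c • dirOp u) (c' • dirOp u') :=
    ((dirOp_commute u u').smul_left _).smul_right _
  rw [dirOp_comb, hcomm.add_pow, LinearMap.sum_apply, map_sum, Finset.sum_mul]
  refine (Finset.abs_sum_le_sum_abs _ _).trans (Finset.sum_le_sum fun a ha => ?_)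
  rw [natCast_eq_smul_one (R := Module.End ℝ SmoothScalar) (N.choose a), mul_smul_comm, mul_one, smul_pow, smul_pow, smul_mul_smul_comm, smul_smul,
    LinearMap.smul_apply, map_smul, smul_eq_mul, abs_mul, abs_mul, abs_mul, abs_pow, abs_pow,
    Nat.abs_cast]
  have h1 : (1 : ℝ) ≤ 1 + ‖u‖ + ‖u'‖ := by
    have := norm_nonneg u; have := norm_nonneg u'; linarith
  have h2 : (1 + ‖u‖ + ‖u'‖) ^ K a ≤ (1 + ‖u‖ + ‖u'‖) ^ (∑ a ∈ Finset.range (N + 1), K a) :=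
    pow_le_pow_right₀ h1 (Finset.single_le_sum (fun _ _ => Nat.zero_le _) ha)
  have h3 : |c| ^ a * |c'| ^ (N - a) ≤ 1 :=
    mul_le_one₀ (pow_le_one₀ (abs_nonneg _) hc) (by positivity) (pow_le_one₀ (abs_nonneg _) hc')
  calc _ ≤ (N.choose a : ℝ) * 1 * (C a * (1 + ‖u‖ + ‖u'‖) ^ K a) := by
        gcongr
        exact h a ha eg heg x hx u u'
    _ ≤ (N.choose a : ℝ) * 1 * (C a * (1 + ‖u‖ + ‖u'‖) ^ (∑ a ∈ Finset.range (N + 1), K a)) := by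
        have := hC a ha
        gcongr
    _ = _ := by ring

/-- The three error terms are at most `1/4`, `1/4` and `1/16` of `‖q‖²`. -/
lemma inner_pos_of_near {q x y : E} (hq : q ≠ 0) (hx : ‖x - q‖ ≤ ‖q‖ / 4) (hy : ‖y - q‖ ≤ ‖q‖ / 4) :
    0 < inner ℝ x y := by
  have hq' : 0 < ‖q‖ := norm_pos_iff.mpr hq
  have e : inner ℝ x y = ‖q‖ ^ 2 + inner ℝ q (y - q) + inner ℝ (x - q) q +
      inner ℝ (x - q) (y - q) := by
    rw [← real_inner_self_eq_norm_sq]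
    simp only [inner_sub_left, inner_sub_right]
    ring
  have h1 := neg_le_of_abs_le (abs_real_inner_le_norm q (y - q))
  have h2 := neg_le_of_abs_le (abs_real_inner_le_norm (x - q) q)
  have h3 := neg_le_of_abs_le (abs_real_inner_le_norm (x - q) (y - q))
  have h4 : ‖q‖ * ‖y - q‖ ≤ ‖q‖ * (‖q‖ / 4) := by gcongr
  have h5 : ‖x - q‖ * ‖q‖ ≤ ‖q‖ / 4 * ‖q‖ := by gcongr
  have h6 : ‖x - q‖ * ‖y - q‖ ≤ ‖q‖ / 4 * (‖q‖ / 4) := by gcongr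
  have h7 : 0 < ‖q‖ ^ 2 := by positivity
  rw [e]
  nlinarith

lemma norm_centered_le {ħ : ℝ} (hħ : 0 ≤ ħ) {s t r : ℝ} (hs : s ∈ Set.Icc (0 : ℝ) 1)
    (ht : t ∈ Set.Icc (0 : ℝ) 1) {u u' : E} (h : ħ * (‖u‖ + ‖u'‖) ≤ r) :
    ‖ħ • ((1 / 2 - s) • u + (1 / 2 - t) • u')‖ ≤ r / 2 := by
  have h1 : |1 / 2 - s| ≤ 1 / 2 := abs_le.mpr ⟨by linarith [hs.2], by linarith [hs.1]⟩
  have h2 : |1 / 2 - t| ≤ 1 / 2 := abs_le.mpr ⟨by linarith [ht.2], by linarith [ht.1]⟩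
  rw [norm_smul, Real.norm_eq_abs, abs_of_nonneg hħ]
  calc ħ * ‖(1 / 2 - s) • u + (1 / 2 - t) • u'‖
      ≤ ħ * (1 / 2 * ‖u‖ + 1 / 2 * ‖u'‖) := by
        gcongr
        refine (norm_add_le _ _).trans ?_
        rw [norm_smul, norm_smul]
        exact add_le_add (by gcongr; exact h1) (by gcongr; exact h2)
    _ ≤ r / 2 := by linarith

/-- Bilinearity gives `ħ²`; one factor turns the charge `1/2` into `ħ/2`. -/
lemma betaForm_smul (ħ : ℝ) (u u' x : E) :
    betaForm (1 / 2) (ħ • u) (ħ • u') x = ħ * betaForm (ħ / 2) u u' x := by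
  rw [betaForm_eq, betaForm_eq]
  simp [det3]
  ring

lemma intervalIntegrable_sum {ι : Type*} (S : Finset ι) {f : ι → ℝ → ℝ} {a b : ℝ}
    (h : ∀ i ∈ S, IntervalIntegrable (f i) volume a b) :
    IntervalIntegrable (fun t => ∑ i ∈ S, f i t) volume a b := by
  have : (fun t => ∑ i ∈ S, f i t) = ∑ i ∈ S, f i := by
    funext t; simp
  rw [this]
  exact IntervalIntegrable.sum S h

/-- Expansion of the phase of a small triangle. -/
lemma triPhase_expansion {q : E} (hq : q ≠ 0) (N : ℕ) : ∃ C : ℝ, 0 ≤ C ∧ ∃ K : ℕ, ∀ ħ : ℝ, 0 < ħ →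
    ħ ≤ 1 → ∀ u u' : E, ħ * (‖u‖ + ‖u'‖) ≤ ‖q‖ / 2 → ∃ θ : ℝ,
      triPhase (q - (ħ / 2) • (u + u')) (q + (ħ / 2) • (u - u')) (q + (ħ / 2) • (u + u')) =
        Complex.exp (-(θ : ℂ) * Complex.I) ∧
      |θ - ∑ n ∈ Finset.range N, ħ ^ (n + 1) * fluxCoeff (ħ / 2) q u u' (n + 1)| ≤
        C * ħ ^ (N + 1) * (1 + ‖u‖ + ‖u'‖) ^ K := by
  have hq' : 0 < ‖q‖ := norm_pos_iff.mpr hq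
  -- The smallness condition keeps the whole triangle in this ball, where inner products are
  -- positive and derivatives of `β` are bounded.
  have hS0 : (0 : E) ∉ Metric.closedBall q (‖q‖ / 4) := by
    rw [Metric.mem_closedBall, dist_zero_left]; linarith
  obtain ⟨C, hC, K, hbound⟩ := eval_dirOp_pow_bound N (isCompact_closedBall q (‖q‖ / 4)) hS0
  refine ⟨C, hC, K, fun ħ h0 h1 u u' hsmall => ?_⟩
  set x := q + (ħ / 2) • (u + u') with hx
  have hpt : ∀ s t : ℝ, x - t • (ħ • u') - s • (ħ • u) =
      q + ħ • ((1 / 2 - s) • u + (1 / 2 - t) • u') := fun s t => by rw [hx]; module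
  have hnear : ∀ s ∈ Set.Icc (0 : ℝ) 1, ∀ t ∈ Set.Icc (0 : ℝ) 1,
      ‖x - t • (ħ • u') - s • (ħ • u) - q‖ ≤ ‖q‖ / 4 := fun s hs t ht => by
    rw [hpt, add_sub_cancel_left]
    exact (norm_centered_le h0.le hs ht hsmall).trans (by linarith)
  obtain ⟨hIntg, htri⟩ := triPhase_eq_flux (x := x) (a := ħ • u) (a' := ħ • u')
    fun s hs t ht s' hs' t' ht' => inner_pos_of_near hq (hnear s hs t ht) (hnear s' hs' t' ht')
  refine ⟨∫ t in (0 : ℝ)..1, ∫ s in (0 : ℝ)..t,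
      betaForm (1 / 2) (ħ • u) (ħ • u') (x - t • (ħ • u') - s • (ħ • u)), ?_, ?_⟩
  · rw [← htri]
    congr 1 <;> rw [hx] <;> module
  have hval : ∀ s t : ℝ, betaForm (1 / 2) (ħ • u) (ħ • u') (x - t • (ħ • u') - s • (ħ • u)) =
      ħ * SmoothScalar.eval (q + ħ • ((1 / 2 - s) • u + (1 / 2 - t) • u'))
        (betaScalar (ħ / 2) u u') := fun s t => by
    rw [betaForm_smul, hpt]; rfl
  simp_rw [hval] at hIntg ⊢
  set y : ℝ → ℝ → E := fun s t => (1 / 2 - s) • u + (1 / 2 - t) • u' with hy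
  set B := betaScalar (ħ / 2) u u'
  -- Taylor's formula in `σ ∈ [0, ħ]` along the ray from `q` in the direction `y s t`; all
  -- coefficients of `u`, `u'` have modulus at most `1`.
  have hrem : ∀ s ∈ Set.Icc (0 : ℝ) 1, ∀ t ∈ Set.Icc (0 : ℝ) 1,
      |SmoothScalar.eval (q + ħ • y s t) B - ∑ k ∈ Finset.range N, ħ ^ k *
        ((k.factorial : ℝ)⁻¹ * SmoothScalar.eval q ((dirOp (y s t) ^ k) B))| ≤
        C * (1 + ‖u‖ + ‖u'‖) ^ K * ħ ^ N := by
    intro s hs t ht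
    have hball : ∀ σ ∈ Set.Icc 0 ħ, q + σ • y s t ∈ Metric.closedBall q (‖q‖ / 4) := by
      intro σ hσ
      rw [Metric.mem_closedBall, dist_eq_norm, add_sub_cancel_left]
      have : σ * (‖u‖ + ‖u'‖) ≤ ‖q‖ / 2 := le_trans (by gcongr; exact hσ.2) hsmall
      exact (norm_centered_le hσ.1 hs ht this).trans (by linarith)
    have := taylor_bound (T := ħ) N
      (fun k σ => SmoothScalar.eval (q + σ • y s t) ((dirOp (y s t) ^ k) B))
      (C * (1 + ‖u‖ + ‖u'‖) ^ K)
      (fun k σ hσ => hasDerivAt_eval_dirOp_pow _ _ _ _ fun h => hS0 (h ▸ hball σ hσ))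
      (fun σ hσ => hbound (ħ / 2) (abs_le.mpr ⟨by linarith, by linarith⟩) _ (hball σ hσ) u u' _ _
        (abs_le.mpr ⟨by linarith [hs.2], by linarith [hs.1]⟩)
        (abs_le.mpr ⟨by linarith [ht.2], by linarith [ht.1]⟩)) ħ ⟨h0.le, le_rfl⟩
    simp only [pow_zero, Module.End.one_apply, zero_smul, add_zero] at this
    simpa only [div_eq_mul_inv, mul_assoc] using this
  have hterm := fun k => integral_taylor_term (ħ / 2) hq u u' k
  have hinner : ∀ t ∈ Set.Icc (0 : ℝ) 1, IntervalIntegrable (fun s : ℝ =>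
      ħ * SmoothScalar.eval (q + ħ • y s t) B) volume 0 t := by
    intro t ht
    refine ContinuousOn.intervalIntegrable fun s hs => ContinuousAt.continuousWithinAt ?_
    rw [Set.uIcc_of_le ht.1] at hs
    have hne : q + ħ • y s t ≠ 0 := fun h => hS0 <| by
      rw [← h, Metric.mem_closedBall, dist_eq_norm, ← hpt]
      exact hnear s ⟨hs.1, hs.2.trans ht.2⟩ t ht
    have h1 : ContinuousAt (B : E → ℝ) (q + ħ • y s t) :=
      (SmoothScalar.differentiableAt B hne).continuousAt
    have h2 : ContinuousAt (fun s : ℝ => q + ħ • y s t) s := by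
      simp only [hy]; fun_prop
    exact continuousAt_const.mul (ContinuousAt.comp (g := (B : E → ℝ)) h1 h2)
  have hsum : ∑ n ∈ Finset.range N, ħ ^ (n + 1) * fluxCoeff (ħ / 2) q u u' (n + 1) =
      ∫ t in (0 : ℝ)..1, ∫ s in (0 : ℝ)..t, ∑ k ∈ Finset.range N, ħ ^ (k + 1) *
        ((k.factorial : ℝ)⁻¹ * SmoothScalar.eval q ((dirOp (y s t) ^ k) B)) := by
    have h2 : ∀ t : ℝ, ∫ s in (0 : ℝ)..t, ∑ k ∈ Finset.range N, ħ ^ (k + 1) *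
        ((k.factorial : ℝ)⁻¹ * SmoothScalar.eval q ((dirOp (y s t) ^ k) B)) =
        ∑ k ∈ Finset.range N, ħ ^ (k + 1) * ∫ s in (0 : ℝ)..t,
        ((k.factorial : ℝ)⁻¹ * SmoothScalar.eval q ((dirOp (y s t) ^ k) B)) := fun t => by
      rw [intervalIntegral.integral_finsetSum fun k _ => ((hterm k).1 t).const_mul _]
      exact Finset.sum_congr rfl fun k _ => intervalIntegral.integral_const_mul _ _
    simp_rw [h2]
    rw [intervalIntegral.integral_finsetSum fun k _ => (hterm k).2.1.const_mul _]
    refine Finset.sum_congr rfl fun k _ => ?_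
    rw [intervalIntegral.integral_const_mul, (hterm k).2.2]
  have hsumint : IntervalIntegrable (fun t : ℝ => ∫ s in (0 : ℝ)..t, ∑ k ∈ Finset.range N,
      ħ ^ (k + 1) * ((k.factorial : ℝ)⁻¹ * SmoothScalar.eval q ((dirOp (y s t) ^ k) B)))
      volume 0 1 := by
    have h2 : ∀ t : ℝ, ∫ s in (0 : ℝ)..t, ∑ k ∈ Finset.range N, ħ ^ (k + 1) *
        ((k.factorial : ℝ)⁻¹ * SmoothScalar.eval q ((dirOp (y s t) ^ k) B)) =
        ∑ k ∈ Finset.range N, ħ ^ (k + 1) * ∫ s in (0 : ℝ)..t,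
        ((k.factorial : ℝ)⁻¹ * SmoothScalar.eval q ((dirOp (y s t) ^ k) B)) := fun t => by
      rw [intervalIntegral.integral_finsetSum fun k _ => ((hterm k).1 t).const_mul _]
      exact Finset.sum_congr rfl fun k _ => intervalIntegral.integral_const_mul _ _
    simp_rw [h2]
    exact intervalIntegrable_sum _ fun k _ => (hterm k).2.1.const_mul _
  rw [hsum, ← intervalIntegral.integral_sub hIntg hsumint]
  have hA : 0 ≤ C * (1 + ‖u‖ + ‖u'‖) ^ K := by positivity
  have hb := intervalIntegral.norm_integral_le_of_norm_le_const (a := (0 : ℝ)) (b := 1)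
    (f := fun t => (∫ s in (0 : ℝ)..t, ħ * SmoothScalar.eval (q + ħ • y s t) B) -
      ∫ s in (0 : ℝ)..t, ∑ k ∈ Finset.range N, ħ ^ (k + 1) *
        ((k.factorial : ℝ)⁻¹ * SmoothScalar.eval q ((dirOp (y s t) ^ k) B)))
    (C := ħ * (C * (1 + ‖u‖ + ‖u'‖) ^ K * ħ ^ N)) (fun t ht => by
      rw [Set.uIoc_of_le zero_le_one] at ht
      have ht' : t ∈ Set.Icc (0 : ℝ) 1 := ⟨ht.1.le, ht.2⟩
      rw [← intervalIntegral.integral_sub (hinner t ht')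
        (intervalIntegrable_sum _ fun k _ => ((hterm k).1 t).const_mul _)]
      have hb := intervalIntegral.norm_integral_le_of_norm_le_const (a := (0 : ℝ)) (b := t)
        (f := fun s => ħ * SmoothScalar.eval (q + ħ • y s t) B - ∑ k ∈ Finset.range N, ħ ^ (k + 1) *
          ((k.factorial : ℝ)⁻¹ * SmoothScalar.eval q ((dirOp (y s t) ^ k) B)))
        (C := ħ * (C * (1 + ‖u‖ + ‖u'‖) ^ K * ħ ^ N)) (fun s hs => by
          rw [Set.uIoc_of_le ht.1.le] at hs
          have := hrem s ⟨hs.1.le, hs.2.trans ht.2⟩ t ht'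
          have e : ħ * SmoothScalar.eval (q + ħ • y s t) B - ∑ k ∈ Finset.range N, ħ ^ (k + 1) *
              ((k.factorial : ℝ)⁻¹ * SmoothScalar.eval q ((dirOp (y s t) ^ k) B)) =
              ħ * (SmoothScalar.eval (q + ħ • y s t) B - ∑ k ∈ Finset.range N, ħ ^ k *
              ((k.factorial : ℝ)⁻¹ * SmoothScalar.eval q ((dirOp (y s t) ^ k) B))) := by
            rw [mul_sub, Finset.mul_sum]
            congr 1
            exact Finset.sum_congr rfl fun k _ => by ring
          rw [e, norm_mul, Real.norm_eq_abs, abs_of_pos h0, Real.norm_eq_abs]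
          gcongr)
      refine hb.trans ?_
      rw [sub_zero, abs_of_pos ht.1]
      exact mul_le_of_le_one_right (by positivity) ht.2)
  rw [Real.norm_eq_abs] at hb
  refine hb.trans (le_of_eq ?_)
  rw [sub_zero, abs_one]
  ring

/-! ### Expansion of the multiplier -/

/-- The multiplier of the product of two Weyl operators. -/
def multiplier (ħ : ℝ) (q u v u' v' : E) : ℂ :=
  triPhase (q - (ħ / 2) • (u + u')) (q + (ħ / 2) • (u - u')) (q + (ħ / 2) • (u + u')) *
    Complex.exp (((ħ / 2 * (inner ℝ u v' - inner ℝ v u') : ℝ) : ℂ) * Complex.I)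

lemma norm_exp_ofReal_mul_I_sub_le (x y : ℝ) :
    ‖Complex.exp (x * Complex.I) - Complex.exp (y * Complex.I)‖ ≤ |x - y| := by
  have h : Complex.exp (x * Complex.I) - Complex.exp (y * Complex.I) =
      Complex.exp (y * Complex.I) * (Complex.exp (Complex.I * ((x - y : ℝ) : ℂ)) - 1) := by
    rw [mul_sub, ← Complex.exp_add, mul_one]
    congr 2
    push_cast
    ring
  rw [h, norm_mul, Complex.norm_exp_ofReal_mul_I, one_mul]
  exact Real.norm_exp_I_mul_ofReal_sub_one_le

/-- Valid for all real `x`: for `|x| ≥ 1` the exponential and every Taylor term are separately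
dominated by `|x|^n`. -/
lemma norm_exp_sub_taylor_le (x : ℝ) (n : ℕ) :
    ‖Complex.exp (x * Complex.I) - ∑ k ∈ Finset.range n, (x * Complex.I) ^ k / k.factorial‖ ≤
      (3 + n) * |x| ^ n := by
  have hx : ‖(x : ℂ) * Complex.I‖ = |x| := by simp
  rcases le_total |x| 1 with h | h
  · refine (Complex.norm_exp_sub_sum_le_norm_mul_exp _ n).trans ?_
    rw [hx, mul_comm]
    have : Real.exp |x| ≤ 3 :=
      (Real.exp_le_exp.mpr h).trans (Real.exp_one_lt_d9.le.trans (by norm_num))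
    have hn : (0 : ℝ) ≤ n := Nat.cast_nonneg n
    gcongr
    linarith
  · have h1 : (1 : ℝ) ≤ |x| ^ n := one_le_pow₀ h
    have h2 : ‖∑ k ∈ Finset.range n, ((x : ℂ) * Complex.I) ^ k / k.factorial‖ ≤ n * |x| ^ n := by
      have hs : ∑ _k ∈ Finset.range n, |x| ^ n = n * |x| ^ n := by simp
      rw [← hs]
      refine norm_sum_le_of_le _ fun k hk => ?_
      rw [norm_div, norm_pow, hx, Complex.norm_natCast]
      have h3 : (1 : ℝ) ≤ k.factorial := by exact_mod_cast Nat.succ_le_of_lt (Nat.factorial_pos k)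
      calc |x| ^ k / k.factorial ≤ |x| ^ k := div_le_self (by positivity) h3
        _ ≤ |x| ^ n := pow_le_pow_right₀ h (Finset.mem_range.mp hk).le
    refine (norm_sub_le _ _).trans ?_
    rw [Complex.norm_exp_ofReal_mul_I]
    linarith

lemma coeff_pow_eq_zero {S : PowerSeries ℂ} (h : PowerSeries.coeff 0 S = 0) {n k : ℕ}
    (hk : n < k) : PowerSeries.coeff n (S ^ k) = 0 := by
  have h1 : PowerSeries.X ∣ S := by
    rw [PowerSeries.X_dvd_iff, ← PowerSeries.coeff_zero_eq_constantCoeff_apply, h]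
  exact PowerSeries.X_pow_dvd_iff.mp (pow_dvd_pow_of_dvd h1 k) n hk

/-- Powers beyond the degree do not contribute, so the cut-off may be raised to a common `N`. -/
lemma coeff_formalExp_eq {S : PowerSeries ℂ} (h : PowerSeries.coeff 0 S = 0) {n N : ℕ}
    (hn : n ≤ N) : PowerSeries.coeff n (formalExp S) = ∑ k ∈ Finset.range (N + 1),
      ((Nat.factorial k : ℂ)⁻¹) * PowerSeries.coeff n (S ^ k) := by
  rw [formalExp, PowerSeries.coeff_mk]
  refine Finset.sum_subset (Finset.range_mono (by omega)) fun k _ hk => ?_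
  rw [coeff_pow_eq_zero h (by simpa using hk), mul_zero]

/-- The truncated exponential of the exponent, as a polynomial in `ħ`. -/
def truncExp (N : ℕ) : Polynomial (SymbolPoly JetPoly) :=
  ∑ k ∈ Finset.range (N + 1),
    Polynomial.C (MvPolynomial.C (MvPolynomial.C ((Nat.factorial k : ℂ)⁻¹))) *
      (PowerSeries.trunc (N + 1) (PowerSeries.mk exponentPoly)) ^ k

lemma map_trunc_exponent (N : ℕ) (eg : ℝ) {q : E} (u v u' v' : E) (hq : q ≠ 0) :
    (PowerSeries.trunc (N + 1) (PowerSeries.mk exponentPoly)).map (jetEval eg q u v u' v') =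
      PowerSeries.trunc (N + 1) (multiplierExponent zassCoeff eg q u v u' v') := by
  rw [← PowerSeries.trunc_map]
  congr 1
  ext n
  rw [PowerSeries.coeff_map, PowerSeries.coeff_mk, jetEval_exponentPoly n eg u v u' v' hq]

lemma map_truncExp (N : ℕ) (eg : ℝ) {q : E} (u v u' v' : E) (hq : q ≠ 0) :
    (truncExp N).map (jetEval eg q u v u' v') = ∑ k ∈ Finset.range (N + 1),
      Polynomial.C ((Nat.factorial k : ℂ)⁻¹) *
        (PowerSeries.trunc (N + 1) (multiplierExponent zassCoeff eg q u v u' v')) ^ k := by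
  rw [truncExp, Polynomial.map_sum]
  refine Finset.sum_congr rfl fun k _ => ?_
  rw [Polynomial.map_mul, Polynomial.map_pow, map_trunc_exponent N eg u v u' v' hq,
    Polynomial.map_C, jetEval_const]

/-- Truncating the exponent at degree `N` does not affect coefficients up to `N` of its powers. -/
lemma jetEval_coeff_truncExp {n N : ℕ} (hn : n ≤ N) (eg : ℝ) {q : E} (u v u' v' : E) (hq : q ≠ 0) :
    jetEval eg q u v u' v' ((truncExp N).coeff n) =
      jetEval eg q u v u' v' (multiplierPoly n) := by
  rw [← evalSymbol_evalJet eg q u v u' v' (multiplierPoly n),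
    evalSymbol_multiplierPoly eg n u v u' v' hq, multiplierSeries,
    coeff_formalExp_eq (coeff_zero_multiplierExponent eg q u v u' v') hn, ← Polynomial.coeff_map,
    map_truncExp N eg u v u' v' hq, Polynomial.finsetSum_coeff]
  refine Finset.sum_congr rfl fun k _ => ?_
  rw [Polynomial.coeff_C_mul]
  congr 1
  have h := PowerSeries.trunc_trunc_pow (multiplierExponent zassCoeff eg q u v u' v') (N + 1) k
  have h1 := congrArg (fun p => Polynomial.coeff p n) h
  simp only [PowerSeries.coeff_trunc, if_pos (Nat.lt_succ_of_le hn)] at h1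
  rw [← h1, ← Polynomial.coe_pow, Polynomial.coeff_coe]

/-- The value is `i` times a real number, so its exponential can be compared with the multiplier by
Lipschitz estimates. For `N = 0` the truncation drops even the symplectic term. -/
lemma eval_trunc_exponent (N : ℕ) (ħ eg : ℝ) (q u v u' v' : E) :
    (PowerSeries.trunc (N + 1) (multiplierExponent zassCoeff eg q u v u' v')).eval (ħ : ℂ) =
      ((-(∑ n ∈ Finset.range N, ħ ^ (n + 1) * fluxCoeff eg q u u' (n + 1)) +
        (if N = 0 then 0 else ħ / 2 * (inner ℝ u v' - inner ℝ v u')) : ℝ) : ℂ) * Complex.I := by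
  change Polynomial.eval₂ (RingHom.id ℂ) _ _ = _
  rw [PowerSeries.eval₂_trunc_eq_sum_range, Finset.sum_range_succ']
  simp only [RingHom.id_apply]
  rw [coeff_zero_multiplierExponent, zero_mul, add_zero]
  have hc : ∀ n, PowerSeries.coeff (n + 1) (multiplierExponent zassCoeff eg q u v u' v') *
      (ħ : ℂ) ^ (n + 1) = -((ħ ^ (n + 1) * fluxCoeff eg q u u' (n + 1) : ℝ) : ℂ) * Complex.I +
      if n = 0 then ((ħ / 2 * (inner ℝ u v' - inner ℝ v u') : ℝ) : ℂ) * Complex.I else 0 := by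
    intro n
    rw [multiplierExponent, PowerSeries.coeff_mk]
    change (-Complex.I * ((fluxCoeff eg q u u' (n + 1) : ℝ) : ℂ) + _) * _ = _
    by_cases hn : n = 0
    · subst hn
      simp only [zero_add, if_true]
      push_cast
      ring
    · rw [if_neg (by omega), if_neg hn]
      push_cast
      ring
  rw [Finset.sum_congr rfl fun n _ => hc n, Finset.sum_add_distrib, Finset.sum_ite_eq',
    ← Finset.sum_mul]
  rcases N with _ | N
  · simp
  · simp only [Finset.mem_range, Nat.zero_lt_succ, if_true, Nat.succ_ne_zero, if_false]
    push_cast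
    rw [Finset.sum_neg_distrib]
    ring

lemma jetEval_bound_family (W : ℕ → SymbolPoly JetPoly) (M : ℕ) {q : E} (hq : q ≠ 0) :
    ∃ C : ℝ, 0 ≤ C ∧ ∃ K : ℕ, ∀ n < M, ∀ eg : ℝ, |eg| ≤ 1 → ∀ u v u' v' : E,
      ‖jetEval eg q u v u' v' (W n)‖ ≤ C * (1 + ‖u‖ + ‖v‖ + ‖u'‖ + ‖v'‖) ^ K := by
  choose C hC K h using fun n => jetEval_bound (W n) (isCompact_singleton (x := q))
    (fun h => hq (Set.mem_singleton_iff.mp h).symm)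
  refine ⟨∑ n ∈ Finset.range M, C n, Finset.sum_nonneg fun n _ => hC n,
    ∑ n ∈ Finset.range M, K n, fun n hn eg heg u v u' v' => ?_⟩
  refine (h n eg heg q rfl u v u' v').trans ?_
  have h1 : 1 ≤ 1 + ‖u‖ + ‖v‖ + ‖u'‖ + ‖v'‖ := by
    have := norm_nonneg u; have := norm_nonneg v
    have := norm_nonneg u'; have := norm_nonneg v'
    linarith
  have h2 := Finset.single_le_sum (f := C) (fun i _ => hC i) (Finset.mem_range.mpr hn)
  have h3 := Finset.single_le_sum (f := K) (fun i _ => Nat.zero_le _) (Finset.mem_range.mpr hn)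
  exact mul_le_mul h2 (pow_le_pow_right₀ h1 h3) (by positivity) ((hC n).trans h2)

lemma norm_sum_pow_mul_le {ħ : ℝ} (h0 : 0 < ħ) (h1 : ħ ≤ 1) (M m : ℕ) {c : ℕ → ℂ} {A : ℝ}
    (hA : 0 ≤ A) (hc : ∀ n < M, ‖c n‖ ≤ A) :
    ‖∑ n ∈ Finset.range M, (ħ : ℂ) ^ (n + m) * c n‖ ≤ M * (A * ħ ^ m) := by
  have hs : ∑ _k ∈ Finset.range M, A * ħ ^ m = M * (A * ħ ^ m) := by simp
  rw [← hs]
  refine norm_sum_le_of_le _ fun n hn => ?_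
  rw [norm_mul, norm_pow, Complex.norm_real, Real.norm_eq_abs, abs_of_pos h0, mul_comm]
  exact mul_le_mul (hc n (Finset.mem_range.mp hn)) (pow_le_pow_of_le_one h0.le h1 (by omega))
    (by positivity) hA

/-- The multiplier agrees with its formal expansion up to order `N`, with a remainder of
polynomial growth. -/
theorem multiplier_expansion {q : E} (hq : q ≠ 0) (N : ℕ) : ∃ C : ℝ, 0 ≤ C ∧ ∃ K : ℕ,
    ∀ ħ : ℝ, 0 < ħ → ħ ≤ 1 → ∀ u v u' v' : E,
      ‖multiplier ħ q u v u' v' - ∑ n ∈ Finset.range (N + 1),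
        (ħ : ℂ) ^ n * jetEval (ħ / 2) q u v u' v' (multiplierPoly n)‖ ≤
      C * ħ ^ (N + 1) * (1 + ‖u‖ + ‖v‖ + ‖u'‖ + ‖v'‖) ^ K := by
  have hq' : 0 < ‖q‖ := norm_pos_iff.mpr hq
  obtain ⟨C₁, c₁, K₁, h₁⟩ := triPhase_expansion hq N
  obtain ⟨C₂, c₂, K₂, h₂⟩ := jetEval_bound_family exponentPoly (N + 1) hq
  obtain ⟨C₃, c₃, K₃, h₃⟩ := jetEval_bound_family multiplierPoly (N + 1) hq
  set D := (truncExp N).natDegree + 1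
  obtain ⟨C₄, c₄, K₄, h₄⟩ := jetEval_bound_family (fun n => (truncExp N).coeff (n + (N + 1))) D hq
  -- The summands belong, in order, to the Taylor remainder of the flux, the symplectic phase lost
  -- when `N = 0`, the remainder of the exponential series, the powers of `ħ` above `N` in
  -- `truncExp`, and the regime of large frequencies.
  refine ⟨C₁ + 1 + (3 + (N + 1 : ℕ)) * (N * C₂) ^ (N + 1) + D * C₄ +
    (1 + (N + 1 : ℕ) * C₃) * (2 / ‖q‖) ^ (N + 1), by positivity,
    K₁ + 2 + K₂ * (N + 1) + K₄ + (K₃ + (N + 1)), fun ħ h0 h1 u v u' v' => ?_⟩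
  set B := 1 + ‖u‖ + ‖v‖ + ‖u'‖ + ‖v'‖ with hB
  have nu := norm_nonneg u
  have nv := norm_nonneg v
  have nu' := norm_nonneg u'
  have nv' := norm_nonneg v'
  have hB1 : 1 ≤ B := by linarith
  have hB0 : 0 ≤ B := by linarith
  have heg : |ħ / 2| ≤ 1 := abs_le.mpr ⟨by linarith, by linarith⟩
  set K := K₁ + 2 + K₂ * (N + 1) + K₄ + (K₃ + (N + 1)) with hK
  have hBK : ∀ k ≤ K, B ^ k ≤ B ^ K := fun k hk => pow_le_pow_right₀ hB1 hk
  have t₁ : 0 ≤ C₁ * ħ ^ (N + 1) * B ^ K := by positivity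
  have t₂ : 0 ≤ 1 * ħ ^ (N + 1) * B ^ K := by positivity
  have t₃ : 0 ≤ (3 + (N + 1 : ℕ)) * (N * C₂) ^ (N + 1) * ħ ^ (N + 1) * B ^ K := by positivity
  have t₄ : 0 ≤ D * C₄ * ħ ^ (N + 1) * B ^ K := by positivity
  have t₅ : 0 ≤ (1 + (N + 1 : ℕ) * C₃) * (2 / ‖q‖) ^ (N + 1) * ħ ^ (N + 1) * B ^ K := by positivity
  have hsplit : (C₁ + 1 + (3 + (N + 1 : ℕ)) * (N * C₂) ^ (N + 1) + D * C₄ +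
      (1 + (N + 1 : ℕ) * C₃) * (2 / ‖q‖) ^ (N + 1)) * ħ ^ (N + 1) * B ^ K =
      C₁ * ħ ^ (N + 1) * B ^ K + 1 * ħ ^ (N + 1) * B ^ K +
      (3 + (N + 1 : ℕ)) * (N * C₂) ^ (N + 1) * ħ ^ (N + 1) * B ^ K + D * C₄ * ħ ^ (N + 1) * B ^ K +
      (1 + (N + 1 : ℕ) * C₃) * (2 / ‖q‖) ^ (N + 1) * ħ ^ (N + 1) * B ^ K := by ring
  rw [hsplit]
  rcases le_or_gt (ħ * (‖u‖ + ‖u'‖)) (‖q‖ / 2) with hs | hl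
  · obtain ⟨θ, htri, hθ⟩ := h₁ ħ h0 h1 u u' hs
    -- `x` is the exact phase of the multiplier and `y` its truncation.
    set x : ℝ := -θ + ħ / 2 * (inner ℝ u v' - inner ℝ v u') with hx
    set y : ℝ := -(∑ n ∈ Finset.range N, ħ ^ (n + 1) * fluxCoeff (ħ / 2) q u u' (n + 1)) +
        (if N = 0 then 0 else ħ / 2 * (inner ℝ u v' - inner ℝ v u')) with hy
    have hM : multiplier ħ q u v u' v' = Complex.exp (x * Complex.I) := by
      rw [multiplier, htri, ← Complex.exp_add, hx]
      congr 1
      push_cast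
      ring
    have hyI := eval_trunc_exponent N ħ (ħ / 2) q u v u' v'
    rw [← hy] at hyI
    have hin : |ħ / 2 * (inner ℝ u v' - inner ℝ v u')| ≤ ħ * B ^ 2 := by
      have e1 := abs_real_inner_le_norm u v'
      have e2 := abs_real_inner_le_norm v u'
      have e3 : |inner ℝ u v' - inner ℝ v u'| ≤ ‖u‖ * ‖v'‖ + ‖v‖ * ‖u'‖ :=
        (abs_sub _ _).trans (add_le_add e1 e2)
      have e4 : ‖u‖ * ‖v'‖ ≤ B * B := mul_le_mul (by linarith) (by linarith) nv' hB0
      have e5 : ‖v‖ * ‖u'‖ ≤ B * B := mul_le_mul (by linarith) (by linarith) nu' hB0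
      rw [abs_mul, abs_of_pos (by positivity : 0 < ħ / 2)]
      calc ħ / 2 * |inner ℝ u v' - inner ℝ v u'| ≤ ħ / 2 * (B * B + B * B) := by
            gcongr; linarith
        _ = ħ * B ^ 2 := by ring
    have hxy : |x - y| ≤ C₁ * ħ ^ (N + 1) * B ^ K + 1 * ħ ^ (N + 1) * B ^ K := by
      have e : x - y = -(θ - ∑ n ∈ Finset.range N, ħ ^ (n + 1) *
          fluxCoeff (ħ / 2) q u u' (n + 1)) +
          (if N = 0 then ħ / 2 * (inner ℝ u v' - inner ℝ v u') else 0) := by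
        rw [hx, hy]; split_ifs <;> ring
      rw [e]
      refine (abs_add_le _ _).trans (add_le_add ?_ ?_)
      · rw [abs_neg]
        refine hθ.trans ?_
        gcongr
        exact (pow_le_pow_left₀ (by positivity) (by linarith) K₁).trans (hBK K₁ (by omega))
      · split_ifs with hN
        · subst hN
          refine hin.trans ?_
          rw [one_mul, zero_add, pow_one]
          exact mul_le_mul_of_nonneg_left (hBK 2 (by omega)) h0.le
        · rw [abs_zero]; positivity
    have hysize : |y| ≤ N * C₂ * ħ * B ^ K₂ := by
      have : ‖(y : ℂ) * Complex.I‖ = |y| := by simp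
      rw [← this, ← hyI]
      change ‖Polynomial.eval₂ (RingHom.id ℂ) _ _‖ ≤ _
      rw [PowerSeries.eval₂_trunc_eq_sum_range, Finset.sum_range_succ']
      simp only [RingHom.id_apply]
      rw [coeff_zero_multiplierExponent, zero_mul, add_zero]
      have hb := norm_sum_pow_mul_le h0 h1 N 1 (A := C₂ * B ^ K₂) (by positivity)
        (c := fun n => PowerSeries.coeff (n + 1) (multiplierExponent zassCoeff (ħ / 2) q u v u' v'))
        (fun n hn => by
          rw [← jetEval_exponentPoly _ _ u v u' v' hq]
          exact h₂ (n + 1) (by omega) _ heg u v u' v')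
      simp only [mul_comm ((ħ : ℂ) ^ (_ + 1))] at hb
      refine hb.trans (le_of_eq ?_)
      ring
    have htay := norm_exp_sub_taylor_le y (N + 1)
    have htay' : (3 + (N + 1 : ℕ)) * |y| ^ (N + 1) ≤
        (3 + (N + 1 : ℕ)) * (N * C₂) ^ (N + 1) * ħ ^ (N + 1) * B ^ K := by
      calc (3 + ((N + 1 : ℕ) : ℝ)) * |y| ^ (N + 1)
          ≤ (3 + (N + 1 : ℕ)) * (N * C₂ * ħ * B ^ K₂) ^ (N + 1) := by gcongr
        _ = (3 + (N + 1 : ℕ)) * (N * C₂) ^ (N + 1) * ħ ^ (N + 1) * B ^ (K₂ * (N + 1)) := by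
          rw [mul_pow, mul_pow, ← pow_mul]; ring
        _ ≤ _ := by
          exact mul_le_mul_of_nonneg_left (hBK (K₂ * (N + 1)) (by omega)) (by positivity)
    have hpoly : ∑ k ∈ Finset.range (N + 1), ((y : ℂ) * Complex.I) ^ k / k.factorial =
        ∑ n ∈ Finset.range (N + 1), (ħ : ℂ) ^ n * jetEval (ħ / 2) q u v u' v' (multiplierPoly n) +
        ∑ n ∈ Finset.range D, (ħ : ℂ) ^ (n + (N + 1)) *
          jetEval (ħ / 2) q u v u' v' ((truncExp N).coeff (n + (N + 1))) := by
      have e1 : ∑ k ∈ Finset.range (N + 1), ((y : ℂ) * Complex.I) ^ k / k.factorial =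
          ((truncExp N).map (jetEval (ħ / 2) q u v u' v')).eval (ħ : ℂ) := by
        rw [map_truncExp N _ u v u' v' hq, Polynomial.eval_finsetSum]
        refine Finset.sum_congr rfl fun k _ => ?_
        rw [Polynomial.eval_mul, Polynomial.eval_C, Polynomial.eval_pow, hyI]
        ring
      rw [e1, Polynomial.eval_eq_sum_range' (n := N + 1 + D), Finset.sum_range_add]
      · congr 1
        · refine Finset.sum_congr rfl fun n hn => ?_
          rw [Polynomial.coeff_map, jetEval_coeff_truncExp
            (Nat.lt_succ_iff.mp (Finset.mem_range.mp hn)) _ u v u' v' hq, mul_comm]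
        · refine Finset.sum_congr rfl fun n hn => ?_
          rw [Polynomial.coeff_map, mul_comm, add_comm (N + 1) n]
      · exact lt_of_le_of_lt Polynomial.natDegree_map_le (by omega)
    have hrest : ‖∑ n ∈ Finset.range D, (ħ : ℂ) ^ (n + (N + 1)) *
        jetEval (ħ / 2) q u v u' v' ((truncExp N).coeff (n + (N + 1)))‖ ≤
        D * C₄ * ħ ^ (N + 1) * B ^ K := by
      refine (norm_sum_pow_mul_le h0 h1 D (N + 1) (A := C₄ * B ^ K₄) (by positivity)
        (fun n hn => h₄ n hn _ heg u v u' v')).trans ?_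
      calc (D : ℝ) * (C₄ * B ^ K₄ * ħ ^ (N + 1)) = D * C₄ * ħ ^ (N + 1) * B ^ K₄ := by ring
        _ ≤ _ := by
          exact mul_le_mul_of_nonneg_left (hBK K₄ (by omega)) (by positivity)
    have hfin : multiplier ħ q u v u' v' - ∑ n ∈ Finset.range (N + 1),
        (ħ : ℂ) ^ n * jetEval (ħ / 2) q u v u' v' (multiplierPoly n) =
        (Complex.exp (x * Complex.I) - Complex.exp (y * Complex.I)) +
        (Complex.exp (y * Complex.I) -
          ∑ k ∈ Finset.range (N + 1), ((y : ℂ) * Complex.I) ^ k / k.factorial) +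
        ∑ n ∈ Finset.range D, (ħ : ℂ) ^ (n + (N + 1)) *
          jetEval (ħ / 2) q u v u' v' ((truncExp N).coeff (n + (N + 1))) := by
      rw [hpoly, hM]; ring
    rw [hfin]
    refine (norm_add_le _ _).trans ?_
    have := norm_add_le (Complex.exp (x * Complex.I) - Complex.exp (y * Complex.I))
      (Complex.exp (y * Complex.I) -
          ∑ k ∈ Finset.range (N + 1), ((y : ℂ) * Complex.I) ^ k / k.factorial)
    have := norm_exp_ofReal_mul_I_sub_le x y
    linarith
  · have hm : ‖multiplier ħ q u v u' v'‖ ≤ 1 := by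
      rw [multiplier, norm_mul, Complex.norm_exp_ofReal_mul_I, mul_one]
      exact norm_triPhase_le _ _ _
    have hsum : ‖∑ n ∈ Finset.range (N + 1), (ħ : ℂ) ^ n *
        jetEval (ħ / 2) q u v u' v' (multiplierPoly n)‖ ≤ (N + 1 : ℕ) * (C₃ * B ^ K₃) := by
      simpa using norm_sum_pow_mul_le h0 h1 (N + 1) 0 (A := C₃ * B ^ K₃) (by positivity)
        (fun n hn => h₃ n hn _ heg u v u' v')
    -- For large frequencies `2ħB/‖q‖ ≥ 1`, so any polynomial bound in `B` can be multiplied by its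
    -- power `N + 1` to supply the missing `ħ^(N+1)`.
    have hone : 1 ≤ (2 / ‖q‖) ^ (N + 1) * ħ ^ (N + 1) * B ^ (N + 1) := by
      rw [← mul_pow, ← mul_pow]
      refine one_le_pow₀ ?_
      have : ‖q‖ / 2 ≤ ħ * B := hl.le.trans (by gcongr; linarith)
      rw [mul_assoc, div_mul_eq_mul_div, le_div_iff₀ hq']
      linarith
    have hBK3 : 1 ≤ B ^ K₃ := one_le_pow₀ hB1
    have : ‖multiplier ħ q u v u' v' - ∑ n ∈ Finset.range (N + 1), (ħ : ℂ) ^ n *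
        jetEval (ħ / 2) q u v u' v' (multiplierPoly n)‖ ≤
        (1 + (N + 1 : ℕ) * C₃) * (2 / ‖q‖) ^ (N + 1) * ħ ^ (N + 1) * B ^ K := by
      calc _ ≤ 1 + (N + 1 : ℕ) * (C₃ * B ^ K₃) := (norm_sub_le _ _).trans (add_le_add hm hsum)
        _ ≤ B ^ K₃ + (N + 1 : ℕ) * (C₃ * B ^ K₃) := by linarith
        _ = (1 + (N + 1 : ℕ) * C₃) * B ^ K₃ * 1 := by ring
        _ ≤ (1 + (N + 1 : ℕ) * C₃) * B ^ K₃ *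
            ((2 / ‖q‖) ^ (N + 1) * ħ ^ (N + 1) * B ^ (N + 1)) := by gcongr
        _ = (1 + (N + 1 : ℕ) * C₃) * (2 / ‖q‖) ^ (N + 1) * ħ ^ (N + 1) * B ^ (K₃ + (N + 1)) := by
          rw [pow_add]; ring
        _ ≤ _ := by
          exact mul_le_mul_of_nonneg_left (hBK (K₃ + (N + 1)) (by omega)) (by positivity)
    linarith

/-! ### Fourier transforms -/

open FourierTransform

/-- The Fourier transforms of an integrable and square-integrable function in the two senses
agree. -/
lemma fourier_toLp_ae_eq {V : Type*} [NormedAddCommGroup V] [InnerProductSpace ℝ V]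
    [FiniteDimensional ℝ V] [MeasurableSpace V] [BorelSpace V] {a : V → ℂ} (h₁ : Integrable a)
    (h₂ : MemLp a 2) : ((𝓕 (h₂.toLp a) : Lp ℂ 2 (volume : Measure V)) : V → ℂ) =ᵐ[volume] 𝓕 a := by
  have hcont : Continuous (𝓕 a) := VectorFourier.fourierIntegral_continuous
    Real.continuous_fourierChar continuous_inner h₁
  -- Both transforms are determined by their integrals against test functions, and for both the
  -- transform can be moved onto the test function.
  refine ae_eq_of_integral_contDiff_smul_eq ((Lp.memLp (𝓕 (h₂.toLp a) : Lp ℂ 2 (volume : Measure V))).locallyIntegrable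
    (by norm_num))
    hcont.locallyIntegrable fun g hg hs => ?_
  have hs' : HasCompactSupport fun x => (g x : ℂ) := hs.comp_left (g := fun x : ℝ => (x : ℂ)) rfl
  have hg' : ContDiff ℝ ∞ fun x => (g x : ℂ) := Complex.ofRealCLM.contDiff.comp hg
  set φ : 𝓢(V, ℂ) := hs'.toSchwartzMap hg'
  have hφ : ∀ x, φ x = (g x : ℂ) := fun x => rfl
  have e := congrArg (fun T => T φ) (Lp.fourier_toTemperedDistribution_eq (h₂.toLp a))
  simp only [TemperedDistribution.fourier_apply, Lp.toTemperedDistribution_apply] at e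
  have e1 : ∫ x, g x • ((𝓕 (h₂.toLp a) : Lp ℂ 2 (volume : Measure V)) : V → ℂ) x =
      ∫ x, φ x • ((𝓕 (h₂.toLp a) : Lp ℂ 2 (volume : Measure V)) : V → ℂ) x := by
    refine integral_congr_ae (Eventually.of_forall fun x => ?_)
    simp only [hφ, Complex.real_smul, smul_eq_mul]
  have e2 : ∫ x, g x • 𝓕 a x = ∫ x, φ x • 𝓕 a x := by
    refine integral_congr_ae (Eventually.of_forall fun x => ?_)
    simp only [hφ, Complex.real_smul, smul_eq_mul]
  rw [e1, ← e, e2]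
  have e3 : ∫ x, (𝓕 φ) x • (h₂.toLp a : V → ℂ) x = ∫ x, (𝓕 (φ : V → ℂ)) x • a x := by
    refine integral_congr_ae ?_
    filter_upwards [h₂.coeFn_toLp] with x hx
    rw [hx, SchwartzMap.fourier_coe]
  rw [e3]
  have := VectorFourier.integral_fourierIntegral_smul_eq_flip (L := innerₗ V) (μ := volume)
    (ν := volume) Real.continuous_fourierChar continuous_inner φ.integrable h₁
  rw [flip_innerₗ] at this
  exact this

/-- The character `s ↦ e^{is}`. -/
def char (s : ℝ) : ℂ := Complex.exp (s * Complex.I)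

lemma norm_char (s : ℝ) : ‖char s‖ = 1 := Complex.norm_exp_ofReal_mul_I s

lemma char_add (s t : ℝ) : char (s + t) = char s * char t := by
  rw [char, char, char, ← Complex.exp_add]
  push_cast
  ring_nf

lemma continuous_char : Continuous char := by unfold char; fun_prop

lemma conj_char (s : ℝ) : starRingEnd ℂ (char s) = char (-s) := by
  rw [char, char, ← Complex.exp_conj]
  simp

/-- The (unnormalized) Fourier transform on `ℝ³`. -/
def ft (a : E → ℂ) (v : E) : ℂ := ∫ q, char (-inner ℝ q v) * a q

/-- The (unnormalized) inverse Fourier transform on `ℝ³`. -/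
def ift (a : E → ℂ) (v : E) : ℂ := ∫ q, char (inner ℝ q v) * a q

/-- Passage between frequency conventions: the rescaling by `2π` is the source of every factor
`(2π)³` below. -/
lemma ft_eq (a : E → ℂ) (v : E) : ft a v = 𝓕 a ((2 * Real.pi)⁻¹ • v) := by
  rw [Real.fourier_eq', ft]
  refine integral_congr_ae (Eventually.of_forall fun q => ?_)
  simp only [char, smul_eq_mul, inner_smul_right]
  congr 3
  have := Real.pi_pos
  field_simp

lemma ift_eq_conj (b : E → ℂ) (v : E) :
    ift b v = starRingEnd ℂ (ft (fun q => starRingEnd ℂ (b q)) v) := by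
  rw [ft, ift, ← integral_conj]
  refine integral_congr_ae (Eventually.of_forall fun q => ?_)
  simp [conj_char]

lemma two_pi_ne_zero : (2 * Real.pi) ≠ 0 := by have := Real.pi_pos; positivity

lemma lintegral_comp_two_pi_smul (φ : E → ENNReal) (hφ : Measurable φ) :
    ∫⁻ v, φ ((2 * Real.pi)⁻¹ • v) = ENNReal.ofReal ((2 * Real.pi) ^ 3) * ∫⁻ v, φ v := by
  have hm : Measurable fun v : E => (2 * Real.pi)⁻¹ • v := measurable_const_smul _
  rw [← lintegral_map hφ hm, Measure.map_addHaar_smul _ (inv_ne_zero two_pi_ne_zero),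
    lintegral_smul_measure]
  congr 2
  have := Real.pi_pos
  rw [finrank_euclideanSpace_fin, inv_pow, inv_inv, abs_of_pos (by positivity)]

lemma continuous_ft {a : E → ℂ} (h : Integrable a) : Continuous (ft a) := by
  have hcont : Continuous (𝓕 a) := VectorFourier.fourierIntegral_continuous
    Real.continuous_fourierChar continuous_inner h
  have : ft a = fun v => 𝓕 a ((2 * Real.pi)⁻¹ • v) := funext (ft_eq a)
  rw [this]
  fun_prop

lemma eLpNorm_two_sq {α : Type*} [MeasurableSpace α] {μ : Measure α} {F : Type*}
    [NormedAddCommGroup F] (f : α → F) :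
    eLpNorm f 2 μ ^ 2 = ∫⁻ x, ‖f x‖ₑ ^ 2 ∂μ := by
  have h := eLpNorm_nnreal_pow_eq_lintegral (f := f) (μ := μ) (p := 2) (by norm_num)
  simpa using h

/-- Plancherel's theorem. -/
lemma lintegral_ft_sq {a : E → ℂ} (h₁ : Integrable a) (h₂ : MemLp a 2) :
    ∫⁻ v, ‖ft a v‖ₑ ^ 2 = ENNReal.ofReal ((2 * Real.pi) ^ 3) * ∫⁻ q, ‖a q‖ₑ ^ 2 := by
  have hcont : Continuous (𝓕 a) := VectorFourier.fourierIntegral_continuous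
    Real.continuous_fourierChar continuous_inner h₁
  simp_rw [ft_eq]
  rw [lintegral_comp_two_pi_smul (fun v => ‖𝓕 a v‖ₑ ^ 2) (by fun_prop)]
  congr 1
  rw [← eLpNorm_two_sq, ← eLpNorm_two_sq, ← eLpNorm_congr_ae (fourier_toLp_ae_eq h₁ h₂),
    ← eLpNorm_congr_ae h₂.coeFn_toLp]
  have := Lp.norm_fourier_eq (h₂.toLp a)
  rw [Lp.norm_def, Lp.norm_def, ENNReal.toReal_eq_toReal_iff' (Lp.eLpNorm_ne_top _)
    (Lp.eLpNorm_ne_top _)] at this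
  rw [this]

lemma memLp_two_of_lintegral {α : Type*} [MeasurableSpace α] {μ : Measure α} {F : Type*}
    [NormedAddCommGroup F] {f : α → F} (hf : AEStronglyMeasurable f μ)
    (h : ∫⁻ x, ‖f x‖ₑ ^ 2 ∂μ < ⊤) : MemLp f 2 μ := by
  refine ⟨hf, ?_⟩
  rw [← eLpNorm_two_sq] at h
  by_contra hc
  rw [not_lt, top_le_iff] at hc
  simp [hc] at h

lemma lintegral_sq_lt_top {α : Type*} [MeasurableSpace α] {μ : Measure α} {F : Type*}
    [NormedAddCommGroup F] {f : α → F} (hf : MemLp f 2 μ) : ∫⁻ x, ‖f x‖ₑ ^ 2 ∂μ < ⊤ := by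
  rw [← eLpNorm_two_sq]
  exact ENNReal.pow_lt_top hf.2

lemma integrable_conj {a : E → ℂ} (h : Integrable a) :
    Integrable fun q => starRingEnd ℂ (a q) :=
  (integrable_norm_iff (Complex.continuous_conj.comp_aestronglyMeasurable h.1)).mp (by
    simpa using h.norm)

lemma memLp_conj {a : E → ℂ} (h : MemLp a 2) : MemLp (fun q => starRingEnd ℂ (a q)) 2 :=
  h.congr_norm (Complex.continuous_conj.comp_aestronglyMeasurable h.1)
    (Eventually.of_forall fun q => by simp)

/-- Parseval's formula. -/
lemma integral_ft_mul_ift {a b : E → ℂ} (ha₁ : Integrable a) (ha₂ : MemLp a 2)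
    (hb₁ : Integrable b) (hb₂ : MemLp b 2) :
    ∫ v, ft a v * ift b v = ((2 * Real.pi) ^ 3 : ℝ) * ∫ q, a q * b q := by
  set b' : E → ℂ := fun q => starRingEnd ℂ (b q)
  have hb₁' : Integrable b' := integrable_conj hb₁
  have hb₂' : MemLp b' 2 := memLp_conj hb₂
  have h1 : ∫ v, ft a v * ift b v = ∫ v, (fun w => 𝓕 a w * starRingEnd ℂ (𝓕 b' w))
      ((2 * Real.pi)⁻¹ • v) := by
    refine integral_congr_ae (Eventually.of_forall fun v => ?_)
    simp only
    rw [ift_eq_conj, ft_eq, ft_eq]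
  rw [h1, Measure.integral_comp_smul volume (fun w => 𝓕 a w * starRingEnd ℂ (𝓕 b' w))]
  have h2 := Lp.inner_fourier_eq (hb₂'.toLp b') (ha₂.toLp a)
  rw [L2.inner_def, L2.inner_def] at h2
  have h3 : ∫ x, inner ℂ (((𝓕 (hb₂'.toLp b') : Lp ℂ 2 (volume : Measure E)) : E → ℂ) x) (((𝓕 (ha₂.toLp a) : Lp ℂ 2 (volume : Measure E)) : E → ℂ) x) =
      ∫ w, 𝓕 a w * starRingEnd ℂ (𝓕 b' w) := by
    refine integral_congr_ae ?_
    filter_upwards [fourier_toLp_ae_eq hb₁' hb₂', fourier_toLp_ae_eq ha₁ ha₂] with w h h'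
    rw [h, h', RCLike.inner_apply]
  have h4 : ∫ x, inner ℂ ((hb₂'.toLp b' : E → ℂ) x) ((ha₂.toLp a : E → ℂ) x) =
      ∫ w, a w * b w := by
    refine integral_congr_ae ?_
    filter_upwards [hb₂'.coeFn_toLp, ha₂.coeFn_toLp] with w h h'
    rw [h, h', RCLike.inner_apply]
    simp [b']
  rw [← h3, h2, h4, finrank_euclideanSpace_fin, inv_pow, inv_inv,
    abs_of_pos (by have := Real.pi_pos; positivity), Complex.real_smul]

/-- Fourier inversion. -/
lemma ift_ft {a : E → ℂ} (hc : Continuous a) (h₁ : Integrable a) (h₂ : Integrable (ft a)) (q : E) :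
    ift (ft a) q = ((2 * Real.pi) ^ 3 : ℝ) * a q := by
  have h𝓕 : 𝓕 a = fun w => ft a ((2 * Real.pi) • w) := by
    funext w
    rw [ft_eq, smul_smul, inv_mul_cancel₀ two_pi_ne_zero, one_smul]
  have hi : Integrable (𝓕 a) := by
    rw [h𝓕]
    exact h₂.comp_smul two_pi_ne_zero
  have hinv := congrFun (hc.fourierInv_fourier_eq h₁ hi) q
  rw [← hinv, Real.fourierInv_eq', ift]
  have h3 : ∫ v, char (inner ℝ v q) * ft a v = ∫ v, (fun w => Complex.exp
      ((2 * Real.pi * inner ℝ w q : ℝ) * Complex.I) • 𝓕 a w) ((2 * Real.pi)⁻¹ • v) := by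
    refine integral_congr_ae (Eventually.of_forall fun v => ?_)
    simp only [char, smul_eq_mul, inner_smul_left, ft_eq]
    congr 3
    have := Real.pi_pos
    simp
    field_simp
  rw [h3, Measure.integral_comp_smul volume (fun w => Complex.exp
      ((2 * Real.pi * inner ℝ w q : ℝ) * Complex.I) • 𝓕 a w), finrank_euclideanSpace_fin, inv_pow, inv_inv,
    abs_of_pos (by have := Real.pi_pos; positivity), Complex.real_smul]

/-! ### Schwartz functions on phase space -/

open FourierTransform

/-- The weight `(1 + |x|)^{-k}`. -/
def wt (k : ℕ) (x : E) : ℝ := ((1 + ‖x‖) ^ k)⁻¹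

lemma wt_pos (k : ℕ) (x : E) : 0 < wt k x := by unfold wt; positivity

lemma wt_le_one (k : ℕ) (x : E) : wt k x ≤ 1 :=
  inv_le_one_of_one_le₀ (one_le_pow₀ (by linarith [norm_nonneg x]))

lemma wt_anti {k l : ℕ} (h : k ≤ l) (x : E) : wt l x ≤ wt k x :=
  inv_anti₀ (by positivity) (pow_le_pow_right₀ (by linarith [norm_nonneg x]) h)

lemma integrable_wt {k : ℕ} (hk : 4 ≤ k) : Integrable (wt k) := by
  have h : (Module.finrank ℝ E : ℝ) < k := by
    rw [finrank_euclideanSpace_fin]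
    exact_mod_cast hk
  refine (integrable_one_add_norm h).congr (Eventually.of_forall fun x => ?_)
  simp only [wt]
  rw [Real.rpow_neg (by positivity), Real.rpow_natCast]

/-- The product weight is dominated by the joint weight of order `2k`, each factor being controlled
by the norm of the pair. -/
lemma schwartz_decay (f : 𝓢(Phase, ℂ)) (k : ℕ) :
    ∃ C : ℝ, 0 ≤ C ∧ ∀ p q : E, ‖f (p, q)‖ ≤ C * (wt k p * wt k q) := by
  refine ⟨2 ^ (k + k) * ((Finset.Iic (k + k, 0)).sup fun m => SchwartzMap.seminorm ℝ m.1 m.2) f,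
    by positivity, fun p q => ?_⟩
  have h := SchwartzMap.one_add_le_sup_seminorm_apply (𝕜 := ℝ) (m := (k + k, 0)) (k := k + k)
    (n := 0) le_rfl le_rfl f (p, q)
  rw [norm_iteratedFDeriv_zero] at h
  have h1 : (1 + ‖p‖) ^ k * (1 + ‖q‖) ^ k ≤ (1 + ‖((p, q) : Phase)‖) ^ (k + k) := by
    rw [pow_add]
    gcongr
    · exact norm_fst_le ((p, q) : Phase)
    · exact norm_snd_le ((p, q) : Phase)
  rw [wt, wt, ← mul_inv, ← div_eq_mul_inv, le_div_iff₀ (by positivity), mul_comm]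
  exact (mul_le_mul_of_nonneg_right h1 (norm_nonneg _)).trans h

lemma fourierPh_eq (φ : Phase → ℂ) (w : Phase) : fourierPh φ w =
    (((2 * Real.pi) ^ 3 : ℝ) : ℂ)⁻¹ *
      ∫ z : Phase, char (-(inner ℝ z.1 w.1 + inner ℝ z.2 w.2)) * φ z := by
  rw [fourierPh]
  congr 1
  refine integral_congr_ae (Eventually.of_forall fun z => ?_)
  simp only [char]
  congr 2
  push_cast
  ring

instance isAddHaarMeasure_phase : (volume : Measure Phase).IsAddHaarMeasure :=
  inferInstanceAs ((volume : Measure E).prod (volume : Measure E)).IsAddHaarMeasure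

/-- Phase space with its Euclidean structure. -/
abbrev PhaseL2 := WithLp 2 (E × E)

/-- The identification of the Euclidean phase space with the product. -/
def phaseEquiv : PhaseL2 ≃L[ℝ] Phase := WithLp.prodContinuousLinearEquiv 2 ℝ E E

/-- The rescaled identification of phase spaces. -/
def scaledEquiv : Phase ≃L[ℝ] PhaseL2 :=
  phaseEquiv.symm.trans (ContinuousLinearEquiv.smulLeft (Units.mk0 (2 * Real.pi)⁻¹
    (inv_ne_zero two_pi_ne_zero)))

lemma scaledEquiv_apply (w : Phase) :
    scaledEquiv w = (2 * Real.pi)⁻¹ • (WithLp.toLp 2 w : PhaseL2) := rfl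

/-- Phase space as a product carries the sup norm; the Fourier transform is taken on its Euclidean
version and transported back. -/
lemma fourierPh_eq_fourier (φ : 𝓢(Phase, ℂ)) (w : Phase) : fourierPh φ w =
    (((2 * Real.pi) ^ 3 : ℝ) : ℂ)⁻¹ * 𝓕 (fun x : PhaseL2 => φ (phaseEquiv x)) (scaledEquiv w) := by
  rw [fourierPh_eq, Real.fourier_eq']
  congr 1
  have hmp : MeasurePreserving (WithLp.ofLp : PhaseL2 → Phase) volume volume :=
    WithLp.volume_preserving_ofLp E E
  have hme : MeasurableEmbedding (WithLp.ofLp : PhaseL2 → Phase) :=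
    (phaseEquiv.toHomeomorph.measurableEmbedding)
  rw [← hmp.integral_comp hme]
  refine integral_congr_ae (Eventually.of_forall fun x => ?_)
  simp only [char, smul_eq_mul, scaledEquiv_apply, inner_smul_right, WithLp.prod_inner_apply]
  congr 3
  have := Real.pi_pos
  push_cast
  field_simp

lemma exists_schwartz_eq_fourierPh (φ : 𝓢(Phase, ℂ)) :
    ∃ ψ : 𝓢(Phase, ℂ), ∀ w, ψ w = fourierPh φ w := by
  refine ⟨(((2 * Real.pi) ^ 3 : ℝ) : ℂ)⁻¹ • SchwartzMap.compCLMOfContinuousLinearEquiv ℂ scaledEquiv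
    (𝓕 (SchwartzMap.compCLMOfContinuousLinearEquiv ℂ phaseEquiv φ)), fun w => ?_⟩
  rw [fourierPh_eq_fourier]
  rfl

lemma exists_schwartz_fourierPh_eq (χ : 𝓢(Phase, ℂ)) :
    ∃ φ : 𝓢(Phase, ℂ), ∀ w, fourierPh φ w = χ w := by
  set ψ : 𝓢(PhaseL2, ℂ) := (((2 * Real.pi) ^ 3 : ℝ) : ℂ) •
    SchwartzMap.compCLMOfContinuousLinearEquiv ℂ scaledEquiv.symm χ
  refine ⟨SchwartzMap.compCLMOfContinuousLinearEquiv ℂ phaseEquiv.symm (𝓕⁻ ψ), fun w => ?_⟩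
  rw [fourierPh_eq_fourier]
  have h1 : (fun x : PhaseL2 => (SchwartzMap.compCLMOfContinuousLinearEquiv ℂ phaseEquiv.symm
      (𝓕⁻ ψ)) (phaseEquiv x)) = ((𝓕⁻ ψ : 𝓢(PhaseL2, ℂ)) : PhaseL2 → ℂ) := by
    funext x
    simp
  rw [h1, ← SchwartzMap.fourier_coe, FourierTransform.fourier_fourierInv_eq]
  have h2 : ψ (scaledEquiv w) = (((2 * Real.pi) ^ 3 : ℝ) : ℂ) * χ w := by
    simp [ψ]
  rw [h2, inv_mul_cancel_left₀]
  have := Real.pi_pos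
  exact_mod_cast (by positivity : ((2 * Real.pi) ^ 3 : ℝ) ≠ 0)

/-- The partial Fourier transform in the momentum variable. -/
def partialFt (f : Phase → ℂ) (z : Phase) : ℂ := ft (fun p => f (p, z.2)) z.1

section

variable (f : 𝓢(Phase, ℂ))

lemma continuous_fst_slice (q : E) : Continuous fun p => f (p, q) := by
  have := f.continuous
  fun_prop

lemma integrable_fst_slice (q : E) : Integrable fun p => f (p, q) := by
  obtain ⟨C, hC, h⟩ := schwartz_decay f 4
  refine ((integrable_wt le_rfl).const_mul (C * wt 4 q)).mono'
    (continuous_fst_slice f q).aestronglyMeasurable (Eventually.of_forall fun p => ?_)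
  exact (h p q).trans (le_of_eq (by ring))

lemma continuous_snd_slice (p : E) : Continuous fun q => f (p, q) := by
  have := f.continuous
  fun_prop

lemma integrable_snd_slice (p : E) : Integrable fun q => f (p, q) := by
  obtain ⟨C, hC, h⟩ := schwartz_decay f 4
  refine ((integrable_wt le_rfl).const_mul (C * wt 4 p)).mono'
    (continuous_snd_slice f p).aestronglyMeasurable (Eventually.of_forall fun q => ?_)
  exact (h p q).trans (le_of_eq (by ring))

lemma continuous_partialFt : Continuous (partialFt f) := by
  obtain ⟨C, hC, h⟩ := schwartz_decay f 4
  have hf := f.continuous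
  refine continuous_of_dominated (bound := fun p => C * wt 4 p) (fun z => ?_) (fun z => ?_)
    ((integrable_wt le_rfl).const_mul C) (Eventually.of_forall fun p => ?_)
  · have h1 : Continuous fun p : E => inner ℝ p z.1 := continuous_id.inner continuous_const
    exact ((continuous_char.comp h1.neg).mul (continuous_fst_slice f z.2)).aestronglyMeasurable
  · refine Eventually.of_forall fun p => ?_
    rw [norm_mul, norm_char, one_mul]
    refine (h p z.2).trans ?_
    have := mul_le_mul_of_nonneg_left (wt_le_one 4 z.2) (mul_nonneg hC (wt_pos 4 p).le)
    linarith
  · have h1 : Continuous fun z : Phase => inner ℝ p z.1 := continuous_const.inner continuous_fst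
    exact (continuous_char.comp h1.neg).mul (by fun_prop)

lemma norm_partialFt_le_snd (k : ℕ) :
    ∃ C : ℝ, 0 ≤ C ∧ ∀ u y : E, ‖partialFt f (u, y)‖ ≤ C * wt k y := by
  obtain ⟨C, hC, h⟩ := schwartz_decay f (k + 4)
  refine ⟨C * ∫ p, wt (k + 4) p, mul_nonneg hC (integral_nonneg fun p => (wt_pos _ p).le),
    fun u y => ?_⟩
  have h1 : ‖partialFt f (u, y)‖ ≤ ∫ p, C * wt (k + 4) y * wt (k + 4) p := by
    refine norm_integral_le_of_norm_le ((integrable_wt (by omega)).const_mul _)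
      (Eventually.of_forall fun p => ?_)
    rw [norm_mul, norm_char, one_mul]
    exact (h p y).trans (le_of_eq (by ring))
  refine h1.trans ?_
  rw [integral_const_mul]
  have h2 : wt (k + 4) y ≤ wt k y := wt_anti (by omega) y
  have h3 : 0 ≤ ∫ p, wt (k + 4) p := integral_nonneg fun p => (wt_pos _ p).le
  generalize (∫ p, wt (k + 4) p) = A at h3
  calc C * wt (k + 4) y * A ≤ C * wt k y * A :=
        mul_le_mul_of_nonneg_right (mul_le_mul_of_nonneg_left h2 hC) h3
    _ = _ := by ring

lemma fourierPh_eq_ft (u v : E) : fourierPh f (u, v) =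
    (((2 * Real.pi) ^ 3 : ℝ) : ℂ)⁻¹ * ft (fun y => partialFt f (u, y)) v := by
  rw [fourierPh_eq]
  congr 1
  have hi : Integrable fun z : Phase =>
      char (-(inner ℝ z.1 u + inner ℝ z.2 v)) * f z := by
    have hc : Continuous fun z : Phase => char (-(inner ℝ z.1 u + inner ℝ z.2 v)) :=
      continuous_char.comp ((continuous_fst.inner continuous_const).add
        (continuous_snd.inner continuous_const)).neg
    refine (integrable_norm_iff (hc.mul f.continuous).aestronglyMeasurable).mp ?_
    refine (f.integrable (μ := volume)).norm.congr (Eventually.of_forall fun z => ?_)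
    simp [norm_char]
  change ∫ z : E × E, _ ∂(volume.prod volume) = _
  rw [integral_prod_symm _ hi, ft]
  refine integral_congr_ae (Eventually.of_forall fun y => ?_)
  simp only [partialFt, ft]
  rw [← integral_const_mul]
  refine integral_congr_ae (Eventually.of_forall fun p => ?_)
  simp only
  rw [neg_add, char_add]
  ring

lemma integrable_partialFt_snd (u : E) : Integrable fun y => partialFt f (u, y) := by
  obtain ⟨C, _, h⟩ := norm_partialFt_le_snd f 4
  have hc : Continuous fun y => partialFt f (u, y) := by
    have := continuous_partialFt f
    fun_prop
  exact ((integrable_wt le_rfl).const_mul C).mono' hc.aestronglyMeasurable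
    (Eventually.of_forall fun y => h u y)

lemma partialFt_eq_ift (u y : E) :
    partialFt f (u, y) = ift (fun v => fourierPh f (u, v)) y := by
  obtain ⟨ψ, hψ⟩ := exists_schwartz_eq_fourierPh f
  have hpi : (((2 * Real.pi) ^ 3 : ℝ) : ℂ) ≠ 0 := by
    have := Real.pi_pos
    exact_mod_cast (by positivity : ((2 * Real.pi) ^ 3 : ℝ) ≠ 0)
  have h1 : ft (fun y => partialFt f (u, y)) =
      fun v => (((2 * Real.pi) ^ 3 : ℝ) : ℂ) * ψ (u, v) := by
    funext v
    rw [hψ, fourierPh_eq_ft, mul_inv_cancel_left₀ hpi]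
  have hc : Continuous fun y => partialFt f (u, y) := by
    have := continuous_partialFt f
    fun_prop
  have h2 := ift_ft hc (integrable_partialFt_snd f u)
    (by rw [h1]; exact (integrable_snd_slice ψ u).const_mul _) y
  rw [h1] at h2
  have h3 : ift (fun v => (((2 * Real.pi) ^ 3 : ℝ) : ℂ) * ψ (u, v)) y =
      (((2 * Real.pi) ^ 3 : ℝ) : ℂ) * ift (fun v => ψ (u, v)) y := by
    rw [ift, ift, ← integral_const_mul]
    refine integral_congr_ae (Eventually.of_forall fun v => ?_)
    simp only
    ring
  rw [h3] at h2
  rw [← mul_left_cancel₀ hpi h2]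
  simp only [hψ]

/-- Decay in `y` of order `2k` comes from the function itself, decay in `u` of order `2k` from its
full Fourier transform. Their geometric mean decays to order `k` in both variables. -/
lemma norm_partialFt_le (k : ℕ) :
    ∃ C : ℝ, 0 ≤ C ∧ ∀ u y : E, ‖partialFt f (u, y)‖ ≤ C * (wt k u * wt k y) := by
  obtain ⟨ψ, hψ⟩ := exists_schwartz_eq_fourierPh f
  obtain ⟨C₁, c₁, h₁⟩ := norm_partialFt_le_snd f (k + k)
  obtain ⟨C₂, c₂, h₂⟩ := schwartz_decay ψ (k + k + 4)
  obtain ⟨A, hAeq⟩ : ∃ A : ℝ, A = ∫ v, wt (k + k + 4) v := ⟨_, rfl⟩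
  have hA : 0 ≤ A := hAeq ▸ integral_nonneg fun v => (wt_pos _ v).le
  have hwt : ∀ x : E, wt (k + k) x = wt k x ^ 2 := fun x => by
    rw [wt, wt, inv_pow, pow_add, pow_two]
  have hwt' : ∀ x : E, wt (k + k + 4) x ≤ wt (k + k) x := wt_anti (by omega)
  refine ⟨√(C₁ * (C₂ * A)), Real.sqrt_nonneg _, fun u y => ?_⟩
  have h3 : ‖partialFt f (u, y)‖ ≤ C₂ * A * wt (k + k) u := by
    rw [partialFt_eq_ift]
    have : ‖ift (fun v => fourierPh f (u, v)) y‖ ≤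
        ∫ v, C₂ * wt (k + k + 4) u * wt (k + k + 4) v := by
      refine norm_integral_le_of_norm_le ((integrable_wt (by omega)).const_mul _)
        (Eventually.of_forall fun v => ?_)
      simp only [← hψ]
      rw [norm_mul, norm_char, one_mul]
      exact (h₂ u v).trans (le_of_eq (by ring))
    refine this.trans ?_
    rw [integral_const_mul, ← hAeq]
    calc C₂ * wt (k + k + 4) u * A ≤ C₂ * wt (k + k) u * A :=
          mul_le_mul_of_nonneg_right (mul_le_mul_of_nonneg_left (hwt' u) c₂) hA
      _ = _ := by ring
  have h4 := h₁ u y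
  have hu := wt_pos k u
  have hy := wt_pos k y
  have h5 : (√(C₁ * (C₂ * A)) * (wt k u * wt k y)) ^ 2 =
      (C₁ * wt (k + k) y) * (C₂ * A * wt (k + k) u) := by
    rw [mul_pow, Real.sq_sqrt (by positivity), hwt, hwt]
    ring
  have h6 : ‖partialFt f (u, y)‖ ^ 2 ≤ (√(C₁ * (C₂ * A)) * (wt k u * wt k y)) ^ 2 := by
    rw [h5, pow_two]
    exact mul_le_mul h4 h3 (norm_nonneg _) ((norm_nonneg _).trans h4)
  exact (abs_le_of_sq_le_sq' h6 (by positivity)).2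

lemma integrable_partialFt_fst (y : E) : Integrable fun u => partialFt f (u, y) := by
  obtain ⟨C, _, h⟩ := norm_partialFt_le f 4
  have hc : Continuous fun u => partialFt f (u, y) := by
    have := continuous_partialFt f
    fun_prop
  exact ((integrable_wt le_rfl).const_mul (C * wt 4 y)).mono' hc.aestronglyMeasurable
    (Eventually.of_forall fun u => (h u y).trans (le_of_eq (by ring)))

lemma ift_partialFt (p q : E) :
    ift (fun u => partialFt f (u, q)) p = (((2 * Real.pi) ^ 3 : ℝ) : ℂ) * f (p, q) :=
  ift_ft (continuous_fst_slice f q) (integrable_fst_slice f q) (integrable_partialFt_fst f q) p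

end

/-! ### Symbols and their Fourier transforms in terms of the partial Fourier transform -/

lemma ift_const_mul (c : ℂ) (a : E → ℂ) (v : E) : ift (fun q => c * a q) v = c * ift a v := by
  rw [ift, ift, ← integral_const_mul]
  exact integral_congr_ae (Eventually.of_forall fun q => by simp only; ring)

lemma norm_ft_le (a : E → ℂ) (v : E) : ‖ft a v‖ ≤ ∫ q, ‖a q‖ := by
  refine (norm_integral_le_integral_norm _).trans (le_of_eq ?_)
  simp only [norm_mul, norm_char, one_mul]

lemma norm_ift_le (a : E → ℂ) (v : E) : ‖ift a v‖ ≤ ∫ q, ‖a q‖ := by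
  refine (norm_integral_le_integral_norm _).trans (le_of_eq ?_)
  simp only [norm_mul, norm_char, one_mul]

lemma continuous_char_inner : Continuous fun z : E × E => char (inner ℝ z.1 z.2) :=
  continuous_char.comp (continuous_fst.inner continuous_snd)

lemma continuous_char_neg_inner : Continuous fun z : E × E => char (-inner ℝ z.1 z.2) :=
  continuous_char.comp (continuous_fst.inner continuous_snd).neg

/-- Fubini, the joint integrand being dominated by the product of the moduli. -/
lemma integral_ft_mul {a b : E → ℂ} (ha : Integrable a) (hb : Integrable b) :
    ∫ v, ft a v * b v = ∫ y, a y * ft b y := by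
  have hi : Integrable (fun z : E × E => char (-inner ℝ z.1 z.2) * (a z.1 * b z.2))
      (volume.prod volume) := by
    refine (integrable_norm_iff (continuous_char_neg_inner.aestronglyMeasurable.mul
      (ha.mul_prod hb).aestronglyMeasurable)).mp ?_
    refine (ha.mul_prod hb).norm.congr (Eventually.of_forall fun z => ?_)
    simp [norm_char]
  have h1 := integral_integral_swap (f := fun y v => char (-inner ℝ y v) * (a y * b v)) hi
  refine Eq.trans ?_ (h1.symm.trans ?_)
  · refine integral_congr_ae (Eventually.of_forall fun v => ?_)
    simp only [ft]
    rw [← integral_mul_const]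
    exact integral_congr_ae (Eventually.of_forall fun y => by simp only; ring)
  · refine integral_congr_ae (Eventually.of_forall fun y => ?_)
    simp only [ft]
    rw [← integral_const_mul]
    refine integral_congr_ae (Eventually.of_forall fun v => ?_)
    simp only
    rw [real_inner_comm]
    ring

lemma integral_ift_mul {a b : E → ℂ} (ha : Integrable a) (hb : Integrable b) :
    ∫ v, ift a v * b v = ∫ y, a y * ift b y := by
  have hi : Integrable (fun z : E × E => char (inner ℝ z.1 z.2) * (a z.1 * b z.2))
      (volume.prod volume) := by
    refine (integrable_norm_iff (continuous_char_inner.aestronglyMeasurable.mul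
      (ha.mul_prod hb).aestronglyMeasurable)).mp ?_
    refine (ha.mul_prod hb).norm.congr (Eventually.of_forall fun z => ?_)
    simp [norm_char]
  have h1 := integral_integral_swap (f := fun y v => char (inner ℝ y v) * (a y * b v)) hi
  refine Eq.trans ?_ (h1.symm.trans ?_)
  · refine integral_congr_ae (Eventually.of_forall fun v => ?_)
    simp only [ift]
    rw [← integral_mul_const]
    exact integral_congr_ae (Eventually.of_forall fun y => by simp only; ring)
  · refine integral_congr_ae (Eventually.of_forall fun y => ?_)
    simp only [ift]
    rw [← integral_const_mul]
    refine integral_congr_ae (Eventually.of_forall fun v => ?_)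
    simp only
    rw [real_inner_comm]
    ring

lemma memLp_two_of_bounded {α : Type*} [MeasurableSpace α] {μ : Measure α} {a : α → ℂ}
    (h₁ : Integrable a μ) {C : ℝ} (hb : ∀ x, ‖a x‖ ≤ C) : MemLp a 2 μ := by
  rw [memLp_two_iff_integrable_sq_norm h₁.aestronglyMeasurable]
  refine (h₁.norm.const_mul C).mono' (h₁.aestronglyMeasurable.norm.pow 2)
    (Eventually.of_forall fun x => ?_)
  rw [Real.norm_eq_abs, abs_of_nonneg (by positivity), pow_two]
  exact mul_le_mul_of_nonneg_right (hb x) (norm_nonneg _)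

lemma lintegral_ift_sq {a : E → ℂ} (h₁ : Integrable a) (h₂ : MemLp a 2) :
    ∫⁻ v, ‖ift a v‖ₑ ^ 2 = ENNReal.ofReal ((2 * Real.pi) ^ 3) * ∫⁻ q, ‖a q‖ₑ ^ 2 := by
  rw [← lintegral_ft_sq h₁ h₂, ← (Measure.measurePreserving_neg (volume : Measure E)).lintegral_comp
    ((continuous_ft h₁).measurable.enorm.pow_const 2)]
  refine lintegral_congr fun v => ?_
  rw [ift, ft]
  simp only [inner_neg_right, neg_neg]

/-- Exchange of the two variables of a Schwartz function. -/
def schwartzSwap (φ : 𝓢(Phase, ℂ)) : 𝓢(Phase, ℂ) :=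
  SchwartzMap.compCLMOfContinuousLinearEquiv ℂ (ContinuousLinearEquiv.prodComm ℝ E E) φ

lemma schwartzSwap_apply (φ : 𝓢(Phase, ℂ)) (z : Phase) : schwartzSwap φ z = φ z.swap := rfl

lemma fourierPh_schwartzSwap (φ : 𝓢(Phase, ℂ)) (w : Phase) :
    fourierPh (schwartzSwap φ) w = fourierPh φ w.swap := by
  rw [fourierPh_eq, fourierPh_eq]
  congr 1
  have hmp : MeasurePreserving (Prod.swap : E × E → E × E) (volume.prod volume)
    (volume.prod volume) := Measure.measurePreserving_swap
  refine Eq.trans ?_ (hmp.integral_comp MeasurableEquiv.prodComm.measurableEmbedding _)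
  refine integral_congr_ae (Eventually.of_forall fun z => ?_)
  simp only [Prod.fst_swap, Prod.snd_swap, schwartzSwap_apply]
  rw [add_comm (inner ℝ z.2 w.2)]

/-- The class of functions of `(u, q)` used as partial Fourier transforms of symbols. -/
def Admissible (H : Phase → ℂ) : Prop :=
  StronglyMeasurable H ∧ ∃ C : ℝ, 0 ≤ C ∧ ∀ u y : E, ‖H (u, y)‖ ≤ C * (wt 4 u * wt 4 y)

/-- The Fourier transform of the symbol with partial Fourier transform `H`. -/
def symbolFt (H : Phase → ℂ) (w : Phase) : ℂ :=
  (((2 * Real.pi) ^ 3 : ℝ) : ℂ)⁻¹ * ft (fun y => H (w.1, y)) w.2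

/-- The symbol with partial Fourier transform `H`. -/
def symbolOf (H : Phase → ℂ) (z : Phase) : ℂ :=
  (((2 * Real.pi) ^ 3 : ℝ) : ℂ)⁻¹ * ift (fun u => H (u, z.2)) z.1

lemma admissible_partialFt (f : 𝓢(Phase, ℂ)) : Admissible (partialFt f) :=
  ⟨(continuous_partialFt f).stronglyMeasurable, norm_partialFt_le f 4⟩

lemma twoPiCube_ne_zero : (((2 * Real.pi) ^ 3 : ℝ) : ℂ) ≠ 0 := by
  have := Real.pi_pos
  exact_mod_cast (by positivity : ((2 * Real.pi) ^ 3 : ℝ) ≠ 0)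

lemma symbolFt_partialFt (f : 𝓢(Phase, ℂ)) (w : Phase) :
    symbolFt (partialFt f) w = fourierPh f w := (fourierPh_eq_ft f w.1 w.2).symm

lemma symbolOf_partialFt (f : 𝓢(Phase, ℂ)) (z : Phase) :
    symbolOf (partialFt f) z = f z := by
  rw [symbolOf, ift_partialFt, inv_mul_cancel_left₀ twoPiCube_ne_zero]

namespace Admissible

variable {H : Phase → ℂ}

lemma integrable (hH : Admissible H) : Integrable H := by
  obtain ⟨C, _, h⟩ := hH.2
  have hi : Integrable fun z : E × E => C * (wt 4 z.1 * wt 4 z.2) :=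
    ((integrable_wt le_rfl).mul_prod (integrable_wt le_rfl)).const_mul C
  exact hi.mono' hH.1.aestronglyMeasurable (Eventually.of_forall fun z => h z.1 z.2)

lemma bounded (hH : Admissible H) : ∃ C : ℝ, ∀ z, ‖H z‖ ≤ C := by
  obtain ⟨C, hC, h⟩ := hH.2
  refine ⟨C, fun z => (h z.1 z.2).trans ?_⟩
  have := mul_le_one₀ (wt_le_one 4 z.1) (wt_pos 4 z.2).le (wt_le_one 4 z.2)
  nlinarith

lemma integrable_snd (hH : Admissible H) (u : E) : Integrable fun y => H (u, y) := by
  obtain ⟨C, _, h⟩ := hH.2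
  exact ((integrable_wt le_rfl).const_mul (C * wt 4 u)).mono'
    (hH.1.comp_measurable (by fun_prop)).aestronglyMeasurable
    (Eventually.of_forall fun y => (h u y).trans (le_of_eq (by ring)))

lemma integrable_fst (hH : Admissible H) (y : E) : Integrable fun u => H (u, y) := by
  obtain ⟨C, _, h⟩ := hH.2
  exact ((integrable_wt le_rfl).const_mul (C * wt 4 y)).mono'
    (hH.1.comp_measurable (by fun_prop)).aestronglyMeasurable
    (Eventually.of_forall fun u => (h u y).trans (le_of_eq (by ring)))

lemma memLp (hH : Admissible H) : MemLp H 2 volume := by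
  obtain ⟨C, h⟩ := hH.bounded
  exact memLp_two_of_bounded hH.integrable h

lemma memLp_snd (hH : Admissible H) (u : E) : MemLp (fun y => H (u, y)) 2 volume := by
  obtain ⟨C, h⟩ := hH.bounded
  exact memLp_two_of_bounded (hH.integrable_snd u) fun y => h (u, y)

lemma memLp_fst (hH : Admissible H) (y : E) : MemLp (fun u => H (u, y)) 2 volume := by
  obtain ⟨C, h⟩ := hH.bounded
  exact memLp_two_of_bounded (hH.integrable_fst y) fun u => h (u, y)

lemma stronglyMeasurable_symbolFt (hH : Admissible H) : StronglyMeasurable (symbolFt H) := by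
  refine StronglyMeasurable.const_mul ?_ _
  have h1 : StronglyMeasurable fun t : Phase × E => char (-inner ℝ t.2 t.1.2) * H (t.1.1, t.2) :=
    (continuous_char_neg_inner.comp (by fun_prop : Continuous fun t : Phase × E =>
      (t.2, t.1.2))).stronglyMeasurable.mul (hH.1.comp_measurable (by fun_prop))
  exact h1.integral_prod_right

lemma stronglyMeasurable_symbolOf (hH : Admissible H) : StronglyMeasurable (symbolOf H) := by
  refine StronglyMeasurable.const_mul ?_ _
  have h1 : StronglyMeasurable fun t : Phase × E => char (inner ℝ t.2 t.1.1) * H (t.2, t.1.2) :=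
    (continuous_char_inner.comp (by fun_prop : Continuous fun t : Phase × E =>
      (t.2, t.1.1))).stronglyMeasurable.mul (hH.1.comp_measurable (by fun_prop))
  exact h1.integral_prod_right

/-- Plancherel in the second variable for each fixed `u`: the normalization `(2π)⁻³` enters squared
and Plancherel returns one factor `(2π)³`. -/
lemma lintegral_symbolFt_sq (hH : Admissible H) : ∫⁻ w, ‖symbolFt H w‖ₑ ^ 2 =
    ENNReal.ofReal ((2 * Real.pi) ^ 3)⁻¹ * ∫⁻ z, ‖H z‖ₑ ^ 2 := by
  have hpi := Real.pi_pos
  have e1 := lintegral_prod (μ := (volume : Measure E)) (ν := (volume : Measure E))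
    (fun w : E × E => ‖symbolFt H w‖ₑ ^ 2)
    (hH.stronglyMeasurable_symbolFt.enorm.pow_const 2).aemeasurable
  have e2 := lintegral_prod (μ := (volume : Measure E)) (ν := (volume : Measure E))
    (fun w : E × E => ‖H w‖ₑ ^ 2) (hH.1.enorm.pow_const 2).aemeasurable
  refine e1.trans (Eq.trans ?_ (congrArg _ e2.symm))
  rw [← lintegral_const_mul' _ _ ENNReal.ofReal_ne_top]
  refine lintegral_congr fun u => ?_
  simp only [symbolFt, enorm_mul, mul_pow]
  rw [lintegral_const_mul' _ _ (by finiteness), lintegral_ft_sq (hH.integrable_snd u) (hH.memLp_snd u),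
    ← mul_assoc]
  congr 1
  rw [← Complex.ofReal_inv, ← ofReal_norm, Complex.norm_real, Real.norm_eq_abs,
    abs_of_nonneg (by positivity), ← ENNReal.ofReal_pow (by positivity),
    ← ENNReal.ofReal_mul (by positivity)]
  congr 1
  field_simp

lemma memLp_symbolFt (hH : Admissible H) : MemLp (symbolFt H) 2 volume := by
  refine memLp_two_of_lintegral hH.stronglyMeasurable_symbolFt.aestronglyMeasurable ?_
  rw [hH.lintegral_symbolFt_sq]
  exact ENNReal.mul_lt_top ENNReal.ofReal_lt_top (lintegral_sq_lt_top hH.memLp)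

lemma memLp_symbolOf (hH : Admissible H) : MemLp (symbolOf H) 2 volume := by
  refine memLp_two_of_lintegral hH.stronglyMeasurable_symbolOf.aestronglyMeasurable ?_
  have e1 := lintegral_prod_symm (μ := (volume : Measure E)) (ν := (volume : Measure E))
    (fun w : E × E => ‖symbolOf H w‖ₑ ^ 2)
    (hH.stronglyMeasurable_symbolOf.enorm.pow_const 2).aemeasurable
  have e2 := lintegral_prod_symm (μ := (volume : Measure E)) (ν := (volume : Measure E))
    (fun w : E × E => ‖H w‖ₑ ^ 2) (hH.1.enorm.pow_const 2).aemeasurable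
  have e3 : ∫⁻ w, ‖symbolOf H w‖ₑ ^ 2 = ‖(((2 * Real.pi) ^ 3 : ℝ) : ℂ)⁻¹‖ₑ ^ 2 *
      (ENNReal.ofReal ((2 * Real.pi) ^ 3) * ∫⁻ z, ‖H z‖ₑ ^ 2) := by
    refine e1.trans (Eq.trans ?_ (congrArg (fun t => _ * (_ * t)) e2.symm))
    rw [← lintegral_const_mul' _ _ ENNReal.ofReal_ne_top,
      ← lintegral_const_mul' _ _ (by finiteness)]
    refine lintegral_congr fun q => ?_
    simp only [symbolOf, enorm_mul, mul_pow]
    rw [lintegral_const_mul' _ _ (by finiteness),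
      lintegral_ift_sq (hH.integrable_fst q) (hH.memLp_fst q), mul_pow]
  rw [e3]
  exact ENNReal.mul_lt_top (by finiteness) (ENNReal.mul_lt_top ENNReal.ofReal_lt_top
    (lintegral_sq_lt_top hH.memLp))

lemma norm_symbolFt_le (hH : Admissible H) : ∃ C : ℝ, ∀ w, ‖symbolFt H w‖ ≤ C := by
  obtain ⟨C, hC, h⟩ := hH.2
  refine ⟨‖(((2 * Real.pi) ^ 3 : ℝ) : ℂ)⁻¹‖ * ∫ y, C * wt 4 y, fun w => ?_⟩
  rw [symbolFt, norm_mul]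
  refine mul_le_mul_of_nonneg_left ((norm_ft_le _ _).trans ?_) (norm_nonneg _)
  refine integral_mono (hH.integrable_snd _).norm ((integrable_wt le_rfl).const_mul C) fun y => ?_
  exact (h w.1 y).trans (mul_le_mul_of_nonneg_left
    (mul_le_of_le_one_left (wt_pos 4 y).le (wt_le_one 4 w.1)) hC)

lemma norm_symbolOf_le (hH : Admissible H) : ∃ C : ℝ, ∀ w, ‖symbolOf H w‖ ≤ C := by
  obtain ⟨C, hC, h⟩ := hH.2
  refine ⟨‖(((2 * Real.pi) ^ 3 : ℝ) : ℂ)⁻¹‖ * ∫ y, C * wt 4 y, fun w => ?_⟩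
  rw [symbolOf, norm_mul]
  refine mul_le_mul_of_nonneg_left ((norm_ift_le _ _).trans ?_) (norm_nonneg _)
  refine integral_mono (hH.integrable_fst _).norm ((integrable_wt le_rfl).const_mul C) fun u => ?_
  exact (h u w.2).trans (mul_le_mul_of_nonneg_left
    (mul_le_of_le_one_right (wt_pos 4 u).le (wt_le_one 4 w.2)) hC)

/-- The function `symbolFt H` is the Fourier transform of `symbolOf H`. -/
theorem isFourierL2 (hH : Admissible H) : IsFourierL2 (symbolOf H) (symbolFt H) := by
  refine ⟨hH.memLp_symbolOf, hH.memLp_symbolFt, fun φ => ?_⟩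
  obtain ⟨ψ, hψ⟩ := exists_schwartz_eq_fourierPh φ
  obtain ⟨C₁, h₁⟩ := hH.norm_symbolFt_le
  obtain ⟨C₂, h₂⟩ := hH.norm_symbolOf_le
  have i1 : Integrable (fun w : E × E => symbolFt H w * φ w) (volume.prod volume) :=
    (φ.integrable (μ := (volume : Measure Phase))).bdd_mul
      hH.stronglyMeasurable_symbolFt.aestronglyMeasurable (Eventually.of_forall h₁)
  have i2 : Integrable (fun w : E × E => symbolOf H w * ψ w) (volume.prod volume) :=
    (ψ.integrable (μ := (volume : Measure Phase))).bdd_mul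
      hH.stronglyMeasurable_symbolOf.aestronglyMeasurable (Eventually.of_forall h₂)
  obtain ⟨C₃, h₃⟩ := (admissible_partialFt (schwartzSwap φ)).bounded
  have i3 : Integrable (fun w : E × E => H w * partialFt (schwartzSwap φ) w.swap)
      (volume.prod volume) :=
    hH.integrable.mul_bdd ((continuous_partialFt (schwartzSwap φ)).comp
      continuous_swap).aestronglyMeasurable (Eventually.of_forall fun w => h₃ _)
  -- In `l1` the transform in the position variable is moved onto `φ`, in `l2` the inverse transform
  -- in the momentum variable onto the transform of `φ`. Both leave `H` paired with the same partial
  -- transform of `φ`, in opposite orders of integration.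
  have l1 : ∫ w, symbolFt H w * φ w = (((2 * Real.pi) ^ 3 : ℝ) : ℂ)⁻¹ *
      ∫ u, ∫ y, H (u, y) * partialFt (schwartzSwap φ) (y, u) := by
    refine (integral_prod _ i1).trans ?_
    rw [← integral_const_mul]
    refine integral_congr_ae (Eventually.of_forall fun u => ?_)
    simp only [symbolFt, mul_assoc]
    rw [integral_const_mul, integral_ft_mul (hH.integrable_snd u) (integrable_snd_slice φ u)]
    rfl
  have l2 : ∫ w, symbolOf H w * ψ w = (((2 * Real.pi) ^ 3 : ℝ) : ℂ)⁻¹ *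
      ∫ y, ∫ u, H (u, y) * partialFt (schwartzSwap φ) (y, u) := by
    refine (integral_prod_symm _ i2).trans ?_
    rw [← integral_const_mul]
    refine integral_congr_ae (Eventually.of_forall fun y => ?_)
    simp only [symbolOf, mul_assoc]
    rw [integral_const_mul, integral_ift_mul (hH.integrable_fst y) (integrable_fst_slice ψ y)]
    congr 1
    refine integral_congr_ae (Eventually.of_forall fun u => ?_)
    simp only
    rw [partialFt_eq_ift]
    simp only [fourierPh_schwartzSwap, hψ, Prod.swap_prod_mk]
  have l3 : ∫ z, symbolOf H z * fourierPh φ z = ∫ w, symbolOf H w * ψ w := by simp only [hψ]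
  rw [l3, l1, l2]
  congr 1
  exact integral_integral_swap i3

end Admissible

/-! ### Endpoints of a segment in terms of its midpoint -/

/-- The endpoints `(q - ħu/2, q + ħu/2)` of the segment with midpoint `q` and direction `ħu`. -/
def endpoints (ħ : ℝ) (z : Phase) : E × E := (z.2 - (ħ / 2) • z.1, z.2 + (ħ / 2) • z.1)

/-- The pair `((y - x)/ħ, (x + y)/2)`. -/
def midpoints (ħ : ℝ) (t : E × E) : Phase := (ħ⁻¹ • (t.2 - t.1), (2 : ℝ)⁻¹ • (t.1 + t.2))

lemma continuous_endpoints (ħ : ℝ) : Continuous (endpoints ħ) := by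
  unfold endpoints
  fun_prop

lemma continuous_midpoints (ħ : ℝ) : Continuous (midpoints ħ) := by
  unfold midpoints
  fun_prop

lemma midpoints_endpoints {ħ : ℝ} (h : ħ ≠ 0) (z : Phase) : midpoints ħ (endpoints ħ z) = z := by
  refine Prod.ext ?_ ?_
  · simp only [midpoints, endpoints]
    rw [show z.2 + (ħ / 2) • z.1 - (z.2 - (ħ / 2) • z.1) = ħ • z.1 by module, smul_smul,
      inv_mul_cancel₀ h, one_smul]
  · simp only [midpoints, endpoints]
    module

lemma endpoints_midpoints {ħ : ℝ} (h : ħ ≠ 0) (t : E × E) : endpoints ħ (midpoints ħ t) = t := by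
  have : (ħ / 2) * ħ⁻¹ = 1 / 2 := by field_simp
  refine Prod.ext ?_ ?_
  · simp only [midpoints, endpoints, smul_smul, this]
    module
  · simp only [midpoints, endpoints, smul_smul, this]
    module

/-- The change of variables from midpoint and direction to endpoints. -/
def endpointsEquiv {ħ : ℝ} (h : ħ ≠ 0) : Phase ≃ᵐ E × E where
  toFun := endpoints ħ
  invFun := midpoints ħ
  left_inv := midpoints_endpoints h
  right_inv := endpoints_midpoints h
  measurable_toFun := (continuous_endpoints ħ).measurable
  measurable_invFun := (continuous_midpoints ħ).measurable

lemma lintegral_comp_add_smul {ħ : ℝ} (h : 0 < ħ) (x : E) {φ : E → ENNReal} (hφ : Measurable φ) :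
    ∫⁻ u, φ (x + ħ • u) = ENNReal.ofReal (ħ ^ 3)⁻¹ * ∫⁻ y, φ y := by
  have hm : Measurable fun v : E => ħ • v := measurable_const_smul _
  have h2 : Measurable fun v : E => φ (x + v) := hφ.comp (measurable_const_add x)
  rw [← lintegral_map (f := fun v : E => φ (x + v)) h2 hm, Measure.map_addHaar_smul _ h.ne',
    lintegral_smul_measure, lintegral_add_left_eq_self, finrank_euclideanSpace_fin,
    abs_of_nonneg (by positivity), smul_eq_mul]

/-- At fixed direction the midpoint is translated to the left endpoint; at fixed left endpoint the
direction is scaled by `ħ`, which gives the Jacobian. -/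
lemma map_endpoints {ħ : ℝ} (h : 0 < ħ) : Measure.map (endpoints ħ) (volume : Measure Phase) =
    ENNReal.ofReal (ħ ^ 3)⁻¹ • (volume : Measure (E × E)) := by
  refine Measure.ext_of_lintegral _ fun φ hφ => ?_
  rw [lintegral_map hφ (continuous_endpoints ħ).measurable, lintegral_smul_measure]
  have hm : Measurable fun z : E × E => φ (endpoints ħ z) :=
    hφ.comp (continuous_endpoints ħ).measurable
  have hm' : Measurable fun z : E × E => φ (z.2, z.2 + ħ • z.1) := hφ.comp (by fun_prop)
  have e1 : ∫⁻ z, φ (endpoints ħ z) = ∫⁻ u : E, ∫⁻ y : E, φ (endpoints ħ (u, y)) :=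
    lintegral_prod _ hm.aemeasurable
  have e2 : ∫⁻ t, φ t = ∫⁻ x : E, ∫⁻ y : E, φ (x, y) := lintegral_prod _ hφ.aemeasurable
  have e3 : ∀ u : E, ∫⁻ y : E, φ (endpoints ħ (u, y)) = ∫⁻ x : E, φ (x, x + ħ • u) := fun u => by
    rw [← lintegral_sub_right_eq_self (fun x => φ (x, x + ħ • u)) ((ħ / 2) • u)]
    refine lintegral_congr fun y => ?_
    simp only [endpoints]
    congr 2
    module
  rw [e1, e2, smul_eq_mul]
  simp_rw [e3]
  rw [lintegral_lintegral_swap hm'.aemeasurable,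
    ← lintegral_const_mul' _ _ ENNReal.ofReal_ne_top]
  exact lintegral_congr fun x => lintegral_comp_add_smul h x (hφ.comp measurable_prodMk_left)

lemma integral_comp_endpoints {ħ : ℝ} (h : 0 < ħ) {G : Type*} [NormedAddCommGroup G]
    [NormedSpace ℝ G] (g : E × E → G) : ∫ z, g (endpoints ħ z) = (ħ ^ 3)⁻¹ • ∫ t, g t := by
  refine ((endpointsEquiv h.ne').measurableEmbedding.integral_map g).symm.trans ?_
  change ∫ y, g y ∂(Measure.map (endpoints ħ) volume) = _
  rw [map_endpoints h, integral_smul_measure, ENNReal.toReal_ofReal (by positivity)]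

lemma lintegral_comp_endpoints {ħ : ℝ} (h : 0 < ħ) {g : E × E → ENNReal} (hg : Measurable g) :
    ∫⁻ z, g (endpoints ħ z) = ENNReal.ofReal (ħ ^ 3)⁻¹ * ∫⁻ t, g t := by
  rw [← lintegral_map hg (continuous_endpoints ħ).measurable, map_endpoints h,
    lintegral_smul_measure, smul_eq_mul]

/-! ### Measurability of the quaternionic data -/

/-- Read off from the closed form of the transport: the degenerate set is closed, and off it the
expression is a quotient of continuous functions. -/
lemma stronglyMeasurable_uTrans : StronglyMeasurable fun t : E × E => uTrans t.1 t.2 := by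
  classical
  simp_rw [uTrans_eq_ite]
  refine StronglyMeasurable.ite ?_ stronglyMeasurable_const ?_
  · exact (isClosed_singleton.preimage continuous_dQuat).measurableSet
  · exact (continuous_dQuat.norm.measurable.inv.stronglyMeasurable).smul
      continuous_dQuat.stronglyMeasurable

lemma stronglyMeasurable_jq : StronglyMeasurable jq :=
  (continuous_norm.measurable.inv.stronglyMeasurable).smul continuous_vecQ.stronglyMeasurable

lemma stronglyMeasurable_embedQ : StronglyMeasurable fun t : ℂ × E => embedQ t.1 t.2 := by
  unfold embedQ
  refine StronglyMeasurable.add ?_ ?_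
  · exact (Quaternion.continuous_coe.comp (by fun_prop)).stronglyMeasurable
  · exact (by fun_prop : Continuous fun t : ℂ × E => t.1.im).stronglyMeasurable.smul
      (stronglyMeasurable_jq.comp_measurable measurable_snd)

lemma norm_jq_le_one (x : E) : ‖jq x‖ ≤ 1 := by
  by_cases hx : x = 0
  · simp [hx, jq]
  · have h := congrArg norm (jq_mul_self hx)
    rw [norm_mul, norm_neg, norm_one] at h
    nlinarith [norm_nonneg (jq x)]

lemma norm_embedQ_le (c : ℂ) (x : E) : ‖embedQ c x‖ ≤ 2 * ‖c‖ := by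
  refine (norm_add_le _ _).trans ?_
  rw [Quaternion.norm_coe, norm_smul]
  have h1 : ‖c.re‖ ≤ ‖c‖ := Complex.abs_re_le_norm c
  have h2 : ‖c.im‖ ≤ ‖c‖ := Complex.abs_im_le_norm c
  nlinarith [norm_jq_le_one x, norm_nonneg c, norm_nonneg c.im, norm_nonneg (jq x)]

/-! ### The quaternionic cross-Wigner functions -/

/-- The integrand, at midpoint `y` and direction `u`, of the component along `b` of the matrix
elements of the Weyl operators. -/
def wignerDensity (ħ : ℝ) (Φ Ψ : E → ℍ[ℝ]) (b : ℍ[ℝ]) (z : Phase) : ℂ :=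
  ⟨inner ℝ b (star (Φ (endpoints ħ z).1) * (uTrans (endpoints ħ z).1 (endpoints ħ z).2 *
      Ψ (endpoints ħ z).2)),
    -inner ℝ b (star (Φ (endpoints ħ z).1) * (uTrans (endpoints ħ z).1 (endpoints ħ z).2 *
      (jq (endpoints ħ z).2 * Ψ (endpoints ħ z).2)))⟩

/-- The sign in the imaginary part of `wignerDensity` is chosen so that this real-linear functional
of `c` becomes the real part of a complex product. Scalar Fourier analysis thereby applies to
quaternionic matrix elements. -/
lemma re_mul_wignerDensity (ħ : ℝ) (Φ Ψ : E → ℍ[ℝ]) (b : ℍ[ℝ]) (z : Phase) (c : ℂ) :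
    (c * wignerDensity ħ Φ Ψ b z).re = inner ℝ b (star (Φ (endpoints ħ z).1) *
      (uTrans (endpoints ħ z).1 (endpoints ħ z).2 *
        (embedQ c (endpoints ħ z).2 * Ψ (endpoints ħ z).2))) := by
  rw [embedQ, quaternion_coe_eq]
  simp only [wignerDensity, Complex.mul_re, add_mul, mul_add, smul_mul_assoc, mul_smul_comm,
    inner_add_right, inner_smul_right, one_mul]
  ring

lemma norm_wignerDensity_le (ħ : ℝ) (Φ Ψ : E → ℍ[ℝ]) (b : ℍ[ℝ]) (z : Phase) :
    ‖wignerDensity ħ Φ Ψ b z‖ ≤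
      2 * ‖b‖ * (‖Φ (endpoints ħ z).1‖ * ‖Ψ (endpoints ħ z).2‖) := by
  refine (Complex.norm_le_abs_re_add_abs_im _).trans ?_
  have h1 : |(wignerDensity ħ Φ Ψ b z).re| ≤
      ‖b‖ * (‖Φ (endpoints ħ z).1‖ * ‖Ψ (endpoints ħ z).2‖) := by
    refine (abs_real_inner_le_norm _ _).trans (le_of_eq ?_)
    rw [norm_mul, norm_mul, norm_star, norm_uTrans, one_mul]
  have h2 : |(wignerDensity ħ Φ Ψ b z).im| ≤
      ‖b‖ * (‖Φ (endpoints ħ z).1‖ * ‖Ψ (endpoints ħ z).2‖) := by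
    simp only [wignerDensity, abs_neg]
    refine (abs_real_inner_le_norm _ _).trans ?_
    rw [norm_mul, norm_mul, norm_mul, norm_star, norm_uTrans, one_mul]
    have := mul_le_of_le_one_left (norm_nonneg (Ψ (endpoints ħ z).2))
      (norm_jq_le_one (endpoints ħ z).2)
    gcongr
  linarith

section

variable {ħ : ℝ} {Φ Ψ : E → ℍ[ℝ]}

lemma stronglyMeasurable_wignerDensity (mΦ : StronglyMeasurable Φ) (mΨ : StronglyMeasurable Ψ)
    (b : ℍ[ℝ]) : StronglyMeasurable (wignerDensity ħ Φ Ψ b) := by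
  have hm := (continuous_endpoints ħ).measurable
  have h1 : StronglyMeasurable fun z => star (Φ (endpoints ħ z).1) :=
    continuous_star.comp_stronglyMeasurable (mΦ.comp_measurable hm.fst)
  have h2 := stronglyMeasurable_uTrans.comp_measurable hm
  have h3 := mΨ.comp_measurable hm.snd
  have h4 := stronglyMeasurable_jq.comp_measurable hm.snd
  have h5 : StronglyMeasurable fun z => (wignerDensity ħ Φ Ψ b z).re :=
    stronglyMeasurable_const.inner (h1.mul (h2.mul h3))
  have h6 : StronglyMeasurable fun z => (wignerDensity ħ Φ Ψ b z).im :=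
    (stronglyMeasurable_const.inner (h1.mul (h2.mul (h4.mul h3)))).neg
  have h7 : wignerDensity ħ Φ Ψ b = fun z => ((wignerDensity ħ Φ Ψ b z).re : ℂ) +
      ((wignerDensity ħ Φ Ψ b z).im : ℂ) * Complex.I := funext fun z => (Complex.re_add_im _).symm
  rw [h7]
  exact ((Complex.measurable_ofReal.comp h5.measurable).add
    ((Complex.measurable_ofReal.comp h6.measurable).mul_const Complex.I)).stronglyMeasurable

lemma integrable_endpoints_slice (hΦ : MemLp Φ 2) (hΨ : MemLp Ψ 2) (u : E) :
    Integrable fun y => ‖Φ (endpoints ħ (u, y)).1‖ * ‖Ψ (endpoints ħ (u, y)).2‖ := by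
  have h1 := hΦ.comp_measurePreserving (measurePreserving_sub_right volume ((ħ / 2) • u))
  have h2 := hΨ.comp_measurePreserving (measurePreserving_add_right volume ((ħ / 2) • u))
  exact h1.norm.integrable_mul h2.norm

lemma integrable_wignerDensity_snd (mΦ : StronglyMeasurable Φ) (mΨ : StronglyMeasurable Ψ)
    (hΦ : MemLp Φ 2) (hΨ : MemLp Ψ 2) (b : ℍ[ℝ]) (u : E) :
    Integrable fun y => wignerDensity ħ Φ Ψ b (u, y) :=
  ((integrable_endpoints_slice hΦ hΨ u).const_mul (2 * ‖b‖)).mono'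
    ((stronglyMeasurable_wignerDensity mΦ mΨ b).comp_measurable
      measurable_prodMk_left).aestronglyMeasurable
    (Eventually.of_forall fun y => norm_wignerDensity_le ħ Φ Ψ b (u, y))

/-- In endpoint coordinates the bound is a product of a function of `x` and one of `y`, so the
integral is at most a multiple of the squared norms of `Φ` and `Ψ`. -/
lemma lintegral_wignerDensity_sq_lt_top (hħ : 0 < ħ) (mΦ : StronglyMeasurable Φ)
    (mΨ : StronglyMeasurable Ψ) (hΦ : MemLp Φ 2) (hΨ : MemLp Ψ 2) (b : ℍ[ℝ]) :
    ∫⁻ z, ‖wignerDensity ħ Φ Ψ b z‖ₑ ^ 2 < ⊤ := by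
  have hb : ∀ z, ‖wignerDensity ħ Φ Ψ b z‖ₑ ^ 2 ≤ ENNReal.ofReal (2 * ‖b‖) ^ 2 *
      (‖Φ (endpoints ħ z).1‖ₑ ^ 2 * ‖Ψ (endpoints ħ z).2‖ₑ ^ 2) := fun z => by
    rw [← mul_pow, ← mul_pow]
    refine pow_le_pow_left' ?_ 2
    rw [← ofReal_norm, ← ofReal_norm, ← ofReal_norm, ← ENNReal.ofReal_mul (norm_nonneg _),
      ← ENNReal.ofReal_mul (by positivity)]
    exact ENNReal.ofReal_le_ofReal (norm_wignerDensity_le ħ Φ Ψ b z)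
  have hm : Measurable fun t : E × E => ‖Φ t.1‖ₑ ^ 2 * ‖Ψ t.2‖ₑ ^ 2 :=
    ((mΦ.enorm.comp measurable_fst).pow_const 2).mul ((mΨ.enorm.comp measurable_snd).pow_const 2)
  refine (lintegral_mono hb).trans_lt ?_
  rw [lintegral_const_mul' _ _ (by finiteness), lintegral_comp_endpoints hħ hm]
  have hp : ∫⁻ t : E × E, ‖Φ t.1‖ₑ ^ 2 * ‖Ψ t.2‖ₑ ^ 2 = (∫⁻ x, ‖Φ x‖ₑ ^ 2) * ∫⁻ y, ‖Ψ y‖ₑ ^ 2 :=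
    lintegral_prod_mul (mΦ.enorm.pow_const 2).aemeasurable (mΨ.enorm.pow_const 2).aemeasurable
  rw [hp]
  have h1 := lintegral_sq_lt_top hΦ
  have h2 := lintegral_sq_lt_top hΨ
  exact ENNReal.mul_lt_top (by finiteness) (ENNReal.mul_lt_top (by finiteness)
    (ENNReal.mul_lt_top h1 h2))

lemma memLp_wignerDensity (hħ : 0 < ħ) (mΦ : StronglyMeasurable Φ)
    (mΨ : StronglyMeasurable Ψ) (hΦ : MemLp Φ 2) (hΨ : MemLp Ψ 2) (b : ℍ[ℝ]) :
    MemLp (wignerDensity ħ Φ Ψ b) 2 volume :=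
  memLp_two_of_lintegral (stronglyMeasurable_wignerDensity mΦ mΨ b).aestronglyMeasurable
    (lintegral_wignerDensity_sq_lt_top hħ mΦ mΨ hΦ hΨ b)

lemma ae_memLp_wignerDensity_snd (hħ : 0 < ħ) (mΦ : StronglyMeasurable Φ)
    (mΨ : StronglyMeasurable Ψ) (hΦ : MemLp Φ 2) (hΨ : MemLp Ψ 2) (b : ℍ[ℝ]) :
    ∀ᵐ u : E, MemLp (fun y => wignerDensity ħ Φ Ψ b (u, y)) 2 := by
  have hm := stronglyMeasurable_wignerDensity (ħ := ħ) mΦ mΨ b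
  have h1 := lintegral_wignerDensity_sq_lt_top hħ mΦ mΨ hΦ hΨ b
  have h2 : ∫⁻ z, ‖wignerDensity ħ Φ Ψ b z‖ₑ ^ 2 =
      ∫⁻ u : E, ∫⁻ y : E, ‖wignerDensity ħ Φ Ψ b (u, y)‖ₑ ^ 2 :=
    lintegral_prod _ (hm.enorm.pow_const 2).aemeasurable
  rw [h2] at h1
  filter_upwards [ae_lt_top (hm.enorm.pow_const 2).lintegral_prod_right' h1.ne] with u hu
  exact memLp_two_of_lintegral (hm.comp_measurable measurable_prodMk_left).aestronglyMeasurable hu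

/-- The quaternionic cross-Wigner function: the component along `b` of the matrix elements of the
Weyl operators. -/
def wigner (ħ : ℝ) (Φ Ψ : E → ℍ[ℝ]) (b : ℍ[ℝ]) (w : Phase) : ℂ :=
  ift (fun y => wignerDensity ħ Φ Ψ b (w.1, y)) w.2

lemma stronglyMeasurable_wigner (mΦ : StronglyMeasurable Φ) (mΨ : StronglyMeasurable Ψ)
    (b : ℍ[ℝ]) : StronglyMeasurable (wigner ħ Φ Ψ b) := by
  have h1 : StronglyMeasurable fun t : Phase × E =>
      char (inner ℝ t.2 t.1.2) * wignerDensity ħ Φ Ψ b (t.1.1, t.2) :=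
    (continuous_char_inner.comp (by fun_prop : Continuous fun t : Phase × E =>
      (t.2, t.1.2))).stronglyMeasurable.mul
        ((stronglyMeasurable_wignerDensity mΦ mΨ b).comp_measurable (by fun_prop))
  exact h1.integral_prod_right

lemma memLp_wigner (hħ : 0 < ħ) (mΦ : StronglyMeasurable Φ) (mΨ : StronglyMeasurable Ψ)
    (hΦ : MemLp Φ 2) (hΨ : MemLp Ψ 2) (b : ℍ[ℝ]) : MemLp (wigner ħ Φ Ψ b) 2 volume := by
  have hm := stronglyMeasurable_wigner (ħ := ħ) mΦ mΨ b
  refine memLp_two_of_lintegral hm.aestronglyMeasurable ?_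
  have e1 : ∫⁻ w, ‖wigner ħ Φ Ψ b w‖ₑ ^ 2 = ∫⁻ u : E, ∫⁻ v : E, ‖wigner ħ Φ Ψ b (u, v)‖ₑ ^ 2 :=
    lintegral_prod _ (hm.enorm.pow_const 2).aemeasurable
  have e2 : ∫⁻ z, ‖wignerDensity ħ Φ Ψ b z‖ₑ ^ 2 =
      ∫⁻ u : E, ∫⁻ y : E, ‖wignerDensity ħ Φ Ψ b (u, y)‖ₑ ^ 2 :=
    lintegral_prod _ ((stronglyMeasurable_wignerDensity mΦ mΨ b).enorm.pow_const 2).aemeasurable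
  have e3 : ∫⁻ w, ‖wigner ħ Φ Ψ b w‖ₑ ^ 2 =
      ENNReal.ofReal ((2 * Real.pi) ^ 3) * ∫⁻ z, ‖wignerDensity ħ Φ Ψ b z‖ₑ ^ 2 := by
    rw [e1, e2, ← lintegral_const_mul' (ENNReal.ofReal ((2 * Real.pi) ^ 3))
      (fun u => ∫⁻ y : E, ‖wignerDensity ħ Φ Ψ b (u, y)‖ₑ ^ 2) ENNReal.ofReal_ne_top]
    refine lintegral_congr_ae ?_
    filter_upwards [ae_memLp_wignerDensity_snd hħ mΦ mΨ hΦ hΨ b] with u hu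
    simp only [wigner]
    exact lintegral_ift_sq (integrable_wignerDensity_snd mΦ mΨ hΦ hΨ b u) hu
  rw [e3]
  exact ENNReal.mul_lt_top ENNReal.ofReal_lt_top
    (lintegral_wignerDensity_sq_lt_top hħ mΦ mΨ hΦ hΨ b)

/-- Translating the integration variable to the midpoint turns the character into `e^{i y·v}`, so
the matrix element is an inverse Fourier transform in the midpoint. -/
lemma inner_qInner_weylT (mΦ : StronglyMeasurable Φ) (mΨ : StronglyMeasurable Ψ)
    (hΦ : MemLp Φ 2) (hΨ : MemLp Ψ 2) (b : ℍ[ℝ]) (w : Phase) (c : ℂ) :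
    inner ℝ b (qInner Φ (weylT ħ w.1 w.2 fun x => embedQ c x * Ψ x)) =
      (c * wigner ħ Φ Ψ b w).re := by
  obtain ⟨u, v⟩ := w
  -- The explicit form of the Weyl operator fails only where `𝔧` is undefined, a single point.
  have hne : ∀ᵐ x : E, x + ħ • u ≠ 0 := by
    have : ({-(ħ • u)} : Set E)ᶜ ∈ ae (volume : Measure E) := compl_mem_ae_iff.mpr (by simp)
    filter_upwards [this] with x hx h
    exact hx (eq_neg_of_add_eq_zero_left h)
  set G : E → ℍ[ℝ] := fun x => star (Φ x) * (uTrans x (x + ħ • u) *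
    (embedQ (c * char (inner ℝ (x + (ħ / 2) • u) v)) (x + ħ • u) * Ψ (x + ħ • u))) with hG
  have e1 : qInner Φ (weylT ħ u v fun x => embedQ c x * Ψ x) = ∫ x, G x := by
    refine integral_congr_ae ?_
    filter_upwards [hne] with x hx
    rw [weylT_apply _ _ _ _ hx, ← mul_assoc (embedQ _ _), embedQ_mul _ _ hx, mul_comm _ c, hG,
      real_inner_comm]
    rfl
  have e2 : ∀ y, G (y - (ħ / 2) • u) = star (Φ (endpoints ħ (u, y)).1) *
      (uTrans (endpoints ħ (u, y)).1 (endpoints ħ (u, y)).2 *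
        (embedQ (c * char (inner ℝ y v)) (endpoints ħ (u, y)).2 * Ψ (endpoints ħ (u, y)).2)) :=
    fun y => by
      simp only [hG, endpoints]
      rw [show y - (ħ / 2) • u + ħ • u = y + (ħ / 2) • u by module, sub_add_cancel]
  have hmy : Measurable fun y : E => endpoints ħ (u, y) :=
    (continuous_endpoints ħ).measurable.comp measurable_prodMk_left
  have hIntg : Integrable fun y => G (y - (ħ / 2) • u) := by
    refine ((integrable_endpoints_slice (ħ := ħ) hΦ hΨ u).const_mul (2 * ‖c‖)).mono' ?_ ?_
    · simp_rw [e2]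
      have hc : Continuous fun y : E => c * char (inner ℝ y v) :=
        continuous_const.mul (continuous_char.comp (continuous_id.inner continuous_const))
      exact ((continuous_star.comp_stronglyMeasurable (mΦ.comp_measurable hmy.fst)).mul
        ((stronglyMeasurable_uTrans.comp_measurable hmy).mul
          ((stronglyMeasurable_embedQ.comp_measurable (hc.measurable.prodMk hmy.snd)).mul
            (mΨ.comp_measurable hmy.snd)))).aestronglyMeasurable
    · refine Eventually.of_forall fun y => ?_
      rw [e2, norm_mul, norm_mul, norm_mul, norm_star, norm_uTrans, one_mul]
      have := norm_embedQ_le (c * char (inner ℝ y v)) (endpoints ħ (u, y)).2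
      rw [norm_mul, norm_char, mul_one] at this
      calc _ ≤ ‖Φ (endpoints ħ (u, y)).1‖ * (2 * ‖c‖ * ‖Ψ (endpoints ħ (u, y)).2‖) := by gcongr
        _ = _ := by ring
  rw [e1, ← integral_sub_right_eq_self G ((ħ / 2) • u)]
  have e3 := (innerSL ℝ b).integral_comp_comm hIntg
  simp only [innerSL_apply_apply] at e3
  rw [← e3, wigner, ift, ← integral_const_mul, ← RCLike.re_eq_complex_re, ← integral_re]
  · refine integral_congr_ae (Eventually.of_forall fun y => ?_)
    simp only [RCLike.re_eq_complex_re]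
    rw [e2, ← mul_assoc c, re_mul_wignerDensity]
  · refine Integrable.const_mul ?_ c
    refine (integrable_wignerDensity_snd (ħ := ħ) mΦ mΨ hΦ hΨ b u).bdd_mul (c := 1) ?_ ?_
    · exact (continuous_char.comp (continuous_id.inner continuous_const)).aestronglyMeasurable
    · exact Eventually.of_forall fun y => (norm_char _).le

end

/-! ### Weak integrals of Weyl operators -/

lemma quaternion_eq_sum_basis (q : ℍ[ℝ]) : q = q.re • (1 : ℍ[ℝ]) + (q.imI • vecQ (basisVec 0) +
    (q.imJ • vecQ (basisVec 1) + q.imK • vecQ (basisVec 2))) := by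
  ext <;> simp [vecQ_re, vecQ_imI, vecQ_imJ, vecQ_imK, basisVec]

lemma inner_one_eq (q : ℍ[ℝ]) : inner ℝ (1 : ℍ[ℝ]) q = q.re := by simp [Quaternion.inner_def]

lemma inner_vecQ_zero (q : ℍ[ℝ]) : inner ℝ (vecQ (basisVec 0)) q = q.imI := by
  simp [Quaternion.inner_def, vecQ_re, vecQ_imI, vecQ_imJ, vecQ_imK, basisVec]

lemma inner_vecQ_one (q : ℍ[ℝ]) : inner ℝ (vecQ (basisVec 1)) q = q.imJ := by
  simp [Quaternion.inner_def, vecQ_re, vecQ_imI, vecQ_imJ, vecQ_imK, basisVec]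

lemma inner_vecQ_two (q : ℍ[ℝ]) : inner ℝ (vecQ (basisVec 2)) q = q.imK := by
  simp [Quaternion.inner_def, vecQ_re, vecQ_imI, vecQ_imJ, vecQ_imK, basisVec]

/-- Finite dimension: the four real components suffice. -/
lemma integrable_of_forall_inner {α : Type*} [MeasurableSpace α] {μ : Measure α} {I : α → ℍ[ℝ]}
    (h : ∀ b : ℍ[ℝ], Integrable (fun x => inner ℝ b (I x)) μ) : Integrable I μ := by
  have h0 := h 1
  have h1 := h (vecQ (basisVec 0))
  have h2 := h (vecQ (basisVec 1))
  have h3 := h (vecQ (basisVec 2))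
  simp only [inner_one_eq, inner_vecQ_zero, inner_vecQ_one, inner_vecQ_two] at h0 h1 h2 h3
  refine ((h0.smul_const (1 : ℍ[ℝ])).add ((h1.smul_const (vecQ (basisVec 0))).add
    ((h2.smul_const (vecQ (basisVec 1))).add (h3.smul_const (vecQ (basisVec 2)))))).congr
    (Eventually.of_forall fun x => ?_)
  exact (quaternion_eq_sum_basis (I x)).symm

section

variable {ħ : ℝ} {Φ Ψ : E → ℍ[ℝ]}

lemma integrable_weylMatrix (hħ : 0 < ħ) (mΦ : StronglyMeasurable Φ) (mΨ : StronglyMeasurable Ψ)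
    (hΦ : MemLp Φ 2) (hΨ : MemLp Ψ 2) {F : Phase → ℂ} (hF : MemLp F 2 volume) :
    Integrable fun w : Phase => qInner Φ (weylT ħ w.1 w.2 fun x => embedQ (F w) x * Ψ x) := by
  refine integrable_of_forall_inner fun b => ?_
  simp_rw [inner_qInner_weylT mΦ mΨ hΦ hΨ b]
  exact (hF.integrable_mul (memLp_wigner hħ mΦ mΨ hΦ hΨ b)).re

lemma inner_integral_weylMatrix (hħ : 0 < ħ) (mΦ : StronglyMeasurable Φ)
    (mΨ : StronglyMeasurable Ψ) (hΦ : MemLp Φ 2) (hΨ : MemLp Ψ 2) {F : Phase → ℂ}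
    (hF : MemLp F 2 volume) (b : ℍ[ℝ]) :
    inner ℝ b (∫ w : Phase, qInner Φ (weylT ħ w.1 w.2 fun x => embedQ (F w) x * Ψ x)) =
      (∫ w, F w * wigner ħ Φ Ψ b w).re := by
  have e := (innerSL ℝ b).integral_comp_comm (integrable_weylMatrix hħ mΦ mΨ hΦ hΨ hF)
  simp only [innerSL_apply_apply] at e
  rw [← e]
  simp_rw [inner_qInner_weylT mΦ mΨ hΦ hΨ b]
  exact integral_re (hF.integrable_mul (memLp_wigner hħ mΦ mΨ hΦ hΨ b))

/-- Parseval in `v` for almost every `u`; only almost every slice of the density is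
square-integrable. -/
lemma integral_symbolFt_mul_wigner (hħ : 0 < ħ) (mΦ : StronglyMeasurable Φ)
    (mΨ : StronglyMeasurable Ψ) (hΦ : MemLp Φ 2) (hΨ : MemLp Ψ 2) {H : Phase → ℂ}
    (hH : Admissible H) (b : ℍ[ℝ]) :
    ∫ w, symbolFt H w * wigner ħ Φ Ψ b w = ∫ z, H z * wignerDensity ħ Φ Ψ b z := by
  have i1 : Integrable (fun w : E × E => symbolFt H w * wigner ħ Φ Ψ b w) (volume.prod volume) :=
    hH.memLp_symbolFt.integrable_mul (memLp_wigner hħ mΦ mΨ hΦ hΨ b)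
  have i2 : Integrable (fun w : E × E => H w * wignerDensity ħ Φ Ψ b w) (volume.prod volume) :=
    hH.memLp.integrable_mul (memLp_wignerDensity hħ mΦ mΨ hΦ hΨ b)
  refine (integral_prod _ i1).trans (Eq.trans ?_ (integral_prod _ i2).symm)
  refine integral_congr_ae ?_
  filter_upwards [ae_memLp_wignerDensity_snd hħ mΦ mΨ hΦ hΨ b] with u hu
  simp only [symbolFt, wigner, mul_assoc]
  rw [integral_const_mul, integral_ft_mul_ift (hH.integrable_snd u) (hH.memLp_snd u)
    (integrable_wignerDensity_snd mΦ mΨ hΦ hΨ b u) hu,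
    inv_mul_cancel_left₀ twoPiCube_ne_zero]

/-! ### Integral kernels -/

/-- The integral kernel of the operator with symbol `symbolOf H`. -/
def weylKernel (ħ : ℝ) (H : Phase → ℂ) (t : E × E) : ℍ[ℝ] :=
  ((2 * Real.pi * ħ) ^ 3)⁻¹ • (uTrans t.1 t.2 * embedQ (H (midpoints ħ t)) t.2)

lemma stronglyMeasurable_weylKernel {H : Phase → ℂ} (hH : StronglyMeasurable H) :
    StronglyMeasurable (weylKernel ħ H) := by
  have h := stronglyMeasurable_uTrans.mul (stronglyMeasurable_embedQ.comp_measurable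
    ((hH.comp_measurable (continuous_midpoints ħ).measurable).measurable.prodMk measurable_snd))
  exact h.const_smul ((2 * Real.pi * ħ) ^ 3)⁻¹

lemma ae_snd_ne_zero : ∀ᵐ t : E × E, t.2 ≠ 0 := by
  have h : ({0} : Set E)ᶜ ∈ ae (volume : Measure E) := compl_mem_ae_iff.mpr (by simp)
  exact Measure.quasiMeasurePreserving_snd.ae h

lemma norm_weylKernel {H : Phase → ℂ} (hħ : 0 < ħ) {t : E × E} (ht : t.2 ≠ 0) :
    ‖weylKernel ħ H t‖ = ((2 * Real.pi * ħ) ^ 3)⁻¹ * ‖H (midpoints ħ t)‖ := by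
  have := Real.pi_pos
  rw [weylKernel, norm_smul, norm_mul, norm_uTrans, one_mul, norm_embedQ _ ht,
    Real.norm_of_nonneg (by positivity)]

/-- The transport has norm one and the embedding of `ℂ` is isometric off the origin, so only the
change to endpoints contributes, with the factor `ħ³`. -/
lemma lintegral_weylKernel_sq (hħ : 0 < ħ) {H : Phase → ℂ} (hH : StronglyMeasurable H) :
    ∫⁻ t, ‖weylKernel ħ H t‖ₑ ^ 2 =
      ENNReal.ofReal (((2 * Real.pi) ^ 6 * ħ ^ 3)⁻¹) * ∫⁻ z, ‖H z‖ₑ ^ 2 := by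
  have hpi := Real.pi_pos
  have e1 : ∫⁻ t, ‖weylKernel ħ H t‖ₑ ^ 2 = ENNReal.ofReal (((2 * Real.pi * ħ) ^ 6)⁻¹) *
      ∫⁻ t, ‖H (midpoints ħ t)‖ₑ ^ 2 := by
    rw [← lintegral_const_mul' _ _ ENNReal.ofReal_ne_top]
    refine lintegral_congr_ae ?_
    filter_upwards [ae_snd_ne_zero] with t ht
    rw [← ofReal_norm, norm_weylKernel hħ ht, ← ofReal_norm, ENNReal.ofReal_mul (by positivity),
      mul_pow, ← ENNReal.ofReal_pow (by positivity)]
    congr 2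
    rw [inv_pow, ← pow_mul]
  have hm : Measurable fun t => ‖H (midpoints ħ t)‖ₑ ^ 2 :=
    (hH.enorm.comp (continuous_midpoints ħ).measurable).pow_const 2
  have e2 := lintegral_comp_endpoints hħ hm
  simp only [midpoints_endpoints hħ.ne'] at e2
  rw [e1, e2, ← mul_assoc, ← ENNReal.ofReal_mul (by positivity)]
  have e3 : ((2 * Real.pi) ^ 6 * ħ ^ 3)⁻¹ * (ħ ^ 3)⁻¹ = ((2 * Real.pi * ħ) ^ 6)⁻¹ := by
    field_simp
  rw [e3]

lemma memLp_weylKernel (hħ : 0 < ħ) {H : Phase → ℂ} (hH : Admissible H) :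
    MemLp (weylKernel ħ H) 2 volume := by
  refine memLp_two_of_lintegral (stronglyMeasurable_weylKernel hH.1).aestronglyMeasurable ?_
  rw [lintegral_weylKernel_sq hħ hH.1]
  exact ENNReal.mul_lt_top ENNReal.ofReal_lt_top (lintegral_sq_lt_top hH.memLp)

lemma memLp_norm_mul_norm (mΦ : StronglyMeasurable Φ) (mΨ : StronglyMeasurable Ψ)
    (hΦ : MemLp Φ 2) (hΨ : MemLp Ψ 2) :
    MemLp (fun t : E × E => ‖Φ t.1‖ * ‖Ψ t.2‖) 2 volume := by
  have m1 : StronglyMeasurable fun t : E × E => Φ t.1 := mΦ.comp_measurable measurable_fst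
  have m2 : StronglyMeasurable fun t : E × E => Ψ t.2 := mΨ.comp_measurable measurable_snd
  refine memLp_two_of_lintegral (m1.norm.mul m2.norm).aestronglyMeasurable ?_
  have hp : ∫⁻ t : E × E, ‖‖Φ t.1‖ * ‖Ψ t.2‖‖ₑ ^ 2 =
      (∫⁻ x, ‖Φ x‖ₑ ^ 2) * ∫⁻ y, ‖Ψ y‖ₑ ^ 2 := by
    simp_rw [enorm_mul, enorm_norm, mul_pow]
    exact lintegral_prod_mul (mΦ.enorm.pow_const 2).aemeasurable
      (mΨ.enorm.pow_const 2).aemeasurable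
  rw [hp]
  exact ENNReal.mul_lt_top (lintegral_sq_lt_top hΦ) (lintegral_sq_lt_top hΨ)

lemma integrable_kernel_matrix {K : E × E → ℍ[ℝ]} (hK : MemLp K 2 volume)
    (mΦ : StronglyMeasurable Φ) (mΨ : StronglyMeasurable Ψ) (hΦ : MemLp Φ 2) (hΨ : MemLp Ψ 2) :
    Integrable fun t : E × E => star (Φ t.1) * (K t * Ψ t.2) := by
  have m1 : StronglyMeasurable fun t : E × E => Φ t.1 := mΦ.comp_measurable measurable_fst
  have m2 : StronglyMeasurable fun t : E × E => Ψ t.2 := mΨ.comp_measurable measurable_snd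
  have h1 := memLp_norm_mul_norm mΦ mΨ hΦ hΨ
  have h2 : Integrable fun t : E × E => ‖K t‖ * (‖Φ t.1‖ * ‖Ψ t.2‖) :=
    hK.norm.integrable_mul h1
  refine h2.mono' ((continuous_star.comp_stronglyMeasurable m1).aestronglyMeasurable.mul
    (hK.1.mul m2.aestronglyMeasurable)) (Eventually.of_forall fun t => le_of_eq ?_)
  rw [norm_mul, norm_mul, norm_star]
  ring

/-- The weak integral of the Weyl operators is given by the integral kernel. -/
lemma integral_weylMatrix (hħ : 0 < ħ) (mΦ : StronglyMeasurable Φ) (mΨ : StronglyMeasurable Ψ)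
    (hΦ : MemLp Φ 2) (hΨ : MemLp Ψ 2) {H : Phase → ℂ} (hH : Admissible H) :
    ∫ w : Phase, qInner Φ (weylT ħ w.1 w.2 fun x => embedQ (symbolFt H w) x * Ψ x) =
      ((2 * Real.pi) ^ 3 : ℝ) • ∫ t : E × E, star (Φ t.1) * (weylKernel ħ H t * Ψ t.2) := by
  have hpi := Real.pi_pos
  refine ext_inner_left ℝ fun b => ?_
  rw [inner_integral_weylMatrix hħ mΦ mΨ hΦ hΨ hH.memLp_symbolFt b,
    integral_symbolFt_mul_wigner hħ mΦ mΨ hΦ hΨ hH b, inner_smul_right]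
  have e1 := (innerSL ℝ b).integral_comp_comm
    (integrable_kernel_matrix (memLp_weylKernel hħ hH) mΦ mΨ hΦ hΨ)
  simp only [innerSL_apply_apply] at e1
  have i1 : Integrable fun z => H z * wignerDensity ħ Φ Ψ b z :=
    hH.memLp.integrable_mul (memLp_wignerDensity hħ mΦ mΨ hΦ hΨ b)
  rw [← e1, ← RCLike.re_eq_complex_re, ← integral_re i1]
  have e2 := integral_comp_endpoints hħ
    (fun t : E × E => inner ℝ b (star (Φ t.1) * (weylKernel ħ H t * Ψ t.2)))
  rw [smul_eq_mul] at e2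
  have e3 : ∫ t : E × E, inner ℝ b (star (Φ t.1) * (weylKernel ħ H t * Ψ t.2)) =
      ħ ^ 3 * ∫ z, inner ℝ b (star (Φ (endpoints ħ z).1) *
        (weylKernel ħ H (endpoints ħ z) * Ψ (endpoints ħ z).2)) := by
    rw [e2, mul_inv_cancel_left₀ (by positivity)]
  rw [e3, ← mul_assoc, ← integral_const_mul]
  refine integral_congr_ae (Eventually.of_forall fun z => ?_)
  simp only [RCLike.re_eq_complex_re]
  rw [re_mul_wignerDensity]
  simp only [weylKernel, midpoints_endpoints hħ.ne', smul_mul_assoc, mul_smul_comm,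
    inner_smul_right, mul_assoc]
  field_simp

end

/-! ### Operators with square-integrable kernels -/

lemma sq_lintegral_mul_le {α : Type*} [MeasurableSpace α] {μ : Measure α} {f g : α → ENNReal}
    (hf : AEMeasurable f μ) (hg : AEMeasurable g μ) :
    (∫⁻ a, f a * g a ∂μ) ^ 2 ≤ (∫⁻ a, f a ^ 2 ∂μ) * ∫⁻ a, g a ^ 2 ∂μ := by
  have h := ENNReal.lintegral_mul_le_Lp_mul_Lq μ Real.HolderConjugate.two_two hf hg
  have e : ∀ t : ENNReal, (t ^ (1 / 2 : ℝ)) ^ 2 = t := fun t => by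
    rw [← ENNReal.rpow_natCast, ← ENNReal.rpow_mul]
    norm_num
  have h2 := pow_le_pow_left' h 2
  rw [mul_pow, e, e] at h2
  simpa using h2

/-- Application of an integral kernel. -/
def kernelFun (K : E × E → ℍ[ℝ]) (Ψ : E → ℍ[ℝ]) (x : E) : ℍ[ℝ] := ∫ y, K (x, y) * Ψ y

section

variable {K : E × E → ℍ[ℝ]} {Ψ : E → ℍ[ℝ]}

/-- The Hilbert–Schmidt estimate, by Cauchy–Schwarz in `y`. Keeping the norms inside the inner
integral makes it usable for Fubini as well. -/
lemma lintegral_kernel_sq_le (mK : StronglyMeasurable K) (mΨ : AEStronglyMeasurable Ψ) :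
    ∫⁻ x, (∫⁻ y, ‖K (x, y)‖ₑ * ‖Ψ y‖ₑ) ^ 2 ≤
      (∫⁻ t, ‖K t‖ₑ ^ 2) * ∫⁻ y, ‖Ψ y‖ₑ ^ 2 := by
  have e : ∫⁻ t, ‖K t‖ₑ ^ 2 = ∫⁻ x : E, ∫⁻ y : E, ‖K (x, y)‖ₑ ^ 2 :=
    lintegral_prod _ (mK.enorm.pow_const 2).aemeasurable
  rw [e, ← lintegral_mul_const _ (mK.enorm.pow_const 2).lintegral_prod_right']
  exact lintegral_mono fun x => sq_lintegral_mul_le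
    (mK.comp_measurable measurable_prodMk_left).enorm.aemeasurable mΨ.enorm

lemma ae_memLp_kernel_snd (mK : StronglyMeasurable K) (hK : MemLp K 2 volume) :
    ∀ᵐ x : E, MemLp (fun y => K (x, y)) 2 := by
  have h1 := lintegral_sq_lt_top hK
  have e : ∫⁻ t, ‖K t‖ₑ ^ 2 = ∫⁻ x : E, ∫⁻ y : E, ‖K (x, y)‖ₑ ^ 2 :=
    lintegral_prod _ (mK.enorm.pow_const 2).aemeasurable
  rw [e] at h1
  filter_upwards [ae_lt_top (mK.enorm.pow_const 2).lintegral_prod_right' h1.ne] with u hu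
  exact memLp_two_of_lintegral (mK.comp_measurable measurable_prodMk_left).aestronglyMeasurable hu

lemma ae_memLp_kernel_fst (mK : StronglyMeasurable K) (hK : MemLp K 2 volume) :
    ∀ᵐ y : E, MemLp (fun x => K (x, y)) 2 := by
  have h1 := lintegral_sq_lt_top hK
  have e : ∫⁻ t, ‖K t‖ₑ ^ 2 = ∫⁻ y : E, ∫⁻ x : E, ‖K (x, y)‖ₑ ^ 2 :=
    lintegral_prod_symm _ (mK.enorm.pow_const 2).aemeasurable
  rw [e] at h1
  filter_upwards [ae_lt_top (mK.enorm.pow_const 2).lintegral_prod_left' h1.ne] with u hu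
  exact memLp_two_of_lintegral (mK.comp_measurable measurable_prodMk_right).aestronglyMeasurable hu

lemma enorm_kernelFun_le (x : E) : ‖kernelFun K Ψ x‖ₑ ≤ ∫⁻ y, ‖K (x, y)‖ₑ * ‖Ψ y‖ₑ := by
  refine (enorm_integral_le_lintegral_enorm _).trans (le_of_eq ?_)
  refine lintegral_congr fun y => ?_
  rw [← ofReal_norm, norm_mul, ENNReal.ofReal_mul (norm_nonneg _), ofReal_norm, ofReal_norm]

lemma lintegral_kernelFun_sq_le (mK : StronglyMeasurable K) (mΨ : AEStronglyMeasurable Ψ) :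
    ∫⁻ x, ‖kernelFun K Ψ x‖ₑ ^ 2 ≤ (∫⁻ t, ‖K t‖ₑ ^ 2) * ∫⁻ y, ‖Ψ y‖ₑ ^ 2 :=
  (lintegral_mono fun x => pow_le_pow_left' (enorm_kernelFun_le x) 2).trans
    (lintegral_kernel_sq_le mK mΨ)

lemma aestronglyMeasurable_kernelFun (mK : StronglyMeasurable K) (mΨ : AEStronglyMeasurable Ψ) :
    AEStronglyMeasurable (kernelFun K Ψ) :=
  (mK.aestronglyMeasurable.mul mΨ.comp_snd).integral_prod_right'

lemma memLp_kernelFun (mK : StronglyMeasurable K) (hK : MemLp K 2 volume) (hΨ : MemLp Ψ 2) :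
    MemLp (kernelFun K Ψ) 2 := by
  refine memLp_two_of_lintegral (aestronglyMeasurable_kernelFun mK hΨ.1) ?_
  exact (lintegral_kernelFun_sq_le mK hΨ.1).trans_lt
    (ENNReal.mul_lt_top (lintegral_sq_lt_top hK) (lintegral_sq_lt_top hΨ))

lemma eLpNorm_kernelFun_le (mK : StronglyMeasurable K) (mΨ : AEStronglyMeasurable Ψ) :
    eLpNorm (kernelFun K Ψ) 2 volume ≤ eLpNorm K 2 volume * eLpNorm Ψ 2 volume := by
  have h := lintegral_kernelFun_sq_le mK mΨ
  rw [← eLpNorm_two_sq, ← eLpNorm_two_sq, ← eLpNorm_two_sq, ← mul_pow] at h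
  exact (ENNReal.pow_le_pow_left_iff two_ne_zero).mp h

end

/-- The operator with a square-integrable kernel. -/
def kernelOp (K : E × E → ℍ[ℝ]) (mK : StronglyMeasurable K) (hK : MemLp K 2 volume) :
    L2H →L[ℝ] L2H :=
  LinearMap.mkContinuous
    { toFun := fun Ψ => (memLp_kernelFun mK hK (Lp.memLp Ψ)).toLp (kernelFun K Ψ)
      map_add' := fun Ψ Ψ' => by
        rw [← MemLp.toLp_add]
        refine MemLp.toLp_congr _ _ ?_
        filter_upwards [ae_memLp_kernel_snd mK hK] with x hx
        simp only [kernelFun, Pi.add_apply]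
        rw [← integral_add (f := fun y => K (x, y) * Ψ y) (g := fun y => K (x, y) * Ψ' y)
          (hx.integrable_mul (Lp.memLp Ψ)) (hx.integrable_mul (Lp.memLp Ψ'))]
        refine integral_congr_ae ?_
        filter_upwards [Lp.coeFn_add Ψ Ψ'] with y hy
        rw [hy, Pi.add_apply, mul_add]
      map_smul' := fun c Ψ => by
        rw [RingHom.id_apply, ← MemLp.toLp_const_smul]
        refine MemLp.toLp_congr _ _ (Eventually.of_forall fun x => ?_)
        simp only [kernelFun, Pi.smul_apply]
        rw [← integral_smul]
        refine integral_congr_ae ?_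
        filter_upwards [Lp.coeFn_smul c Ψ] with y hy
        simp [hy] }
    (eLpNorm K 2 volume).toReal fun Ψ => by
      simp only [LinearMap.coe_mk, AddHom.coe_mk]
      rw [Lp.norm_toLp, Lp.norm_def, ← ENNReal.toReal_mul]
      exact ENNReal.toReal_mono (ENNReal.mul_ne_top hK.2.ne (Lp.memLp Ψ).2.ne)
        (eLpNorm_kernelFun_le mK (Lp.memLp Ψ).1)

lemma kernelOp_ae_eq {K : E × E → ℍ[ℝ]} (mK : StronglyMeasurable K) (hK : MemLp K 2 volume)
    (Ψ : L2H) : (kernelOp K mK hK Ψ : E → ℍ[ℝ]) =ᵐ[volume] kernelFun K Ψ :=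
  MemLp.coeFn_toLp (memLp_kernelFun mK hK (Lp.memLp Ψ))

lemma qInner_kernelOp {K : E × E → ℍ[ℝ]} (mK : StronglyMeasurable K) (hK : MemLp K 2 volume)
    (Φ Ψ : L2H) :
    qInner Φ (kernelOp K mK hK Ψ) = ∫ t : E × E, star (Φ t.1) * (K t * Ψ t.2) := by
  have hi := integrable_kernel_matrix hK (Lp.stronglyMeasurable Φ) (Lp.stronglyMeasurable Ψ)
    (Lp.memLp Φ) (Lp.memLp Ψ)
  refine Eq.trans ?_ (integral_prod _ hi).symm
  refine integral_congr_ae ?_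
  filter_upwards [kernelOp_ae_eq mK hK Ψ, ae_memLp_kernel_snd mK hK] with x hx hx2
  rw [hx, kernelFun]
  exact (integral_const_mul_of_integrable (hx2.integrable_mul (Lp.memLp Ψ))).symm

/-- Composition of operators with square-integrable kernels. -/
lemma kernelOp_comp {K₁ K₂ K₃ : E × E → ℍ[ℝ]} (m₁ : StronglyMeasurable K₁) (h₁ : MemLp K₁ 2 volume)
    (m₂ : StronglyMeasurable K₂) (h₂ : MemLp K₂ 2 volume)
    (m₃ : StronglyMeasurable K₃) (h₃ : MemLp K₃ 2 volume)
    (h : ∀ᵐ x : E, ∀ᵐ y : E, ∫ z, K₁ (x, z) * K₂ (z, y) = K₃ (x, y)) :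
    (kernelOp K₁ m₁ h₁).comp (kernelOp K₂ m₂ h₂) = kernelOp K₃ m₃ h₃ := by
  ext1 Ψ
  refine Lp.ext ?_
  filter_upwards [kernelOp_ae_eq m₁ h₁ (kernelOp K₂ m₂ h₂ Ψ), kernelOp_ae_eq m₃ h₃ Ψ, h,
    ae_memLp_kernel_snd m₁ h₁] with x hx₁ hx₃ hx hxm
  rw [ContinuousLinearMap.comp_apply, hx₁, hx₃, kernelFun, kernelFun]
  have mΨ := Lp.stronglyMeasurable Ψ
  have hΨ := Lp.memLp Ψ
  have hmeas : StronglyMeasurable fun s : E × E => K₁ (x, s.1) * (K₂ s * Ψ s.2) :=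
    (m₁.comp_measurable (measurable_const.prodMk measurable_fst)).mul
      (m₂.mul (mΨ.comp_measurable measurable_snd))
  have hm2 : Measurable fun z : E => ∫⁻ y, ‖K₂ (z, y)‖ₑ * ‖Ψ y‖ₑ :=
    (m₂.enorm.mul (mΨ.enorm.comp measurable_snd)).lintegral_prod_right'
  -- Justification of Fubini: Cauchy–Schwarz in `z` against the kernel row of `K₁`, combined with
  -- the Hilbert–Schmidt estimate for `K₂`.
  have hIntg : Integrable (fun s : E × E => K₁ (x, s.1) * (K₂ s * Ψ s.2)) (volume.prod volume) := by
    refine ⟨hmeas.aestronglyMeasurable, ?_⟩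
    rw [hasFiniteIntegral_iff_enorm, lintegral_prod _ hmeas.enorm.aemeasurable]
    have e1 : ∀ z : E, ∫⁻ y, ‖K₁ (x, z) * (K₂ (z, y) * Ψ y)‖ₑ =
        ‖K₁ (x, z)‖ₑ * ∫⁻ y, ‖K₂ (z, y)‖ₑ * ‖Ψ y‖ₑ := fun z => by
      rw [← lintegral_const_mul' _ _ enorm_ne_top]
      refine lintegral_congr fun y => ?_
      rw [← ofReal_norm, norm_mul, norm_mul, ENNReal.ofReal_mul (norm_nonneg _),
        ENNReal.ofReal_mul (norm_nonneg _), ofReal_norm, ofReal_norm, ofReal_norm]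
    simp_rw [e1]
    have e2 := sq_lintegral_mul_le (μ := (volume : Measure E))
      (m₁.comp_measurable (measurable_const (a := x) |>.prodMk measurable_id)).enorm.aemeasurable
      hm2.aemeasurable
    have e3 := (lintegral_kernel_sq_le m₂ mΨ.aestronglyMeasurable).trans_lt
      (ENNReal.mul_lt_top (lintegral_sq_lt_top h₂) (lintegral_sq_lt_top hΨ))
    have e4 := e2.trans_lt (ENNReal.mul_lt_top (lintegral_sq_lt_top hxm) e3)
    exact (ENNReal.pow_lt_top_iff.mp e4).resolve_right two_ne_zero
  have l1 : ∫ z, K₁ (x, z) * (kernelOp K₂ m₂ h₂ Ψ) z =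
      ∫ z, ∫ y, K₁ (x, z) * (K₂ (z, y) * Ψ y) := by
    refine integral_congr_ae ?_
    filter_upwards [kernelOp_ae_eq m₂ h₂ Ψ, ae_memLp_kernel_snd m₂ h₂] with z hz hz2
    rw [hz, kernelFun]
    exact (integral_const_mul_of_integrable (hz2.integrable_mul hΨ)).symm
  rw [l1, integral_integral_swap hIntg]
  refine integral_congr_ae ?_
  filter_upwards [hx, ae_memLp_kernel_fst m₂ h₂] with y hy hy2
  have hi : Integrable fun z => K₁ (x, z) * K₂ (z, y) := hxm.integrable_mul hy2
  rw [← hy, ← integral_mul_const_of_integrable hi]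
  simp only [mul_assoc]

/-- The operator with symbol `symbolOf H`. -/
def weylOp {ħ : ℝ} (hħ : 0 < ħ) {H : Phase → ℂ} (hH : Admissible H) : L2H →L[ℝ] L2H :=
  kernelOp (weylKernel ħ H) (stronglyMeasurable_weylKernel hH.1) (memLp_weylKernel hħ hH)

theorem isWeylOperator_weylOp {ħ : ℝ} (hħ : 0 < ħ) {H : Phase → ℂ} (hH : Admissible H) :
    IsWeylOperator ħ (symbolOf H) (weylOp hħ hH) := by
  refine ⟨symbolFt H, hH.isFourierL2, fun Φ Ψ => ⟨integrable_weylMatrix hħ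
    (Lp.stronglyMeasurable Φ) (Lp.stronglyMeasurable Ψ) (Lp.memLp Φ) (Lp.memLp Ψ)
    hH.memLp_symbolFt, ?_⟩⟩
  have hpi := Real.pi_pos
  rw [integral_weylMatrix hħ (Lp.stronglyMeasurable Φ) (Lp.stronglyMeasurable Ψ) (Lp.memLp Φ)
    (Lp.memLp Ψ) hH, smul_smul, inv_mul_cancel₀ (by positivity), one_smul, weylOp,
    qInner_kernelOp]

/-! ### Regularity of the triangle phase -/

lemma continuous_coord (i : Fin 3) : Continuous fun x : E => x i := by fun_prop

lemma continuous_triZ : Continuous fun t : E × E × E => triZ t.1 t.2.1 t.2.2 := by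
  have h0 : Continuous fun t : E × E × E => t.1 := continuous_fst
  have h1 : Continuous fun t : E × E × E => t.2.1 := continuous_fst.comp continuous_snd
  have h2 : Continuous fun t : E × E × E => t.2.2 := continuous_snd.comp continuous_snd
  have hre : Continuous fun t : E × E × E => triRe t.1 t.2.1 t.2.2 :=
    ((((h0.norm.mul h1.norm).mul h2.norm).add (h2.norm.mul (h0.inner h1))).add
      (h1.norm.mul (h0.inner h2))).add (h0.norm.mul (h1.inner h2))
  have hc := continuous_coord
  have hdet : Continuous fun t : E × E × E => det3 t.1 t.2.1 t.2.2 := by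
    unfold det3
    fun_prop
  have h : (fun t : E × E × E => triZ t.1 t.2.1 t.2.2) =
      fun t => ((triRe t.1 t.2.1 t.2.2 : ℝ) : ℂ) + ((-det3 t.1 t.2.1 t.2.2 : ℝ) : ℂ) * Complex.I := by
    funext t
    exact (Complex.re_add_im (triZ t.1 t.2.1 t.2.2)).symm
  rw [h]
  exact (Complex.continuous_ofReal.comp hre).add
    ((Complex.continuous_ofReal.comp hdet.neg).mul continuous_const)

lemma stronglyMeasurable_triPhase :
    StronglyMeasurable fun t : E × E × E => triPhase t.1 t.2.1 t.2.2 :=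
  (continuous_triZ.norm.measurable.inv.stronglyMeasurable).smul continuous_triZ.stronglyMeasurable

/-- Equality in Cauchy–Schwarz would force the cross product to vanish. -/
lemma norm_mul_norm_add_inner_pos {x y : E} (h : crossQ x y ≠ 0) : 0 < ‖x‖ * ‖y‖ + inner ℝ x y := by
  rcases (by linarith [neg_le_of_abs_le (abs_real_inner_le_norm x y)] :
    0 ≤ ‖x‖ * ‖y‖ + inner ℝ x y).lt_or_eq with h1 | h1
  · exact h1
  · exfalso
    refine h ?_
    have h2 := crossQ_mul_self x y
    have h3 : ‖x‖ ^ 2 * ‖y‖ ^ 2 - inner ℝ x y ^ 2 = 0 := by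
      have : inner ℝ x y = -(‖x‖ * ‖y‖) := by linarith
      rw [this]
      ring
    rw [h3, neg_zero, Quaternion.coe_zero] at h2
    exact mul_self_eq_zero.mp h2

/-- The squared modulus is a product of three factors, each positive when no two vertices are
collinear with the origin. -/
lemma triZ_ne_zero {x₀ x₁ x₂ : E} (h₀₁ : crossQ x₀ x₁ ≠ 0) (h₀₂ : crossQ x₀ x₂ ≠ 0)
    (h₁₂ : crossQ x₁ x₂ ≠ 0) : triZ x₀ x₁ x₂ ≠ 0 := by
  intro h
  have hre : triRe x₀ x₁ x₂ = 0 := congrArg Complex.re h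
  have him : -det3 x₀ x₁ x₂ = 0 := congrArg Complex.im h
  have hsq := triRe_sq_add_det3_sq x₀ x₁ x₂
  rw [hre, neg_eq_zero.mp him] at hsq
  have := norm_mul_norm_add_inner_pos h₀₁
  have := norm_mul_norm_add_inner_pos h₀₂
  have := norm_mul_norm_add_inner_pos h₁₂
  have : 0 < 2 * (‖x₀‖ * ‖x₁‖ + inner ℝ x₀ x₁) * (‖x₀‖ * ‖x₂‖ + inner ℝ x₀ x₂) *
        (‖x₁‖ * ‖x₂‖ + inner ℝ x₁ x₂) := by positivity
  linarith

lemma continuousAt_triPhase {x₀ x₁ x₂ : E} (h₀₁ : crossQ x₀ x₁ ≠ 0) (h₀₂ : crossQ x₀ x₂ ≠ 0)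
    (h₁₂ : crossQ x₁ x₂ ≠ 0) :
    ContinuousAt (fun t : E × E × E => triPhase t.1 t.2.1 t.2.2) (x₀, x₁, x₂) := by
  have h0 : ‖triZ x₀ x₁ x₂‖ ≠ 0 := norm_ne_zero_iff.mpr (triZ_ne_zero h₀₁ h₀₂ h₁₂)
  have h1 : ContinuousAt (fun t : E × E × E => triZ t.1 t.2.1 t.2.2) (x₀, x₁, x₂) :=
    continuous_triZ.continuousAt
  have h2 : ContinuousAt (fun t : E × E × E => ‖triZ t.1 t.2.1 t.2.2‖⁻¹) (x₀, x₁, x₂) :=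
    h1.norm.inv₀ h0
  unfold triPhase
  exact h2.smul h1

/-! ### Generic triangles -/

/-- The linear map `z ↦ (a × z) · 𝔢`. -/
def crossLin (a : E) : E →ₗ[ℝ] ℍ[ℝ] where
  toFun := crossQ a
  map_add' := crossQ_add_right a
  map_smul' s x := crossQ_smul_right s a x

/-- The exceptional set is the kernel of a nonzero linear map, a proper subspace. -/
lemma ae_crossQ_ne_zero {a : E} (ha : a ≠ 0) : ∀ᵐ z : E, crossQ a z ≠ 0 := by
  have h : LinearMap.ker (crossLin a) ≠ ⊤ := by
    intro h
    have hz : ∀ z, crossQ a z = 0 := fun z =>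
      LinearMap.mem_ker.mp (h ▸ Submodule.mem_top : z ∈ LinearMap.ker (crossLin a))
    refine ha ?_
    have h0 := hz (basisVec 0)
    have h1 := hz (basisVec 1)
    have e0 := crossQ_imJ a (basisVec 0)
    have e1 := crossQ_imK a (basisVec 0)
    have e2 := crossQ_imK a (basisVec 1)
    rw [h0] at e0 e1
    rw [h1] at e2
    ext i
    fin_cases i <;> simp [basisVec] at e0 e1 e2 ⊢ <;> linarith
  have h2 := Measure.addHaar_submodule (volume : Measure E) _ h
  exact compl_mem_ae_iff.mpr h2

lemma quasiMeasurePreserving_affine (c : E) {s : ℝ} (hs : s ≠ 0) :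
    Measure.QuasiMeasurePreserving (fun z : E => c + s • z) volume volume := by
  have h1 : Measure.QuasiMeasurePreserving (fun z : E => s • z) volume volume := by
    refine ⟨measurable_const_smul s, ?_⟩
    rw [Measure.map_addHaar_smul _ hs]
    exact Measure.smul_absolutelyContinuous
  exact (measurePreserving_add_left volume c).quasiMeasurePreserving.comp h1

lemma ae_crossQ_affine_ne_zero {a : E} (ha : a ≠ 0) (c : E) {s : ℝ} (hs : s ≠ 0) :
    ∀ᵐ z : E, crossQ a (c + s • z) ≠ 0 :=
  (quasiMeasurePreserving_affine c hs).ae (ae_crossQ_ne_zero ha)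

lemma ae_ne (a : E) : ∀ᵐ z : E, z ≠ a := compl_mem_ae_iff.mpr (by simp : volume ({a} : Set E) = 0)

/-! ### Weights -/

/-- A Peetre-type inequality; it allows decay to be redistributed among the variables of a
convolution. -/
lemma wt_mul_wt_le (k : ℕ) (a b : E) : wt k a * wt k b ≤ wt k (a + b) := by
  rw [wt, wt, wt, ← mul_inv, ← mul_pow]
  refine inv_anti₀ (by positivity) (pow_le_pow_left₀ (by positivity) ?_ k)
  nlinarith [norm_add_le a b, norm_nonneg a, norm_nonneg b,
    mul_nonneg (norm_nonneg a) (norm_nonneg b)]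

lemma wt_mul_wt_add_smul_le (k : ℕ) {s : ℝ} (hs : 0 ≤ s) (u q : E) :
    wt k u * wt k (q + s • u) ≤ (1 + s) ^ k * wt k q := by
  have h1 : 1 + ‖q‖ ≤ (1 + s) * ((1 + ‖u‖) * (1 + ‖q + s • u‖)) := by
    have h2 : ‖q‖ ≤ ‖q + s • u‖ + s * ‖u‖ := by
      calc ‖q‖ = ‖(q + s • u) - s • u‖ := by rw [add_sub_cancel_right]
        _ ≤ _ := norm_sub_le _ _
        _ = _ := by rw [norm_smul, Real.norm_of_nonneg hs]
    have := norm_nonneg u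
    have := norm_nonneg (q + s • u)
    have : 0 ≤ s * ‖q + s • u‖ := by positivity
    have : 0 ≤ (1 + s) * (‖u‖ * ‖q + s • u‖) := by positivity
    nlinarith
  have h3 := pow_le_pow_left₀ (by positivity) h1 k
  rw [mul_pow, mul_pow] at h3
  rw [wt, wt, wt, ← mul_inv, ← div_eq_mul_inv, le_div_iff₀ (by positivity), mul_comm,
    ← div_eq_mul_inv, div_le_iff₀ (by positivity)]
  exact h3

lemma wt_add (k l : ℕ) (x : E) : wt (k + l) x = wt k x * wt l x := by
  rw [wt, wt, wt, pow_add, mul_inv]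

/-! ### The star product in terms of partial Fourier transforms -/

/-- The phase of the triangle with midpoint data `q`, `u₁`, `u₂`. -/
def triTerm (ħ : ℝ) (q u₁ u₂ : E) : ℂ :=
  triPhase (q - (ħ / 2) • (u₁ + u₂)) (q + (ħ / 2) • (u₁ - u₂)) (q + (ħ / 2) • (u₁ + u₂))

/-- The integrand of the composition of two symbols. -/
def starIntegrand (ħ : ℝ) (f g : 𝓢(Phase, ℂ)) (q u₁ u₂ : E) : ℂ :=
  partialFt f (u₁, q - (ħ / 2) • u₂) * partialFt g (u₂, q + (ħ / 2) • u₁) * triTerm ħ q u₁ u₂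

/-- The partial Fourier transform of the star product. -/
def starH (ħ : ℝ) (f g : 𝓢(Phase, ℂ)) (z : Phase) : ℂ :=
  (((2 * Real.pi) ^ 3 : ℝ) : ℂ)⁻¹ * ∫ u, starIntegrand ħ f g z.2 u (z.1 - u)

/-- The star product. -/
def starFun (ħ : ℝ) (f g : 𝓢(Phase, ℂ)) (z : Phase) : ℂ :=
  (((2 * Real.pi) ^ 3 : ℝ) : ℂ)⁻¹ * ((((2 * Real.pi) ^ 3 : ℝ) : ℂ)⁻¹ *
    ∫ t : E × E, char (inner ℝ (t.1 + t.2) z.1) * starIntegrand ħ f g z.2 t.1 t.2)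

lemma stronglyMeasurable_triTerm (ħ : ℝ) :
    StronglyMeasurable fun t : E × E × E => triTerm ħ t.1 t.2.1 t.2.2 := by
  have hc : Continuous fun t : E × E × E => (t.1 - (ħ / 2) • (t.2.1 + t.2.2),
      t.1 + (ħ / 2) • (t.2.1 - t.2.2), t.1 + (ħ / 2) • (t.2.1 + t.2.2)) := by fun_prop
  have h := stronglyMeasurable_triPhase.comp_measurable hc.measurable
  unfold triTerm
  exact h

section

variable {ħ : ℝ} (f g : 𝓢(Phase, ℂ))

lemma stronglyMeasurable_starIntegrand :
    StronglyMeasurable fun t : E × E × E => starIntegrand ħ f g t.1 t.2.1 t.2.2 := by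
  have hf := continuous_partialFt f
  have hg := continuous_partialFt g
  have h1 : Continuous fun t : E × E × E => partialFt f (t.2.1, t.1 - (ħ / 2) • t.2.2) := by fun_prop
  have h2 : Continuous fun t : E × E × E => partialFt g (t.2.2, t.1 + (ħ / 2) • t.2.1) := by fun_prop
  exact (h1.stronglyMeasurable.mul h2.stronglyMeasurable).mul (stronglyMeasurable_triTerm ħ)

/-- Of the order `12` of decay in `u`, four are spent on recentring the weight of the second factor
from `q + ħu/2` to `q`. The remaining `8` leave enough for the substitution `u' = U - u` afterwards.
-/
lemma norm_starIntegrand_le (hħ : 0 < ħ) : ∃ C : ℝ, 0 ≤ C ∧ ∀ q u u' : E,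
    ‖starIntegrand ħ f g q u u'‖ ≤ C * (wt 8 u * (wt 4 u' * wt 4 q)) := by
  obtain ⟨C₁, c₁, h₁⟩ := norm_partialFt_le f 12
  obtain ⟨C₂, c₂, h₂⟩ := norm_partialFt_le g 4
  refine ⟨C₁ * C₂ * (1 + ħ / 2) ^ 4, by positivity, fun q u u' => ?_⟩
  rw [starIntegrand, norm_mul, norm_mul]
  have t1 : ‖partialFt f (u, q - (ħ / 2) • u')‖ ≤ C₁ * wt 12 u := by
    refine (h₁ _ _).trans (mul_le_mul_of_nonneg_left ?_ c₁)
    exact mul_le_of_le_one_right (wt_pos 12 u).le (wt_le_one _ _)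
  have t2 := h₂ u' (q + (ħ / 2) • u)
  have t3 := wt_mul_wt_add_smul_le 4 (by positivity : 0 ≤ ħ / 2) u q
  have t4 : ‖triTerm ħ q u u'‖ ≤ 1 := norm_triPhase_le _ _ _
  have t5 : wt 12 u = wt 8 u * wt 4 u := wt_add 8 4 u
  have p1 := wt_pos 8 u
  have p2 := wt_pos 4 u'
  have p3 := wt_pos 12 u
  have p4 := wt_pos 4 (q + (ħ / 2) • u)
  calc _ ≤ (C₁ * wt 12 u) * (C₂ * (wt 4 u' * wt 4 (q + (ħ / 2) • u))) * 1 :=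
        mul_le_mul (mul_le_mul t1 t2 (norm_nonneg _) (by positivity)) t4 (norm_nonneg _)
          (by positivity)
    _ = C₁ * C₂ * wt 8 u * wt 4 u' * (wt 4 u * wt 4 (q + (ħ / 2) • u)) := by rw [t5]; ring
    _ ≤ C₁ * C₂ * wt 8 u * wt 4 u' * ((1 + ħ / 2) ^ 4 * wt 4 q) :=
        mul_le_mul_of_nonneg_left t3 (by positivity)
    _ = _ := by ring

lemma norm_starIntegrand_sub_le (hħ : 0 < ħ) : ∃ C : ℝ, 0 ≤ C ∧ ∀ q u U : E,
    ‖starIntegrand ħ f g q u (U - u)‖ ≤ C * (wt 4 U * wt 4 q) * wt 4 u := by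
  obtain ⟨C, hC, h⟩ := norm_starIntegrand_le f g hħ
  refine ⟨C, hC, fun q u U => (h q u (U - u)).trans ?_⟩
  have h1 := wt_mul_wt_le 4 u (U - u)
  rw [add_sub_cancel] at h1
  have h2 : wt 8 u = wt 4 u * wt 4 u := wt_add 4 4 u
  have p1 := wt_pos 4 u
  have p2 := wt_pos 4 q
  calc _ = C * wt 4 q * wt 4 u * (wt 4 u * wt 4 (U - u)) := by rw [h2]; ring
    _ ≤ C * wt 4 q * wt 4 u * wt 4 U := mul_le_mul_of_nonneg_left h1 (by positivity)
    _ = _ := by ring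

lemma admissible_starH (hħ : 0 < ħ) : Admissible (starH ħ f g) := by
  constructor
  · have hc : Continuous fun t : Phase × E => (t.1.2, t.2, t.1.1 - t.2) := by fun_prop
    have hm := (stronglyMeasurable_starIntegrand (ħ := ħ) f g).comp_measurable hc.measurable
    simp only [Function.comp_def] at hm
    have hm2 : StronglyMeasurable fun z : Phase => ∫ u, starIntegrand ħ f g z.2 u (z.1 - u) :=
      hm.integral_prod_right
    exact hm2.const_mul _
  · obtain ⟨C, hC, h⟩ := norm_starIntegrand_sub_le f g hħ
    obtain ⟨A, hA⟩ : ∃ A, A = ∫ u, wt 4 u := ⟨_, rfl⟩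
    have hA0 : 0 ≤ A := hA ▸ integral_nonneg fun u => (wt_pos 4 u).le
    refine ⟨‖(((2 * Real.pi) ^ 3 : ℝ) : ℂ)⁻¹‖ * (C * A), by positivity, fun U q => ?_⟩
    rw [starH, norm_mul, mul_assoc]
    refine mul_le_mul_of_nonneg_left ?_ (norm_nonneg _)
    refine (norm_integral_le_of_norm_le ((integrable_wt le_rfl).const_mul (C * (wt 4 U * wt 4 q)))
      (Eventually.of_forall fun u => h q u U)).trans ?_
    rw [integral_const_mul, ← hA]
    exact le_of_eq (by ring)

lemma integrable_starIntegrand (hħ : 0 < ħ) (q : E) :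
    Integrable fun t : E × E => starIntegrand ħ f g q t.1 t.2 := by
  obtain ⟨C, hC, h⟩ := norm_starIntegrand_le f g hħ
  have hi : Integrable fun t : E × E => C * wt 4 q * (wt 8 t.1 * wt 4 t.2) :=
    ((integrable_wt (by norm_num)).mul_prod (integrable_wt le_rfl)).const_mul _
  have hc : Continuous fun t : E × E => (q, t.1, t.2) := by fun_prop
  exact hi.mono' ((stronglyMeasurable_starIntegrand f g).comp_measurable
    hc.measurable).aestronglyMeasurable
    (Eventually.of_forall fun t => (h q t.1 t.2).trans (le_of_eq (by ring)))

/-- Fubini and the substitution `U = u + u'` turn the twisted convolution in `starH` into the double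
integral of `starFun`. -/
lemma symbolOf_starH (hħ : 0 < ħ) (z : Phase) : symbolOf (starH ħ f g) z = starFun ħ f g z := by
  obtain ⟨p, q⟩ := z
  simp only [symbolOf, starFun]
  congr 1
  simp only [starH]
  rw [ift_const_mul]
  congr 1
  obtain ⟨C, hC, h⟩ := norm_starIntegrand_sub_le f g hħ
  have hi : Integrable (fun t : E × E => char (inner ℝ t.1 p) *
      starIntegrand ħ f g q t.2 (t.1 - t.2)) (volume.prod volume) := by
    have hb : Integrable (fun t : E × E => C * wt 4 q * (wt 4 t.1 * wt 4 t.2))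
        (volume.prod volume) :=
      ((integrable_wt le_rfl).mul_prod (integrable_wt le_rfl)).const_mul _
    have hc : Continuous fun t : E × E => char (inner ℝ t.1 p) :=
      continuous_char.comp (continuous_fst.inner continuous_const)
    have hc' : Continuous fun t : E × E => (q, t.2, t.1 - t.2) := by fun_prop
    have hm := (stronglyMeasurable_starIntegrand (ħ := ħ) f g).comp_measurable hc'.measurable
    refine hb.mono' (hc.stronglyMeasurable.mul hm).aestronglyMeasurable
      (Eventually.of_forall fun t => ?_)
    rw [norm_mul, norm_char, one_mul]
    exact (h q t.2 t.1).trans (le_of_eq (by ring))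
  have hi2 : Integrable (fun t : E × E => char (inner ℝ (t.1 + t.2) p) *
      starIntegrand ħ f g q t.1 t.2) (volume.prod volume) := by
    have hc : Continuous fun t : E × E => char (inner ℝ (t.1 + t.2) p) :=
      continuous_char.comp ((continuous_fst.add continuous_snd).inner continuous_const)
    exact (integrable_starIntegrand f g hħ q).bdd_mul (c := 1) hc.aestronglyMeasurable
      (Eventually.of_forall fun t => (norm_char _).le)
  refine Eq.trans ?_ (integral_prod _ hi2).symm
  have l1 : ift (fun U => ∫ u, starIntegrand ħ f g q u (U - u)) p =
      ∫ U, ∫ u, char (inner ℝ U p) * starIntegrand ħ f g q u (U - u) := by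
    rw [ift]
    exact integral_congr_ae (Eventually.of_forall fun U => (integral_const_mul _ _).symm)
  rw [l1, integral_integral_swap hi]
  refine integral_congr_ae (Eventually.of_forall fun u => ?_)
  simp only
  rw [← integral_sub_right_eq_self (fun u' => char (inner ℝ (u + u') p) *
    starIntegrand ħ f g q u u') u]
  simp only [add_sub_cancel]

end

/-! ### Composition of Weyl operators -/

/-- The map `c ↦ Re c + 𝔧(x) Im c`. -/
def embedLin (x : E) : ℂ →L[ℝ] ℍ[ℝ] :=
  LinearMap.toContinuousLinearMap
    { toFun := fun c => embedQ c x
      map_add' := fun c d => by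
        simp only [embedQ, quaternion_coe_eq, Complex.add_re, Complex.add_im]
        module
      map_smul' := fun s c => by
        simp only [embedQ, quaternion_coe_eq, Complex.smul_re, Complex.smul_im, smul_eq_mul,
          RingHom.id_apply]
        module }

lemma embedLin_apply (x : E) (c : ℂ) : embedLin x c = embedQ c x := rfl

section

variable {ħ : ℝ}

/-- The complex factor at `z` is carried to `y` by covariant constancy, and the two transports merge
at the price of a triangle phase. All factors then sit at `y`, where they multiply as complex
numbers. -/
lemma weylKernel_mul_weylKernel (F G : Phase → ℂ) {x y z : E} (hxy : crossQ x y ≠ 0)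
    (hxz : crossQ x z ≠ 0) (hyz : crossQ y z ≠ 0) :
    weylKernel ħ F (x, z) * weylKernel ħ G (z, y) =
      (((2 * Real.pi * ħ) ^ 3)⁻¹ * ((2 * Real.pi * ħ) ^ 3)⁻¹) • (uTrans x y *
        embedQ (F (midpoints ħ (x, z)) * G (midpoints ħ (z, y)) * triPhase x z y) y) := by
  have d₂₀ : dQuat y x ≠ 0 := dQuat_ne_zero_of_crossQ_ne_zero hxy
  have d₀₁ : dQuat x z ≠ 0 := dQuat_ne_zero_of_crossQ_ne_zero fun h => hxz (by
    rw [crossQ_swap, h, neg_zero])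
  have d₁₂ : dQuat z y ≠ 0 := dQuat_ne_zero_of_crossQ_ne_zero hyz
  have hy : y ≠ 0 := fun h => hxy (by
    rw [h, ← zero_smul ℝ (0 : E), crossQ_smul_right, zero_smul])
  rw [weylKernel, weylKernel, smul_mul_smul_comm]
  congr 1
  simp only
  rw [mul_assoc, ← mul_assoc (embedQ _ z), embedQ_mul_uTrans d₁₂, mul_assoc (uTrans z y),
    ← mul_assoc (uTrans x z), uTrans_mul_uTrans d₂₀ d₀₁ d₁₂, embedQ_mul _ _ hy, mul_assoc,
    embedQ_mul _ _ hy, mul_comm (triPhase x z y)]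

/-- With the intermediate point written as `x + ħu`, the two subsegments have directions `u` and `U
- u`, and their midpoints differ from `q` by `-ħ(U-u)/2` and `ħu/2`. -/
lemma starIntegrand_endpoints (hħ : 0 < ħ) (f g : 𝓢(Phase, ℂ)) (U q u : E) {x y : E}
    (hx : x = q - (ħ / 2) • U) (hy : y = q + (ħ / 2) • U) :
    partialFt f (midpoints ħ (x, x + ħ • u)) * partialFt g (midpoints ħ (x + ħ • u, y)) *
      triPhase x (x + ħ • u) y = starIntegrand ħ f g q u (U - u) := by
  have e1 : midpoints ħ (x, x + ħ • u) = (u, q - (ħ / 2) • (U - u)) := by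
    refine Prod.ext ?_ ?_
    · simp only [midpoints, add_sub_cancel_left]
      rw [smul_smul, inv_mul_cancel₀ hħ.ne', one_smul]
    · simp only [midpoints, hx]
      module
  have e2 : midpoints ħ (x + ħ • u, y) = (U - u, q + (ħ / 2) • u) := by
    refine Prod.ext ?_ ?_
    · simp only [midpoints]
      rw [hx, hy, show q + (ħ / 2) • U - (q - (ħ / 2) • U + ħ • u) = ħ • (U - u) by module,
        smul_smul, inv_mul_cancel₀ hħ.ne', one_smul]
    · simp only [midpoints, hx, hy]
      module
  have e3 : q - (ħ / 2) • (u + (U - u)) = x := by rw [hx]; module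
  have e4 : q + (ħ / 2) • (u - (U - u)) = x + ħ • u := by rw [hx]; module
  have e5 : q + (ħ / 2) • (u + (U - u)) = y := by rw [hy]; module
  rw [e1, e2, starIntegrand, triTerm, e3, e4, e5]

lemma integrable_starIntegrand_sub (hħ : 0 < ħ) (f g : 𝓢(Phase, ℂ)) (q U : E) :
    Integrable fun u => starIntegrand ħ f g q u (U - u) := by
  obtain ⟨C, hC, h⟩ := norm_starIntegrand_sub_le f g hħ
  have hc : Continuous fun u : E => (q, u, U - u) := by fun_prop
  have hm := (stronglyMeasurable_starIntegrand (ħ := ħ) f g).comp_measurable hc.measurable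
  simp only [Function.comp_def] at hm
  exact ((integrable_wt le_rfl).const_mul (C * (wt 4 U * wt 4 q))).mono' hm.aestronglyMeasurable
    (Eventually.of_forall fun u => h q u U)

lemma integral_weylKernel_mul (hħ : 0 < ħ) (f g : 𝓢(Phase, ℂ)) {x y : E}
    (hxy : crossQ x y ≠ 0) :
    ∫ z, weylKernel ħ (partialFt f) (x, z) * weylKernel ħ (partialFt g) (z, y) =
      weylKernel ħ (starH ħ f g) (x, y) := by
  have hpi := Real.pi_pos
  have hx : x ≠ 0 := fun h => hxy (by rw [h, ← zero_smul ℝ (0 : E), crossQ_smul_left, zero_smul])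
  have hy : y ≠ 0 := fun h => hxy (by
    rw [h, ← zero_smul ℝ (0 : E), crossQ_smul_right, zero_smul])
  obtain ⟨U, hU⟩ : ∃ U, U = (midpoints ħ (x, y)).1 := ⟨_, rfl⟩
  obtain ⟨q, hq⟩ : ∃ q, q = (midpoints ħ (x, y)).2 := ⟨_, rfl⟩
  have hm : midpoints ħ (x, y) = (U, q) := by rw [hU, hq]
  have he := endpoints_midpoints hħ.ne' (x, y)
  rw [hm] at he
  have hxe : x = q - (ħ / 2) • U := (congrArg Prod.fst he).symm
  have hye : y = q + (ħ / 2) • U := (congrArg Prod.snd he).symm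
  set k : E → ℂ := fun z => partialFt f (midpoints ħ (x, z)) * partialFt g (midpoints ħ (z, y)) *
    triPhase x z y with hk
  have hku : ∀ u, k (x + ħ • u) = starIntegrand ħ f g q u (U - u) := fun u =>
    starIntegrand_endpoints hħ f g U q u hxe hye
  have ik : Integrable k := by
    have h1 : Integrable fun u => k (x + ħ • u) := by
      simp_rw [hku]
      exact integrable_starIntegrand_sub hħ f g q U
    have h2 := (integrable_comp_smul_iff volume (fun z => k (x + z)) hħ.ne').mp h1
    have h3 := h2.comp_sub_right x
    simpa using h3
  -- The Jacobian `ħ³` of `z = x + ħu` turns the squared kernel constant `(2πħ)⁻⁶` into `(2πħ)⁻³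
  -- (2π)⁻³`, the constants of the kernel and of `starH`.
  have hIntg : ∫ z, k z = ((ħ ^ 3 : ℝ) : ℂ) * ∫ u, starIntegrand ħ f g q u (U - u) := by
    have h1 := Measure.integral_comp_smul (volume : Measure E) (fun z => k (x + z)) ħ
    rw [integral_add_left_eq_self, finrank_euclideanSpace_fin, abs_of_nonneg (by positivity)] at h1
    simp only [hku] at h1
    rw [h1, Complex.real_smul, ← mul_assoc, ← Complex.ofReal_mul, mul_inv_cancel₀ (by positivity),
      Complex.ofReal_one, one_mul]
  have hae : ∀ᵐ z, weylKernel ħ (partialFt f) (x, z) * weylKernel ħ (partialFt g) (z, y) =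
      (((2 * Real.pi * ħ) ^ 3)⁻¹ * ((2 * Real.pi * ħ) ^ 3)⁻¹) •
        (uTrans x y * embedLin y (k z)) := by
    filter_upwards [ae_crossQ_ne_zero hx, ae_crossQ_ne_zero hy] with z h1 h2
    rw [weylKernel_mul_weylKernel _ _ hxy h1 h2]
    rfl
  rw [integral_congr_ae hae, integral_smul,
    integral_const_mul_of_integrable ((embedLin y).integrable_comp ik),
    ContinuousLinearMap.integral_comp_comm _ ik, hIntg, weylKernel, hm, mul_smul]
  congr 1
  simp only [starH]
  rw [← mul_smul_comm, ← embedLin_apply, ← map_smul]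
  congr 2
  rw [Complex.real_smul, ← mul_assoc, ← Complex.ofReal_mul, ← Complex.ofReal_inv]
  congr 2
  field_simp

lemma weylOp_comp (hħ : 0 < ħ) (f g : 𝓢(Phase, ℂ)) :
    (weylOp hħ (admissible_partialFt f)).comp (weylOp hħ (admissible_partialFt g)) =
      weylOp hħ (admissible_starH f g hħ) := by
  refine kernelOp_comp _ _ _ _ _ _ ?_
  filter_upwards [ae_ne 0] with x hx
  filter_upwards [ae_crossQ_ne_zero hx] with y hy
  exact integral_weylKernel_mul hħ f g hy

theorem isWeylOperator_schwartz (hħ : 0 < ħ) (f : 𝓢(Phase, ℂ)) :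
    IsWeylOperator ħ f (weylOp hħ (admissible_partialFt f)) := by
  have h := isWeylOperator_weylOp hħ (admissible_partialFt f)
  rwa [funext (symbolOf_partialFt f)] at h

theorem isStarProduct_starFun (hħ : 0 < ħ) (f g : 𝓢(Phase, ℂ)) :
    IsStarProduct ħ f g (starFun ħ f g) := by
  refine ⟨_, _, isWeylOperator_schwartz hħ f, isWeylOperator_schwartz hħ g, ?_⟩
  rw [weylOp_comp hħ f g]
  have h := isWeylOperator_weylOp hħ (admissible_starH f g hħ)
  rwa [funext (symbolOf_starH f g hħ)] at h

/-! ### Continuity of the star product -/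

lemma continuous_crossQ_prod : Continuous fun t : E × E => crossQ t.1 t.2 := by
  have hc := continuous_coord
  unfold crossQ
  fun_prop

/-- Each of the three cross products equals `±ħ` times one that is affine in `u'` alone, with a
fixed first factor that is nonzero for almost every `u`. -/
lemma ae_generic_triangle (hħ : 0 < ħ) {q : E} (hq : q ≠ 0) : ∀ᵐ t : E × E,
    crossQ (q - (ħ / 2) • (t.1 + t.2)) (q + (ħ / 2) • (t.1 - t.2)) ≠ 0 ∧
    crossQ (q - (ħ / 2) • (t.1 + t.2)) (q + (ħ / 2) • (t.1 + t.2)) ≠ 0 ∧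
    crossQ (q + (ħ / 2) • (t.1 - t.2)) (q + (ħ / 2) • (t.1 + t.2)) ≠ 0 := by
  have hs : ħ / 2 ≠ 0 := by positivity
  have c0 : Continuous fun t : E × E => q - (ħ / 2) • (t.1 + t.2) := by fun_prop
  have c1 : Continuous fun t : E × E => q + (ħ / 2) • (t.1 - t.2) := by fun_prop
  have c2 : Continuous fun t : E × E => q + (ħ / 2) • (t.1 + t.2) := by fun_prop
  have o : ∀ {a b : E × E → E}, Continuous a → Continuous b →
      IsOpen {t : E × E | crossQ (a t) (b t) ≠ 0} := fun ha hb =>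
    isOpen_compl_singleton.preimage (continuous_crossQ_prod.comp (ha.prodMk hb))
  refine (Measure.ae_prod_iff_ae_ae (μ := (volume : Measure E)) (ν := (volume : Measure E))
    ((o c0 c1).inter ((o c0 c2).inter (o c1 c2))).measurableSet).mpr ?_
  filter_upwards [ae_ne 0, ae_ne ((-(ħ / 2)⁻¹) • q)] with u hu hu'
  have hqu : q + (ħ / 2) • u ≠ 0 := fun h => hu' (by
    rw [neg_smul, eq_neg_iff_add_eq_zero, ← smul_right_injective E hs |>.eq_iff]
    simp only [smul_add, smul_zero, smul_smul, mul_inv_cancel₀ hs, one_smul]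
    rw [add_comm, h])
  filter_upwards [ae_crossQ_affine_ne_zero hu q (neg_ne_zero.mpr hs),
    ae_crossQ_affine_ne_zero hq u one_ne_zero, ae_crossQ_ne_zero hqu] with u' h1 h2 h3
  have s1 : crossQ (q - (ħ / 2) • (u + u')) (q + (ħ / 2) • (u - u')) =
      (-ħ) • crossQ u (q + (-(ħ / 2)) • u') := by
    ext <;> simp [crossQ_re, crossQ_imI, crossQ_imJ, crossQ_imK] <;> ring
  have s2 : crossQ (q - (ħ / 2) • (u + u')) (q + (ħ / 2) • (u + u')) =
      ħ • crossQ q (u + (1 : ℝ) • u') := by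
    ext <;> simp [crossQ_re, crossQ_imI, crossQ_imJ, crossQ_imK] <;> ring
  have s3 : crossQ (q + (ħ / 2) • (u - u')) (q + (ħ / 2) • (u + u')) =
      ħ • crossQ (q + (ħ / 2) • u) u' := by
    ext <;> simp [crossQ_re, crossQ_imI, crossQ_imJ, crossQ_imK] <;> ring
  change crossQ (q - (ħ / 2) • (u + u')) (q + (ħ / 2) • (u - u')) ≠ 0 ∧
    crossQ (q - (ħ / 2) • (u + u')) (q + (ħ / 2) • (u + u')) ≠ 0 ∧
    crossQ (q + (ħ / 2) • (u - u')) (q + (ħ / 2) • (u + u')) ≠ 0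
  rw [s1, s2, s3]
  exact ⟨smul_ne_zero (neg_ne_zero.mpr hħ.ne') h1, smul_ne_zero hħ.ne' h2, smul_ne_zero hħ.ne' h3⟩

/-- Dominated convergence: the triangle phase is discontinuous, but for almost every `(u, u')` it is
continuous at the given point. This is where `q ≠ 0` is needed. -/
lemma continuousOn_starFun (hħ : 0 < ħ) (f g : 𝓢(Phase, ℂ)) :
    ContinuousOn (starFun ħ f g) regular := by
  intro z₀ hz₀
  refine ContinuousAt.continuousWithinAt ?_
  obtain ⟨C, hC, h⟩ := norm_starIntegrand_le f g hħ
  refine continuousAt_const.mul (continuousAt_const.mul ?_)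
  refine continuousAt_of_dominated (bound := fun t : E × E => C * (wt 8 t.1 * wt 4 t.2)) ?_ ?_ ?_ ?_
  · refine Eventually.of_forall fun z => ?_
    have hc : Continuous fun t : E × E => char (inner ℝ (t.1 + t.2) z.1) :=
      continuous_char.comp ((continuous_fst.add continuous_snd).inner continuous_const)
    exact hc.aestronglyMeasurable.mul (integrable_starIntegrand f g hħ z.2).aestronglyMeasurable
  · refine Eventually.of_forall fun z => Eventually.of_forall fun t => ?_
    rw [norm_mul, norm_char, one_mul]
    refine (h z.2 t.1 t.2).trans (mul_le_mul_of_nonneg_left ?_ hC)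
    refine mul_le_mul_of_nonneg_left ?_ (wt_pos 8 t.1).le
    exact mul_le_of_le_one_right (wt_pos 4 t.2).le (wt_le_one 4 z.2)
  · exact ((integrable_wt (by norm_num)).mul_prod (integrable_wt le_rfl)).const_mul C
  · filter_upwards [ae_generic_triangle hħ hz₀] with t ht
    have hf := continuous_partialFt f
    have hg := continuous_partialFt g
    have c1 : Continuous fun z : Phase => char (inner ℝ (t.1 + t.2) z.1) :=
      continuous_char.comp (continuous_const.inner continuous_fst)
    have c2 : Continuous fun z : Phase => partialFt f (t.1, z.2 - (ħ / 2) • t.2) := by fun_prop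
    have c3 : Continuous fun z : Phase => partialFt g (t.2, z.2 + (ħ / 2) • t.1) := by fun_prop
    have c4 : Continuous fun z : Phase => (z.2 - (ħ / 2) • (t.1 + t.2),
      z.2 + (ħ / 2) • (t.1 - t.2), z.2 + (ħ / 2) • (t.1 + t.2)) := by fun_prop
    have c5 : ContinuousAt (fun z : Phase => triTerm ħ z.2 t.1 t.2) z₀ := by
      have := ContinuousAt.comp (f := fun z : Phase => (z.2 - (ħ / 2) • (t.1 + t.2),
        z.2 + (ħ / 2) • (t.1 - t.2), z.2 + (ħ / 2) • (t.1 + t.2)))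
        (continuousAt_triPhase ht.1 ht.2.1 ht.2.2) c4.continuousAt
      unfold triTerm
      exact this
    unfold starIntegrand
    exact c1.continuousAt.mul ((c2.continuousAt.mul c3.continuousAt).mul c5)

end

/-! ### Derivatives of inverse Fourier transforms -/

/-- Continuous functions of rapid decay on phase space. -/
def Decays (a : Phase → ℂ) : Prop :=
  Continuous a ∧ ∀ k : ℕ, ∃ C : ℝ, 0 ≤ C ∧ ∀ u v : E, ‖a (u, v)‖ ≤ C * (wt k u * wt k v)

lemma decays_schwartz (f : 𝓢(Phase, ℂ)) : Decays f := ⟨f.continuous, schwartz_decay f⟩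

lemma decays_fourierPh (f : 𝓢(Phase, ℂ)) : Decays (fourierPh f) := by
  obtain ⟨ψ, hψ⟩ := exists_schwartz_eq_fourierPh f
  have h : fourierPh f = ψ := funext fun w => (hψ w).symm
  rw [h]
  exact decays_schwartz ψ

lemma one_add_norm_mul_wt (k : ℕ) (x : E) : (1 + ‖x‖) * wt (k + 1) x = wt k x := by
  rw [wt, wt, pow_succ]
  have : 1 + ‖x‖ ≠ 0 := by positivity
  field_simp

namespace Decays

variable {a : Phase → ℂ}

lemma const_mul (ha : Decays a) (c : ℂ) : Decays fun w => c * a w := by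
  refine ⟨continuous_const.mul ha.1, fun k => ?_⟩
  obtain ⟨C, hC, h⟩ := ha.2 k
  refine ⟨‖c‖ * C, by positivity, fun u v => ?_⟩
  rw [norm_mul, mul_assoc]
  exact mul_le_mul_of_nonneg_left (h u v) (norm_nonneg _)

lemma mul_of_linear_growth (ha : Decays a) {m : Phase → ℂ} (hm : Continuous m)
    (hb : ∀ u v : E, ‖m (u, v)‖ ≤ (1 + ‖u‖) * (1 + ‖v‖)) : Decays fun w => m w * a w := by
  refine ⟨hm.mul ha.1, fun k => ?_⟩
  obtain ⟨C, hC, h⟩ := ha.2 (k + 1)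
  refine ⟨C, hC, fun u v => ?_⟩
  rw [norm_mul, ← one_add_norm_mul_wt k u, ← one_add_norm_mul_wt k v]
  refine (mul_le_mul (hb u v) (h u v) (norm_nonneg _) (by positivity)).trans (le_of_eq (by ring))

lemma norm_coord_le (x : E) (i : Fin 3) : ‖(x i : ℂ)‖ ≤ ‖x‖ := by
  rw [Complex.norm_real]
  exact PiLp.norm_apply_le x i

lemma coord_fst (ha : Decays a) (i : Fin 3) :
    Decays fun w => Complex.I * (w.1 i : ℂ) * a w := by
  refine ha.mul_of_linear_growth (by fun_prop) fun u v => ?_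
  rw [norm_mul, Complex.norm_I, one_mul]
  nlinarith [norm_coord_le u i, norm_nonneg u, norm_nonneg v,
    mul_nonneg (norm_nonneg u) (norm_nonneg v)]

lemma coord_snd (ha : Decays a) (i : Fin 3) :
    Decays fun w => Complex.I * (w.2 i : ℂ) * a w := by
  refine ha.mul_of_linear_growth (by fun_prop) fun u v => ?_
  rw [norm_mul, Complex.norm_I, one_mul]
  nlinarith [norm_coord_le v i, norm_nonneg u, norm_nonneg v,
    mul_nonneg (norm_nonneg u) (norm_nonneg v)]

lemma integrable (ha : Decays a) : Integrable a :=
  Admissible.integrable ⟨ha.1.stronglyMeasurable, ha.2 4⟩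

lemma integrable_norm_mul (ha : Decays a) : Integrable fun w : Phase => ‖w‖ * ‖a w‖ := by
  have h1 := (ha.mul_of_linear_growth (m := fun w => ((‖w‖ : ℝ) : ℂ)) (by fun_prop)
    fun u v => by
      rw [Complex.norm_real, norm_norm, Prod.norm_mk]
      refine max_le ?_ ?_ <;>
      nlinarith [norm_nonneg u, norm_nonneg v, mul_nonneg (norm_nonneg u) (norm_nonneg v)]).integrable
  refine h1.norm.congr (Eventually.of_forall fun w => ?_)
  simp

end Decays

/-- The pairing `u · p + v · q`. -/
def phasePairing : Phase →L[ℝ] Phase →L[ℝ] ℝ :=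
  (innerSL ℝ).bilinearComp (ContinuousLinearMap.fst ℝ E E) (ContinuousLinearMap.fst ℝ E E) +
    (innerSL ℝ).bilinearComp (ContinuousLinearMap.snd ℝ E E) (ContinuousLinearMap.snd ℝ E E)

lemma phasePairing_apply (w z : Phase) :
    phasePairing w z = inner ℝ w.1 z.1 + inner ℝ w.2 z.2 := rfl

/-- The unnormalized inverse Fourier transform on phase space. -/
def invFt (a : Phase → ℂ) (z : Phase) : ℂ := ∫ w, char (phasePairing w z) * a w

lemma invFt_eq_fourierIntegral (a : Phase → ℂ) : invFt a =
    VectorFourier.fourierIntegral Real.fourierChar volume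
      (ContinuousLinearMap.toLinearMap₁₂ (-((2 * Real.pi)⁻¹ • phasePairing))) a := by
  funext z
  rw [invFt, VectorFourier.fourierIntegral]
  refine integral_congr_ae (Eventually.of_forall fun w => ?_)
  have h1 : -(ContinuousLinearMap.toLinearMap₁₂ (-((2 * Real.pi)⁻¹ • phasePairing)) w) z =
      (2 * Real.pi)⁻¹ * phasePairing w z := by
    simp
  simp only
  rw [h1, Circle.smul_def, Real.fourierChar_apply, smul_eq_mul, ← mul_assoc,
    mul_inv_cancel₀ two_pi_ne_zero, one_mul]
  rfl

/-- Differentiation under the integral sign, with `invFt` rewritten as a Fourier integral for the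
pairing rescaled by `-1/(2π)`. -/
lemma fderiv_invFt {a : Phase → ℂ} (ha : Decays a) (z ζ : Phase) : fderiv ℝ (invFt a) z ζ =
    invFt (fun w => Complex.I * (phasePairing w ζ : ℂ) * a w) z := by
  have h := VectorFourier.hasFDerivAt_fourierIntegral (-((2 * Real.pi)⁻¹ • phasePairing))
    ha.integrable ha.integrable_norm_mul z
  rw [← invFt_eq_fourierIntegral] at h
  rw [h.fderiv, VectorFourier.fourierIntegral_continuousLinearMap_apply Real.continuous_fourierChar,
    ← invFt_eq_fourierIntegral]
  · congr 1
    funext w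
    rw [VectorFourier.fourierSMulRight_apply]
    have hpi : (Real.pi : ℂ) ≠ 0 := by exact_mod_cast Real.pi_ne_zero
    simp only [_root_.neg_apply, _root_.smul_apply, smul_eq_mul,
      Complex.real_smul, neg_smul]
    push_cast
    field_simp
  · refine (ha.integrable_norm_mul.const_mul
      (2 * Real.pi * ‖-((2 * Real.pi)⁻¹ • phasePairing)‖)).mono'
      ha.integrable.1.fourierSMulRight (Eventually.of_forall fun w => ?_)
    refine (VectorFourier.norm_fourierSMulRight_le _ _ _).trans (le_of_eq (by ring))

lemma inner_basisVec (x : E) (i : Fin 3) : inner ℝ x (basisVec i) = x i := by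
  simp [basisVec, EuclideanSpace.inner_single_right]

lemma dP_invFt {a : Phase → ℂ} (ha : Decays a) (i : Fin 3) :
    dP i (invFt a) = invFt fun w => Complex.I * (w.1 i : ℂ) * a w := by
  funext z
  rw [dP, dirDeriv, fderiv_invFt ha]
  simp only [phasePairing_apply, inner_basisVec, inner_zero_right, add_zero]

lemma dQ_invFt {a : Phase → ℂ} (ha : Decays a) (i : Fin 3) :
    dQ i (invFt a) = invFt fun w => Complex.I * (w.2 i : ℂ) * a w := by
  funext z
  rw [dQ, dirDeriv, fderiv_invFt ha]
  simp only [phasePairing_apply, inner_basisVec, inner_zero_right, zero_add]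

lemma iterate_dP_invFt (i : Fin 3) (n : ℕ) {a : Phase → ℂ} (ha : Decays a) :
    Decays (fun w => (Complex.I * (w.1 i : ℂ)) ^ n * a w) ∧
      (dP i)^[n] (invFt a) = invFt fun w => (Complex.I * (w.1 i : ℂ)) ^ n * a w := by
  induction n with
  | zero => simpa using ha
  | succ n ih =>
    have h : (fun w : Phase => (Complex.I * (w.1 i : ℂ)) ^ (n + 1) * a w) =
        fun w => Complex.I * (w.1 i : ℂ) * ((Complex.I * (w.1 i : ℂ)) ^ n * a w) := by
      funext w
      ring
    rw [h]
    exact ⟨ih.1.coord_fst i, by rw [Function.iterate_succ_apply', ih.2, dP_invFt ih.1]⟩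

lemma iterate_dQ_invFt (i : Fin 3) (n : ℕ) {a : Phase → ℂ} (ha : Decays a) :
    Decays (fun w => (Complex.I * (w.2 i : ℂ)) ^ n * a w) ∧
      (dQ i)^[n] (invFt a) = invFt fun w => (Complex.I * (w.2 i : ℂ)) ^ n * a w := by
  induction n with
  | zero => simpa using ha
  | succ n ih =>
    have h : (fun w : Phase => (Complex.I * (w.2 i : ℂ)) ^ (n + 1) * a w) =
        fun w => Complex.I * (w.2 i : ℂ) * ((Complex.I * (w.2 i : ℂ)) ^ n * a w) := by
      funext w
      ring
    rw [h]
    exact ⟨ih.1.coord_snd i, by rw [Function.iterate_succ_apply', ih.2, dQ_invFt ih.1]⟩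

lemma multiDeriv_invFt (α γ : Fin 3 → ℕ) {a : Phase → ℂ} (ha : Decays a) :
    Decays (fun w => (∏ i, (Complex.I * (w.1 i : ℂ)) ^ α i) *
      (∏ i, (Complex.I * (w.2 i : ℂ)) ^ γ i) * a w) ∧
    multiDeriv α γ (invFt a) = invFt fun w => (∏ i, (Complex.I * (w.1 i : ℂ)) ^ α i) *
      (∏ i, (Complex.I * (w.2 i : ℂ)) ^ γ i) * a w := by
  have h1 := iterate_dQ_invFt 2 (γ 2) ha
  have h2 := iterate_dQ_invFt 1 (γ 1) h1.1
  have h3 := iterate_dQ_invFt 0 (γ 0) h2.1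
  have h4 := iterate_dP_invFt 2 (α 2) h3.1
  have h5 := iterate_dP_invFt 1 (α 1) h4.1
  have h6 := iterate_dP_invFt 0 (α 0) h5.1
  constructor
  · refine Eq.mpr (congrArg Decays ?_) h6.1
    funext w
    simp only [Fin.prod_univ_three, mul_assoc]
  · rw [multiDeriv, h1.2, h2.2, h3.2, h4.2, h5.2, h6.2]
    congr 1
    funext w
    simp only [Fin.prod_univ_three, mul_assoc]

/-- Fourier inversion on phase space. -/
lemma eq_invFt (f : 𝓢(Phase, ℂ)) :
    (f : Phase → ℂ) = invFt fun w => (((2 * Real.pi) ^ 3 : ℝ) : ℂ)⁻¹ * fourierPh f w := by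
  funext z
  obtain ⟨p, q⟩ := z
  rw [← symbolOf_partialFt, symbolOf, ift]
  have hi : Integrable (fun w : E × E => char (phasePairing w (p, q)) * fourierPh f w)
      (volume.prod volume) := by
    have hc : Continuous fun w : Phase => char (phasePairing w (p, q)) := by
      have := continuous_char
      fun_prop
    exact (decays_fourierPh f).integrable.bdd_mul (c := 1) hc.aestronglyMeasurable
      (Eventually.of_forall fun w => (norm_char _).le)
  have h1 : invFt (fun w => (((2 * Real.pi) ^ 3 : ℝ) : ℂ)⁻¹ * fourierPh f w) (p, q) =
      (((2 * Real.pi) ^ 3 : ℝ) : ℂ)⁻¹ * ∫ w, char (phasePairing w (p, q)) * fourierPh f w := by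
    rw [invFt, ← integral_const_mul]
    exact integral_congr_ae (Eventually.of_forall fun w => by simp only; ring)
  rw [h1]
  congr 1
  refine Eq.trans ?_ (integral_prod _ hi).symm
  refine integral_congr_ae (Eventually.of_forall fun u => ?_)
  simp only [partialFt_eq_ift, ift]
  rw [← integral_const_mul]
  refine integral_congr_ae (Eventually.of_forall fun v => ?_)
  simp only [phasePairing_apply, char_add]
  ring

/-! ### Bidifferential operators as Fourier multipliers -/

/-- The plane wave expansion of a bilinear Fourier multiplier. -/
def pairInt (a b : Phase → ℂ) (m : Phase → Phase → ℂ) (z : Phase) : ℂ :=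
  ∫ t : Phase × Phase, (char (phasePairing t.1 z) * a t.1) * (char (phasePairing t.2 z) * b t.2) *
    m t.1 t.2

lemma continuous_char_phasePairing (z : Phase) : Continuous fun w => char (phasePairing w z) := by
  have := continuous_char
  fun_prop

lemma Decays.integrable_char_mul {a : Phase → ℂ} (ha : Decays a) (z : Phase) :
    Integrable fun w => char (phasePairing w z) * a w :=
  ha.integrable.bdd_mul (c := 1) (continuous_char_phasePairing z).aestronglyMeasurable
    (Eventually.of_forall fun _ => (norm_char _).le)

lemma one_add_norm_pow_mul_wt (k K : ℕ) (x : E) : (1 + ‖x‖) ^ K * wt (k + K) x = wt k x := by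
  rw [wt, wt, pow_add]
  have : 1 + ‖x‖ ≠ 0 := by positivity
  field_simp

/-- The constant `A` depends only on the two functions and the growth exponent. Hence a multiplier
bound carrying `ħ^(N+1)` passes directly to the integral, at every point `z`. -/
lemma pairInt_bound {a b : Phase → ℂ} (ha : Decays a) (hb : Decays b) (K : ℕ) :
    ∃ A : ℝ, 0 ≤ A ∧ ∀ (m : Phase → Phase → ℂ) (z : Phase) (C : ℝ), 0 ≤ C →
      (StronglyMeasurable fun t : Phase × Phase => m t.1 t.2) →
      (∀ w w' : Phase, ‖m w w'‖ ≤ C * (1 + ‖w.1‖ + ‖w.2‖ + ‖w'.1‖ + ‖w'.2‖) ^ K) →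
      (Integrable fun t : Phase × Phase => (char (phasePairing t.1 z) * a t.1) *
        (char (phasePairing t.2 z) * b t.2) * m t.1 t.2) ∧ ‖pairInt a b m z‖ ≤ C * A := by
  obtain ⟨C₁, c₁, h₁⟩ := ha.2 (4 + K)
  obtain ⟨C₂, c₂, h₂⟩ := hb.2 (4 + K)
  set B : Phase × Phase → ℝ := fun t =>
    (C₁ * (wt 4 t.1.1 * wt 4 t.1.2)) * (C₂ * (wt 4 t.2.1 * wt 4 t.2.2)) with hB
  have iw : Integrable fun w : E × E => wt 4 w.1 * wt 4 w.2 :=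
    (integrable_wt le_rfl).mul_prod (integrable_wt le_rfl)
  have iB : Integrable B := (iw.const_mul C₁).mul_prod (iw.const_mul C₂)
  have hB0 : ∀ t, 0 ≤ B t := fun t => by
    have := wt_pos 4 t.1.1
    have := wt_pos 4 t.1.2
    have := wt_pos 4 t.2.1
    have := wt_pos 4 t.2.2
    simp only [hB]
    positivity
  refine ⟨∫ t, B t, integral_nonneg hB0, fun m z C hC mm hm => ?_⟩
  have hbd : ∀ t : Phase × Phase, ‖(char (phasePairing t.1 z) * a t.1) *
      (char (phasePairing t.2 z) * b t.2) * m t.1 t.2‖ ≤ C * B t := by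
    rintro ⟨⟨u, v⟩, ⟨u', v'⟩⟩
    simp only [norm_mul, norm_char, one_mul, hB]
    have e1 := h₁ u v
    have e2 := h₂ u' v'
    have e3 : (1 + ‖u‖ + ‖v‖ + ‖u'‖ + ‖v'‖) ^ K ≤
        ((1 + ‖u‖) ^ K * (1 + ‖v‖) ^ K) * ((1 + ‖u'‖) ^ K * (1 + ‖v'‖) ^ K) := by
      rw [← mul_pow, ← mul_pow, ← mul_pow]
      refine pow_le_pow_left₀ (by positivity) ?_ K
      have n1 := norm_nonneg u
      have n2 := norm_nonneg v
      have n3 := norm_nonneg u'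
      have n4 := norm_nonneg v'
      have k1 : 1 + ‖u‖ + ‖v‖ ≤ (1 + ‖u‖) * (1 + ‖v‖) := by nlinarith
      have k2 : 1 + ‖u'‖ + ‖v'‖ ≤ (1 + ‖u'‖) * (1 + ‖v'‖) := by nlinarith
      calc 1 + ‖u‖ + ‖v‖ + ‖u'‖ + ‖v'‖ ≤ (1 + ‖u‖ + ‖v‖) * (1 + ‖u'‖ + ‖v'‖) := by nlinarith
        _ ≤ _ := mul_le_mul k1 k2 (by positivity) (by positivity)
    have e4 := (hm (u, v) (u', v')).trans (mul_le_mul_of_nonneg_left e3 hC)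
    have p1 := wt_pos (4 + K) u
    have p2 := wt_pos (4 + K) v
    have p3 := wt_pos (4 + K) u'
    have p4 := wt_pos (4 + K) v'
    refine (mul_le_mul (mul_le_mul e1 e2 (norm_nonneg _) (by positivity)) e4 (norm_nonneg _)
      (by positivity)).trans (le_of_eq ?_)
    rw [← one_add_norm_pow_mul_wt 4 K u, ← one_add_norm_pow_mul_wt 4 K v,
      ← one_add_norm_pow_mul_wt 4 K u', ← one_add_norm_pow_mul_wt 4 K v']
    ring
  constructor
  · refine (iB.const_mul C).mono' ?_ (Eventually.of_forall hbd)
    have c1 := ((continuous_char_phasePairing z).mul ha.1).comp (continuous_fst (X := Phase)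
      (Y := Phase))
    have c2 := ((continuous_char_phasePairing z).mul hb.1).comp (continuous_snd (X := Phase)
      (Y := Phase))
    exact ((c1.mul c2).stronglyMeasurable.mul mm).aestronglyMeasurable
  · refine (norm_integral_le_of_norm_le (iB.const_mul C) (Eventually.of_forall hbd)).trans
      (le_of_eq (integral_const_mul _ _))

lemma neg_I_pow_mul_monomial (m : Fin 4 × Fin 3 →₀ ℕ) (w w' : Phase) :
    (-Complex.I) ^ m.degree *
      (((∏ i, (Complex.I * (w.1 i : ℂ)) ^ m (0, i)) * (∏ i, (Complex.I * (w.2 i : ℂ)) ^ m (1, i))) *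
      ((∏ i, (Complex.I * (w'.1 i : ℂ)) ^ m (2, i)) *
        (∏ i, (Complex.I * (w'.2 i : ℂ)) ^ m (3, i)))) =
      ∏ s : Fin 4 × Fin 3, (((![w.1, w.2, w'.1, w'.2] s.1) s.2 : ℝ) : ℂ) ^ m s := by
  rw [Finsupp.degree_eq_sum, ← Finset.prod_pow_eq_pow_sum, Fintype.prod_prod_type,
    Fintype.prod_prod_type, Fin.prod_univ_four, Fin.prod_univ_four]
  have e : ∀ (x : E) (n : Fin 3 → ℕ), (∏ i, (-Complex.I) ^ n i) *
      ∏ i, (Complex.I * (x i : ℂ)) ^ n i = ∏ i, ((x i : ℝ) : ℂ) ^ n i := fun x n => by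
    rw [← Finset.prod_mul_distrib]
    refine Finset.prod_congr rfl fun i _ => ?_
    rw [← mul_pow, ← mul_assoc, neg_mul, Complex.I_mul_I, neg_neg, one_mul]
  have h0 := e w.1 fun i => m (0, i)
  have h1 := e w.2 fun i => m (1, i)
  have h2 := e w'.1 fun i => m (2, i)
  have h3 := e w'.2 fun i => m (3, i)
  simp only [Matrix.cons_val]
  rw [← h0, ← h1, ← h2, ← h3]
  ring

/-- Each derivative brings down `i` times a frequency, which the factor `-i` built into `bidiff`
cancels, so the multiplier is the polynomial itself. -/
lemma bidiff_invFt {a b : Phase → ℂ} (ha : Decays a) (hb : Decays b) (P : SymbolPoly ℂ)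
    (z : Phase) : bidiff P (invFt a) (invFt b) z =
      pairInt a b (fun w w' => evalSymbol P w.1 w.2 w'.1 w'.2) z := by
  set Aw : (Fin 4 × Fin 3 →₀ ℕ) → Phase → ℂ := fun m w =>
    (∏ i, (Complex.I * (w.1 i : ℂ)) ^ m (0, i)) * (∏ i, (Complex.I * (w.2 i : ℂ)) ^ m (1, i)) * a w
    with hA
  set Bw : (Fin 4 × Fin 3 →₀ ℕ) → Phase → ℂ := fun m w =>
    (∏ i, (Complex.I * (w.1 i : ℂ)) ^ m (2, i)) * (∏ i, (Complex.I * (w.2 i : ℂ)) ^ m (3, i)) * b w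
    with hBw
  have dA : ∀ m, Decays (Aw m) := fun m =>
    (multiDeriv_invFt (fun i => m (0, i)) (fun i => m (1, i)) ha).1
  have dB : ∀ m, Decays (Bw m) := fun m =>
    (multiDeriv_invFt (fun i => m (2, i)) (fun i => m (3, i)) hb).1
  have l1 : bidiff P (invFt a) (invFt b) z = ∑ m ∈ P.support, ∫ t : Phase × Phase,
      P.coeff m * (-Complex.I) ^ m.degree * ((char (phasePairing t.1 z) * Aw m t.1) *
        (char (phasePairing t.2 z) * Bw m t.2)) := by
    refine Finset.sum_congr rfl fun m _ => ?_
    rw [(multiDeriv_invFt (fun i => m (0, i)) (fun i => m (1, i)) ha).2,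
      (multiDeriv_invFt (fun i => m (2, i)) (fun i => m (3, i)) hb).2, integral_const_mul, mul_assoc]
    congr 1
    exact (integral_prod_mul (μ := (volume : Measure Phase)) (ν := (volume : Measure Phase))
      (fun w => char (phasePairing w z) * Aw m w) (fun w => char (phasePairing w z) * Bw m w)).symm
  rw [l1, ← integral_finsetSum]
  · refine integral_congr_ae (Eventually.of_forall fun t => ?_)
    simp only
    rw [evalSymbol, MvPolynomial.eval_eq', Finset.mul_sum]
    refine Finset.sum_congr rfl fun m _ => ?_
    rw [← neg_I_pow_mul_monomial m t.1 t.2]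
    simp only [hA, hBw]
    ring
  · intro m _
    exact (((dA m).integrable_char_mul z).mul_prod ((dB m).integrable_char_mul z)).const_mul _

/-! ### The star product as a Fourier multiplier -/

/-- The interchange `((u, v), (u', v')) ↦ ((u, u'), (v, v'))`. -/
def interchange : (E × E) × (E × E) ≃ᵐ (E × E) × (E × E) where
  toFun t := ((t.1.1, t.2.1), (t.1.2, t.2.2))
  invFun t := ((t.1.1, t.2.1), (t.1.2, t.2.2))
  left_inv _ := rfl
  right_inv _ := rfl
  measurable_toFun := by
    change Measurable fun t : (E × E) × (E × E) => ((t.1.1, t.2.1), (t.1.2, t.2.2))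
    fun_prop
  measurable_invFun := by
    change Measurable fun t : (E × E) × (E × E) => ((t.1.1, t.2.1), (t.1.2, t.2.2))
    fun_prop

/-- A composition of associators and one swap. -/
lemma measurePreserving_interchange : MeasurePreserving interchange
    (volume : Measure ((E × E) × (E × E))) (volume : Measure ((E × E) × (E × E))) := by
  have h1 := measurePreserving_prodAssoc (volume : Measure E) (volume : Measure E)
    ((volume : Measure E).prod (volume : Measure E))
  have h2 := (measurePreserving_prodAssoc (volume : Measure E) (volume : Measure E)
    (volume : Measure E))
  have h2' := h2.symm
  have hs : MeasurePreserving (Prod.swap : E × E → E × E) (volume.prod volume)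
    (volume.prod volume) := Measure.measurePreserving_swap
  have hid := MeasurePreserving.id (volume : Measure E)
  have h3 := h2.comp ((hs.prod hid).comp h2')
  exact h1.symm.comp ((hid.prod h3).comp h1)

lemma stronglyMeasurable_multiplier (ħ : ℝ) (q : E) : StronglyMeasurable fun t : Phase × Phase =>
    multiplier ħ q t.1.1 t.1.2 t.2.1 t.2.2 := by
  have hc : Continuous fun t : Phase × Phase => (q, t.1.1, t.2.1) := by fun_prop
  have h1 := (stronglyMeasurable_triTerm ħ).comp_measurable hc.measurable
  simp only [Function.comp_def] at h1
  have h2 : Continuous fun t : Phase × Phase => char (ħ / 2 * (inner ℝ t.1.1 t.2.2 -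
      inner ℝ t.1.2 t.2.1)) := by
    have c1 : Continuous fun t : Phase × Phase => t.1.1 := by fun_prop
    have c2 : Continuous fun t : Phase × Phase => t.1.2 := by fun_prop
    have c3 : Continuous fun t : Phase × Phase => t.2.1 := by fun_prop
    have c4 : Continuous fun t : Phase × Phase => t.2.2 := by fun_prop
    exact continuous_char.comp (continuous_const.mul ((c1.inner c4).sub (c2.inner c3)))
  exact h1.mul h2.stronglyMeasurable

lemma norm_multiplier_le (ħ : ℝ) (q u v u' v' : E) : ‖multiplier ħ q u v u' v'‖ ≤ 1 := by
  rw [multiplier, norm_mul, Complex.norm_exp_ofReal_mul_I, mul_one]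
  exact norm_triPhase_le _ _ _

/-- Writing both partial transforms as inverse transforms in `v` and `v'`, the shifts of `q` by
`-ħu'/2` and `ħu/2` produce exactly the symplectic phase of `multiplier`. -/
lemma starFun_eq_pairInt (ħ : ℝ) (f g : 𝓢(Phase, ℂ)) (z : Phase) : starFun ħ f g z =
    pairInt (fun w => (((2 * Real.pi) ^ 3 : ℝ) : ℂ)⁻¹ * fourierPh f w)
      (fun w => (((2 * Real.pi) ^ 3 : ℝ) : ℂ)⁻¹ * fourierPh g w)
      (fun w w' => multiplier ħ z.2 w.1 w.2 w'.1 w'.2) z := by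
  obtain ⟨p, q⟩ := z
  obtain ⟨c, hc⟩ : ∃ c, c = (((2 * Real.pi) ^ 3 : ℝ) : ℂ)⁻¹ := ⟨_, rfl⟩
  have ha := (decays_fourierPh f).const_mul c
  have hb := (decays_fourierPh g).const_mul c
  obtain ⟨A, hA, h⟩ := pairInt_bound ha hb 0
  have hi := (h (fun w w' => multiplier ħ q w.1 w.2 w'.1 w'.2) (p, q) 1 zero_le_one
    (stronglyMeasurable_multiplier ħ q) fun w w' => by
      simpa using norm_multiplier_le ħ q w.1 w.2 w'.1 w'.2).1
  have hi2 := (measurePreserving_interchange.integrable_comp_emb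
    interchange.measurableEmbedding).mpr hi
  rw [← hc, pairInt, ← measurePreserving_interchange.integral_comp interchange.measurableEmbedding]
  refine Eq.trans ?_ (integral_prod _ hi2).symm
  simp only [starFun, ← hc]
  rw [← integral_const_mul, ← integral_const_mul]
  refine integral_congr_ae (Eventually.of_forall fun t => ?_)
  obtain ⟨u, u'⟩ := t
  have e : ∀ v v' : E, char (phasePairing (u, v) (p, q)) * (c * fourierPh f (u, v)) *
      (char (phasePairing (u', v') (p, q)) * (c * fourierPh g (u', v'))) *
      multiplier ħ q u v u' v' = (c * (c * (char (inner ℝ (u + u') p) * triTerm ħ q u u'))) *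
        ((char (inner ℝ v (q - (ħ / 2) • u')) * fourierPh f (u, v)) *
          (char (inner ℝ v' (q + (ħ / 2) • u)) * fourierPh g (u', v'))) := fun v v' => by
    have e1 : multiplier ħ q u v u' v' = triTerm ħ q u u' *
      char (ħ / 2 * (inner ℝ u v' - inner ℝ v u')) := rfl
    have e2 : char (phasePairing (u, v) (p, q)) * char (phasePairing (u', v') (p, q)) *
        char (ħ / 2 * (inner ℝ u v' - inner ℝ v u')) = char (inner ℝ (u + u') p) *
        (char (inner ℝ v (q - (ħ / 2) • u')) * char (inner ℝ v' (q + (ħ / 2) • u))) := by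
      rw [← char_add, ← char_add, ← char_add, ← char_add]
      congr 1
      simp only [phasePairing_apply, inner_add_left, inner_add_right, inner_sub_right,
        inner_smul_right, real_inner_comm u v']
      ring
    rw [e1]
    linear_combination (c * c * triTerm ħ q u u' * fourierPh f (u, v) * fourierPh g (u', v')) * e2
  have l1 : ∫ y : E × E, char (phasePairing (u, y.1) (p, q)) * (c * fourierPh f (u, y.1)) *
      (char (phasePairing (u', y.2) (p, q)) * (c * fourierPh g (u', y.2))) *
      multiplier ħ q u y.1 u' y.2 = (c * (c * (char (inner ℝ (u + u') p) * triTerm ħ q u u'))) *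
        (partialFt f (u, q - (ħ / 2) • u') * partialFt g (u', q + (ħ / 2) • u)) := by
    simp_rw [e]
    rw [integral_const_mul, partialFt_eq_ift, partialFt_eq_ift]
    congr 1
    exact integral_prod_mul (μ := (volume : Measure E)) (ν := (volume : Measure E))
      (fun v => char (inner ℝ v (q - (ħ / 2) • u')) * fourierPh f (u, v))
      (fun v' => char (inner ℝ v' (q + (ħ / 2) • u)) * fourierPh g (u', v'))
  refine Eq.trans ?_ l1.symm
  simp only [starIntegrand]
  ring

/-! ### The asymptotic expansion -/

lemma continuous_evalSymbol (P : SymbolPoly ℂ) : Continuous fun t : Phase × Phase =>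
    evalSymbol P t.1.1 t.1.2 t.2.1 t.2.2 := by
  have h : ∀ s : Fin 4 × Fin 3, Continuous fun t : Phase × Phase =>
      (((![t.1.1, t.1.2, t.2.1, t.2.2] s.1) s.2 : ℝ) : ℂ) := by
    rintro ⟨i, j⟩
    fin_cases i <;> simp only [Fin.zero_eta, Fin.mk_one, Fin.reduceFinMk, Matrix.cons_val] <;>
      fun_prop
  unfold evalSymbol
  simp_rw [MvPolynomial.eval_eq']
  exact continuous_finsetSum _ fun m _ => continuous_const.mul
    (continuous_finsetProd _ fun s _ => (h s).pow _)

/-- Both sides are bilinear Fourier multipliers of the same pair of transforms; their difference has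
the remainder of `multiplier_expansion` as multiplier. -/
theorem starFun_expansion (f g : 𝓢(Phase, ℂ)) (N : ℕ) {z : Phase} (hz : z ∈ regular) :
    (fun ħ : ℝ => starFun ħ f g z -
      ∑ n ∈ Finset.range (N + 1), (ħ : ℂ) ^ n * starCoeff (multiplierPoly n) (ħ / 2) f g z)
      =O[𝓝[>] 0] fun ħ : ℝ => ħ ^ (N + 1) := by
  have hq : z.2 ≠ 0 := hz
  obtain ⟨a, hadef⟩ : ∃ a, a = fun w => (((2 * Real.pi) ^ 3 : ℝ) : ℂ)⁻¹ * fourierPh f w := ⟨_, rfl⟩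
  obtain ⟨b, hbdef⟩ : ∃ b, b = fun w => (((2 * Real.pi) ^ 3 : ℝ) : ℂ)⁻¹ * fourierPh g w := ⟨_, rfl⟩
  have ha : Decays a := hadef ▸ (decays_fourierPh f).const_mul _
  have hb : Decays b := hbdef ▸ (decays_fourierPh g).const_mul _
  have hf : (f : Phase → ℂ) = invFt a := hadef ▸ eq_invFt f
  have hg : (g : Phase → ℂ) = invFt b := hbdef ▸ eq_invFt g
  obtain ⟨C, hC, K, hM⟩ := multiplier_expansion hq N
  obtain ⟨D, hD, L, hJ⟩ := jetEval_bound_family multiplierPoly (N + 1) hq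
  obtain ⟨A, hA, hA'⟩ := pairInt_bound ha hb K
  obtain ⟨A₀, hA₀, hA₀'⟩ := pairInt_bound ha hb 0
  obtain ⟨A₁, hA₁, hA₁'⟩ := pairInt_bound ha hb L
  refine IsBigO.of_bound (C * A) ?_
  filter_upwards [Ioo_mem_nhdsGT (zero_lt_one : (0 : ℝ) < 1)] with ħ hħ
  have hħ0 : 0 < ħ := hħ.1
  have hħ1 : ħ ≤ 1 := hħ.2.le
  have hh : |ħ / 2| ≤ 1 := by rw [abs_of_nonneg (by positivity)]; linarith
  set J : ℕ → Phase → Phase → ℂ := fun n w w' =>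
    evalSymbol (evalJet (ħ / 2) z.2 (multiplierPoly n)) w.1 w.2 w'.1 w'.2 with hJdef
  have mJ : ∀ n, StronglyMeasurable fun t : Phase × Phase => J n t.1 t.2 := fun n =>
    (continuous_evalSymbol _).stronglyMeasurable
  have iM := (hA₀' (fun w w' => multiplier ħ z.2 w.1 w.2 w'.1 w'.2) z 1 zero_le_one
    (stronglyMeasurable_multiplier ħ z.2) fun w w' => by
      simpa using norm_multiplier_le ħ z.2 w.1 w.2 w'.1 w'.2).1
  have iJ : ∀ n ∈ Finset.range (N + 1), Integrable fun t : Phase × Phase =>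
      (ħ : ℂ) ^ n * ((char (phasePairing t.1 z) * a t.1) * (char (phasePairing t.2 z) * b t.2) *
        J n t.1 t.2) := fun n hn =>
    ((hA₁' (J n) z D hD (mJ n) fun w w' =>
      hJ n (Finset.mem_range.mp hn) (ħ / 2) hh w.1 w.2 w'.1 w'.2).1).const_mul _
  set R : Phase → Phase → ℂ := fun w w' => multiplier ħ z.2 w.1 w.2 w'.1 w'.2 -
    ∑ n ∈ Finset.range (N + 1), (ħ : ℂ) ^ n * J n w w' with hR
  have mR : StronglyMeasurable fun t : Phase × Phase => R t.1 t.2 :=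
    (stronglyMeasurable_multiplier ħ z.2).sub
      (Finset.stronglyMeasurable_fun_sum _ fun n _ => (mJ n).const_mul _)
  have key : starFun ħ f g z - ∑ n ∈ Finset.range (N + 1),
      (ħ : ℂ) ^ n * starCoeff (multiplierPoly n) (ħ / 2) f g z = pairInt a b R z := by
    have e1 : ∀ n, (ħ : ℂ) ^ n * starCoeff (multiplierPoly n) (ħ / 2) f g z =
        ∫ t : Phase × Phase, (ħ : ℂ) ^ n * ((char (phasePairing t.1 z) * a t.1) *
          (char (phasePairing t.2 z) * b t.2) * J n t.1 t.2) := fun n => by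
      rw [starCoeff, hf, hg, bidiff_invFt ha hb, integral_const_mul]
      rfl
    rw [starFun_eq_pairInt, ← hadef, ← hbdef]
    simp_rw [e1]
    rw [← integral_finsetSum _ iJ, pairInt, ← integral_sub iM (integrable_finsetSum _ iJ)]
    refine integral_congr_ae (Eventually.of_forall fun t => ?_)
    simp only [hR, mul_sub, Finset.mul_sum]
    congr 1
    exact Finset.sum_congr rfl fun n _ => by ring
  rw [key]
  have h := (hA' R z (C * ħ ^ (N + 1)) (by positivity) mR fun w w' =>
    hM ħ hħ0 hħ1 w.1 w.2 w'.1 w'.2).2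
  rw [Real.norm_of_nonneg (by positivity)]
  exact h.trans (le_of_eq (by ring))

/-! ### Uniqueness of symbols -/

lemma ae_eq_zero_of_integral_mul_schwartz {D : Phase → ℂ} (hD : MemLp D 2 volume)
    (h : ∀ χ : 𝓢(Phase, ℂ), ∫ w, D w * χ w = 0) : D =ᵐ[volume] 0 := by
  refine ae_eq_zero_of_integral_contDiff_smul_eq_zero (hD.locallyIntegrable one_le_two)
    fun g hg hgc => ?_
  have h1 : ContDiff ℝ ∞ fun w => (g w : ℂ) := Complex.ofRealCLM.contDiff.comp hg
  have h2 : HasCompactSupport fun w => (g w : ℂ) := hgc.comp_left Complex.ofReal_zero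
  rw [← h (h2.toSchwartzMap h1)]
  refine integral_congr_ae (Eventually.of_forall fun w => ?_)
  simp [mul_comm]

lemma memLp_schwartz (φ : 𝓢(Phase, ℂ)) : MemLp φ 2 (volume : Measure Phase) :=
  φ.memLp 2 volume

lemma IsFourierL2.ae_eq {f F F' : Phase → ℂ} (h : IsFourierL2 f F) (h' : IsFourierL2 f F') :
    F =ᵐ[volume] F' := by
  have h1 : (fun w => F w - F' w) =ᵐ[volume] 0 := by
    refine ae_eq_zero_of_integral_mul_schwartz (h.2.1.sub h'.2.1) fun χ => ?_
    have i1 : Integrable fun w => F w * χ w := h.2.1.integrable_mul (memLp_schwartz χ)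
    have i2 : Integrable fun w => F' w * χ w := h'.2.1.integrable_mul (memLp_schwartz χ)
    simp_rw [sub_mul]
    rw [integral_sub i1 i2, h.2.2, h'.2.2, sub_self]
  filter_upwards [h1] with w hw
  exact sub_eq_zero.mp hw

/-- The duality in `IsFourierL2` tests `f` only against Fourier transforms of Schwartz functions,
but these exhaust the Schwartz space. -/
lemma IsFourierL2.ae_eq_of_ae_eq {f f' F F' : Phase → ℂ} (h : IsFourierL2 f F)
    (h' : IsFourierL2 f' F') (hF : F =ᵐ[volume] F') : f =ᵐ[volume] f' := by
  have h1 : (fun w => f w - f' w) =ᵐ[volume] 0 := by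
    refine ae_eq_zero_of_integral_mul_schwartz (h.1.sub h'.1) fun χ => ?_
    obtain ⟨φ, hφ⟩ := exists_schwartz_fourierPh_eq χ
    have i1 : Integrable fun w => f w * χ w := h.1.integrable_mul (memLp_schwartz χ)
    have i2 : Integrable fun w => f' w * χ w := h'.1.integrable_mul (memLp_schwartz χ)
    simp_rw [sub_mul]
    rw [integral_sub i1 i2, sub_eq_zero]
    simp_rw [← hφ]
    rw [← h.2.2, ← h'.2.2]
    refine integral_congr_ae ?_
    filter_upwards [hF] with w hw
    rw [hw]
  filter_upwards [h1] with w hw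
  exact sub_eq_zero.mp hw

/-- The real part of the quaternionic pairing already is the Hilbert space inner product, so the
pairing determines vectors and operators. -/
lemma inner_eq_re_qInner (Φ Ψ : L2H) : inner ℝ Φ Ψ = (qInner Φ Ψ).re := by
  have hi : Integrable fun x => star (Φ x) * Ψ x :=
    (Lp.memLp Φ).star.integrable_mul (Lp.memLp Ψ)
  have e := (innerSL ℝ (1 : ℍ[ℝ])).integral_comp_comm hi
  simp only [innerSL_apply_apply] at e
  rw [← inner_one_eq, qInner, ← e, L2.inner_def]
  refine integral_congr_ae (Eventually.of_forall fun x => ?_)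
  simp only [inner_one_eq]
  simp only [Quaternion.inner_def, Quaternion.re_mul, Quaternion.re_star,
    Quaternion.imI_star, Quaternion.imJ_star, Quaternion.imK_star]
  ring

lemma eq_of_forall_qInner {Ψ Ψ' : L2H} (h : ∀ Φ : L2H, qInner Φ Ψ = qInner Φ Ψ') : Ψ = Ψ' :=
  ext_inner_left ℝ fun Φ => by rw [inner_eq_re_qInner, inner_eq_re_qInner, h]

lemma IsWeylOperator.eq {ħ : ℝ} {f : Phase → ℂ} {A A' : L2H →L[ℝ] L2H}
    (h : IsWeylOperator ħ f A) (h' : IsWeylOperator ħ f A') : A = A' := by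
  obtain ⟨F, hF, hA⟩ := h
  obtain ⟨F', hF', hA'⟩ := h'
  ext1 Ψ
  refine eq_of_forall_qInner fun Φ => ?_
  rw [(hA Φ Ψ).2, (hA' Φ Ψ).2]
  congr 1
  refine integral_congr_ae ?_
  filter_upwards [hF.ae_eq hF'] with w hw
  rw [hw]

/-! ### Injectivity of the Weyl correspondence -/

lemma inner_mul_star_eq (p b r k : ℍ[ℝ]) :
    inner ℝ (p * b * star r) k = inner ℝ b (star p * (k * r)) := by
  simp only [Quaternion.inner_def, Quaternion.re_mul, Quaternion.imI_mul, Quaternion.imJ_mul,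
    Quaternion.imK_mul, Quaternion.re_star, Quaternion.imI_star, Quaternion.imJ_star,
    Quaternion.imK_star]
  ring

lemma partialFt_sub (φ ψ : 𝓢(Phase, ℂ)) (z : Phase) :
    partialFt (φ - ψ : 𝓢(Phase, ℂ)) z = partialFt φ z - partialFt ψ z := by
  have hc : Continuous fun p : E => char (-inner ℝ p z.1) :=
    continuous_char.comp (continuous_id.inner continuous_const).neg
  have hi : ∀ f : 𝓢(Phase, ℂ), Integrable fun p => char (-inner ℝ p z.1) * f (p, z.2) := fun f =>
    (integrable_fst_slice f z.2).bdd_mul (c := 1) hc.aestronglyMeasurable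
      (Eventually.of_forall fun _ => (norm_char _).le)
  simp only [partialFt, ft]
  rw [← integral_sub (hi φ) (hi ψ)]
  refine integral_congr_ae (Eventually.of_forall fun p => ?_)
  simp [mul_sub]

lemma weylKernel_sub (ħ : ℝ) (H H' : Phase → ℂ) (t : E × E) :
    weylKernel ħ (fun z => H z - H' z) t = weylKernel ħ H t - weylKernel ħ H' t := by
  simp only [weylKernel]
  rw [← embedLin_apply, map_sub, mul_sub, smul_sub]
  rfl

/-- The integral kernel attached to a Schwartz symbol, as a square-integrable function. -/
def kernelLp {ħ : ℝ} (hħ : 0 < ħ) (φ : 𝓢(Phase, ℂ)) : Lp ℍ[ℝ] 2 (volume : Measure (E × E)) :=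
  (memLp_weylKernel hħ (admissible_partialFt φ)).toLp (weylKernel ħ (partialFt φ))

lemma memLp_fourierPh (φ : 𝓢(Phase, ℂ)) : MemLp (fourierPh φ) 2 (volume : Measure Phase) := by
  obtain ⟨ψ, hψ⟩ := exists_schwartz_eq_fourierPh φ
  have h : fourierPh φ = ψ := funext fun w => (hψ w).symm
  rw [h]
  exact memLp_schwartz ψ

/-- The Fourier transform of a Schwartz symbol, as a square-integrable function. -/
def fourierLp (φ : 𝓢(Phase, ℂ)) : Lp ℂ 2 (volume : Measure Phase) :=
  (memLp_fourierPh φ).toLp (fourierPh φ)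

lemma fourierPh_sub (φ ψ : 𝓢(Phase, ℂ)) (w : Phase) :
    fourierPh (φ - ψ : 𝓢(Phase, ℂ)) w = fourierPh φ w - fourierPh ψ w := by
  rw [fourierPh_eq, fourierPh_eq, fourierPh_eq, ← mul_sub]
  have hc : Continuous fun z : Phase => char (-(inner ℝ z.1 w.1 + inner ℝ z.2 w.2)) :=
    continuous_char.comp ((continuous_fst.inner continuous_const).add
      (continuous_snd.inner continuous_const)).neg
  have hi : ∀ f : 𝓢(Phase, ℂ), Integrable fun z : Phase =>
      char (-(inner ℝ z.1 w.1 + inner ℝ z.2 w.2)) * f z := fun f =>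
    (decays_schwartz f).integrable.bdd_mul (c := 1) hc.aestronglyMeasurable
      (Eventually.of_forall fun _ => (norm_char _).le)
  rw [← integral_sub (hi φ) (hi ψ)]
  congr 1
  refine integral_congr_ae (Eventually.of_forall fun p => ?_)
  simp [mul_sub]

lemma kernelLp_sub {ħ : ℝ} (hħ : 0 < ħ) (φ ψ : 𝓢(Phase, ℂ)) :
    kernelLp hħ (φ - ψ) = kernelLp hħ φ - kernelLp hħ ψ := by
  rw [kernelLp, kernelLp, kernelLp, ← MemLp.toLp_sub]
  refine MemLp.toLp_congr _ _ (Eventually.of_forall fun t => ?_)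
  rw [Pi.sub_apply, ← weylKernel_sub]
  congr 1
  exact funext fun z => partialFt_sub φ ψ z

lemma fourierLp_sub (φ ψ : 𝓢(Phase, ℂ)) : fourierLp (φ - ψ) = fourierLp φ - fourierLp ψ := by
  rw [fourierLp, fourierLp, fourierLp, ← MemLp.toLp_sub]
  exact MemLp.toLp_congr _ _ (Eventually.of_forall fun t => fourierPh_sub φ ψ t)

lemma norm_sq_toLp {α : Type*} [MeasurableSpace α] {μ : Measure α} {F : Type*}
    [NormedAddCommGroup F] {f : α → F} (hf : MemLp f 2 μ) :
    ‖hf.toLp f‖ ^ 2 = (∫⁻ x, ‖f x‖ₑ ^ 2 ∂μ).toReal := by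
  rw [Lp.norm_toLp, ← ENNReal.toReal_pow, eLpNorm_two_sq]

/-- Both norms are constants times the `L²` norm of the partial Fourier transform. Injectivity of
the Weyl correspondence rests on this isometry. -/
lemma norm_kernelLp_sq {ħ : ℝ} (hħ : 0 < ħ) (φ : 𝓢(Phase, ℂ)) :
    ‖kernelLp hħ φ‖ ^ 2 = ((2 * Real.pi * ħ) ^ 3)⁻¹ * ‖fourierLp φ‖ ^ 2 := by
  have hpi := Real.pi_pos
  have h1 := (admissible_partialFt φ).lintegral_symbolFt_sq
  rw [funext (symbolFt_partialFt φ)] at h1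
  rw [kernelLp, fourierLp, norm_sq_toLp, norm_sq_toLp, h1,
    lintegral_weylKernel_sq hħ (admissible_partialFt φ).1, ENNReal.toReal_mul, ENNReal.toReal_mul,
    ENNReal.toReal_ofReal (by positivity), ENNReal.toReal_ofReal (by positivity), ← mul_assoc]
  congr 1
  field_simp

lemma norm_kernelLp {ħ : ℝ} (hħ : 0 < ħ) (φ : 𝓢(Phase, ℂ)) :
    ‖kernelLp hħ φ‖ = √(((2 * Real.pi * ħ) ^ 3)⁻¹) * ‖fourierLp φ‖ := by
  have hpi := Real.pi_pos
  rw [← abs_of_nonneg (norm_nonneg (kernelLp hħ φ)), ← Real.sqrt_sq_eq_abs, norm_kernelLp_sq hħ,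
    Real.sqrt_mul (by positivity), Real.sqrt_sq (norm_nonneg _)]

/-- Indicators of balls as test vectors show that all averages of `K` over balls of the product
vanish, balls in the sup norm being products; Lebesgue differentiation concludes. -/
lemma ae_eq_zero_of_kernel_matrix_eq_zero {K : E × E → ℍ[ℝ]} (hK : MemLp K 2 volume)
    (h : ∀ Φ Ψ : L2H, ∫ t : E × E, star (Φ t.1) * (K t * Ψ t.2) = 0) : K =ᵐ[volume] 0 := by
  have hball : ∀ (c : E × E) (r : ℝ), ∫ t in Metric.closedBall c r, K t = 0 := fun c r => by
    have hs : ∀ x : E, volume (Metric.closedBall x r) ≠ ⊤ := fun x =>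
      measure_closedBall_lt_top.ne
    have h0 := h (indicatorConstLp 2 measurableSet_closedBall (hs c.1) 1)
      (indicatorConstLp 2 measurableSet_closedBall (hs c.2) 1)
    rw [← h0, ← integral_indicator measurableSet_closedBall]
    have a1 := Measure.quasiMeasurePreserving_fst (μ := (volume : Measure E))
      (ν := (volume : Measure E)) |>.ae (indicatorConstLp_coeFn (p := 2)
        (hs := measurableSet_closedBall) (hμs := hs c.1) (c := (1 : ℍ[ℝ])))
    have a2 := Measure.quasiMeasurePreserving_snd (μ := (volume : Measure E))
      (ν := (volume : Measure E)) |>.ae (indicatorConstLp_coeFn (p := 2)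
        (hs := measurableSet_closedBall) (hμs := hs c.2) (c := (1 : ℍ[ℝ])))
    refine integral_congr_ae ?_
    filter_upwards [a1, a2] with t h1 h2
    rw [h1, h2]
    have hmem : t ∈ Metric.closedBall c r ↔ t.1 ∈ Metric.closedBall c.1 r ∧
        t.2 ∈ Metric.closedBall c.2 r := by
      rw [← Set.mem_prod, closedBall_prod_same]
    by_cases m1 : t.1 ∈ Metric.closedBall c.1 r
    · by_cases m2 : t.2 ∈ Metric.closedBall c.2 r
      · simp only [Set.indicator_of_mem m1, Set.indicator_of_mem m2,
          Set.indicator_of_mem (hmem.mpr ⟨m1, m2⟩), star_one, one_mul, mul_one]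
      · rw [Set.indicator_of_notMem m2, Set.indicator_of_notMem fun hm => m2 (hmem.mp hm).2]
        simp
    · rw [Set.indicator_of_notMem m1, Set.indicator_of_notMem fun hm => m1 (hmem.mp hm).1]
      simp
  have hlim := IsUnifLocDoublingMeasure.ae_tendsto_average (volume : Measure (E × E))
    (hK.locallyIntegrable one_le_two) 1
  filter_upwards [hlim] with x hx
  have hδ : Tendsto (fun n : ℕ => (1 : ℝ) / ((n : ℝ) + 1)) atTop (𝓝[>] 0) := by
    refine tendsto_nhdsWithin_iff.mpr ⟨tendsto_one_div_add_atTop_nhds_zero_nat,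
      Eventually.of_forall fun n => ?_⟩
    exact Set.mem_Ioi.mpr (by positivity)
  have h1 := hx (fun _ : ℕ => x) _ hδ (Eventually.of_forall fun n =>
    Metric.mem_closedBall_self (by positivity))
  simp only [setAverage_eq, hball, smul_zero] at h1
  exact (tendsto_nhds_unique h1 tendsto_const_nhds)

section

variable {ħ : ℝ}

lemma memLp_tensor {Φ Ψ : E → ℍ[ℝ]} (mΦ : StronglyMeasurable Φ) (mΨ : StronglyMeasurable Ψ)
    (hΦ : MemLp Φ 2) (hΨ : MemLp Ψ 2) (b : ℍ[ℝ]) :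
    MemLp (fun t : E × E => Φ t.1 * b * star (Ψ t.2)) 2 volume := by
  have m1 : StronglyMeasurable fun t : E × E => Φ t.1 := mΦ.comp_measurable measurable_fst
  have m2 : StronglyMeasurable fun t : E × E => Ψ t.2 := mΨ.comp_measurable measurable_snd
  refine ((memLp_norm_mul_norm mΦ mΨ hΦ hΨ).const_mul ‖b‖).of_le
    ((m1.mul stronglyMeasurable_const).mul
      (continuous_star.comp_stronglyMeasurable m2)).aestronglyMeasurable
    (Eventually.of_forall fun t => le_of_eq ?_)
  rw [norm_mul, norm_mul, norm_star, norm_mul, norm_mul, norm_norm, norm_norm, norm_norm]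
  ring

lemma inner_tensor_toLp {Φ Ψ : E → ℍ[ℝ]} (mΦ : StronglyMeasurable Φ) (mΨ : StronglyMeasurable Ψ)
    (hΦ : MemLp Φ 2) (hΨ : MemLp Ψ 2) (b : ℍ[ℝ]) {K : E × E → ℍ[ℝ]} (hK : MemLp K 2 volume) :
    inner ℝ ((memLp_tensor mΦ mΨ hΦ hΨ b).toLp _) (hK.toLp K) =
      inner ℝ b (∫ t : E × E, star (Φ t.1) * (K t * Ψ t.2)) := by
  have e := (innerSL ℝ b).integral_comp_comm (integrable_kernel_matrix hK mΦ mΨ hΦ hΨ)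
  simp only [innerSL_apply_apply] at e
  rw [← e, L2.inner_def]
  refine integral_congr_ae ?_
  filter_upwards [(memLp_tensor mΦ mΨ hΦ hΨ b).coeFn_toLp, hK.coeFn_toLp] with t h1 h2
  rw [h1, h2, inner_mul_star_eq]

lemma memLp_conj_wigner (hħ : 0 < ħ) {Φ Ψ : E → ℍ[ℝ]} (mΦ : StronglyMeasurable Φ)
    (mΨ : StronglyMeasurable Ψ) (hΦ : MemLp Φ 2) (hΨ : MemLp Ψ 2) (b : ℍ[ℝ]) :
    MemLp (fun w => starRingEnd ℂ (wigner ħ Φ Ψ b w)) 2 (volume : Measure Phase) :=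
  (memLp_wigner hħ mΦ mΨ hΦ hΨ b).star

lemma inner_conj_wigner_toLp (hħ : 0 < ħ) {Φ Ψ : E → ℍ[ℝ]} (mΦ : StronglyMeasurable Φ)
    (mΨ : StronglyMeasurable Ψ) (hΦ : MemLp Φ 2) (hΨ : MemLp Ψ 2) (b : ℍ[ℝ]) {F : Phase → ℂ}
    (hF : MemLp F 2 volume) :
    inner ℂ ((memLp_conj_wigner hħ mΦ mΨ hΦ hΨ b).toLp _) (hF.toLp F) =
      ∫ w, F w * wigner ħ Φ Ψ b w := by
  rw [L2.inner_def]
  refine integral_congr_ae ?_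
  filter_upwards [(memLp_conj_wigner hħ mΦ mΨ hΦ hΨ b).coeFn_toLp, hF.coeFn_toLp] with w h1 h2
  rw [h1, h2, RCLike.inner_apply, Complex.conj_conj]

lemma exists_fourierLp_tendsto (D : Lp ℂ 2 (volume : Measure Phase)) :
    ∃ φ : ℕ → 𝓢(Phase, ℂ), Tendsto (fun n => fourierLp (φ n)) atTop (𝓝 D) := by
  have hd := SchwartzMap.denseRange_toLpCLM (E := Phase) (F := ℂ) (p := 2) (by simp)
    (μ := (volume : Measure Phase))
  obtain ⟨s, hs, hlim⟩ := mem_closure_iff_seq_limit.mp (hd D)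
  choose χ hχ using hs
  choose φ hφ using fun n => exists_schwartz_fourierPh_eq (χ n)
  refine ⟨φ, hlim.congr fun n => ?_⟩
  rw [← hχ n]
  refine Lp.ext ?_
  filter_upwards [(χ n).coeFn_toLp 2 volume, (memLp_fourierPh (φ n)).coeFn_toLp] with w h1 h2
  rw [fourierLp, h2, hφ n w]
  exact h1

/-- A square-integrable function all of whose weak integrals against the Weyl operators vanish
is zero. -/
theorem ae_eq_zero_of_weak_integrals (hħ : 0 < ħ) {D : Phase → ℂ} (hD : MemLp D 2 volume)
    (h : ∀ (Φ Ψ : L2H) (b : ℍ[ℝ]), (∫ w, D w * wigner ħ Φ Ψ b w).re = 0) : D =ᵐ[volume] 0 := by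
  have hpi := Real.pi_pos
  obtain ⟨φ, hφ⟩ := exists_fourierLp_tendsto (hD.toLp D)
  obtain ⟨c, hc⟩ : ∃ c, c = √(((2 * Real.pi * ħ) ^ 3)⁻¹) := ⟨_, rfl⟩
  have hc0 : 0 < c := hc ▸ Real.sqrt_pos.mpr (by positivity)
  have hnorm : ∀ ψ, ‖kernelLp hħ ψ‖ = c * ‖fourierLp ψ‖ := fun ψ => hc ▸ norm_kernelLp hħ ψ
  -- Approximate `D` by Fourier transforms of Schwartz symbols; by the isometry the corresponding
  -- kernels converge to some `K`.
  have hcau : CauchySeq fun n => kernelLp hħ (φ n) := by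
    refine Metric.cauchySeq_iff.mpr fun ε hε => ?_
    obtain ⟨N, hN⟩ := Metric.cauchySeq_iff.mp hφ.cauchySeq (ε / c) (by positivity)
    refine ⟨N, fun m hm n hn => ?_⟩
    have := hN m hm n hn
    rw [dist_eq_norm, ← fourierLp_sub, lt_div_iff₀ hc0] at this
    rw [dist_eq_norm, ← kernelLp_sub, hnorm]
    linarith
  obtain ⟨K, hK⟩ := cauchySeq_tendsto_of_complete hcau
  have hKK : (Lp.memLp K).toLp K = K := Lp.toLp_coeFn K _
  -- The matrix elements of `K` are limits of weak integrals of Schwartz symbols, hence equal to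
  -- those of `D` up to a constant, and these vanish by hypothesis.
  have hzero : ∀ Φ Ψ : L2H, ∫ t : E × E, star (Φ t.1) * (K t * Ψ t.2) = 0 := fun Φ Ψ => by
    have mΦ := Lp.stronglyMeasurable Φ
    have mΨ := Lp.stronglyMeasurable Ψ
    have lΦ := Lp.memLp Φ
    have lΨ := Lp.memLp Ψ
    refine ext_inner_left ℝ fun b => ?_
    rw [← inner_tensor_toLp mΦ mΨ lΦ lΨ b (Lp.memLp K), hKK, inner_zero_right]
    have t1 := (tendsto_const_nhds (x := (memLp_tensor mΦ mΨ lΦ lΨ b).toLp _)).inner (𝕜 := ℝ) hK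
    have t2 := Complex.continuous_re.continuousAt.tendsto.comp
      ((tendsto_const_nhds (x := (memLp_conj_wigner hħ mΦ mΨ lΦ lΨ b).toLp _)).inner (𝕜 := ℂ) hφ)
    rw [inner_conj_wigner_toLp hħ mΦ mΨ lΦ lΨ b hD, h] at t2
    have e : ∀ n, inner ℝ ((memLp_tensor mΦ mΨ lΦ lΨ b).toLp _) (kernelLp hħ (φ n)) =
        ((2 * Real.pi) ^ 3)⁻¹ * (inner ℂ ((memLp_conj_wigner hħ mΦ mΨ lΦ lΨ b).toLp _)
          (fourierLp (φ n))).re := fun n => by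
      have e1 := congrArg (inner ℝ b)
        (integral_weylMatrix hħ mΦ mΨ lΦ lΨ (admissible_partialFt (φ n)))
      rw [inner_integral_weylMatrix hħ mΦ mΨ lΦ lΨ (admissible_partialFt (φ n)).memLp_symbolFt b,
        funext (symbolFt_partialFt (φ n)), inner_smul_right] at e1
      rw [kernelLp, fourierLp, inner_tensor_toLp mΦ mΨ lΦ lΨ b,
        inner_conj_wigner_toLp hħ mΦ mΨ lΦ lΨ b, e1, inv_mul_cancel_left₀ (by positivity)]
    have t3 := t2.const_mul ((2 * Real.pi) ^ 3)⁻¹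
    rw [mul_zero] at t3
    exact tendsto_nhds_unique t1 (t3.congr fun n => (e n).symm)
  have hK0 : K = 0 := by
    refine Lp.ext ?_
    filter_upwards [ae_eq_zero_of_kernel_matrix_eq_zero (Lp.memLp K) hzero,
      Lp.coeFn_zero ℍ[ℝ] 2 (volume : Measure (E × E))] with t h1 h2
    rw [h1, h2]
  -- As `K = 0`, the isometry read backwards forces the approximants of `D` to tend to zero.
  have hn : Tendsto (fun n => ‖fourierLp (φ n)‖) atTop (𝓝 0) := by
    have h1 := (hK.norm).const_mul c⁻¹
    rw [hK0, norm_zero, mul_zero] at h1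
    refine h1.congr fun n => ?_
    rw [hnorm, inv_mul_cancel_left₀ hc0.ne']
  have hD0 : hD.toLp D = 0 := tendsto_nhds_unique hφ (tendsto_zero_iff_norm_tendsto_zero.mpr hn)
  filter_upwards [hD.coeFn_toLp, Lp.coeFn_zero ℂ 2 (volume : Measure Phase)] with w h1 h2
  rw [← h1, hD0, h2]

/-- The Weyl correspondence is injective. -/
theorem IsWeylOperator.ae_eq (hħ : 0 < ħ) {f f' : Phase → ℂ} {A : L2H →L[ℝ] L2H}
    (h : IsWeylOperator ħ f A) (h' : IsWeylOperator ħ f' A) : f =ᵐ[volume] f' := by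
  have hpi := Real.pi_pos
  obtain ⟨F, hF, hA⟩ := h
  obtain ⟨F', hF', hA'⟩ := h'
  refine hF.ae_eq_of_ae_eq hF' ?_
  have h0 := ae_eq_zero_of_weak_integrals hħ (hF.2.1.sub hF'.2.1) fun Φ Ψ b => by
    have mΦ := Lp.stronglyMeasurable Φ
    have mΨ := Lp.stronglyMeasurable Ψ
    have lΦ := Lp.memLp Φ
    have lΨ := Lp.memLp Ψ
    have hw := memLp_wigner hħ mΦ mΨ lΦ lΨ b
    have i1 : Integrable fun w => F w * wigner ħ Φ Ψ b w := hF.2.1.integrable_mul hw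
    have i2 : Integrable fun w => F' w * wigner ħ Φ Ψ b w := hF'.2.1.integrable_mul hw
    have e1 := ((hA Φ Ψ).2).symm.trans (hA' Φ Ψ).2
    have e2 := smul_right_injective ℍ[ℝ] (by positivity : ((2 * Real.pi) ^ 3)⁻¹ ≠ 0) e1
    have e3 := congrArg (inner ℝ b) e2
    rw [inner_integral_weylMatrix hħ mΦ mΨ lΦ lΨ hF.2.1 b,
      inner_integral_weylMatrix hħ mΦ mΨ lΦ lΨ hF'.2.1 b] at e3
    simp only [Pi.sub_apply, sub_mul]
    rw [integral_sub i1 i2, Complex.sub_re, e3, sub_self]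
  filter_upwards [h0] with w hw
  exact sub_eq_zero.mp hw

/-- A symbol determines its operator, so the factors of the product are forced; injectivity of the
correspondence then determines the symbol of the product. -/
theorem IsStarProduct.ae_eq_starFun (hħ : 0 < ħ) {f g : 𝓢(Phase, ℂ)} {h : Phase → ℂ}
    (hh : IsStarProduct ħ f g h) : h =ᵐ[volume] starFun ħ f g := by
  obtain ⟨A, B, hA, hB, hAB⟩ := hh
  obtain ⟨A', B', hA', hB', hAB'⟩ := isStarProduct_starFun hħ f g
  rw [hA.eq hA', hB.eq hB'] at hAB
  exact IsWeylOperator.ae_eq hħ hAB hAB'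

end

end Monopole

end

theorem mainTheorem1 :
    -- `T(u,v)` is the exponential of `J(u·P + v·Q)`
    (∀ (ħ : ℝ) (u v x : Monopole.E) (Ψ : Monopole.E → ℍ[ℝ]), ContDiffOn ℝ ∞ Ψ {0}ᶜ →
      (∀ s : ℝ, x + s • u ≠ 0) →
      Monopole.weylT ħ ((0 : ℝ) • u) ((0 : ℝ) • v) Ψ x = Ψ x ∧
      ∀ t : ℝ, HasDerivAt (fun s : ℝ => Monopole.weylT ħ (s • u) (s • v) Ψ x)
        (Monopole.weylGenerator ħ u v (Monopole.weylT ħ (t • u) (t • v) Ψ) x) t) ∧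
    ∃ (r : ℕ → ℕ → ℝ) (W : ℕ → Monopole.SymbolPoly Monopole.JetPoly),
      -- the Zassenhaus terms `C_n(J u·P, J u'·P)` expressed through `β`, with `eg = ħ/2`
      (∀ (ħ : ℝ) (n : ℕ), 2 ≤ n → ∀ (u u' : Monopole.E) (Ψ : Monopole.SmoothField)
        (x : Monopole.E), x ≠ 0 →
        (Monopole.zassenhaus (Monopole.jMom ħ u) (Monopole.jMom ħ u') n Ψ :
            Monopole.E → ℍ[ℝ]) x =
          (ħ ^ (n - 1) * Monopole.zassTerm r (ħ / 2) n u u' x) •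
            (Monopole.jq x * (Ψ : Monopole.E → ℍ[ℝ]) x)) ∧
      -- the coefficient of `ħ ^ n` of the expanded multiplier is the polynomial `W n`
      (∀ (eg : ℝ) (n : ℕ) (q u v u' v' : Monopole.E), q ≠ 0 →
        Monopole.evalSymbol (Monopole.evalJet eg q (W n)) u v u' v' =
          PowerSeries.coeff n (Monopole.multiplierSeries r eg q u v u' v')) ∧
      -- the operators `B_0`, `B_1`, `B_2`
      (∀ (eg : ℝ) (f g : Monopole.Phase → ℂ), ContDiffOn ℝ ∞ f Monopole.regular →
        ContDiffOn ℝ ∞ g Monopole.regular → ∀ z ∈ Monopole.regular,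
        Monopole.starCoeff (W 0) eg f g z = f z * g z ∧
        Monopole.starCoeff (W 1) eg f g z =
          Complex.I / 2 * Monopole.magneticBracket eg f g z ∧
        Monopole.starCoeff (W 2) eg f g z = Monopole.secondOrder eg f g z) ∧
      -- existence, uniqueness and expansion of the star product
      (∀ f g : 𝓢(Monopole.Phase, ℂ), ∃ F : ℝ → Monopole.Phase → ℂ,
        (∀ ħ : ℝ, 0 < ħ → ContinuousOn (F ħ) Monopole.regular ∧
          Monopole.IsStarProduct ħ f g (F ħ) ∧
          ∀ h : Monopole.Phase → ℂ, Monopole.IsStarProduct ħ f g h → h =ᵐ[volume] F ħ) ∧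
        ∀ (N : ℕ), ∀ z ∈ Monopole.regular,
          (fun ħ : ℝ => F ħ z -
            ∑ n ∈ Finset.range (N + 1),
              (ħ : ℂ) ^ n * Monopole.starCoeff (W n) (ħ / 2) f g z)
            =O[𝓝[>] 0] fun ħ : ℝ => ħ ^ (N + 1)) := by
  refine ⟨fun ħ u v x Ψ hΨ h => Monopole.weylT_isExponential ħ u v x Ψ hΨ h, Monopole.zassCoeff,
    Monopole.multiplierPoly, fun ħ n hn u u' Ψ x _ => Monopole.zassenhaus_jMom ħ hn u u' Ψ x,
    fun eg n q u v u' v' hq => Monopole.evalSymbol_multiplierPoly eg n u v u' v' hq,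
    fun eg f g hf hg z hz => Monopole.starCoeff_first_terms eg f g hf hg z hz, fun f g => ?_⟩
  exact ⟨fun ħ => Monopole.starFun ħ f g, fun ħ hħ => ⟨Monopole.continuousOn_starFun hħ f g,
    Monopole.isStarProduct_starFun hħ f g, fun h hh => Monopole.IsStarProduct.ae_eq_starFun hħ hh⟩,
    fun N z hz => Monopole.starFun_expansion f g N hz⟩
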